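/- **Setting.** Fix $p\in[1,\infty)$. A *filtered $SQ_p$ algebra* is a norm-closed subalgebra $A\subseteq B(E)$, where $E$ is a complex Banach space isometric to a subspace of a quotient of an $L_p$ space, with closed linear subspaces $A_r\subseteq A$ ($r>0$) such that $A_r\subseteq A_{r'}$ for $r\le r'$, $A_rA_{r'}\subseteq A_{r+r'}$, and $\bigcup_rA_r$ is dense in $A$; if $A$ has a unit $1_A\neq0$, then $\|1_A\|=1$ and $1_A\in A_r$ for all $r$. *Norms.* $A^+=A\oplus\mathbb C$ is the unitization, $A^+_r=A_r\oplus\mathbb C$, and $\pi:A^+\to\mathbb C$ is the projection. $M_n(A^+)$ has the norm $\|(a,z)\|=\max(\|a+z1\|_{B(\ell_p^n(E))},\|z\|_{B(\ell_p^n)})$, where $1=1_A$ if $A$ is unital (so that $A^+\cong A\oplus\mathbb C$) and $1=I_E$ otherwise. The cone $CA$ and the suspension $SA$ are the algebras of $F\in C([0,1],A)$ with $F(0)=0$, respectively $F(0)=F(1)=0$, filtered by $A_r$-valued functions; $M_n(CA^+)$ and $M_n(SA^+)$ have the supremum norm as algebras of functions $[0,1]\to M_n(A^+)$. A *filtered homomorphism*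 $f:A\to B$ is a $p$-completely bounded algebra homomorphism with $f(A_r)\subseteq B_r$ for all $r$; $f^+:A^+\to B^+$ is its unital extension, with $p$-completely bounded norm $\|f^+\|_{pcb}\ (\ge1)$, and $Sf:SA\to SB$ is $F\mapsto f\circ F$. *Quantitative $K$-theory.* Let $U$ be one of the algebras $A^+,SA^+,CA^+,\mathbb C$ ($\mathbb C$ with $M_n(\mathbb C)=B(\ell_p^n)$ and the trivial filtration). An $(\varepsilon,r,N)$-idempotent of $M_n(U)$ is an $e\in M_n(U_r)$ with $\|e^2-e\|<\varepsilon$ and $\|e\|,\|1-e\|\le N$. An $(\varepsilon,r,N)$-inverse pair is a pair $u,v\in M_n(U_r)$ with $\|u\|,\|v\|\le N$ and $\|uv-1\|,\|vu-1\|<\varepsilon$; then $u$ is an $(\varepsilon,r,N)$-invertible. $K_0^{\varepsilon,r,N}(U)$ is the Grothendieck group of the semigroup (under $\mathrm{diag}$) of $(\varepsilon,r,N)$-idempotents of all sizes, where $e\sim e'$ if after adding zeros they are joined by a norm-continuous path of $(4\varepsilon,r,4N)$-idempotents. $K_1^{\varepsilon,r,N}(U)$ is the group of $(\varepsilon,r,N)$-invertibles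 of all sizes, where $u\sim u'$ if after adding diagonal $1$'s they are the end points of a $(4\varepsilon,2r,4N)$-invertible of $C([0,1],M_k(U))$. For $X=A$ or $X=SA$, $K_i^{\varepsilon,r,N}(X)$ is the kernel of $\pi_*:K_i^{\varepsilon,r,N}(X^+)\to K_i^{\varepsilon,r,N}(\mathbb C)$. There are relaxation maps $\iota:K_i^{\varepsilon,r,N}(X)\to K_i^{\varepsilon',r',N'}(X)$, $[x]\mapsto[x]$, for $\varepsilon\le\varepsilon'$, $r\le r'$, $N\le N'$. For a filtered homomorphism $f$ and $\kappa\ge\|f^+\|_{pcb}$ there are maps $f_*:K_i^{\varepsilon,r,N}(A)\to K_i^{\kappa\varepsilon,r,\kappa N}(B)$, $[x]\mapsto[f^+(x)]$, and likewise $(Sf)_*$. *Controlled morphisms.* A *control pair* $(\lambda,h)$ consists of a non-decreasing $\lambda:[1,\infty)\to[1,\infty)$ and a function $h:(0,\frac1{20})\times[1,\infty)\to[1,\infty)$, $(\varepsilon,N)\mapsto h_{\varepsilon,N}$, non-increasing in $\varepsilon$; $\le$ between control pairs is pointwise. Parameters $(\varepsilon,r,N)$ are *admissible* for $(\lambda,h)$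 if $0<\varepsilon<\frac1{20\lambda_N}$, $r>0$ and $N\ge1$. A *$(\lambda,h)$-controlled morphism* $\mathcal F:\mathcal K_i(X)\to\mathcal K_j(Y)$ is a family of homomorphisms $F^{\varepsilon,r,N}:K_i^{\varepsilon,r,N}(X)\to K_j^{\lambda_N\varepsilon,\,h_{\varepsilon,N}r,\,\lambda_N}(Y)$, for admissible $(\varepsilon,r,N)$, with $\iota\circ F^{\varepsilon,r,N}=F^{\varepsilon',r',N'}\circ\iota$ whenever $\varepsilon\le\varepsilon'$, $r\le r'$, $N\le N'$ and $h_{\varepsilon,N}r\le h_{\varepsilon',N'}r'$. Let $\mathcal F:\mathcal K_i(X)\to\mathcal K_j(Y)$ be $(\lambda^{\mathcal F},h^{\mathcal F})$-controlled and $\mathcal G:\mathcal K_j(Y)\to\mathcal K_i(X)$ be $(\lambda^{\mathcal G},h^{\mathcal G})$-controlled. $\mathcal G$ is a *$(\lambda,h)$-inverse* of $\mathcal F$ if the control pairs of $\mathcal F$ and $\mathcal G$ are at most $(\lambda,h)$, and $\mathcal G\circ\mathcal F\sim\mathrm{Id}$ and $\mathcal F\circ\mathcal G\sim\mathrm{Id}$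 with control $(\lambda,h)$. The relation $\mathcal G\circ\mathcal F\sim\mathrm{Id}$ with control $(\lambda,h)$ means that $\lambda^{\mathcal G}_{\lambda^{\mathcal F}_N}\lambda^{\mathcal F}_N\le\lambda_N$ for all $N\ge1$, and that for $(\varepsilon,r,N)$ admissible for $(\lambda,h)$ and all $x\in K_i^{\varepsilon,r,N}(X)$, the parameters of the group that contains $G(F(x))$ are at most $(\lambda_N\varepsilon,h_{\varepsilon,N}r,\lambda_N)$, and $G(F(x))$ and $x$ have the same image in $K_i^{\lambda_N\varepsilon,\,h_{\varepsilon,N}r,\,\lambda_N}(X)$; the relation $\mathcal F\circ\mathcal G\sim\mathrm{Id}$ is read in the same way. *The controlled boundary map* of $0\to SA\to CA\to A\to0$, relative to control pairs $(\lambda,h)\le(\lambda',h')\le(\lambda^{\mathcal D},h^{\mathcal D})$, is a $(\lambda^{\mathcal D},h^{\mathcal D})$-controlled morphism $\mathcal D_{1S}:\mathcal K_1(A)\to\mathcal K_0(SA)$ with the following property. Let $(\varepsilon,r,N)$ be admissible for $(\lambda^{\mathcal D},h^{\mathcal D})$ and let $u\in M_n(A^+)$ be an $(\varepsilon,r,N)$-invertible.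 Consider all choices of * $m\ge0$ and an $(\varepsilon,r,N)$-invertible $v\in M_m(A^+)$ such that $\mathrm{diag}(u,v)$ and $I_{n+m}$ are joined by a $(2\varepsilon,2r,2(N+\varepsilon))$-invertible of $C([0,1],M_{n+m}(A^+))$; * a $(\lambda_N\varepsilon,h_{\varepsilon,N}r,\lambda_N)$-inverse pair $(w,w')$ in $M_{n+m}(CA^+)$ with $\|w(1)-\mathrm{diag}(u,v)\|<\lambda_N\varepsilon$; * $y\in M_{n+m}(SA_{h'_{\varepsilon,N}r})$ with $\|w\,\mathrm{diag}(I_n,0)\,w'-\mathrm{diag}(I_n,0)-y\|<3\lambda'_N\varepsilon$. Such choices exist, and for every one of them $y+\mathrm{diag}(I_n,0)$ and $\mathrm{diag}(I_n,0)$ are $(\lambda^{\mathcal D}_N\varepsilon,h^{\mathcal D}_{\varepsilon,N}r,\lambda^{\mathcal D}_N)$-idempotents over $SA^+$, and $\mathcal D_{1S}([u])=[y+\mathrm{diag}(I_n,0)]-[\mathrm{diag}(I_n,0)]$ whenever $[u]\in K_1^{\varepsilon,r,N}(A)$. **Statement.** There are control pairs $(\lambda,h)\le(\lambda',h')\le(\lambda^{\mathcal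 D},h^{\mathcal D})$, $(\lambda^{\mathcal B},h^{\mathcal B})$ and $(\lambda^{I},h^{I})$, depending only on $p$, and for every filtered $SQ_p$ algebra $A$ controlled morphisms $\mathcal D_{1S}:\mathcal K_1(A)\to\mathcal K_0(SA)$ (with control $(\lambda^{\mathcal D},h^{\mathcal D})$) and $\mathcal B_A:\mathcal K_0(SA)\to\mathcal K_1(A)$ (with control $(\lambda^{\mathcal B},h^{\mathcal B})$), such that: 1. $\mathcal D_{1S}$ is the controlled boundary map of $0\to SA\to CA\to A\to0$ relative to $(\lambda,h)\le(\lambda',h')\le(\lambda^{\mathcal D},h^{\mathcal D})$, for every filtered $SQ_p$ algebra $A$; 2. $\mathcal B_A$ is a $(\lambda^I,h^I)$-inverse of $\mathcal D_{1S}$, for every filtered $SQ_p$ algebra $A$; 3. $\mathcal B_B\circ(Sf)_*=f_*\circ\mathcal B_A$ for every filtered homomorphism $f:A\to B$ of filtered $SQ_p$ algebras: for all $\kappa\ge\|f^+\|_{pcb}$, all $(\varepsilon,r,N)$ such that $(\varepsilon,r,N)$ and $(\kappa\varepsilon,r,\kappa N)$ are admissible for $(\lambda^{\mathcal B},h^{\mathcal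 B})$, and all $x\in K_0^{\varepsilon,r,N}(SA)$, the elements $$\mathcal B_B((Sf)_*x)\in K_1^{\lambda^{\mathcal B}_{\kappa N}\kappa\varepsilon,\ h^{\mathcal B}_{\kappa\varepsilon,\kappa N}r,\ \lambda^{\mathcal B}_{\kappa N}}(B),\qquad f_*(\mathcal B_A x)\in K_1^{\kappa\lambda^{\mathcal B}_N\varepsilon,\ h^{\mathcal B}_{\varepsilon,N}r,\ \kappa\lambda^{\mathcal B}_N}(B)$$ have the same image in $K_1^{\varepsilon',r',N'}(B)$, where $\varepsilon'$, $r'$, $N'$ are the maxima of the respective parameters. -/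

import Mathlib

universe u v w

open Filter Topology MeasureTheory
open scoped ENNReal

namespace QuantK

/-! ## Matrix norms on `ℓ_p^n(E)` -/

/-- The operator on the `ℓ_p`-direct sum `E ⊕ ⋯ ⊕ E` given by an `n × n` matrix of bounded
operators on `E`. -/
noncomputable def matCLM (p : ℝ≥0∞) [Fact (1 ≤ p)] {E : Type u} [NormedAddCommGroup E]
    [NormedSpace ℂ E] {n : ℕ} (x : Matrix (Fin n) (Fin n) (E →L[ℂ] E)) :
    PiLp p (fun _ : Fin n => E) →L[ℂ] PiLp p (fun _ : Fin n => E) :=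
  ((PiLp.continuousLinearEquiv p ℂ (fun _ : Fin n => E)).symm :
      (Fin n → E) →L[ℂ] PiLp p (fun _ : Fin n => E)) ∘L
    (ContinuousLinearMap.pi fun i => ∑ j, (x i j) ∘L (PiLp.proj p (fun _ : Fin n => E) j))

theorem matCLM_apply (p : ℝ≥0∞) [Fact (1 ≤ p)] {E : Type u} [NormedAddCommGroup E]
    [NormedSpace ℂ E] {n : ℕ} (x : Matrix (Fin n) (Fin n) (E →L[ℂ] E))
    (ξ : PiLp p (fun _ : Fin n => E)) (i : Fin n) :
    matCLM p x ξ i = ∑ j, x i j (ξ j) := by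
  simp [matCLM]

theorem norm_le_sum_entries (p : ℝ≥0∞) [Fact (1 ≤ p)] {E : Type u} [NormedAddCommGroup E]
    {n : ℕ} (η : PiLp p (fun _ : Fin n => E)) : ‖η‖ ≤ ∑ i, ‖η i‖ := by
  have h : η = ∑ i, PiLp.single p i (η i) := by
    ext k
    rw [WithLp.ofLp_sum]
    simp [Finset.sum_apply, Pi.single_apply]
  conv_lhs => rw [h]
  refine (norm_sum_le _ _).trans (le_of_eq ?_)
  exact Finset.sum_congr rfl fun i _ => PiLp.norm_single p (fun _ : Fin n => E) i (η i)

theorem norm_matCLM_le (p : ℝ≥0∞) [Fact (1 ≤ p)] {E : Type u} [NormedAddCommGroup E]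
    [NormedSpace ℂ E] {n : ℕ} (x : Matrix (Fin n) (Fin n) (E →L[ℂ] E)) :
    ‖matCLM p x‖ ≤ ∑ i, ∑ j, ‖x i j‖ := by
  refine ContinuousLinearMap.opNorm_le_bound _ (by positivity) fun ξ => ?_
  refine (norm_le_sum_entries p _).trans ?_
  rw [Finset.sum_mul]
  refine Finset.sum_le_sum fun i _ => ?_
  rw [matCLM_apply, Finset.sum_mul]
  refine (norm_sum_le _ _).trans (Finset.sum_le_sum fun j _ => ?_)
  exact ((x i j).le_opNorm _).trans
    (mul_le_mul_of_nonneg_left (PiLp.norm_apply_le ξ j) (norm_nonneg _))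

theorem norm_entry_le_matCLM (p : ℝ≥0∞) [Fact (1 ≤ p)] {E : Type u} [NormedAddCommGroup E]
    [NormedSpace ℂ E] {n : ℕ} (x : Matrix (Fin n) (Fin n) (E →L[ℂ] E)) (k l : Fin n) :
    ‖x k l‖ ≤ ‖matCLM p x‖ := by
  refine ContinuousLinearMap.opNorm_le_bound _ (norm_nonneg _) fun ξ => ?_
  have h := (PiLp.norm_apply_le (matCLM p x (PiLp.single p l ξ)) k).trans
    ((matCLM p x).le_opNorm _)
  rw [PiLp.norm_single, matCLM_apply] at h
  rw [Finset.sum_eq_single l (fun j _ hj => by simp [hj]) (by simp)] at h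
  simpa using h

/-- The norm of a complex `n × n` matrix in `B(ℓ_p^n)`. -/
noncomputable def scalarNorm (p : ℝ≥0∞) [Fact (1 ≤ p)] (n : ℕ) (z : Matrix (Fin n) (Fin n) ℂ) : ℝ :=
  ‖matCLM p (z.map fun c => c • (1 : ℂ →L[ℂ] ℂ))‖

/-! ## Unital matrix-normed filtered algebras and their quantitative `K`-groups -/

/-- The data of a unital algebra from which quantitative `K`-groups are formed: norms on all matrix
algebras and a filtration `(U_r)`. -/
structure UnitalMatAlg where
  carrier : Type u
  [ring : Ring carrier]
  nrm : ∀ n : ℕ, Matrix (Fin n) (Fin n) carrier → ℝ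
  nrm_nonneg : ∀ n x, 0 ≤ nrm n x
  fil : ℝ → Set carrier
  fil_mono : ∀ r r' : ℝ, r ≤ r' → fil r ⊆ fil r'

attribute [instance] UnitalMatAlg.ring

/-- Square matrices of size `n` over `U`. -/
abbrev UnitalMatAlg.Mat (U : UnitalMatAlg.{u}) (n : ℕ) : Type u :=
  Matrix (Fin n) (Fin n) U.carrier

/-- `ℂ`, with `M_n(ℂ) = B(ℓ_p^n)` and the trivial filtration. -/
noncomputable def complexAlg (p : ℝ≥0∞) [Fact (1 ≤ p)] : UnitalMatAlg.{0} where
  carrier := ℂ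
  nrm := scalarNorm p
  nrm_nonneg _ _ := norm_nonneg _
  fil _ := Set.univ
  fil_mono _ _ _ := subset_rfl

/-- `x` is an `(ε, r, N)`-idempotent of `M_n(U)`. -/
def QuasiIdem (U : UnitalMatAlg.{u}) (ε r N : ℝ) {n : ℕ} (x : U.Mat n) : Prop :=
  U.nrm n (x * x - x) < ε ∧ (∀ i j, x i j ∈ U.fil r) ∧ U.nrm n x ≤ N ∧ U.nrm n (1 - x) ≤ N

/-- `(x, y)` is an `(ε, r, N)`-inverse pair in `M_n(U)`. -/
def InversePair (U : UnitalMatAlg.{u}) (ε r N : ℝ) {n : ℕ} (x y : U.Mat n) : Prop :=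
  (∀ i j, x i j ∈ U.fil r) ∧ (∀ i j, y i j ∈ U.fil r) ∧ U.nrm n x ≤ N ∧ U.nrm n y ≤ N ∧
    U.nrm n (x * y - 1) < ε ∧ U.nrm n (y * x - 1) < ε

/-- `x` is an `(ε, r, N)`-invertible of `M_n(U)`. -/
def QuasiInv (U : UnitalMatAlg.{u}) (ε r N : ℝ) {n : ℕ} (x : U.Mat n) : Prop :=
  ∃ y : U.Mat n, InversePair U ε r N x y

/-- Norm continuity of a path in `M_n(U)`. -/
def NormContinuous (U : UnitalMatAlg.{u}) {n : ℕ} (γ : unitInterval → U.Mat n) : Prop :=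
  ∀ s, Tendsto (fun t => U.nrm n (γ t - γ s)) (𝓝 s) (𝓝 0)

/-- `x` and `y` are homotopic through `(ε, r, N)`-idempotents of `M_n(U)`. -/
def IdemHomotopic (U : UnitalMatAlg.{u}) (ε r N : ℝ) {n : ℕ} (x y : U.Mat n) : Prop :=
  ∃ γ : unitInterval → U.Mat n, NormContinuous U γ ∧ γ 0 = x ∧ γ 1 = y ∧
    ∀ t, QuasiIdem U ε r N (γ t)

/-- `x` and `y` are the end points of an `(ε, r, N)`-invertible of `C([0,1], M_n(U))`. -/
def InvHomotopic (U : UnitalMatAlg.{u}) (ε r N : ℝ) {n : ℕ} (x y : U.Mat n) : Prop :=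
  ∃ γ δ : unitInterval → U.Mat n, NormContinuous U γ ∧ NormContinuous U δ ∧ γ 0 = x ∧ γ 1 = y ∧
    ∀ t, InversePair U ε r N (γ t) (δ t)

/-- The degree of a `K`-group. -/
inductive KDeg
  | zero
  | one

/-- Elements of `Idem_n` (degree `0`), respectively of `GL_n` (degree `1`). -/
def IsQuasi (i : KDeg) (U : UnitalMatAlg.{u}) (ε r N : ℝ) {n : ℕ} (x : U.Mat n) : Prop :=
  match i with
  | .zero => QuasiIdem U ε r N x
  | .one => QuasiInv U ε r N x

/-- The homotopy relation that defines the classes at parameters `(ε, r, N)`: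
`(4ε, r, 4N)`-homotopy in degree `0` and `(4ε, 2r, 4N)`-homotopy in degree `1`. -/
def ClassHomotopic (i : KDeg) (U : UnitalMatAlg.{u}) (ε r N : ℝ) {n : ℕ} (x y : U.Mat n) : Prop :=
  match i with
  | .zero => IdemHomotopic U (4 * ε) r (4 * N) x y
  | .one => InvHomotopic U (4 * ε) (2 * r) (4 * N) x y

/-- The filler on the diagonal of the inclusions `M_n → M_{n+1}`. -/
def KDeg.filler (i : KDeg) (R : Type u) [Ring R] : R :=
  match i with
  | .zero => 0
  | .one => 1

/-- For `n ≤ k`, the image of `x ∈ M_n` in `M_k` under `x ↦ diag(x, d, …, d)`. -/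
def padTo {R : Type u} [Zero R] (d : R) {n : ℕ} (k : ℕ) (x : Matrix (Fin n) (Fin n) R) :
    Matrix (Fin k) (Fin k) R := fun i j =>
  if h : (i : ℕ) < n ∧ (j : ℕ) < n then x ⟨i, h.1⟩ ⟨j, h.2⟩ else if i = j then d else 0

/-- The block diagonal matrix `diag(x, y)`. -/
def bdiag {R : Type u} [Zero R] {n m : ℕ} (x : Matrix (Fin n) (Fin n) R)
    (y : Matrix (Fin m) (Fin m) R) : Matrix (Fin (n + m)) (Fin (n + m)) R :=
  Matrix.reindex finSumFinEquiv finSumFinEquiv (Matrix.fromBlocks x 0 0 y)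

/-- `Idem_∞^{ε,r,N}(U)`, respectively `GL_∞^{ε,r,N}(U)`. -/
abbrev KGen (i : KDeg) (U : UnitalMatAlg.{u}) (ε r N : ℝ) : Type u :=
  Σ n : ℕ, {x : U.Mat n // IsQuasi i U ε r N x}

theorem KGen.ext_mat {i : KDeg} {U : UnitalMatAlg.{u}} {ε r N : ℝ} {n : ℕ} {x y : U.Mat n}
    (h : x = y) (hx : IsQuasi i U ε r N x) (hy : IsQuasi i U ε r N y) :
    (⟨n, ⟨x, hx⟩⟩ : KGen i U ε r N) = ⟨n, ⟨y, hy⟩⟩ := by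
  subst h; rfl

/-- The equivalence relation `∼` on `Idem_∞`, respectively `GL_∞`. -/
def KGen.Equiv {i : KDeg} {U : UnitalMatAlg.{u}} {ε r N : ℝ} (a b : KGen i U ε r N) : Prop :=
  ∃ k, a.1 ≤ k ∧ b.1 ≤ k ∧
    ClassHomotopic i U ε r N (padTo (i.filler U.carrier) k a.2.1)
      (padTo (i.filler U.carrier) k b.2.1)

/-- The relations `[a] = [b]` for `a ∼ b` and `[diag(a, b)] = [a] + [b]`. -/
def kRel (i : KDeg) (U : UnitalMatAlg.{u}) (ε r N : ℝ) :
    AddSubgroup (FreeAbelianGroup (KGen i U ε r N)) :=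
  AddSubgroup.closure
    ({g | ∃ a b : KGen i U ε r N, a.Equiv b ∧
        g = FreeAbelianGroup.of a - FreeAbelianGroup.of b} ∪
     {g | ∃ (a b : KGen i U ε r N) (h : IsQuasi i U ε r N (bdiag a.2.1 b.2.1)),
        g = FreeAbelianGroup.of ⟨a.1 + b.1, ⟨bdiag a.2.1 b.2.1, h⟩⟩
          - FreeAbelianGroup.of a - FreeAbelianGroup.of b})

/-- The Grothendieck group of the abelian semigroup `Idem_∞^{ε,r,N}(U)/∼` (degree `0`),
respectively of `GL_∞^{ε,r,N}(U)/∼` (degree `1`), with addition `[x] + [y] = [diag(x, y)]`.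
The latter semigroup is already a group, hence is its own Grothendieck group. -/
def KUnital (i : KDeg) (U : UnitalMatAlg.{u}) (ε r N : ℝ) : Type u :=
  FreeAbelianGroup (KGen i U ε r N) ⧸ kRel i U ε r N

noncomputable instance (i : KDeg) (U : UnitalMatAlg.{u}) (ε r N : ℝ) :
    AddCommGroup (KUnital i U ε r N) :=
  inferInstanceAs (AddCommGroup (FreeAbelianGroup (KGen i U ε r N) ⧸ kRel i U ε r N))

/-- The class `[x]`. -/
def kClass (i : KDeg) (U : UnitalMatAlg.{u}) (ε r N : ℝ) {n : ℕ} (x : U.Mat n)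
    (hx : IsQuasi i U ε r N x) : KUnital i U ε r N :=
  QuotientAddGroup.mk' (kRel i U ε r N) (FreeAbelianGroup.of ⟨n, ⟨x, hx⟩⟩)

theorem KUnital.hom_ext {i : KDeg} {U : UnitalMatAlg.{u}} {ε r N : ℝ} {G : Type v} [AddCommGroup G]
    {f g : KUnital i U ε r N →+ G}
    (h : ∀ (n : ℕ) (x : U.Mat n) (hx : IsQuasi i U ε r N x),
      f (kClass i U ε r N x hx) = g (kClass i U ε r N x hx)) : f = g := by
  refine QuotientAddGroup.addMonoidHom_ext (kRel i U ε r N) ?_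
  refine FreeAbelianGroup.lift_ext _ _ ?_
  rintro ⟨n, x, hx⟩
  exact h n x hx

/-! ## Functoriality -/

/-- Unital filtered homomorphisms `U → V` all of whose matrix amplifications have norm at
most `κ`. -/
structure UnitalHom (U : UnitalMatAlg.{u}) (V : UnitalMatAlg.{v}) (κ : ℝ) where
  hom : U.carrier →+* V.carrier
  pos : 0 < κ
  map_fil : ∀ r : ℝ, ∀ x ∈ U.fil r, hom x ∈ V.fil r
  bound : ∀ (n : ℕ) (x : U.Mat n), V.nrm n (hom.mapMatrix x) ≤ κ * U.nrm n x

/-- The identity. -/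
def UnitalHom.id (U : UnitalMatAlg.{u}) : UnitalHom U U 1 where
  hom := RingHom.id _
  pos := one_pos
  map_fil _ _ hx := hx
  bound n x := by rw [one_mul, RingHom.mapMatrix_id]; exact le_rfl

/-- `Relaxes ε r N ε' r' N'`: the parameters `(ε', r', N')` relax `(ε, r, N)`. -/
structure Relaxes (ε r N ε' r' N' : ℝ) : Prop where
  eps : ε ≤ ε'
  prop : r ≤ r'
  bd : N ≤ N'

section Functoriality

variable {U : UnitalMatAlg.{u}} {V : UnitalMatAlg.{v}} {κ : ℝ} (φ : UnitalHom U V κ)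
  {ε r N ε' r' N' : ℝ}

theorem UnitalHom.quasiIdem (h : Relaxes (κ * ε) r (κ * N) ε' r' N') {n : ℕ} {x : U.Mat n}
    (hx : QuasiIdem U ε r N x) : QuasiIdem V ε' r' N' (φ.hom.mapMatrix x) := by
  obtain ⟨h1, h2, h3, h4⟩ := hx
  have hk := φ.pos
  refine ⟨?_, fun i j => V.fil_mono r r' h.prop (φ.map_fil r _ (h2 i j)), ?_, ?_⟩
  · rw [← map_mul, ← map_sub]
    exact ((φ.bound n _).trans_lt (mul_lt_mul_of_pos_left h1 hk)).trans_le h.eps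
  · exact ((φ.bound n _).trans (mul_le_mul_of_nonneg_left h3 hk.le)).trans h.bd
  · rw [← map_one φ.hom.mapMatrix, ← map_sub]
    exact ((φ.bound n _).trans (mul_le_mul_of_nonneg_left h4 hk.le)).trans h.bd

theorem UnitalHom.inversePair (h : Relaxes (κ * ε) r (κ * N) ε' r' N') {n : ℕ} {x y : U.Mat n}
    (hx : InversePair U ε r N x y) :
    InversePair V ε' r' N' (φ.hom.mapMatrix x) (φ.hom.mapMatrix y) := by
  obtain ⟨h1, h2, h3, h4, h5, h6⟩ := hx
  have hk := φ.pos
  refine ⟨fun i j => V.fil_mono r r' h.prop (φ.map_fil r _ (h1 i j)),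
    fun i j => V.fil_mono r r' h.prop (φ.map_fil r _ (h2 i j)), ?_, ?_, ?_, ?_⟩
  · exact ((φ.bound n _).trans (mul_le_mul_of_nonneg_left h3 hk.le)).trans h.bd
  · exact ((φ.bound n _).trans (mul_le_mul_of_nonneg_left h4 hk.le)).trans h.bd
  · rw [← map_mul, ← map_one φ.hom.mapMatrix, ← map_sub]
    exact ((φ.bound n _).trans_lt (mul_lt_mul_of_pos_left h5 hk)).trans_le h.eps
  · rw [← map_mul, ← map_one φ.hom.mapMatrix, ← map_sub]
    exact ((φ.bound n _).trans_lt (mul_lt_mul_of_pos_left h6 hk)).trans_le h.eps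

theorem UnitalHom.isQuasi {i : KDeg} (h : Relaxes (κ * ε) r (κ * N) ε' r' N') {n : ℕ}
    {x : U.Mat n} (hx : IsQuasi i U ε r N x) : IsQuasi i V ε' r' N' (φ.hom.mapMatrix x) := by
  cases i with
  | zero => exact φ.quasiIdem h hx
  | one => exact hx.elim fun y hy => ⟨_, φ.inversePair h hy⟩

theorem UnitalHom.normContinuous {n : ℕ} {γ : unitInterval → U.Mat n} (hγ : NormContinuous U γ) :
    NormContinuous V (fun t => φ.hom.mapMatrix (γ t)) := by
  intro s
  have h0 : Tendsto (fun t => κ * U.nrm n (γ t - γ s)) (𝓝 s) (𝓝 0) := by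
    simpa using (hγ s).const_mul κ
  refine squeeze_zero (fun t => V.nrm_nonneg _ _) (fun t => ?_) h0
  rw [← map_sub]
  exact φ.bound n _

theorem UnitalHom.classHomotopic {i : KDeg} (h : Relaxes (κ * ε) r (κ * N) ε' r' N') {n : ℕ}
    {x y : U.Mat n} (hxy : ClassHomotopic i U ε r N x y) :
    ClassHomotopic i V ε' r' N' (φ.hom.mapMatrix x) (φ.hom.mapMatrix y) := by
  have e4 : κ * (4 * ε) ≤ 4 * ε' := by have := h.eps; linarith
  have n4 : κ * (4 * N) ≤ 4 * N' := by have := h.bd; linarith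
  cases i with
  | zero =>
    obtain ⟨γ, hc, h0, h1, hq⟩ := hxy
    exact ⟨_, φ.normContinuous hc, by rw [h0], by rw [h1],
      fun t => φ.quasiIdem ⟨e4, h.prop, n4⟩ (hq t)⟩
  | one =>
    obtain ⟨γ, δ, hc, hd, h0, h1, hq⟩ := hxy
    refine ⟨_, _, φ.normContinuous hc, φ.normContinuous hd, by rw [h0], by rw [h1],
      fun t => φ.inversePair ⟨e4, ?_, n4⟩ (hq t)⟩
    · have := h.prop; linarith

theorem map_padTo {R : Type u} {S : Type v} [Ring R] [Ring S] (f : R →+* S) (i : KDeg) {n : ℕ}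
    (k : ℕ) (x : Matrix (Fin n) (Fin n) R) :
    f.mapMatrix (padTo (i.filler R) k x) = padTo (i.filler S) k (f.mapMatrix x) := by
  ext a b
  simp only [RingHom.mapMatrix_apply, Matrix.map_apply, padTo]
  split_ifs
  · rfl
  · cases i <;> simp [KDeg.filler]
  · simp

theorem map_bdiag {R : Type u} {S : Type v} [Ring R] [Ring S] (f : R →+* S) {n m : ℕ}
    (x : Matrix (Fin n) (Fin n) R) (y : Matrix (Fin m) (Fin m) R) :
    f.mapMatrix (bdiag x y) = bdiag (f.mapMatrix x) (f.mapMatrix y) := by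
  ext a b
  simp only [bdiag, RingHom.mapMatrix_apply, Matrix.map_apply, Matrix.reindex_apply,
    Matrix.submatrix_apply]
  rcases finSumFinEquiv.symm a with a | a <;> rcases finSumFinEquiv.symm b with b | b <;> simp

/-- The map on generators induced by a unital filtered homomorphism. -/
def KGen.map (i : KDeg) (h : Relaxes (κ * ε) r (κ * N) ε' r' N') (a : KGen i U ε r N) :
    KGen i V ε' r' N' :=
  ⟨a.1, ⟨φ.hom.mapMatrix a.2.1, φ.isQuasi h a.2.2⟩⟩

/-- The homomorphism `[x] ↦ [φ(x)]` from `K_i^{ε,r,N}(U)` to `K_i^{ε',r',N'}(V)`, for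
`κ ε ≤ ε'`, `r ≤ r'`, `κ N ≤ N'`. -/
noncomputable def KUnital.map (i : KDeg) (h : Relaxes (κ * ε) r (κ * N) ε' r' N') :
    KUnital i U ε r N →+ KUnital i V ε' r' N' :=
  QuotientAddGroup.map (kRel i U ε r N) (kRel i V ε' r' N') (FreeAbelianGroup.map (KGen.map φ i h))
    (by
      rw [kRel, AddSubgroup.closure_le]
      rintro g (⟨a, b, ⟨k, ha, hb, hab⟩, rfl⟩ | ⟨a, b, hq, rfl⟩)
      · refine AddSubgroup.subset_closure (Or.inl ⟨KGen.map φ i h a, KGen.map φ i h b,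
          ⟨k, ha, hb, ?_⟩, ?_⟩)
        · have := φ.classHomotopic h hab
          rwa [map_padTo, map_padTo] at this
        · simp [FreeAbelianGroup.map_of_apply]
      · have hq' := φ.isQuasi h hq
        rw [map_bdiag] at hq'
        refine AddSubgroup.subset_closure (Or.inr ⟨KGen.map φ i h a, KGen.map φ i h b, hq', ?_⟩)
        simp only [map_sub, FreeAbelianGroup.map_of_apply]
        congr 3
        exact KGen.ext_mat (map_bdiag φ.hom _ _) _ _)

theorem KUnital.map_kClass (i : KDeg) (h : Relaxes (κ * ε) r (κ * N) ε' r' N') {n : ℕ}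
    (x : U.Mat n) (hx : IsQuasi i U ε r N x) :
    KUnital.map φ i h (kClass i U ε r N x hx) =
      kClass i V ε' r' N' (φ.hom.mapMatrix x) (φ.isQuasi h hx) := by
  change QuotientAddGroup.mk' _ (FreeAbelianGroup.map _ (FreeAbelianGroup.of _)) = _
  rw [FreeAbelianGroup.map_of_apply]
  rfl

end Functoriality

/-! ## Filtered matrix-normed algebras, possibly without unit -/

/-- The data of a filtered algebra `A` with norms on all matrix algebras `M_n(A⁺)` over its
unitization `A⁺ = {(a, z) : a ∈ A, z ∈ ℂ}`. -/
structure MatAlg (p : ℝ≥0∞) [Fact (1 ≤ p)] where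
  carrier : Type u
  [ring : NonUnitalNormedRing carrier]
  [space : NormedSpace ℂ carrier]
  [tower : IsScalarTower ℂ carrier carrier]
  [comm : SMulCommClass ℂ carrier carrier]
  nrm : ∀ n : ℕ, Matrix (Fin n) (Fin n) (Unitization ℂ carrier) → ℝ
  scalar_le : ∀ n x, scalarNorm p n (x.map fun z => z.fst) ≤ nrm n x
  entry_le : ∀ (n : ℕ) (a : Matrix (Fin n) (Fin n) carrier) (k l : Fin n),
    ‖a k l‖ ≤ nrm n (a.map Unitization.inr)
  le_sum : ∀ n x, nrm n x ≤ ∑ i, ∑ j, (‖(x i j).fst‖ + ‖(x i j).snd‖)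
  fil : ℝ → Submodule ℂ carrier
  fil_mono : ∀ r r' : ℝ, r ≤ r' → fil r ≤ fil r'

attribute [instance] MatAlg.ring MatAlg.space MatAlg.tower MatAlg.comm

section MatAlg

variable {p : ℝ≥0∞} [Fact (1 ≤ p)]

theorem MatAlg.nrm_nonneg (X : MatAlg.{u} p) (n : ℕ)
    (x : Matrix (Fin n) (Fin n) (Unitization ℂ X.carrier)) : 0 ≤ X.nrm n x :=
  (norm_nonneg _).trans (X.scalar_le n x)

/-- The unitization `A⁺`, with filtration `(A_r + ℂ)`. -/
noncomputable def MatAlg.plus (X : MatAlg.{u} p) : UnitalMatAlg.{u} where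
  carrier := Unitization ℂ X.carrier
  nrm := X.nrm
  nrm_nonneg := X.nrm_nonneg
  fil r := {x | x.snd ∈ X.fil r}
  fil_mono r r' h _ hx := X.fil_mono r r' h hx

/-- The canonical homomorphism `π : A⁺ → ℂ`. -/
noncomputable def MatAlg.aug (X : MatAlg.{u} p) : UnitalHom X.plus (complexAlg p) 1 where
  hom := (Unitization.fstHom ℂ X.carrier).toRingHom
  pos := one_pos
  map_fil _ _ _ := trivial
  bound n x := by rw [one_mul]; exact X.scalar_le n x

theorem relaxes_one (ε r N : ℝ) : Relaxes (1 * ε) r (1 * N) ε r N :=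
  ⟨by rw [one_mul], le_rfl, by rw [one_mul]⟩

theorem Relaxes.one_mul {ε r N ε' r' N' : ℝ} (h : Relaxes ε r N ε' r' N') :
    Relaxes (1 * ε) r (1 * N) ε' r' N' :=
  ⟨by rw [_root_.one_mul]; exact h.eps, h.prop, by rw [_root_.one_mul]; exact h.bd⟩

/-- `K_i^{ε,r,N}(A)`, the kernel of `π_* : K_i^{ε,r,N}(A⁺) → K_i^{ε,r,N}(ℂ)`. -/
noncomputable def KGrp (i : KDeg) (X : MatAlg.{u} p) (ε r N : ℝ) :
    AddSubgroup (KUnital i X.plus ε r N) :=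
  (KUnital.map X.aug i (relaxes_one ε r N)).ker

/-- A unital filtered homomorphism `φ : A⁺ → B⁺` with `π ∘ φ = π` induces
`K_i^{ε,r,N}(A) → K_i^{ε',r',N'}(B)`. -/
noncomputable def KGrp.map {X : MatAlg.{u} p} {Y : MatAlg.{v} p} {κ : ℝ}
    (φ : UnitalHom X.plus Y.plus κ) (hφ : ∀ x, Y.aug.hom (φ.hom x) = X.aug.hom x) (i : KDeg)
    {ε r N ε' r' N' : ℝ} (h : Relaxes (κ * ε) r (κ * N) ε' r' N')
    (h' : Relaxes ε r N ε' r' N') : KGrp i X ε r N →+ KGrp i Y ε' r' N' :=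
  ((KUnital.map φ i h).comp (KGrp i X ε r N).subtype).codRestrict (KGrp i Y ε' r' N') (by
    rintro ⟨x, hx⟩
    have key : (KUnital.map Y.aug i (relaxes_one ε' r' N')).comp (KUnital.map φ i h) =
        (KUnital.map (UnitalHom.id (complexAlg p)) i h'.one_mul).comp
          (KUnital.map X.aug i (relaxes_one ε r N)) := by
      refine KUnital.hom_ext fun n x hx => ?_
      simp only [AddMonoidHom.comp_apply, KUnital.map_kClass]
      have hm : Y.aug.hom.mapMatrix (φ.hom.mapMatrix x) =
          (UnitalHom.id (complexAlg p)).hom.mapMatrix (X.aug.hom.mapMatrix x) := by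
        ext a b
        exact hφ (x a b)
      unfold kClass
      rw [KGen.ext_mat hm]
    have h1 := DFunLike.congr_fun key x
    rw [KGrp, AddMonoidHom.mem_ker] at hx
    simp only [AddMonoidHom.comp_apply, hx, map_zero] at h1
    exact h1)

/-- The relaxation of control maps `ι_i`. -/
noncomputable def KGrp.relax (i : KDeg) (X : MatAlg.{u} p) {ε r N ε' r' N' : ℝ}
    (h : Relaxes ε r N ε' r' N') : KGrp i X ε r N →+ KGrp i X ε' r' N' :=
  KGrp.map (UnitalHom.id X.plus) (fun _ => rfl) i h.one_mul h

/-- `x` and `y` have equal images in `K_i^{ε',r',N'}(A)` under the relaxation of control maps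
(in particular, these maps are defined). -/
def SameAt {i : KDeg} {X : MatAlg.{u} p} (ε' r' N' : ℝ) {ε₁ r₁ N₁ ε₂ r₂ N₂ : ℝ}
    (x : KGrp i X ε₁ r₁ N₁) (y : KGrp i X ε₂ r₂ N₂) : Prop :=
  ∃ (h₁ : Relaxes ε₁ r₁ N₁ ε' r' N') (h₂ : Relaxes ε₂ r₂ N₂ ε' r' N'),
    KGrp.relax i X h₁ x = KGrp.relax i X h₂ y

/-! ## Filtered homomorphisms -/

/-- A filtered homomorphism: a `p`-completely bounded algebra homomorphism that preserves the
filtrations (for `r ≤ 0` the condition is void in all algebras considered, as `A_r = 0` there). -/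
structure FilteredHom (X : MatAlg.{u} p) (Y : MatAlg.{v} p) where
  hom : X.carrier →ₙₐ[ℂ] Y.carrier
  pcb : ∃ C : ℝ, ∀ (n : ℕ) (a : Matrix (Fin n) (Fin n) X.carrier),
    Y.nrm n ((a.map hom).map Unitization.inr) ≤ C * X.nrm n (a.map Unitization.inr)
  map_fil : ∀ r : ℝ, ∀ a ∈ X.fil r, hom a ∈ Y.fil r

theorem FilteredHom.continuous {X : MatAlg.{u} p} {Y : MatAlg.{v} p} (f : FilteredHom X Y) :
    Continuous f.hom := by
  obtain ⟨C, hC⟩ := f.pcb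
  refine AddMonoidHomClass.continuous_of_bound f.hom |C| fun a => ?_
  let m : Matrix (Fin 1) (Fin 1) X.carrier := fun _ _ => a
  have h1 : ‖f.hom a‖ ≤ Y.nrm 1 ((m.map f.hom).map Unitization.inr) :=
    Y.entry_le 1 (m.map f.hom) 0 0
  have h2 : X.nrm 1 (m.map Unitization.inr) ≤ ‖a‖ := by
    refine (X.le_sum 1 (m.map Unitization.inr)).trans (le_of_eq ?_)
    simp only [Finset.univ_unique, Finset.sum_singleton]
    change ‖(0 : ℂ)‖ + ‖a‖ = ‖a‖
    rw [norm_zero, zero_add]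
  calc ‖f.hom a‖ ≤ C * X.nrm 1 (m.map Unitization.inr) := h1.trans (hC 1 m)
    _ ≤ |C| * X.nrm 1 (m.map Unitization.inr) :=
        mul_le_mul_of_nonneg_right (le_abs_self C) (X.nrm_nonneg _ _)
    _ ≤ |C| * ‖a‖ := mul_le_mul_of_nonneg_left h2 (abs_nonneg C)

/-- The unital homomorphism `f⁺ : A⁺ → B⁺`, `f⁺(a, z) = (f(a), z)`. -/
noncomputable def FilteredHom.plusHom {X : MatAlg.{u} p} {Y : MatAlg.{v} p}
    (f : FilteredHom X Y) : Unitization ℂ X.carrier →+* Unitization ℂ Y.carrier :=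
  (Unitization.lift ((Unitization.inrNonUnitalAlgHom ℂ Y.carrier).comp f.hom)).toRingHom

theorem FilteredHom.plusHom_apply {X : MatAlg.{u} p} {Y : MatAlg.{v} p} (f : FilteredHom X Y)
    (x : Unitization ℂ X.carrier) :
    f.plusHom x = Unitization.inl x.fst + Unitization.inr (f.hom x.snd) := by
  simp [FilteredHom.plusHom, Unitization.lift, Unitization.algebraMap_eq_inl]

theorem FilteredHom.plusHom_fst {X : MatAlg.{u} p} {Y : MatAlg.{v} p} (f : FilteredHom X Y)
    (x : Unitization ℂ X.carrier) : (f.plusHom x).fst = x.fst := by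
  simp [FilteredHom.plusHom_apply]

theorem FilteredHom.plusHom_snd {X : MatAlg.{u} p} {Y : MatAlg.{v} p} (f : FilteredHom X Y)
    (x : Unitization ℂ X.carrier) : (f.plusHom x).snd = f.hom x.snd := by
  simp [FilteredHom.plusHom_apply]

/-- `‖f⁺‖_pcb ≤ κ`. -/
structure FilteredHom.PlusBound {X : MatAlg.{u} p} {Y : MatAlg.{v} p} (f : FilteredHom X Y)
    (κ : ℝ) : Prop where
  pos : 0 < κ
  bound : ∀ (n : ℕ) (x : Matrix (Fin n) (Fin n) (Unitization ℂ X.carrier)),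
    Y.nrm n (x.map f.plusHom) ≤ κ * X.nrm n x

/-- `f⁺` as a unital filtered homomorphism. -/
noncomputable def FilteredHom.plus {X : MatAlg.{u} p} {Y : MatAlg.{v} p} (f : FilteredHom X Y)
    {κ : ℝ} (hκ : f.PlusBound κ) : UnitalHom X.plus Y.plus κ where
  hom := f.plusHom
  pos := hκ.pos
  map_fil r x hx := by
    change (f.plusHom x).snd ∈ Y.fil r
    have h := f.plusHom_snd x
    rw [h]
    exact f.map_fil r _ hx
  bound := hκ.bound

/-- `f_* : K_i^{ε,r,N}(A) → K_i^{κε,r,κN}(B)`, where `κ ≥ ‖f⁺‖_pcb`. -/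
noncomputable def FilteredHom.star {X : MatAlg.{u} p} {Y : MatAlg.{v} p} (f : FilteredHom X Y)
    {κ : ℝ} (hκ : f.PlusBound κ) (i : KDeg) (ε r N : ℝ) (h : Relaxes ε r N (κ * ε) r (κ * N)) :
    KGrp i X ε r N →+ KGrp i Y (κ * ε) r (κ * N) :=
  KGrp.map (f.plus hκ) (fun x => f.plusHom_fst x) i ⟨le_rfl, le_rfl, le_rfl⟩ h

/-! ## Cone and suspension -/

/-- The algebra of `F ∈ C([0,1], A)` that vanish on `Z`. -/
def pathSubalgebra (Z : Set unitInterval) (A : Type u) [NonUnitalNormedRing A] [NormedSpace ℂ A]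
    [IsScalarTower ℂ A A] [SMulCommClass ℂ A A] : NonUnitalSubalgebra ℂ C(unitInterval, A) where
  carrier := {F | ∀ t ∈ Z, F t = 0}
  add_mem' {F G} hF hG t ht := by simp [hF t ht, hG t ht]
  zero_mem' t _ := by simp
  mul_mem' {F G} hF hG t ht := by simp [hF t ht]
  smul_mem' c F hF t ht := by simp [hF t ht]

/-- A subalgebra of a normed algebra is a normed space. -/
noncomputable instance subalgebraNormedSpace {A : Type u} [NonUnitalNormedRing A]
    [NormedSpace ℂ A] (S : NonUnitalSubalgebra ℂ A) : NormedSpace ℂ S where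
  norm_smul_le c a := norm_smul_le c (a : A)

/-- Evaluation at `t` on unitizations, `(F, z) ↦ (F(t), z)`. -/
noncomputable def evalPlus {Z : Set unitInterval} {A : Type u} [NonUnitalNormedRing A]
    [NormedSpace ℂ A] [IsScalarTower ℂ A A] [SMulCommClass ℂ A A] (t : unitInterval)
    (x : Unitization ℂ (pathSubalgebra Z A)) : Unitization ℂ A :=
  Unitization.inl x.fst + Unitization.inr ((x.snd : C(unitInterval, A)) t)

theorem evalPlus_fst {Z : Set unitInterval} {A : Type u} [NonUnitalNormedRing A]
    [NormedSpace ℂ A] [IsScalarTower ℂ A A] [SMulCommClass ℂ A A] (t : unitInterval)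
    (x : Unitization ℂ (pathSubalgebra Z A)) : (evalPlus t x).fst = x.fst := by
  simp [evalPlus]

theorem evalPlus_snd {Z : Set unitInterval} {A : Type u} [NonUnitalNormedRing A]
    [NormedSpace ℂ A] [IsScalarTower ℂ A A] [SMulCommClass ℂ A A] (t : unitInterval)
    (x : Unitization ℂ (pathSubalgebra Z A)) :
    (evalPlus t x).snd = (x.snd : C(unitInterval, A)) t := by
  simp [evalPlus]

theorem path_nrm_le (Z : Set unitInterval) (X : MatAlg.{u} p) (n : ℕ)
    (x : Matrix (Fin n) (Fin n) (Unitization ℂ (pathSubalgebra Z X.carrier))) (t : unitInterval) :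
    X.nrm n (x.map (evalPlus t)) ≤ ∑ i, ∑ j, (‖(x i j).fst‖ + ‖(x i j).snd‖) := by
  refine (X.le_sum n _).trans (Finset.sum_le_sum fun i _ => Finset.sum_le_sum fun j _ => ?_)
  rw [Matrix.map_apply, evalPlus_fst, evalPlus_snd]
  exact add_le_add le_rfl (ContinuousMap.norm_coe_le_norm (x i j).snd.1 t)

theorem path_bddAbove (Z : Set unitInterval) (X : MatAlg.{u} p) (n : ℕ)
    (x : Matrix (Fin n) (Fin n) (Unitization ℂ (pathSubalgebra Z X.carrier))) :
    BddAbove (Set.range fun t : unitInterval => X.nrm n (x.map (evalPlus t))) :=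
  ⟨_, by rintro _ ⟨t, rfl⟩; exact path_nrm_le Z X n x t⟩

/-- `{F ∈ C([0,1], A) : F|_Z = 0}` with the supremum norms on matrices
(`M_n` of its unitization being a subalgebra of `C([0,1], M_n(A⁺))`) and the filtration induced by
that of `A`. -/
noncomputable def pathAlg (Z : Set unitInterval) (X : MatAlg.{u} p) : MatAlg.{u} p where
  carrier := pathSubalgebra Z X.carrier
  nrm n x := ⨆ t : unitInterval, X.nrm n (x.map (evalPlus t))
  scalar_le n x := by
    refine le_trans ?_ (le_ciSup (path_bddAbove Z X n x) 0)
    refine le_trans (le_of_eq ?_) (X.scalar_le n _)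
    congr 1
    ext i j
    simp only [Matrix.map_apply, evalPlus_fst]
  entry_le n a k l := by
    have hb := path_bddAbove Z X n (a.map Unitization.inr)
    refine (ContinuousMap.norm_le (a k l).1 (Real.iSup_nonneg fun t => X.nrm_nonneg _ _)).2
      fun t => ?_
    refine le_trans ?_ (le_ciSup hb t)
    refine (X.entry_le n (a.map fun F => F.1 t) k l).trans (le_of_eq ?_)
    congr 1
    ext i j <;> simp [evalPlus]
  le_sum n x := ciSup_le fun t => path_nrm_le Z X n x t
  fil r :=
    { carrier := {F | ∀ t, F.1 t ∈ X.fil r}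
      add_mem' := fun hF hG t => (X.fil r).add_mem (hF t) (hG t)
      zero_mem' := fun _ => (X.fil r).zero_mem
      smul_mem' := fun c _ hF t => (X.fil r).smul_mem c (hF t) }
  fil_mono r r' h _ hF t := X.fil_mono r r' h (hF t)

/-- The cone `CA = C_0((0,1], A)`. -/
noncomputable def cone (X : MatAlg.{u} p) : MatAlg.{u} p := pathAlg {0} X

/-- The suspension `SA = C_0((0,1), A)`. -/
noncomputable def susp (X : MatAlg.{u} p) : MatAlg.{u} p := pathAlg {0, 1} X

/-- The inclusion `SA → CA`. -/
def suspToCone (X : MatAlg.{u} p) (F : (susp X).carrier) : (cone X).carrier :=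
  ⟨F.1, fun t ht => F.2 t (Or.inl ht)⟩

/-- The quotient map `q : (CA)⁺ → A⁺`, evaluation at `1`. -/
noncomputable def coneEval (X : MatAlg.{u} p) (x : (cone X).plus.carrier) : X.plus.carrier :=
  evalPlus (Z := {0}) (A := X.carrier) 1 x

/-- The homomorphism `F ↦ f ∘ F`. -/
noncomputable def FilteredHom.path {X : MatAlg.{u} p} {Y : MatAlg.{v} p} (f : FilteredHom X Y)
    (Z : Set unitInterval) : FilteredHom (pathAlg Z X) (pathAlg Z Y) where
  hom :=
    { toFun := fun F => ⟨⟨fun t => f.hom (F.1 t), f.continuous.comp F.1.continuous⟩, fun t ht => by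
        change f.hom (F.1 t) = 0
        rw [F.2 t ht, map_zero]⟩
      map_smul' := fun c F => Subtype.ext (ContinuousMap.ext fun t => map_smul f.hom c (F.1 t))
      map_zero' := Subtype.ext (ContinuousMap.ext fun t => map_zero f.hom)
      map_add' := fun F G =>
        Subtype.ext (ContinuousMap.ext fun t => map_add f.hom (F.1 t) (G.1 t))
      map_mul' := fun F G =>
        Subtype.ext (ContinuousMap.ext fun t => map_mul f.hom (F.1 t) (G.1 t)) }
  pcb := by
    obtain ⟨C, hC⟩ := f.pcb
    refine ⟨|C|, fun n a => ciSup_le fun t => ?_⟩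
    have hb := path_bddAbove Z X n (a.map Unitization.inr)
    refine le_trans ?_ (mul_le_mul_of_nonneg_left (le_ciSup hb t) (abs_nonneg C))
    refine le_trans ?_ (mul_le_mul_of_nonneg_right (le_abs_self C) (X.nrm_nonneg _ _))
    refine le_trans (le_of_eq ?_) ((hC n (a.map fun F => F.1 t)).trans (le_of_eq ?_))
    · congr 1
      ext i j
      · exact evalPlus_fst t _
      · exact evalPlus_snd t _
    · congr 2
      ext i j
      · exact (evalPlus_fst (Z := Z) t (Unitization.inr (a i j))).symm
      · exact (evalPlus_snd (Z := Z) t (Unitization.inr (a i j))).symm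
  map_fil r F hF t := f.map_fil r _ (hF t)

theorem FilteredHom.PlusBound.path {X : MatAlg.{u} p} {Y : MatAlg.{v} p} {f : FilteredHom X Y}
    {κ : ℝ} (hκ : f.PlusBound κ) (Z : Set unitInterval) : (f.path Z).PlusBound κ where
  pos := hκ.pos
  bound n x := by
    refine ciSup_le fun t => ?_
    have hb := path_bddAbove Z X n x
    refine le_trans ?_ (mul_le_mul_of_nonneg_left (le_ciSup hb t) hκ.pos.le)
    refine le_trans (le_of_eq ?_) (hκ.bound n (x.map (evalPlus t)))
    congr 1
    ext i j
    · exact (evalPlus_fst t _).trans (((f.path Z).plusHom_fst _).trans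
        ((f.plusHom_fst _).trans (evalPlus_fst t _)).symm)
    · refine (evalPlus_snd t _).trans (Eq.trans ?_ (f.plusHom_snd _).symm)
      exact (congrArg (fun F : pathSubalgebra Z Y.carrier => F.1 t)
        ((f.path Z).plusHom_snd (x i j))).trans (congrArg f.hom (evalPlus_snd (Z := Z) t (x i j)).symm)

/-- The suspension `Sf : SA → SB`. -/
noncomputable def FilteredHom.susp {X : MatAlg.{u} p} {Y : MatAlg.{v} p} (f : FilteredHom X Y) :
    FilteredHom (susp X) (susp Y) := f.path {0, 1}

theorem FilteredHom.PlusBound.susp {X : MatAlg.{u} p} {Y : MatAlg.{v} p} {f : FilteredHom X Y}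
    {κ : ℝ} (hκ : f.PlusBound κ) : f.susp.PlusBound κ := hκ.path _

end MatAlg

/-! ## `SQ_p` algebras -/

/-- `E` is isometric to a subspace of a quotient of an `L_p` space. -/
def IsSQp (p : ℝ≥0∞) [Fact (1 ≤ p)] (E : Type u) [NormedAddCommGroup E] [NormedSpace ℂ E] : Prop :=
  ∃ (Ω : Type u) (_ : MeasurableSpace Ω) (μ : Measure Ω) (M : Submodule ℂ (Lp ℂ p μ)),
    IsClosed (M : Set (Lp ℂ p μ)) ∧ Nonempty (E →ₗᵢ[ℂ] (Lp ℂ p μ ⧸ M))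

/-- A filtered `SQ_p` algebra: a norm-closed subalgebra `A` of `B(E)`, where `E` is a Banach space
that is a subquotient of an `L_p` space, with a filtration `(A_r)_{r > 0}` by closed subspaces.
If `A` has a unit `1_A` (other than `0`), then `‖1_A‖ = 1` and `1_A ∈ A_r` for all `r > 0`. -/
structure FilteredSQpAlgebra (p : ℝ≥0∞) [Fact (1 ≤ p)] where
  E : Type u
  [group : NormedAddCommGroup E]
  [space : NormedSpace ℂ E]
  [complete : CompleteSpace E]
  isSQp : IsSQp p E
  alg : NonUnitalSubalgebra ℂ (E →L[ℂ] E)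
  isClosed_alg : IsClosed (alg : Set (E →L[ℂ] E))
  fil : ℝ → Submodule ℂ (E →L[ℂ] E)
  fil_subset : ∀ r : ℝ, 0 < r → (fil r : Set (E →L[ℂ] E)) ⊆ alg
  isClosed_fil : ∀ r : ℝ, 0 < r → IsClosed (fil r : Set (E →L[ℂ] E))
  fil_mono : ∀ r r' : ℝ, 0 < r → r ≤ r' → fil r ≤ fil r'
  fil_mul : ∀ r r' : ℝ, 0 < r → 0 < r' → ∀ a ∈ fil r, ∀ b ∈ fil r', a * b ∈ fil (r + r')
  fil_dense : (alg : Set (E →L[ℂ] E)) ⊆ closure (⋃ r : Set.Ioi (0 : ℝ), (fil r : Set (E →L[ℂ] E)))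
  unit : ∀ e ∈ alg, e ≠ 0 → (∀ a ∈ alg, e * a = a ∧ a * e = a) →
    ‖e‖ = 1 ∧ ∀ r : ℝ, 0 < r → e ∈ fil r

attribute [instance] FilteredSQpAlgebra.group FilteredSQpAlgebra.space FilteredSQpAlgebra.complete

section SQp

variable {p : ℝ≥0∞} [Fact (1 ≤ p)]

open Classical in
/-- The unit of `Ã` as an operator on `E`: it is `1_A` if `A` is unital and `I_E` otherwise. -/
noncomputable def FilteredSQpAlgebra.one (A : FilteredSQpAlgebra.{u} p) : A.E →L[ℂ] A.E :=
  if h : ∃ e ∈ A.alg, e ≠ 0 ∧ ∀ a ∈ A.alg, e * a = a ∧ a * e = a then h.choose else 1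

theorem FilteredSQpAlgebra.norm_one_le (A : FilteredSQpAlgebra.{u} p) : ‖A.one‖ ≤ 1 := by
  unfold FilteredSQpAlgebra.one
  split_ifs with h
  · exact (A.unit _ h.choose_spec.1 h.choose_spec.2.1 h.choose_spec.2.2).1.le
  · exact ContinuousLinearMap.norm_id_le

/-- The operator `a + z 1` on `E` given by `(a, z) ∈ A⁺`. -/
noncomputable def FilteredSQpAlgebra.act (A : FilteredSQpAlgebra.{u} p)
    (x : Unitization ℂ A.alg) : A.E →L[ℂ] A.E :=
  (x.snd : A.E →L[ℂ] A.E) + x.fst • A.one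

/-- `A` with the norms `‖(a, z)‖ = max(‖a + z 1‖, ‖z‖)` on `M_n(A⁺)`, where `a + z 1` acts on
`ℓ_p^n(E)` and `z` on `ℓ_p^n`. If `A` is not unital, this is the norm of `M_n(A + ℂ I_E)`; if `A` is
unital, it is the norm of `M_n(A) ⊕ M_n(ℂ)` under `A⁺ ≅ A ⊕ ℂ`, `(a, z) ↦ (a + z 1_A, z)`. -/
noncomputable def FilteredSQpAlgebra.toMatAlg (A : FilteredSQpAlgebra.{u} p) : MatAlg.{u} p where
  carrier := A.alg
  nrm n x := max ‖matCLM p (x.map A.act)‖ (scalarNorm p n (x.map fun z => z.fst))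
  scalar_le n x := le_max_right _ _
  entry_le n a k l := by
    refine le_trans ?_ (le_max_left _ _)
    refine le_trans (le_of_eq ?_) (norm_entry_le_matCLM p _ k l)
    simp [FilteredSQpAlgebra.act]
  le_sum n x := by
    refine max_le ?_ ?_
    · refine (norm_matCLM_le p _).trans (Finset.sum_le_sum fun i _ => Finset.sum_le_sum fun j _ => ?_)
      rw [Matrix.map_apply, FilteredSQpAlgebra.act, add_comm]
      refine (norm_add_le _ _).trans (add_le_add ?_ le_rfl)
      rw [norm_smul]
      exact mul_le_of_le_one_right (norm_nonneg _) A.norm_one_le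
    · refine (norm_matCLM_le p _).trans (Finset.sum_le_sum fun i _ => Finset.sum_le_sum fun j _ => ?_)
      rw [Matrix.map_apply, Matrix.map_apply, norm_smul]
      refine (mul_le_of_le_one_right (norm_nonneg _) ContinuousLinearMap.norm_id_le).trans ?_
      exact le_add_of_nonneg_right (norm_nonneg _)
  fil r := if 0 < r then (A.fil r).comap A.alg.toSubmodule.subtype else ⊥
  fil_mono r r' h := by
    by_cases hr : 0 < r
    · rw [if_pos hr, if_pos (hr.trans_le h)]
      exact Submodule.comap_mono (A.fil_mono r r' hr h)
    · rw [if_neg hr]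
      exact bot_le

/-! ## Controlled morphisms -/

/-- A control pair `(λ, h)`; only the values of `λ` on `[1, ∞)` and of `h` on
`(0, 1/20) × [1, ∞)` matter. -/
structure ControlPair where
  lam : ℝ → ℝ
  h : ℝ → ℝ → ℝ
  one_le_lam : ∀ N, 1 ≤ N → 1 ≤ lam N
  lam_mono : MonotoneOn lam (Set.Ici 1)
  one_le_h : ∀ ε N, 0 < ε → ε < 1 / 20 → 1 ≤ N → 1 ≤ h ε N
  h_anti : ∀ N, 1 ≤ N → AntitoneOn (fun ε => h ε N) (Set.Ioo 0 (1 / 20))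

/-- `(λ, h) ≤ (λ', h')`. -/
def ControlPair.Le (c c' : ControlPair) : Prop :=
  ∀ N, 1 ≤ N → c.lam N ≤ c'.lam N ∧ ∀ ε, 0 < ε → ε < 1 / 20 → c.h ε N ≤ c'.h ε N

/-- `0 < ε < 1 / (20 λ_N)`, `r > 0`, `N ≥ 1`. -/
structure ControlPair.Adm (c : ControlPair) (ε r N : ℝ) : Prop where
  eps_pos : 0 < ε
  eps_lt : ε < 1 / (20 * c.lam N)
  r_pos : 0 < r
  one_le : 1 ≤ N

/-- A `(λ, h)`-controlled morphism `𝒦_i(A) → 𝒦_j(B)`. Only the members of the family with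
admissible parameters matter. -/
structure ControlledMorphism (c : ControlPair) (i j : KDeg) (X : MatAlg.{u} p) (Y : MatAlg.{v} p)
    where
  map : ∀ ε r N : ℝ,
    KGrp i X ε r N →+ KGrp j Y (c.lam N * ε) (c.h ε N * r) (c.lam N)
  natural : ∀ ε r N ε' r' N' : ℝ, c.Adm ε r N → c.Adm ε' r' N' →
    ∀ hrel : Relaxes ε r N ε' r' N', c.h ε N * r ≤ c.h ε' N' * r' → ∀ x : KGrp i X ε r N,
      SameAt (c.lam N' * ε') (c.h ε' N' * r') (c.lam N')
        (map ε r N x) (map ε' r' N' (KGrp.relax i X hrel x))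

/-- `𝒢 ∘ ℱ ∼ Id` with control `(λ, h)`; in particular the control pair of the composition is at
most `(λ, h)`. -/
def IsLeftInverse (c : ControlPair) {cF cG : ControlPair} {i j : KDeg} {X : MatAlg.{u} p}
    {Y : MatAlg.{v} p} (G : ControlledMorphism cG j i Y X) (F : ControlledMorphism cF i j X Y) :
    Prop :=
  (∀ N, 1 ≤ N → cG.lam (cF.lam N) * cF.lam N ≤ c.lam N) ∧
  ∀ ε r N : ℝ, c.Adm ε r N → ∀ x : KGrp i X ε r N,
    SameAt (c.lam N * ε) (c.h ε N * r) (c.lam N)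
      (G.map (cF.lam N * ε) (cF.h ε N * r) (cF.lam N) (F.map ε r N x)) x

/-- `𝒢` is a `(λ, h)`-inverse of `ℱ`. -/
def IsControlledInverse (c : ControlPair) {cF cG : ControlPair} {i j : KDeg} {X : MatAlg.{u} p}
    {Y : MatAlg.{v} p} (F : ControlledMorphism cF i j X Y) (G : ControlledMorphism cG j i Y X) :
    Prop :=
  cF.Le c ∧ cG.Le c ∧ IsLeftInverse c G F ∧ IsLeftInverse c F G

/-! ## The controlled boundary map of `0 → SA → CA → A → 0` -/

/-- The choices made in the construction of the image of `[u]`, `u ∈ GL_n^{ε,r,N}(A⁺)`, under the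
boundary map: `v ∈ GL_m^{ε,r,N}(A⁺)` such that `diag(u, v)` is homotopic to the identity, an
approximate lift `w` of `diag(u, v)` to a quasi-invertible over `(CA)⁺` with quasi-inverse `w'`, and
`y ∈ M_{n+m}(SA)` close to `w diag(I_n, 0) w' - diag(I_n, 0)`. -/
structure BoundaryChoice (X : MatAlg.{u} p) (c c' : ControlPair) (ε r N : ℝ) {n : ℕ}
    (u : X.plus.Mat n) where
  m : ℕ
  v : X.plus.Mat m
  w : (cone X).plus.Mat (n + m)
  w' : (cone X).plus.Mat (n + m)
  y : Matrix (Fin (n + m)) (Fin (n + m)) (susp X).carrier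
  v_inv : QuasiInv X.plus ε r N v
  homotopic : InvHomotopic X.plus (2 * ε) (2 * r) (2 * (N + ε)) (bdiag u v) 1
  pair : InversePair (cone X).plus (c.lam N * ε) (c.h ε N * r) (c.lam N) w w'
  lift : X.plus.nrm (n + m) (w.map (coneEval X) - bdiag u v) < c.lam N * ε
  y_mem : ∀ i j, y i j ∈ (susp X).fil (c'.h ε N * r)
  y_close : (cone X).plus.nrm (n + m)
    (w * bdiag (1 : (cone X).plus.Mat n) (0 : (cone X).plus.Mat m) * w'
      - bdiag (1 : (cone X).plus.Mat n) (0 : (cone X).plus.Mat m)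
      - (y.map fun F => (Unitization.inr (suspToCone X F) : Unitization ℂ (cone X).carrier) :
          (cone X).plus.Mat (n + m))) < 3 * c'.lam N * ε

/-- `diag(I_n, 0_m)` over `(SA)⁺`. -/
noncomputable def suspProj (X : MatAlg.{u} p) (n m : ℕ) : (susp X).plus.Mat (n + m) :=
  bdiag (1 : (susp X).plus.Mat n) (0 : (susp X).plus.Mat m)

/-- `D` is the controlled boundary map `𝒦_1(A) → 𝒦_0(SA)` of the extension `0 → SA → CA → A → 0`,
constructed with lifts controlled by `c` and perturbations controlled by `c'`: such choices always
exist, and `D([u]) = [y + diag(I_n, 0)] - [diag(I_n, 0)]` for any of them. -/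
def IsBoundaryMap (X : MatAlg.{u} p) (c c' : ControlPair) {cD : ControlPair}
    (D : ControlledMorphism cD .one .zero X (susp X)) : Prop :=
  ∀ ε r N : ℝ, cD.Adm ε r N → ∀ (n : ℕ) (u : X.plus.Mat n) (hu : IsQuasi .one X.plus ε r N u),
    Nonempty (BoundaryChoice X c c' ε r N u) ∧
    ∀ b : BoundaryChoice X c c' ε r N u,
      ∃ (he : IsQuasi .zero (susp X).plus (cD.lam N * ε) (cD.h ε N * r) (cD.lam N)
          ((b.y.map Unitization.inr : (susp X).plus.Mat (n + b.m)) + suspProj X n b.m))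
        (hp : IsQuasi .zero (susp X).plus (cD.lam N * ε) (cD.h ε N * r) (cD.lam N)
          (suspProj X n b.m)),
        ∀ x : KGrp .one X ε r N, (x : KUnital .one X.plus ε r N) = kClass .one X.plus ε r N u hu →
          (D.map ε r N x : KUnital .zero (susp X).plus (cD.lam N * ε) (cD.h ε N * r) (cD.lam N)) =
            kClass .zero _ _ _ _ _ he - kClass .zero _ _ _ _ _ hp

end SQp
end QuantK

/-! The inverse of the boundary map is a discrete holonomy. An element of K_0(SA) is given by a loop
of quasi-idempotents e(t) whose common value at the two ends is scalar. Sample the loop at the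
points t_j = j/(n+1), let f be the block diagonal matrix of the values e(t_j), and let T be the
cyclic shift of the blocks. If n is so large that neighbouring values differ by an error of order ε,
then T almost commutes with f, and the compressed shift 1 - f + fT is quasi-invertible with
quasi-inverse 1 - f + fT⁻¹. The Bott map sends [e] to the class of this matrix minus the class
obtained in the same way from the constant loop e(0).

The integer n depends on the modulus of continuity of e, over which there is no control. This is
harmless: a block diagonal matrix has the largest of the norms of its blocks, and permutation
matrices are contractive, so that no estimate involves n (`Inv.cyc_tperm`). The value does not
depend on n either. The sample points can be moved (`rotCl_steps`), and a doubled sample point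
splits off a transposition (`rotCl_cons`), which cancels against the same term of the constant loop.
Homotopy invariance, additivity and naturality follow, since the matrix is formed from the values of
e by ring operations.

For the boundary of u, with quasi-inverse u', lift u and u' to the cone by t ↦ (1 - t)π(u) + tu, and
form the invertible matrix E = `eMat`, which is close to diag(u, u') at t = 1. The idempotent E p
E⁻¹, with p = diag(1, 0), is close to p at t = 1, and a small correction turns it into the matrix
`dEl` over (SA)⁺. Every other choice admitted in the statement yields the same class, because the
two idempotents are conjugate, after adding zeros, by a matrix over the cone that is close to 1 at t
= 1 (`dVal_eq_of_lift`).

Bott after boundary (`bVal_dEl`): conjugation by the values E(t_j) replaces the samples of E p E⁻¹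
by p and the shift T by VT, where V is close to the identity except in one block, which is
E(0)⁻¹E(1), nearly diag(π(u)⁻¹u, π(u)u⁻¹). The holonomy is therefore [u] - [π(u)].

Boundary after Bott (`dVal_cyc`): the compressed shift has another lift, a commutator-like product
of diag(1, T) and the symmetry `sMat` of the contracted loops t ↦ e(t t_j). The corresponding
idempotent over (SA)⁺ is, up to a conjugation over (SA)⁺, the matrix diag(1 - z, ..., 1 - z, e, z,
..., z) with z = e(0), whose class exceeds that of the identity by [e] - [z].

Hence both compositions send [x] to [x] - [π(x)], which is the relaxation map on the kernel of π_*
(`eq_relax_of_sub_scal`). All estimates are made relative to a `Scale`: norms are bounded by powers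
of 2N, errors by powers of 2N times ε, propagations by multiples of r, and only the exponents are
recorded. The hypothesis on E enters only through the norms of scalar matrices
(`norm_matCLM_scalar_le`). -/

namespace QuantK

set_option linter.unusedSectionVars false

variable {p : ℝ≥0∞} [Fact (1 ≤ p)]

/-! ### Scalar, permutation and block diagonal matrices on `ℓ_p^n(E)`. -/

section ScalarMatrices

theorem one_le_toReal (hp : p ≠ ∞) : 1 ≤ p.toReal :=
  (ENNReal.dichotomy p).resolve_left hp

theorem piLp_norm_rpow (hp : p ≠ ∞) {ι : Type*} [Fintype ι] {E : Type*} [NormedAddCommGroup E]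
    (f : PiLp p (fun _ : ι => E)) : ‖f‖ ^ p.toReal = ∑ i, ‖f i‖ ^ p.toReal := by
  have h1 := one_le_toReal hp
  rw [PiLp.norm_eq_sum (by linarith), ← Real.rpow_mul (by positivity), one_div,
    inv_mul_cancel₀ (by linarith), Real.rpow_one]

theorem matCLM_mul {E : Type u} [NormedAddCommGroup E] [NormedSpace ℂ E] {n : ℕ}
    (x y : Matrix (Fin n) (Fin n) (E →L[ℂ] E)) : matCLM p (x * y) = matCLM p x ∘L matCLM p y := by
  ext ξ i
  rw [matCLM_apply, ContinuousLinearMap.comp_apply, matCLM_apply]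
  simp only [Matrix.mul_apply, matCLM_apply, map_sum, sum_apply]
  rw [Finset.sum_comm]
  rfl

theorem matCLM_add {E : Type u} [NormedAddCommGroup E] [NormedSpace ℂ E] {n : ℕ}
    (x y : Matrix (Fin n) (Fin n) (E →L[ℂ] E)) : matCLM p (x + y) = matCLM p x + matCLM p y := by
  ext ξ i
  rw [matCLM_apply, add_apply, PiLp.add_apply, matCLM_apply, matCLM_apply]
  simp only [Matrix.add_apply, add_apply, Finset.sum_add_distrib]

theorem norm_matCLM_le_of_sum (hp : p ≠ ∞) {E : Type u} [NormedAddCommGroup E] [NormedSpace ℂ E]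
    {n : ℕ} (x : Matrix (Fin n) (Fin n) (E →L[ℂ] E)) {c : ℝ} (hc : 0 ≤ c)
    (h : ∀ ξ : Fin n → E, ∑ i, ‖∑ j, x i j (ξ j)‖ ^ p.toReal ≤
      c ^ p.toReal * ∑ j, ‖ξ j‖ ^ p.toReal) : ‖matCLM p x‖ ≤ c := by
  have h1 := one_le_toReal hp
  refine ContinuousLinearMap.opNorm_le_bound _ hc fun ξ => ?_
  rw [← Real.rpow_le_rpow_iff (z := p.toReal) (norm_nonneg _) (by positivity) (by linarith),
    Real.mul_rpow hc (norm_nonneg _), piLp_norm_rpow hp, piLp_norm_rpow hp]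
  simpa only [matCLM_apply] using h fun i => ξ i

theorem sum_le_of_norm_matCLM_le (hp : p ≠ ∞) {E : Type u} [NormedAddCommGroup E] [NormedSpace ℂ E]
    {n : ℕ} (x : Matrix (Fin n) (Fin n) (E →L[ℂ] E)) {c : ℝ} (hc : ‖matCLM p x‖ ≤ c)
    (ξ : Fin n → E) : ∑ i, ‖∑ j, x i j (ξ j)‖ ^ p.toReal ≤ c ^ p.toReal * ∑ j, ‖ξ j‖ ^ p.toReal := by
  have h1 := one_le_toReal hp
  have hc0 := (norm_nonneg _).trans hc
  have h := ((matCLM p x).le_opNorm (WithLp.toLp p ξ)).trans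
    (mul_le_mul_of_nonneg_right hc (norm_nonneg _))
  rw [← Real.rpow_le_rpow_iff (z := p.toReal) (norm_nonneg _) (by positivity) (by linarith),
    Real.mul_rpow hc0 (norm_nonneg _), piLp_norm_rpow hp, piLp_norm_rpow hp] at h
  simpa only [matCLM_apply] using h

theorem sum_scalar_le (hp : p ≠ ∞) {n : ℕ} (z : Matrix (Fin n) (Fin n) ℂ) (ξ : Fin n → ℂ) :
    ∑ i, ‖∑ j, z i j * ξ j‖ ^ p.toReal ≤ scalarNorm p n z ^ p.toReal * ∑ j, ‖ξ j‖ ^ p.toReal := by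
  have h := sum_le_of_norm_matCLM_le hp (z.map fun c => c • (1 : ℂ →L[ℂ] ℂ))
    (c := scalarNorm p n z) le_rfl ξ
  simpa using h

/-- The inequality for scalars is applied to the vector of values of the f_j at almost every point
and then integrated. -/
theorem sum_scalar_Lp_le (hp : p ≠ ∞) {Ω : Type u} [MeasurableSpace Ω] {μ : Measure Ω} {n : ℕ}
    (z : Matrix (Fin n) (Fin n) ℂ) (f : Fin n → Lp ℂ p μ) :
    ∑ i, ‖∑ j, z i j • f j‖ ^ p.toReal ≤ scalarNorm p n z ^ p.toReal * ∑ j, ‖f j‖ ^ p.toReal := by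
  have h1 := one_le_toReal hp
  have h0 : 0 < p.toReal := by linarith
  have hp0 : p ≠ 0 := by rintro rfl; simp at h0
  have key : ∀ g : Lp ℂ p μ, ‖g‖ₑ ^ p.toReal = ∫⁻ x, ‖g x‖ₑ ^ p.toReal ∂μ := fun g => by
    rw [Lp.enorm_def, eLpNorm_eq_lintegral_rpow_enorm_toReal hp0 hp, ← ENNReal.rpow_mul, one_div,
      inv_mul_cancel₀ h0.ne', ENNReal.rpow_one]
  have hc : 0 ≤ scalarNorm p n z := norm_nonneg _
  have hcoe : ∀ i, ∀ᵐ x ∂μ, (∑ j, z i j • f j : Lp ℂ p μ) x = ∑ j, z i j * f j x := by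
    intro i
    have : ∀ s : Finset (Fin n), ∀ᵐ x ∂μ, (∑ j ∈ s, z i j • f j : Lp ℂ p μ) x
        = ∑ j ∈ s, z i j * f j x := by
      intro s
      induction s using Finset.induction_on with
      | empty =>
        filter_upwards [Lp.coeFn_zero ℂ p μ] with x hx
        simpa using hx
      | insert a s ha ih =>
        rw [Finset.sum_insert ha]
        filter_upwards [ih, Lp.coeFn_add (z i a • f a) (∑ j ∈ s, z i j • f j),
          Lp.coeFn_smul (z i a) (f a)] with x h2 h3 h4
        rw [h3, Pi.add_apply, h4, h2, Finset.sum_insert ha]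
        rfl
    exact this _
  have hreal : ∀ (m : ℕ) (g : Fin m → Lp ℂ p μ), ENNReal.ofReal (∑ i, ‖g i‖ ^ p.toReal)
      = ∫⁻ x, ∑ i, ‖g i x‖ₑ ^ p.toReal ∂μ := by
    intro m g
    rw [ENNReal.ofReal_sum_of_nonneg (fun i _ => by positivity), lintegral_finsetSum']
    · refine Finset.sum_congr rfl fun i _ => ?_
      rw [← key, ← ENNReal.ofReal_rpow_of_nonneg (norm_nonneg _) h0.le, ofReal_norm]
    · intro i _
      exact (Lp.aestronglyMeasurable (g i)).enorm.pow_const _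
  rw [← ENNReal.ofReal_le_ofReal_iff (by positivity), ENNReal.ofReal_mul (by positivity),
    hreal, hreal, ← lintegral_const_mul'' _ (Finset.aemeasurable_fun_sum _ fun i _ =>
      (Lp.aestronglyMeasurable (f i)).enorm.pow_const _)]
  refine lintegral_mono_ae ?_
  filter_upwards [ae_all_iff.2 hcoe] with x hx
  simp only [hx]
  have h5 := ENNReal.ofReal_le_ofReal (sum_scalar_le hp z fun j => f j x)
  rw [ENNReal.ofReal_mul (by positivity), ENNReal.ofReal_sum_of_nonneg (fun i _ => by positivity),
    ENNReal.ofReal_sum_of_nonneg (fun i _ => by positivity)] at h5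
  simpa only [← ENNReal.ofReal_rpow_of_nonneg (norm_nonneg _) h0.le, ofReal_norm] using h5

/-- The inequality passes from L_p to a quotient by lifting each vector with an increase of the norm
by less than δ and letting δ tend to 0. It passes to subspaces because the embedding is isometric.
-/
theorem sum_scalar_SQp_le (hp : p ≠ ∞) {E : Type u} [NormedAddCommGroup E] [NormedSpace ℂ E]
    (hE : IsSQp p E) {n : ℕ} (z : Matrix (Fin n) (Fin n) ℂ) (ξ : Fin n → E) :
    ∑ i, ‖∑ j, z i j • ξ j‖ ^ p.toReal ≤ scalarNorm p n z ^ p.toReal * ∑ j, ‖ξ j‖ ^ p.toReal := by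
  obtain ⟨Ω, _, μ, M, hM, ⟨φ⟩⟩ := hE
  have h1 := one_le_toReal hp
  have hc : 0 ≤ scalarNorm p n z := norm_nonneg _
  have key : ∀ δ : ℝ, 0 < δ → ∑ i, ‖∑ j, z i j • ξ j‖ ^ p.toReal ≤
      scalarNorm p n z ^ p.toReal * ∑ j, (‖ξ j‖ + δ) ^ p.toReal := by
    intro δ hδ
    choose f hf hfn using fun j => Submodule.Quotient.norm_mk_lt (S := M) (φ (ξ j)) hδ
    have h2 : ∀ i, ‖∑ j, z i j • ξ j‖ ≤ ‖∑ j, z i j • f j‖ := by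
      intro i
      rw [← φ.norm_map, map_sum]
      have : ∑ j, φ (z i j • ξ j) = Submodule.Quotient.mk (p := M) (∑ j, z i j • f j) := by
        rw [← Submodule.mkQ_apply, map_sum]
        refine Finset.sum_congr rfl fun j _ => ?_
        rw [map_smul, map_smul, Submodule.mkQ_apply, hf]
      rw [this]
      exact Submodule.Quotient.norm_mk_le M _
    calc ∑ i, ‖∑ j, z i j • ξ j‖ ^ p.toReal ≤ ∑ i, ‖∑ j, z i j • f j‖ ^ p.toReal := by
          gcongr with i; exact h2 i
      _ ≤ scalarNorm p n z ^ p.toReal * ∑ j, ‖f j‖ ^ p.toReal := sum_scalar_Lp_le hp z f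
      _ ≤ _ := by
          gcongr with j
          refine (hfn j).le.trans ?_
          rw [φ.norm_map]
  have hlim : Tendsto (fun δ : ℝ => scalarNorm p n z ^ p.toReal * ∑ j, (‖ξ j‖ + δ) ^ p.toReal)
      (𝓝[>] 0) (𝓝 (scalarNorm p n z ^ p.toReal * ∑ j, (‖ξ j‖ + 0) ^ p.toReal)) := by
    refine Tendsto.mono_left ?_ nhdsWithin_le_nhds
    have : Continuous fun δ : ℝ => scalarNorm p n z ^ p.toReal * ∑ j, (‖ξ j‖ + δ) ^ p.toReal := by
      refine continuous_const.mul (continuous_finsetSum _ fun j _ => ?_)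
      exact (continuous_const.add continuous_id).rpow_const fun _ => Or.inr (by linarith)
    exact this.tendsto 0
  simp only [add_zero] at hlim
  refine ge_of_tendsto hlim ?_
  filter_upwards [self_mem_nhdsWithin] with δ hδ using key δ hδ

/-- The only point at which the geometry of E is used: a scalar matrix is not larger on `ℓ_p^n(E)`
than on `ℓ_p^n`. The operator T will be the unit of the algebra. -/
theorem norm_matCLM_scalar_le (hp : p ≠ ∞) {E : Type u} [NormedAddCommGroup E] [NormedSpace ℂ E]
    (hE : IsSQp p E) {n : ℕ} (z : Matrix (Fin n) (Fin n) ℂ) {T : E →L[ℂ] E} (hT : ‖T‖ ≤ 1) :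
    ‖matCLM p (z.map fun c => c • T)‖ ≤ scalarNorm p n z := by
  have hc : 0 ≤ scalarNorm p n z := norm_nonneg _
  refine norm_matCLM_le_of_sum hp _ hc fun ξ => ?_
  refine le_trans (le_of_eq ?_) ((sum_scalar_SQp_le hp hE z fun j => T (ξ j)).trans ?_)
  · simp
  · have h1 := one_le_toReal hp
    gcongr with j
    exact (T.le_opNorm _).trans (mul_le_of_le_one_left (norm_nonneg _) hT)

theorem scalarNorm_perm_le (hp : p ≠ ∞) {n : ℕ} (σ : Equiv.Perm (Fin n)) :
    scalarNorm p n (σ.permMatrix ℂ) ≤ 1 := by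
  refine norm_matCLM_le_of_sum hp _ zero_le_one fun ξ => ?_
  rw [Real.one_rpow, one_mul]
  refine le_of_eq ?_
  rw [← Equiv.sum_comp σ fun j => ‖ξ j‖ ^ p.toReal]
  refine Finset.sum_congr rfl fun i _ => ?_
  rw [Finset.sum_eq_single (σ i)]
  · simp [Equiv.Perm.permMatrix, PEquiv.toMatrix_apply]
  · intro j _ hj
    have : ¬ (σ i = j) := fun h => hj h.symm
    simp [Equiv.Perm.permMatrix, PEquiv.toMatrix_apply, this]
  · simp

theorem scalarNorm_smul_one_le (hp : p ≠ ∞) {n : ℕ} (c : ℂ) :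
    scalarNorm p n (c • (1 : Matrix (Fin n) (Fin n) ℂ)) ≤ ‖c‖ := by
  refine norm_matCLM_le_of_sum hp _ (norm_nonneg _) fun ξ => ?_
  rw [Finset.mul_sum]
  refine le_of_eq (Finset.sum_congr rfl fun i _ => ?_)
  rw [Finset.sum_eq_single i]
  · simp [Real.mul_rpow]
  · intro j _ hj
    simp [Matrix.one_apply_ne hj.symm]
  · simp

theorem norm_matCLM_sum_le (hp : p ≠ ∞) {E : Type u} [NormedAddCommGroup E] [NormedSpace ℂ E]
    {n m k : ℕ} (σ : Fin k ≃ Fin n ⊕ Fin m) (x : Matrix (Fin n) (Fin n) (E →L[ℂ] E))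
    (y : Matrix (Fin m) (Fin m) (E →L[ℂ] E)) :
    ‖matCLM p ((Matrix.fromBlocks x 0 0 y).submatrix σ σ)‖ ≤ max ‖matCLM p x‖ ‖matCLM p y‖ := by
  have h1 := one_le_toReal hp
  refine norm_matCLM_le_of_sum hp _ (by positivity) fun ξ => ?_
  have e1 := sum_le_of_norm_matCLM_le hp x (le_max_left _ ‖matCLM p y‖) fun j => ξ (σ.symm (.inl j))
  have e2 := sum_le_of_norm_matCLM_le hp y (le_max_right ‖matCLM p x‖ _) fun j => ξ (σ.symm (.inr j))
  refine le_trans (le_of_eq ?_) ((add_le_add e1 e2).trans (le_of_eq ?_))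
  · rw [← Equiv.sum_comp σ.symm, Fintype.sum_sum_type]
    congr 1 <;>
    · refine Finset.sum_congr rfl fun i _ => ?_
      rw [← Equiv.sum_comp σ.symm, Fintype.sum_sum_type]
      simp
  · rw [← mul_add, ← Equiv.sum_comp σ.symm (fun j => ‖ξ j‖ ^ p.toReal), Fintype.sum_sum_type]

/-- The p-th powers of the norms of the blocks of a vector add up, so that the bound is the maximum
over the blocks and not their sum. This makes the estimates for cyclic shifts independent of the
number of sample points. -/
theorem norm_matCLM_blockDiagonal_le (hp : p ≠ ∞) {E : Type u} [NormedAddCommGroup E]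
    [NormedSpace ℂ E] {n o k : ℕ} (σ : Fin k ≃ Fin n × Fin o)
    (x : Fin o → Matrix (Fin n) (Fin n) (E →L[ℂ] E)) {c : ℝ} (hc : 0 ≤ c)
    (h : ∀ j, ‖matCLM p (x j)‖ ≤ c) :
    ‖matCLM p ((Matrix.blockDiagonal x).submatrix σ σ)‖ ≤ c := by
  refine norm_matCLM_le_of_sum hp _ hc fun ξ => ?_
  have e := Finset.sum_le_sum fun (j : Fin o) (_ : j ∈ Finset.univ) =>
    sum_le_of_norm_matCLM_le hp (x j) (h j) fun i => ξ (σ.symm (i, j))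
  refine le_trans (le_of_eq ?_) (e.trans (le_of_eq ?_))
  · rw [← Equiv.sum_comp σ.symm, Fintype.sum_prod_type_right]
    refine Finset.sum_congr rfl fun j _ => Finset.sum_congr rfl fun i _ => ?_
    rw [← Equiv.sum_comp σ.symm, Fintype.sum_prod_type]
    congr 2
    refine Finset.sum_congr rfl fun l _ => ?_
    rw [Finset.sum_eq_single j]
    · simp [Matrix.blockDiagonal_apply]
    · intro b _ hb
      simp [Matrix.blockDiagonal_apply, hb.symm]
    · simp
  · rw [← Finset.mul_sum, ← Equiv.sum_comp σ.symm (fun j => ‖ξ j‖ ^ p.toReal),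
      Fintype.sum_prod_type_right]

end ScalarMatrices

/-! ### The unitization as a ring. -/

namespace MatAlg

/-- The unitization `A⁺`. -/
def R (X : MatAlg.{u} p) : Type u := Unitization ℂ X.carrier

section

variable {X : MatAlg.{u} p}

noncomputable instance : Ring X.R := X.plus.ring

noncomputable instance : Algebra ℂ X.R := inferInstanceAs (Algebra ℂ (Unitization ℂ X.carrier))

/-- The homomorphism `π : A⁺ → ℂ`. -/
noncomputable def fst (X : MatAlg.{u} p) : X.R →ₐ[ℂ] ℂ := Unitization.fstHom ℂ X.carrier

/-- The component of an element of `A⁺` in `A`. -/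
noncomputable def snd (X : MatAlg.{u} p) : X.R →ₗ[ℂ] X.carrier where
  toFun x := (show Unitization ℂ X.carrier from x).snd
  map_add' _ _ := rfl
  map_smul' _ _ := rfl

/-- The inclusion of `A` into `A⁺`. -/
noncomputable def inr (X : MatAlg.{u} p) : X.carrier →ₗ[ℂ] X.R where
  toFun a := (Unitization.inr a : Unitization ℂ X.carrier)
  map_add' a b := Unitization.inr_add ℂ a b
  map_smul' c a := Unitization.inr_smul ℂ c a

/-- The inclusion of the scalars into `A⁺`. -/
noncomputable def inl (X : MatAlg.{u} p) : ℂ →+* X.R := algebraMap ℂ X.R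

theorem R_ext {x y : X.R} (h : X.fst x = X.fst y) (h' : X.snd x = X.snd y) : x = y :=
  Unitization.ext h h'

theorem snd_mul (x y : X.R) : X.snd (x * y) = X.fst x • X.snd y + X.fst y • X.snd x +
    X.snd x * X.snd y := rfl

@[simp] theorem snd_one : X.snd 1 = 0 := rfl

@[simp] theorem fst_inl (z : ℂ) : X.fst (X.inl z) = z := rfl

@[simp] theorem snd_inl (z : ℂ) : X.snd (X.inl z) = 0 := rfl

@[simp] theorem fst_inr (a : X.carrier) : X.fst (X.inr a) = 0 := rfl

@[simp] theorem snd_inr (a : X.carrier) : X.snd (X.inr a) = a := rfl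

/-- The endomorphism `(a, z) ↦ (0, z)` of `A⁺`. -/
noncomputable def scal (X : MatAlg.{u} p) : X.R →+* X.R := X.inl.comp X.fst.toRingHom

@[simp] theorem fst_scal (x : X.R) : X.fst (X.scal x) = X.fst x := rfl

@[simp] theorem snd_scal (x : X.R) : X.snd (X.scal x) = 0 := rfl

end

/-- The norm of `M_n(A⁺)`. -/
def nrmR (X : MatAlg.{u} p) (n : ℕ) (x : Matrix (Fin n) (Fin n) X.R) : ℝ := X.nrm n x

section

variable {X : MatAlg.{u} p}

theorem nrmR_nonneg (n : ℕ) (x : Matrix (Fin n) (Fin n) X.R) : 0 ≤ X.nrmR n x := X.nrm_nonneg n x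

theorem scalarNorm_le_nrmR (n : ℕ) (x : Matrix (Fin n) (Fin n) X.R) :
    scalarNorm p n (x.map X.fst) ≤ X.nrmR n x := X.scalar_le n x

theorem nrmR_le_sum (n : ℕ) (x : Matrix (Fin n) (Fin n) X.R) :
    X.nrmR n x ≤ ∑ i, ∑ j, (‖X.fst (x i j)‖ + ‖X.snd (x i j)‖) := X.le_sum n x

end

end MatAlg

/-- The properties of the matrix norms of an `SQ_p` algebra, its cone and its suspension that
enter the computation of quantitative `K`-groups. -/
class MatAlg.Nice {p : ℝ≥0∞} [Fact (1 ≤ p)] (X : MatAlg.{u} p) : Prop where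
  finite : p ≠ ∞
  nrm_add : ∀ n x y, X.nrmR n (x + y) ≤ X.nrmR n x + X.nrmR n y
  nrm_mul : ∀ n x y, X.nrmR n (x * y) ≤ X.nrmR n x * X.nrmR n y
  nrm_scalar : ∀ n (z : Matrix (Fin n) (Fin n) ℂ), X.nrmR n (z.map X.inl) ≤ scalarNorm p n z
  nrm_sum : ∀ {n m k : ℕ} (σ : Fin k ≃ Fin n ⊕ Fin m) x y,
    X.nrmR k ((Matrix.fromBlocks x 0 0 y).submatrix σ σ) ≤ max (X.nrmR n x) (X.nrmR m y)
  nrm_blockDiagonal : ∀ {n o k : ℕ} (σ : Fin k ≃ Fin n × Fin o)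
    (x : Fin o → Matrix (Fin n) (Fin n) X.R) (c : ℝ), 0 ≤ c →
    (∀ j, X.nrmR n (x j) ≤ c) → X.nrmR k ((Matrix.blockDiagonal x).submatrix σ σ) ≤ c
  fil_mul : ∀ r r' : ℝ, 0 ≤ r → 0 ≤ r' → ∀ a ∈ X.fil r, ∀ b ∈ X.fil r', a * b ∈ X.fil (r + r')

/-! ### The matrix norms of an `SQ_p` algebra. -/

section

theorem FilteredSQpAlgebra.one_mul_mem (A : FilteredSQpAlgebra.{u} p) {a : A.E →L[ℂ] A.E}
    (ha : a ∈ A.alg) : A.one * a = a ∧ a * A.one = a := by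
  unfold FilteredSQpAlgebra.one
  split_ifs with h
  · exact h.choose_spec.2.2 a ha
  · exact ⟨one_mul _, mul_one _⟩

theorem FilteredSQpAlgebra.one_mul_one (A : FilteredSQpAlgebra.{u} p) : A.one * A.one = A.one := by
  by_cases h : ∃ e ∈ A.alg, e ≠ 0 ∧ ∀ a ∈ A.alg, e * a = a ∧ a * e = a
  · refine (A.one_mul_mem ?_).1
    unfold FilteredSQpAlgebra.one
    rw [dif_pos h]
    exact h.choose_spec.1
  · unfold FilteredSQpAlgebra.one
    rw [dif_neg h, one_mul]

theorem FilteredSQpAlgebra.act_mul (A : FilteredSQpAlgebra.{u} p) (x y : Unitization ℂ A.alg) :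
    A.act (x * y) = A.act x * A.act y := by
  have hx := A.one_mul_mem x.snd.2
  have hy := A.one_mul_mem y.snd.2
  simp only [act, Unitization.fst_mul, Unitization.snd_mul, NonUnitalSubalgebra.coe_add,
    NonUnitalSubalgebra.coe_smul, NonUnitalSubalgebra.coe_mul, add_mul, mul_add, smul_mul_assoc,
    mul_smul_comm, hx.2, hy.1, A.one_mul_one, smul_add, smul_smul]
  rw [mul_comm y.fst x.fst]
  abel

theorem FilteredSQpAlgebra.act_add (A : FilteredSQpAlgebra.{u} p) (x y : Unitization ℂ A.alg) :
    A.act (x + y) = A.act x + A.act y := by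
  simp only [act, Unitization.fst_add, Unitization.snd_add, NonUnitalSubalgebra.coe_add, add_smul]
  abel

/-- The representation `(a, z) ↦ a + z 1` of `A⁺` on `E`. -/
noncomputable def FilteredSQpAlgebra.actHom (A : FilteredSQpAlgebra.{u} p) :
    NonUnitalRingHom A.toMatAlg.R (A.E →L[ℂ] A.E) where
  toFun := A.act
  map_zero' := by
    change A.act 0 = 0
    simp [act]
  map_add' x y := A.act_add x y
  map_mul' x y := A.act_mul x y

/-- The representation `(a, z) ↦ z` of `A⁺` on `ℂ`. -/
noncomputable def MatAlg.scalarHom (X : MatAlg.{u} p) :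
    NonUnitalRingHom X.R (ℂ →L[ℂ] ℂ) where
  toFun x := X.fst x • (1 : ℂ →L[ℂ] ℂ)
  map_zero' := by ext; simp
  map_add' x y := by ext; simp
  map_mul' x y := by ext; simp [mul_comm]

theorem FilteredSQpAlgebra.toMatAlg_nrm (A : FilteredSQpAlgebra.{u} p) {n : ℕ}
    (x : Matrix (Fin n) (Fin n) A.toMatAlg.R) : A.toMatAlg.nrmR n x =
      max ‖matCLM p (x.map A.actHom)‖ ‖matCLM p (x.map A.toMatAlg.scalarHom)‖ := rfl

section

variable {S : Type*} [NonUnitalSemiring S] {E : Type u} [NormedAddCommGroup E] [NormedSpace ℂ E]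
  (φ : NonUnitalRingHom S (E →L[ℂ] E))

theorem norm_matCLM_map_add_le {n : ℕ} (x y : Matrix (Fin n) (Fin n) S) :
    ‖matCLM p ((x + y).map φ)‖ ≤ ‖matCLM p (x.map φ)‖ + ‖matCLM p (y.map φ)‖ := by
  rw [Matrix.map_add _ (map_add φ), matCLM_add]
  exact norm_add_le _ _

theorem norm_matCLM_map_mul_le {n : ℕ} (x y : Matrix (Fin n) (Fin n) S) :
    ‖matCLM p ((x * y).map φ)‖ ≤ ‖matCLM p (x.map φ)‖ * ‖matCLM p (y.map φ)‖ := by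
  rw [Matrix.map_mul, matCLM_mul]
  exact ContinuousLinearMap.opNorm_comp_le _ _

theorem norm_matCLM_map_sum_le (hp : p ≠ ∞) {n m k : ℕ} (σ : Fin k ≃ Fin n ⊕ Fin m)
    (x : Matrix (Fin n) (Fin n) S) (y : Matrix (Fin m) (Fin m) S) :
    ‖matCLM p (((Matrix.fromBlocks x 0 0 y).submatrix σ σ).map φ)‖ ≤
      max ‖matCLM p (x.map φ)‖ ‖matCLM p (y.map φ)‖ := by
  rw [← Matrix.submatrix_map, Matrix.fromBlocks_map, Matrix.map_zero _ (map_zero φ),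
    Matrix.map_zero _ (map_zero φ)]
  exact norm_matCLM_sum_le hp σ _ _

theorem norm_matCLM_map_blockDiagonal_le (hp : p ≠ ∞) {n o k : ℕ} (σ : Fin k ≃ Fin n × Fin o)
    (x : Fin o → Matrix (Fin n) (Fin n) S) {c : ℝ} (hc : 0 ≤ c)
    (h : ∀ j, ‖matCLM p ((x j).map φ)‖ ≤ c) :
    ‖matCLM p (((Matrix.blockDiagonal x).submatrix σ σ).map φ)‖ ≤ c := by
  rw [← Matrix.submatrix_map, Matrix.blockDiagonal_map _ _ (map_zero φ)]
  exact norm_matCLM_blockDiagonal_le hp σ _ hc h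

end

/-- The filtration vanishes at r = 0, so that the matrices of propagation 0 over the unitization are
the scalar ones. They can be multiplied without any loss of propagation. -/
theorem FilteredSQpAlgebra.fil_mul_of_nonneg (A : FilteredSQpAlgebra.{u} p) {r r' : ℝ} (hr : 0 ≤ r)
    (hr' : 0 ≤ r') (a b : A.alg)
    (ha : a ∈ if 0 < r then (A.fil r).comap A.alg.toSubmodule.subtype else ⊥)
    (hb : b ∈ if 0 < r' then (A.fil r').comap A.alg.toSubmodule.subtype else ⊥) :
    a * b ∈ if 0 < r + r' then (A.fil (r + r')).comap A.alg.toSubmodule.subtype else ⊥ := by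
  rcases hr.eq_or_lt with rfl | h
  · rw [if_neg (lt_irrefl _), Submodule.mem_bot] at ha
    rw [ha, zero_mul]
    exact Submodule.zero_mem _
  rcases hr'.eq_or_lt with rfl | h'
  · rw [if_neg (lt_irrefl _), Submodule.mem_bot] at hb
    rw [hb, mul_zero]
    exact Submodule.zero_mem _
  rw [if_pos h] at ha
  rw [if_pos h'] at hb
  rw [if_pos (add_pos h h')]
  exact A.fil_mul r r' h h' _ ha _ hb

theorem FilteredSQpAlgebra.nice (hp : p ≠ ∞) (A : FilteredSQpAlgebra.{u} p) : A.toMatAlg.Nice where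
  finite := hp
  nrm_add n x y := by
    rw [A.toMatAlg_nrm, A.toMatAlg_nrm, A.toMatAlg_nrm]
    exact max_le ((norm_matCLM_map_add_le A.actHom x y).trans
      (add_le_add (le_max_left _ _) (le_max_left _ _)))
      ((norm_matCLM_map_add_le A.toMatAlg.scalarHom x y).trans
      (add_le_add (le_max_right _ _) (le_max_right _ _)))
  nrm_mul n x y := by
    rw [A.toMatAlg_nrm, A.toMatAlg_nrm, A.toMatAlg_nrm]
    exact max_le ((norm_matCLM_map_mul_le A.actHom x y).trans
      (mul_le_mul (le_max_left _ _) (le_max_left _ _) (norm_nonneg _)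
        ((norm_nonneg _).trans (le_max_left _ _))))
      ((norm_matCLM_map_mul_le A.toMatAlg.scalarHom x y).trans
      (mul_le_mul (le_max_right _ _) (le_max_right _ _) (norm_nonneg _)
        ((norm_nonneg _).trans (le_max_right _ _))))
  nrm_scalar n z := by
    rw [A.toMatAlg_nrm]
    refine max_le ?_ (le_of_eq ?_)
    · refine le_trans (le_of_eq ?_) (norm_matCLM_scalar_le hp A.isSQp z A.norm_one_le)
      congr 2
      ext1 i j
      change A.act (Unitization.inl (z i j)) = _
      simp [act]
    · rfl
  nrm_sum σ x y := by
    rw [A.toMatAlg_nrm, A.toMatAlg_nrm, A.toMatAlg_nrm]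
    exact max_le ((norm_matCLM_map_sum_le A.actHom hp σ x y).trans
      (max_le_max (le_max_left _ _) (le_max_left _ _)))
      ((norm_matCLM_map_sum_le A.toMatAlg.scalarHom hp σ x y).trans
      (max_le_max (le_max_right _ _) (le_max_right _ _)))
  nrm_blockDiagonal σ x c hc h := by
    simp only [A.toMatAlg_nrm] at h ⊢
    exact max_le (norm_matCLM_map_blockDiagonal_le A.actHom hp σ x hc
      fun j => (le_max_left _ _).trans (h j))
      (norm_matCLM_map_blockDiagonal_le A.toMatAlg.scalarHom hp σ x hc
      fun j => (le_max_right _ _).trans (h j))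
  fil_mul r r' hr hr' a ha b hb := A.fil_mul_of_nonneg hr hr' a b ha hb

end

/-! ## Norms of matrices with arbitrary finite index types -/

namespace MatAlg

/-- A matrix indexed by a finite type as a matrix indexed by an initial segment of `ℕ`. -/
noncomputable def toFin {S : Type*} {ι : Type*} [Fintype ι] (x : Matrix ι ι S) :
    Matrix (Fin (Fintype.card ι)) (Fin (Fintype.card ι)) S :=
  x.submatrix (Fintype.equivFin ι).symm (Fintype.equivFin ι).symm

/-- The norm of a matrix indexed by a finite type. -/
noncomputable def nm (X : MatAlg.{u} p) {ι : Type*} [Fintype ι] (x : Matrix ι ι X.R) : ℝ :=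
  X.nrmR (Fintype.card ι) (toFin x)

variable {X : MatAlg.{u} p}

theorem nm_nonneg {ι : Type*} [Fintype ι] (x : Matrix ι ι X.R) : 0 ≤ X.nm x := nrmR_nonneg _ _

theorem permMatrix_conj {S : Type*} [Semiring S] {ι : Type*} [Fintype ι] [DecidableEq ι]
    (σ : Equiv.Perm ι) (x : Matrix ι ι S) :
    σ.permMatrix S * x * (σ⁻¹).permMatrix S = x.submatrix σ σ := by
  rw [Equiv.Perm.permMatrix, Equiv.Perm.permMatrix, PEquiv.toMatrix_toPEquiv_mul,
    PEquiv.mul_toMatrix_toPEquiv, Matrix.submatrix_submatrix]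
  rfl

theorem permMatrix_map {S S' : Type*} [Semiring S] [Semiring S'] (f : S →+* S') {ι : Type*}
    [DecidableEq ι] (σ : Equiv.Perm ι) : (σ.permMatrix S).map f = σ.permMatrix S' :=
  PEquiv.map_toMatrix f _

theorem toFin_one {S : Type*} [Semiring S] {ι : Type*} [Fintype ι] [DecidableEq ι] : toFin (1 : Matrix ι ι S) = 1 :=
  Matrix.submatrix_one_equiv _

section

variable [X.Nice]

theorem nrm_perm_le {n : ℕ} (σ : Equiv.Perm (Fin n)) : X.nrmR n (σ.permMatrix X.R) ≤ 1 := by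
  rw [← permMatrix_map X.inl σ]
  exact (Nice.nrm_scalar n _).trans (scalarNorm_perm_le (Nice.finite X) σ)

theorem nrm_submatrix_le {n : ℕ} (σ : Equiv.Perm (Fin n)) (x : Matrix (Fin n) (Fin n) X.R) :
    X.nrmR n (x.submatrix σ σ) ≤ X.nrmR n x := by
  rw [← permMatrix_conj]
  calc _ ≤ X.nrmR n (σ.permMatrix X.R * x) * X.nrmR n (σ⁻¹.permMatrix X.R) := Nice.nrm_mul _ _ _
    _ ≤ X.nrmR n (σ.permMatrix X.R * x) * 1 :=
        mul_le_mul_of_nonneg_left (nrm_perm_le _) (nrmR_nonneg _ _)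
    _ ≤ X.nrmR n (σ.permMatrix X.R) * X.nrmR n x := by rw [mul_one]; exact Nice.nrm_mul _ _ _
    _ ≤ 1 * X.nrmR n x := mul_le_mul_of_nonneg_right (nrm_perm_le _) (nrmR_nonneg _ _)
    _ = _ := one_mul _

theorem nrm_submatrix {n : ℕ} (σ : Equiv.Perm (Fin n)) (x : Matrix (Fin n) (Fin n) X.R) :
    X.nrmR n (x.submatrix σ σ) = X.nrmR n x := by
  refine le_antisymm (nrm_submatrix_le σ x) ?_
  have h := nrm_submatrix_le σ⁻¹ (x.submatrix σ σ)
  rw [Matrix.submatrix_submatrix] at h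
  refine le_trans (le_of_eq ?_) h
  congr 1
  ext1 i j
  simp

/-- Conjugation by permutation matrices is isometric, because they and their inverses are
contractive. Hence the norm does not depend on the enumeration of the index type. -/
theorem nm_eq {ι : Type*} [Fintype ι] {n : ℕ} (e : ι ≃ Fin n) (x : Matrix ι ι X.R) :
    X.nm x = X.nrmR n (x.submatrix e.symm e.symm) := by
  obtain rfl : Fintype.card ι = n := by simpa using Fintype.card_congr e
  rw [nm, toFin, ← nrm_submatrix (e.symm.trans (Fintype.equivFin ι)), Matrix.submatrix_submatrix]
  congr 1
  ext1 i j
  simp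

theorem nm_fin {n : ℕ} (x : Matrix (Fin n) (Fin n) X.R) : X.nm x = X.nrmR n x :=
  nm_eq (Equiv.refl _) x

section

variable {ι κ : Type*} [Fintype ι] [Fintype κ]

theorem nm_submatrix (e : κ ≃ ι) (x : Matrix ι ι X.R) : X.nm (x.submatrix e e) = X.nm x := by
  rw [nm_eq (Fintype.equivFin ι) x, nm_eq (e.trans (Fintype.equivFin ι)), Matrix.submatrix_submatrix]
  congr 1
  ext1 i j
  simp

theorem nm_add_le (x y : Matrix ι ι X.R) : X.nm (x + y) ≤ X.nm x + X.nm y := Nice.nrm_add _ _ _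

theorem nm_mul_le (x y : Matrix ι ι X.R) : X.nm (x * y) ≤ X.nm x * X.nm y := by
  have h : toFin (x * y) = toFin x * toFin y := by
    rw [toFin, toFin, toFin, Matrix.submatrix_mul_equiv]
  rw [nm, h]
  exact Nice.nrm_mul _ _ _

theorem nm_scalar_le (z : Matrix ι ι ℂ) :
    X.nm (z.map X.inl) ≤ scalarNorm p _ (toFin z) :=
  Nice.nrm_scalar (Fintype.card ι) (toFin z)

/-- The passage to the scalar part factors through the matrices over ℂ, and both maps are
contractive. For this reason the affine lifts to the cone do not increase norms. -/
theorem nm_scal_le (x : Matrix ι ι X.R) : X.nm (x.map X.scal) ≤ X.nm x :=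
  (nm_scalar_le (x.map X.fst)).trans (scalarNorm_le_nrmR _ (toFin x))

theorem nm_zero : X.nm (0 : Matrix ι ι X.R) = 0 := by
  refine le_antisymm ?_ (nm_nonneg _)
  have h := nm_scalar_le (X := X) (0 : Matrix ι ι ℂ)
  rw [Matrix.map_zero _ (map_zero _)] at h
  refine h.trans ?_
  have h' : toFin (0 : Matrix ι ι ℂ) = (0 : ℂ) • 1 := by rw [zero_smul]; rfl
  rw [h']
  exact (scalarNorm_smul_one_le (Nice.finite X) _).trans (by simp)

variable [DecidableEq ι] [DecidableEq κ]

theorem nm_smul_one_le (c : ℂ) : X.nm (c • (1 : Matrix ι ι X.R)) ≤ ‖c‖ := by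
  have h := nm_scalar_le (X := X) (c • (1 : Matrix ι ι ℂ))
  have h1 : (c • (1 : Matrix ι ι ℂ)).map X.inl =
      c • (1 : Matrix ι ι X.R) := by
    ext1 i j
    by_cases hij : i = j
    · subst hij
      simp only [Matrix.map_apply, Matrix.smul_apply, Matrix.one_apply_eq, smul_eq_mul, mul_one]
      exact Algebra.algebraMap_eq_smul_one c
    · simp [Matrix.one_apply_ne hij]
  rw [h1] at h
  refine h.trans ?_
  have h2 : toFin (c • (1 : Matrix ι ι ℂ)) = c • 1 := by
    rw [← toFin_one (ι := ι)]; rfl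
  rw [h2]
  exact scalarNorm_smul_one_le (Nice.finite X) _

theorem nm_one_le : X.nm (1 : Matrix ι ι X.R) ≤ 1 := by
  simpa using nm_smul_one_le (X := X) (ι := ι) 1

theorem nm_perm_le (σ : Equiv.Perm ι) : X.nm (σ.permMatrix X.R) ≤ 1 := by
  have h : toFin (σ.permMatrix X.R) =
      ((Fintype.equivFin ι).permCongr σ).permMatrix X.R := by
    ext1 i j
    simp only [toFin, Matrix.submatrix_apply, Equiv.Perm.permMatrix, PEquiv.toMatrix_apply,
      Equiv.toPEquiv_apply, Option.mem_def, Option.some_inj, Equiv.permCongr_apply]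
    congr 1
    rw [eq_iff_iff, Equiv.eq_symm_apply]
  rw [nm, h]
  exact nrm_perm_le _

end

section

variable {ι κ : Type*} [Fintype ι] [Fintype κ]

theorem nm_smul_le (c : ℂ) (x : Matrix ι ι X.R) : X.nm (c • x) ≤ ‖c‖ * X.nm x := by
  classical
  have h : c • x = c • (1 : Matrix ι ι X.R) * x := by rw [Matrix.smul_mul, one_mul]
  rw [h]
  exact (nm_mul_le _ _).trans (mul_le_mul_of_nonneg_right (nm_smul_one_le c) (nm_nonneg _))

theorem nm_neg (x : Matrix ι ι X.R) : X.nm (-x) = X.nm x := by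
  have h : ∀ y : Matrix ι ι X.R, X.nm (-y) ≤ X.nm y := fun y => by
    simpa using nm_smul_le (X := X) (-1) y
  refine le_antisymm (h x) ?_
  simpa using h (-x)

theorem nm_sub_le (x y : Matrix ι ι X.R) : X.nm (x - y) ≤ X.nm x + X.nm y := by
  rw [sub_eq_add_neg, ← nm_neg y]
  exact nm_add_le _ _

theorem nm_sum_le (x : Matrix ι ι X.R) (y : Matrix κ κ X.R) :
    X.nm (Matrix.fromBlocks x 0 0 y) ≤ max (X.nm x) (X.nm y) := by
  let e := (Fintype.equivFin ι); let e' := Fintype.equivFin κ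
  have h := Nice.nrm_sum (X := X) ((Fintype.equivFin (ι ⊕ κ)).symm.trans (Equiv.sumCongr e e'))
    (toFin x) (toFin y)
  refine le_trans (le_of_eq ?_) h
  rw [nm, toFin]
  congr 1
  ext1 i j
  simp only [Matrix.submatrix_apply, Equiv.trans_apply]
  rcases (Fintype.equivFin (ι ⊕ κ)).symm i with a | a <;>
  rcases (Fintype.equivFin (ι ⊕ κ)).symm j with b | b <;> simp [toFin, e, e']

theorem nm_blockDiagonal_le [DecidableEq κ] (x : κ → Matrix ι ι X.R) {c : ℝ} (hc : 0 ≤ c)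
    (h : ∀ k, X.nm (x k) ≤ c) : X.nm (Matrix.blockDiagonal x) ≤ c := by
  let e := (Fintype.equivFin ι); let e' := Fintype.equivFin κ
  have h := Nice.nrm_blockDiagonal (X := X)
    ((Fintype.equivFin (ι × κ)).symm.trans (Equiv.prodCongr e e'))
    (fun k => toFin (x (e'.symm k))) c hc fun k => h _
  refine le_trans (le_of_eq ?_) h
  rw [nm, toFin]
  congr 1
  ext1 i j
  simp only [Matrix.submatrix_apply, Equiv.trans_apply]
  rcases (Fintype.equivFin (ι × κ)).symm i with ⟨a, a'⟩
  rcases (Fintype.equivFin (ι × κ)).symm j with ⟨b, b'⟩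
  simp [toFin, Matrix.blockDiagonal_apply, e, e']

/-- The off-diagonal part becomes block diagonal after multiplication by the permutation that
exchanges the two summands. -/
theorem nm_fromBlocks_le (a b c d : Matrix ι ι X.R) :
    X.nm (Matrix.fromBlocks a b c d) ≤ max (X.nm a) (X.nm d) + max (X.nm b) (X.nm c) := by
  classical
  have h : Matrix.fromBlocks a b c d = Matrix.fromBlocks a 0 0 d +
      Matrix.fromBlocks b 0 0 c * Equiv.Perm.permMatrix X.R (Equiv.sumComm ι ι) := by
    rw [Equiv.Perm.permMatrix, PEquiv.mul_toMatrix_toPEquiv]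
    ext1 i j
    rcases i with i | i <;> rcases j with j | j <;> simp
  rw [h]
  refine (nm_add_le _ _).trans (add_le_add (nm_sum_le _ _) ?_)
  refine (nm_mul_le _ _).trans ?_
  refine (mul_le_mul_of_nonneg_left (nm_perm_le _) (nm_nonneg _)).trans ?_
  rw [mul_one]
  exact nm_sum_le _ _

end

end

/-! ## Propagation -/

section

variable {ι κ : Type*} {r r' : ℝ}

/-- The entries of `x` belong to `A_r + ℂ`. -/
def Fil (X : MatAlg.{u} p) (r : ℝ) {ι : Type*} (x : Matrix ι ι X.R) : Prop :=
  ∀ i j, X.snd (x i j) ∈ X.fil r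

theorem Fil.mono (h : r ≤ r') {x : Matrix ι ι X.R} (hx : X.Fil r x) : X.Fil r' x :=
  fun i j => X.fil_mono r r' h (hx i j)

theorem Fil.add {x y : Matrix ι ι X.R} (hx : X.Fil r x) (hy : X.Fil r y) : X.Fil r (x + y) :=
  fun i j => by
    rw [Matrix.add_apply, map_add]
    exact (X.fil r).add_mem (hx i j) (hy i j)

theorem Fil.neg {x : Matrix ι ι X.R} (hx : X.Fil r x) : X.Fil r (-x) :=
  fun i j => by
    rw [Matrix.neg_apply, map_neg]
    exact (X.fil r).neg_mem (hx i j)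

theorem Fil.sub {x y : Matrix ι ι X.R} (hx : X.Fil r x) (hy : X.Fil r y) : X.Fil r (x - y) :=
  fun i j => by
    rw [Matrix.sub_apply, map_sub]
    exact (X.fil r).sub_mem (hx i j) (hy i j)

theorem Fil.smul (c : ℂ) {x : Matrix ι ι X.R} (hx : X.Fil r x) : X.Fil r (c • x) :=
  fun i j => by
    rw [Matrix.smul_apply, map_smul]
    exact (X.fil r).smul_mem c (hx i j)

theorem Fil.scal (x : Matrix ι ι X.R) : X.Fil r (x.map X.scal) := fun _ _ => by simp

theorem Fil.zero : X.Fil r (0 : Matrix ι ι X.R) := fun _ _ => by simp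

theorem Fil.one [DecidableEq ι] : X.Fil r (1 : Matrix ι ι X.R) := fun i j => by
  by_cases h : i = j <;> simp [h, Matrix.one_apply]

theorem Fil.perm [DecidableEq ι] (σ : Equiv.Perm ι) : X.Fil r (σ.permMatrix X.R) := fun i j => by
  simp only [Equiv.Perm.permMatrix, PEquiv.toMatrix_apply]
  split_ifs <;> simp

theorem Fil.submatrix {x : Matrix ι ι X.R} (hx : X.Fil r x) (f : κ → ι) :
    X.Fil r (x.submatrix f f) := fun _ _ => hx _ _

theorem Fil.sum {x : Matrix ι ι X.R} {y : Matrix κ κ X.R} (hx : X.Fil r x) (hy : X.Fil r y) :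
    X.Fil r (Matrix.fromBlocks x 0 0 y) := by
  rintro (i | i) (j | j)
  · exact hx i j
  · simp
  · simp
  · exact hy i j

theorem Fil.fromBlocks {a b c d : Matrix ι ι X.R} (ha : X.Fil r a) (hb : X.Fil r b)
    (hc : X.Fil r c) (hd : X.Fil r d) : X.Fil r (Matrix.fromBlocks a b c d) := by
  rintro (i | i) (j | j)
  exacts [ha i j, hb i j, hc i j, hd i j]

theorem Fil.blockDiagonal [DecidableEq κ] {x : κ → Matrix ι ι X.R} (hx : ∀ k, X.Fil r (x k)) :
    X.Fil r (Matrix.blockDiagonal x) := by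
  rintro ⟨i, k⟩ ⟨j, l⟩
  rw [Matrix.blockDiagonal_apply]
  split_ifs
  · exact hx _ _ _
  · simp

theorem Fil.mul [Fintype ι] [X.Nice] (hr : 0 ≤ r) (hr' : 0 ≤ r') {x y : Matrix ι ι X.R}
    (hx : X.Fil r x) (hy : X.Fil r' y) : X.Fil (r + r') (x * y) := fun i j => by
  rw [Matrix.mul_apply, map_sum]
  refine Submodule.sum_mem _ fun k _ => ?_
  rw [snd_mul]
  refine Submodule.add_mem _ (Submodule.add_mem _ (Submodule.smul_mem _ _ ?_)
    (Submodule.smul_mem _ _ ?_)) (Nice.fil_mul r r' hr hr' _ (hx i k) _ (hy k j))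
  · exact X.fil_mono _ _ (by linarith) (hy k j)
  · exact X.fil_mono _ _ (by linarith) (hx i k)

end

/-! ## Evaluation of paths -/

section Path

variable {Z : Set unitInterval}

/-- The homomorphism `(a, z) ↦ (f(a), z)`. -/
noncomputable def unitize {X : MatAlg.{u} p} {Y : MatAlg.{v} p} (f : X.carrier →ₙₐ[ℂ] Y.carrier) :
    X.R →+* Y.R where
  toFun x := Y.inl (X.fst x) + Y.inr (f (X.snd x))
  map_zero' := by simp
  map_one' := by simp
  map_add' x y := by
    simp only [map_add]
    abel
  map_mul' x y := R_ext (by simp) (by simp [snd_mul])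

theorem unitize_fst {Y : MatAlg.{v} p} (f : X.carrier →ₙₐ[ℂ] Y.carrier) (x : X.R) :
    Y.fst (unitize f x) = X.fst x := by
  change Y.fst (Y.inl (X.fst x) + Y.inr (f (X.snd x))) = _
  simp

theorem unitize_snd {Y : MatAlg.{v} p} (f : X.carrier →ₙₐ[ℂ] Y.carrier) (x : X.R) :
    Y.snd (unitize f x) = f (X.snd x) := by
  change Y.snd (Y.inl (X.fst x) + Y.inr (f (X.snd x))) = _
  simp

/-- Evaluation at `t`. -/
noncomputable def ev (Z : Set unitInterval) (X : MatAlg.{u} p) (t : unitInterval) :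
    (pathAlg Z X).R →+* X.R :=
  unitize (X := pathAlg Z X)
    { toFun := fun F => F.1 t
      map_smul' := fun _ _ => rfl
      map_zero' := rfl
      map_add' := fun _ _ => rfl
      map_mul' := fun _ _ => rfl }

theorem ev_fst (t : unitInterval) (x : (pathAlg Z X).R) :
    X.fst (ev Z X t x) = (pathAlg Z X).fst x := unitize_fst _ _

theorem ev_snd (t : unitInterval) (x : (pathAlg Z X).R) :
    X.snd (ev Z X t x) = ((pathAlg Z X).snd x).1 t := unitize_snd (X := pathAlg Z X) _ _

theorem pathAlg_nrm_le_iff {n : ℕ} {x : Matrix (Fin n) (Fin n) (pathAlg Z X).R} {c : ℝ} :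
    (pathAlg Z X).nrmR n x ≤ c ↔ ∀ t, X.nrmR n (x.map (ev Z X t)) ≤ c :=
  ⟨fun h t => (le_ciSup (path_bddAbove Z X n x) t).trans h, fun h => ciSup_le h⟩

theorem nrm_ev_le {n : ℕ} (x : Matrix (Fin n) (Fin n) (pathAlg Z X).R) (t : unitInterval) :
    X.nrmR n (x.map (ev Z X t)) ≤ (pathAlg Z X).nrmR n x := pathAlg_nrm_le_iff.1 le_rfl t

instance [X.Nice] : (pathAlg Z X).Nice where
  finite := Nice.finite X
  nrm_add n x y := pathAlg_nrm_le_iff.2 fun t => by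
    rw [Matrix.map_add _ (map_add _)]
    exact (Nice.nrm_add _ _ _).trans (add_le_add (nrm_ev_le x t) (nrm_ev_le y t))
  nrm_mul n x y := pathAlg_nrm_le_iff.2 fun t => by
    rw [Matrix.map_mul]
    exact (Nice.nrm_mul _ _ _).trans
      (mul_le_mul (nrm_ev_le x t) (nrm_ev_le y t) (nrmR_nonneg _ _) (nrmR_nonneg _ _))
  nrm_scalar n z := pathAlg_nrm_le_iff.2 fun t => by
    refine le_trans (le_of_eq ?_) (Nice.nrm_scalar (X := X) n z)
    congr 1
    ext1 i j
    exact R_ext (ev_fst t _) (ev_snd t _)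
  nrm_sum σ x y := pathAlg_nrm_le_iff.2 fun t => by
    rw [← Matrix.submatrix_map, Matrix.fromBlocks_map, Matrix.map_zero _ (map_zero _),
      Matrix.map_zero _ (map_zero _)]
    exact (Nice.nrm_sum σ _ _).trans (max_le_max (nrm_ev_le x t) (nrm_ev_le y t))
  nrm_blockDiagonal σ x c hc h := pathAlg_nrm_le_iff.2 fun t => by
    rw [← Matrix.submatrix_map, Matrix.blockDiagonal_map _ _ (map_zero _)]
    exact Nice.nrm_blockDiagonal σ _ c hc fun j => (nrm_ev_le _ t).trans (h j)
  fil_mul r r' hr hr' a ha b hb t := Nice.fil_mul r r' hr hr' _ (ha t) _ (hb t)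

variable {ι : Type*} [Fintype ι]

theorem pathAlg_nm_le_iff {x : Matrix ι ι (pathAlg Z X).R} {c : ℝ} :
    (pathAlg Z X).nm x ≤ c ↔ ∀ t, X.nm (x.map (ev Z X t)) ≤ c := pathAlg_nrm_le_iff

theorem nm_ev_le (x : Matrix ι ι (pathAlg Z X).R) (t : unitInterval) :
    X.nm (x.map (ev Z X t)) ≤ (pathAlg Z X).nm x := pathAlg_nm_le_iff.1 le_rfl t

end Path

end MatAlg

namespace MatAlg

variable {X : MatAlg.{u} p}

/-! ## Norm continuous paths of matrices -/

/-- Norm continuity of a path of matrices. -/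
def NC (X : MatAlg.{u} p) {ι : Type*} [Fintype ι] (γ : unitInterval → Matrix ι ι X.R) : Prop :=
  ∀ s, Tendsto (fun t => X.nm (γ t - γ s)) (𝓝 s) (𝓝 0)

section NC

variable {ι κ : Type*} [Fintype ι] [Fintype κ] [X.Nice]

theorem NC.const (x : Matrix ι ι X.R) : X.NC fun _ => x := fun s => by
  simp only [sub_self, nm_zero]
  exact tendsto_const_nhds

theorem NC.add {γ δ : unitInterval → Matrix ι ι X.R} (hγ : X.NC γ) (hδ : X.NC δ) :
    X.NC fun t => γ t + δ t := fun s => by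
  have h := (hγ s).add (hδ s)
  rw [add_zero] at h
  refine squeeze_zero (fun t => nm_nonneg _) (fun t => ?_) h
  rw [add_sub_add_comm]
  exact nm_add_le _ _

theorem NC.mul {γ δ : unitInterval → Matrix ι ι X.R} (hγ : X.NC γ) (hδ : X.NC δ) :
    X.NC fun t => γ t * δ t := fun s => by
  have h := (((hγ s).mul (hδ s)).add ((hγ s).mul_const (X.nm (δ s)))).add
    ((hδ s).const_mul (X.nm (γ s)))
  simp only [mul_zero, zero_mul, add_zero] at h
  refine squeeze_zero (fun t => nm_nonneg _) (fun t => ?_) h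
  have e : γ t * δ t - γ s * δ s = (γ t - γ s) * (δ t - δ s) + (γ t - γ s) * δ s +
    γ s * (δ t - δ s) := by noncomm_ring
  rw [e]
  exact (nm_add_le _ _).trans (add_le_add ((nm_add_le _ _).trans
    (add_le_add (nm_mul_le _ _) (nm_mul_le _ _))) (nm_mul_le _ _))

theorem NC.smul {f : unitInterval → ℂ} (hf : Continuous f) (x : Matrix ι ι X.R) :
    X.NC fun t => f t • x := fun s => by
  have h : Tendsto (fun t => ‖f t - f s‖ * X.nm x) (𝓝 s) (𝓝 0) := by
    have h' : Tendsto (fun t => f t - f s) (𝓝 s) (𝓝 (f s - f s)) :=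
      (hf.sub continuous_const).tendsto s
    rw [sub_self] at h'
    simpa using h'.norm.mul_const (X.nm x)
  refine squeeze_zero (fun t => nm_nonneg _) (fun t => ?_) h
  rw [← sub_smul]
  exact nm_smul_le _ _

theorem NC.submatrix (e : κ ≃ ι) {γ : unitInterval → Matrix ι ι X.R} (hγ : X.NC γ) :
    X.NC fun t => (γ t).submatrix e e := fun s => by
  refine (hγ s).congr fun t => ?_
  rw [← nm_submatrix e]
  rfl

theorem nc_fin_iff {n : ℕ} (γ : unitInterval → Matrix (Fin n) (Fin n) X.R) :
    NormContinuous X.plus γ ↔ X.NC γ := by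
  unfold NC
  simp only [nm_fin]
  rfl

end NC

/-! ## Quasi-idempotents and quasi-invertibles with arbitrary index types -/

section Quasi

variable {ι κ : Type*} [Fintype ι] [Fintype κ] [DecidableEq ι] [DecidableEq κ] {ε r N : ℝ}

/-- `x` is an `(ε, r, N)`-idempotent. -/
structure QI (X : MatAlg.{u} p) (ε r N : ℝ) (x : Matrix ι ι X.R) : Prop where
  idem : X.nm (x * x - x) < ε
  fil : X.Fil r x
  bd : X.nm x ≤ N
  bd' : X.nm (1 - x) ≤ N

/-- `(x, y)` is an `(ε, r, N)`-inverse pair. -/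
structure IP (X : MatAlg.{u} p) (ε r N : ℝ) (x y : Matrix ι ι X.R) : Prop where
  fil : X.Fil r x
  fil' : X.Fil r y
  bd : X.nm x ≤ N
  bd' : X.nm y ≤ N
  inv : X.nm (x * y - 1) < ε
  inv' : X.nm (y * x - 1) < ε

/-- `x` is an `(ε, r, N)`-idempotent, respectively an `(ε, r, N)`-invertible. -/
def Q (i : KDeg) (X : MatAlg.{u} p) (ε r N : ℝ) (x : Matrix ι ι X.R) : Prop :=
  match i with
  | .zero => X.QI ε r N x
  | .one => ∃ y, X.IP ε r N x y

variable [X.Nice]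

theorem QI.submatrix (e : κ ≃ ι) {x : Matrix ι ι X.R} (h : X.QI ε r N x) :
    X.QI ε r N (x.submatrix e e) := by
  refine ⟨?_, h.fil.submatrix e, by rw [nm_submatrix]; exact h.bd, ?_⟩
  · rw [Matrix.submatrix_mul_equiv]
    exact (nm_submatrix e (x * x - x)).trans_lt h.idem
  · rw [← Matrix.submatrix_one_equiv e]
    exact (nm_submatrix e (1 - x)).trans_le h.bd'

theorem IP.submatrix (e : κ ≃ ι) {x y : Matrix ι ι X.R} (h : X.IP ε r N x y) :
    X.IP ε r N (x.submatrix e e) (y.submatrix e e) := by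
  refine ⟨h.fil.submatrix e, h.fil'.submatrix e, by rw [nm_submatrix]; exact h.bd,
    by rw [nm_submatrix]; exact h.bd', ?_, ?_⟩
  · rw [Matrix.submatrix_mul_equiv, ← Matrix.submatrix_one_equiv e]
    exact (nm_submatrix e (x * y - 1)).trans_lt h.inv
  · rw [Matrix.submatrix_mul_equiv, ← Matrix.submatrix_one_equiv e]
    exact (nm_submatrix e (y * x - 1)).trans_lt h.inv'

theorem Q.submatrix {i : KDeg} (e : κ ≃ ι) {x : Matrix ι ι X.R} (h : Q i X ε r N x) :
    Q i X ε r N (x.submatrix e e) := by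
  cases i with
  | zero => exact QI.submatrix e h
  | one => exact h.elim fun y hy => ⟨_, hy.submatrix e⟩

theorem quasiIdem_iff {n : ℕ} (x : Matrix (Fin n) (Fin n) X.R) :
    QuasiIdem X.plus ε r N x ↔ X.QI ε r N x := by
  have h : QuasiIdem X.plus ε r N x ↔ X.nrmR n (x * x - x) < ε ∧ X.Fil r x ∧ X.nrmR n x ≤ N ∧
    X.nrmR n (1 - x) ≤ N := Iff.rfl
  rw [h]
  simp only [← nm_fin]
  exact ⟨fun h => ⟨h.1, h.2.1, h.2.2.1, h.2.2.2⟩, fun h => ⟨h.1, h.2, h.3, h.4⟩⟩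

theorem inversePair_iff {n : ℕ} (x y : Matrix (Fin n) (Fin n) X.R) :
    InversePair X.plus ε r N x y ↔ X.IP ε r N x y := by
  have h : InversePair X.plus ε r N x y ↔ X.Fil r x ∧ X.Fil r y ∧ X.nrmR n x ≤ N ∧
    X.nrmR n y ≤ N ∧ X.nrmR n (x * y - 1) < ε ∧ X.nrmR n (y * x - 1) < ε := Iff.rfl
  rw [h]
  simp only [← nm_fin]
  exact ⟨fun h => ⟨h.1, h.2.1, h.2.2.1, h.2.2.2.1, h.2.2.2.2.1, h.2.2.2.2.2⟩,
    fun h => ⟨h.1, h.2, h.3, h.4, h.5, h.6⟩⟩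

theorem isQuasi_iff {i : KDeg} {n : ℕ} (x : Matrix (Fin n) (Fin n) X.R) :
    IsQuasi i X.plus ε r N x ↔ Q i X ε r N x := by
  cases i with
  | zero => exact quasiIdem_iff x
  | one => exact exists_congr fun y => inversePair_iff x y

theorem QI.sum {x : Matrix ι ι X.R} {y : Matrix κ κ X.R} (hx : X.QI ε r N x)
    (hy : X.QI ε r N y) : X.QI ε r N (Matrix.fromBlocks x 0 0 y) := by
  refine ⟨?_, hx.fil.sum hy.fil, (nm_sum_le _ _).trans (max_le hx.bd hy.bd), ?_⟩
  · have e : Matrix.fromBlocks x 0 0 y * Matrix.fromBlocks x 0 0 y - Matrix.fromBlocks x 0 0 y =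
      Matrix.fromBlocks (x * x - x) 0 0 (y * y - y) := by
      rw [Matrix.fromBlocks_multiply, sub_eq_add_neg, Matrix.fromBlocks_neg, Matrix.fromBlocks_add]
      simp [sub_eq_add_neg]
    rw [e]
    exact (nm_sum_le _ _).trans_lt (max_lt hx.idem hy.idem)
  · rw [← Matrix.fromBlocks_one, sub_eq_add_neg, Matrix.fromBlocks_neg, Matrix.fromBlocks_add]
    simp only [neg_zero, add_zero, ← sub_eq_add_neg]
    exact (nm_sum_le _ _).trans (max_le hx.bd' hy.bd')

theorem IP.sum {x x' : Matrix ι ι X.R} {y y' : Matrix κ κ X.R} (hx : X.IP ε r N x x')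
    (hy : X.IP ε r N y y') :
    X.IP ε r N (Matrix.fromBlocks x 0 0 y) (Matrix.fromBlocks x' 0 0 y') := by
  have e : ∀ (x x' : Matrix ι ι X.R) (y y' : Matrix κ κ X.R),
      Matrix.fromBlocks x 0 0 y * Matrix.fromBlocks x' 0 0 y' - 1 =
      Matrix.fromBlocks (x * x' - 1) 0 0 (y * y' - 1) := by
    intro x x' y y'
    rw [Matrix.fromBlocks_multiply, ← Matrix.fromBlocks_one, sub_eq_add_neg, Matrix.fromBlocks_neg,
      Matrix.fromBlocks_add]
    simp [sub_eq_add_neg]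
  refine ⟨hx.fil.sum hy.fil, hx.fil'.sum hy.fil', (nm_sum_le _ _).trans (max_le hx.bd hy.bd),
    (nm_sum_le _ _).trans (max_le hx.bd' hy.bd'), ?_, ?_⟩
  · rw [e]
    exact (nm_sum_le _ _).trans_lt (max_lt hx.inv hy.inv)
  · rw [e]
    exact (nm_sum_le _ _).trans_lt (max_lt hx.inv' hy.inv')

theorem Q.sum {i : KDeg} {x : Matrix ι ι X.R} {y : Matrix κ κ X.R}
    (hx : Q i X ε r N x) (hy : Q i X ε r N y) : Q i X ε r N (Matrix.fromBlocks x 0 0 y) := by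
  cases i with
  | zero => exact QI.sum hx hy
  | one =>
    obtain ⟨x', hx⟩ := hx
    obtain ⟨y', hy⟩ := hy
    exact ⟨_, hx.sum hy⟩

theorem QI.zero (hε : 0 < ε) (hN : 1 ≤ N) : X.QI ε r N (0 : Matrix ι ι X.R) :=
  ⟨by simpa [nm_zero] using hε, Fil.zero, by rw [nm_zero]; linarith,
    by rw [sub_zero]; exact nm_one_le.trans hN⟩

theorem QI.one (hε : 0 < ε) (hN : 1 ≤ N) : X.QI ε r N (1 : Matrix ι ι X.R) :=
  ⟨by simpa [nm_zero] using hε, Fil.one, nm_one_le.trans hN,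
    by rw [sub_self, nm_zero]; linarith⟩

theorem IP.one (hε : 0 < ε) (hN : 1 ≤ N) : X.IP ε r N (1 : Matrix ι ι X.R) 1 :=
  ⟨Fil.one, Fil.one, nm_one_le.trans hN, nm_one_le.trans hN, by simpa [nm_zero] using hε,
    by simpa [nm_zero] using hε⟩

/-- The filler matrix. -/
noncomputable def fillMat (i : KDeg) (X : MatAlg.{u} p) (ι : Type*) [DecidableEq ι] : Matrix ι ι X.R :=
  match i with
  | .zero => 0
  | .one => 1

theorem Q.fill (i : KDeg) (hε : 0 < ε) (hN : 1 ≤ N) : Q i X ε r N (fillMat i X ι) := by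
  cases i with
  | zero => exact QI.zero hε hN
  | one => exact ⟨_, IP.one hε hN⟩

end Quasi

/-! ## Rotations -/

section Rotation

variable {ι : Type*} [DecidableEq ι]

/-- The cosine of `π t / 2`. -/
noncomputable def cs (t : unitInterval) : ℂ := (Real.cos (Real.pi / 2 * t) : ℝ)

/-- The sine of `π t / 2`. -/
noncomputable def sn (t : unitInterval) : ℂ := (Real.sin (Real.pi / 2 * t) : ℝ)

theorem continuous_cs : Continuous cs := by unfold cs; fun_prop

theorem continuous_sn : Continuous sn := by unfold sn; fun_prop

@[simp] theorem cs_zero : cs 0 = 1 := by simp [cs]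

@[simp] theorem cs_one : cs 1 = 0 := by simp [cs]

@[simp] theorem sn_zero : sn 0 = 0 := by simp [sn]

@[simp] theorem sn_one : sn 1 = 1 := by simp [sn]

theorem cs_sq_add_sn_sq (t : unitInterval) : cs t * cs t + sn t * sn t = 1 := by
  have h := Real.cos_sq_add_sin_sq (Real.pi / 2 * t)
  unfold cs sn
  rw [← Complex.ofReal_mul, ← Complex.ofReal_mul, ← Complex.ofReal_add, ← sq, ← sq, h,
    Complex.ofReal_one]

theorem norm_sq_add_norm_sq (t : unitInterval) : ‖cs t‖ ^ 2 + ‖sn t‖ ^ 2 = 1 := by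
  simp only [cs, sn, Complex.norm_real, Real.norm_eq_abs, sq_abs]
  exact Real.cos_sq_add_sin_sq _

theorem norm_cs_le (t : unitInterval) : ‖cs t‖ ≤ 1 := by
  nlinarith [norm_sq_add_norm_sq t, norm_nonneg (cs t), sq_nonneg ‖sn t‖]

theorem norm_add_norm_sq_le (t : unitInterval) : (‖cs t‖ + ‖sn t‖) * (‖cs t‖ + ‖sn t‖) ≤ 2 := by
  nlinarith [norm_sq_add_norm_sq t, sq_nonneg (‖cs t‖ - ‖sn t‖)]

/-- The rotation by a right angle. -/
noncomputable def rotJ (X : MatAlg.{u} p) (ι : Type*) [DecidableEq ι] : Matrix (ι ⊕ ι) (ι ⊕ ι) X.R :=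
  Matrix.fromBlocks 0 (-1) 1 0

/-- The path `[[c g, -s], [s, c h]]` from `diag(g, h)` to the rotation by a right angle. -/
noncomputable def rot (g h : Matrix ι ι X.R) (t : unitInterval) : Matrix (ι ⊕ ι) (ι ⊕ ι) X.R :=
  cs t • Matrix.fromBlocks g 0 0 h + sn t • rotJ X ι

/-- The path `[[c h, s], [-s, c g]]`, quasi-inverse to `rot g h` if `h` is quasi-inverse to `g`. -/
noncomputable def rot' (g h : Matrix ι ι X.R) (t : unitInterval) : Matrix (ι ⊕ ι) (ι ⊕ ι) X.R :=
  cs t • Matrix.fromBlocks h 0 0 g - sn t • rotJ X ι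

variable [Fintype ι]

theorem rotJ_mul_rotJ : rotJ X ι * rotJ X ι = -1 := by
  rw [rotJ, Matrix.fromBlocks_multiply, ← Matrix.fromBlocks_one, Matrix.fromBlocks_neg]
  simp

theorem sum_mul_rotJ (g h : Matrix ι ι X.R) :
    Matrix.fromBlocks g 0 0 h * rotJ X ι = rotJ X ι * Matrix.fromBlocks h 0 0 g := by
  rw [rotJ, Matrix.fromBlocks_multiply, Matrix.fromBlocks_multiply]
  simp

/-- With J the rotation by a right angle, J² = -1 and diag(g, h) J = J diag(h, g), so that the mixed
terms cancel. As c² + s² = 1, the defect of the pair g, h survives only with the factor c². -/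
theorem rot_mul_rot' (g h : Matrix ι ι X.R) (t : unitInterval) : rot g h t * rot' g h t - 1 =
    (cs t * cs t) • Matrix.fromBlocks (g * h - 1) 0 0 (h * g - 1) := by
  have e : Matrix.fromBlocks (g * h - 1) 0 0 (h * g - 1) =
      Matrix.fromBlocks g 0 0 h * Matrix.fromBlocks h 0 0 g - 1 := by
    rw [Matrix.fromBlocks_multiply, ← Matrix.fromBlocks_one, sub_eq_add_neg _ (Matrix.fromBlocks _ _ _ _),
      Matrix.fromBlocks_neg, Matrix.fromBlocks_add]
    simp [sub_eq_add_neg]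
  have h1 : sn t * sn t = 1 - cs t * cs t := by rw [← cs_sq_add_sn_sq t, add_sub_cancel_left]
  rw [e, rot, rot', add_mul, mul_sub, mul_sub]
  simp only [Matrix.smul_mul, Matrix.mul_smul, sum_mul_rotJ, rotJ_mul_rotJ, smul_smul, smul_sub]
  rw [mul_comm (sn t) (cs t), smul_neg, h1, sub_smul, one_smul]
  abel

theorem rot'_mul_rot (g h : Matrix ι ι X.R) (t : unitInterval) : rot' g h t * rot g h t - 1 =
    (cs t * cs t) • Matrix.fromBlocks (h * g - 1) 0 0 (g * h - 1) := by
  have e : Matrix.fromBlocks (h * g - 1) 0 0 (g * h - 1) =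
      Matrix.fromBlocks h 0 0 g * Matrix.fromBlocks g 0 0 h - 1 := by
    rw [Matrix.fromBlocks_multiply, ← Matrix.fromBlocks_one, sub_eq_add_neg _ (Matrix.fromBlocks _ _ _ _),
      Matrix.fromBlocks_neg, Matrix.fromBlocks_add]
    simp [sub_eq_add_neg]
  have h1 : sn t * sn t = 1 - cs t * cs t := by rw [← cs_sq_add_sn_sq t, add_sub_cancel_left]
  rw [e, rot, rot', sub_mul, mul_add, mul_add]
  simp only [Matrix.smul_mul, Matrix.mul_smul, sum_mul_rotJ, rotJ_mul_rotJ, smul_smul, smul_sub]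
  rw [mul_comm (sn t) (cs t), smul_neg, h1, sub_smul, one_smul]
  abel

theorem rot_zero (g h : Matrix ι ι X.R) : rot g h 0 = Matrix.fromBlocks g 0 0 h := by
  simp [rot]

theorem rot'_zero (g h : Matrix ι ι X.R) : rot' g h 0 = Matrix.fromBlocks h 0 0 g := by
  simp [rot']

theorem rot_one (g h : Matrix ι ι X.R) : rot g h 1 = rotJ X ι := by
  simp [rot]

theorem rot'_one (g h : Matrix ι ι X.R) : rot' g h 1 = -rotJ X ι := by
  simp [rot']

theorem rotJ_conj (x y : Matrix ι ι X.R) :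
    rotJ X ι * Matrix.fromBlocks x 0 0 y * -rotJ X ι = Matrix.fromBlocks y 0 0 x := by
  rw [← sum_mul_rotJ, mul_assoc, mul_neg, rotJ_mul_rotJ, neg_neg, mul_one]

theorem Fil.rotJ {r : ℝ} : X.Fil r (rotJ X ι) :=
  Fil.fromBlocks Fil.zero Fil.one.neg Fil.one Fil.zero

theorem Fil.rot {r : ℝ} {g h : Matrix ι ι X.R} (hg : X.Fil r g) (hh : X.Fil r h)
    (t : unitInterval) : X.Fil r (rot g h t) :=
  ((hg.sum hh).smul _).add (Fil.rotJ.smul _)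

theorem Fil.rot' {r : ℝ} {g h : Matrix ι ι X.R} (hg : X.Fil r g) (hh : X.Fil r h)
    (t : unitInterval) : X.Fil r (rot' g h t) :=
  ((hh.sum hg).smul _).sub (Fil.rotJ.smul _)

variable [X.Nice]

theorem nm_rotJ_le : X.nm (rotJ X ι) ≤ 1 := by
  refine (nm_fromBlocks_le _ _ _ _).trans ?_
  rw [nm_zero, nm_neg, max_self, max_self, zero_add]
  exact nm_one_le

theorem NC.rot (g h : Matrix ι ι X.R) : X.NC (rot g h) :=
  (NC.smul continuous_cs _).add (NC.smul continuous_sn _)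

theorem NC.rot' (g h : Matrix ι ι X.R) : X.NC (rot' g h) := by
  have : MatAlg.rot' g h = fun t => cs t • Matrix.fromBlocks h 0 0 g + sn t • -rotJ X ι := by
    ext1 t
    rw [MatAlg.rot', smul_neg, sub_eq_add_neg]
  rw [this]
  exact (NC.smul continuous_cs _).add (NC.smul continuous_sn _)

theorem nm_rot_le {g h : Matrix ι ι X.R} {N : ℝ} (hN : 1 ≤ N) (hg : X.nm g ≤ N) (hh : X.nm h ≤ N)
    (t : unitInterval) : X.nm (rot g h t) ≤ (‖cs t‖ + ‖sn t‖) * N := by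
  have h1 : X.nm (Matrix.fromBlocks g 0 0 h) ≤ N := (nm_sum_le _ _).trans (max_le hg hh)
  refine (nm_add_le _ _).trans ?_
  rw [add_mul]
  refine add_le_add ((nm_smul_le _ _).trans (by gcongr)) ((nm_smul_le _ _).trans ?_)
  exact mul_le_mul_of_nonneg_left (nm_rotJ_le.trans hN) (norm_nonneg _)

theorem nm_rot'_le {g h : Matrix ι ι X.R} {N : ℝ} (hN : 1 ≤ N) (hg : X.nm g ≤ N) (hh : X.nm h ≤ N)
    (t : unitInterval) : X.nm (rot' g h t) ≤ (‖cs t‖ + ‖sn t‖) * N := by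
  have h1 : X.nm (Matrix.fromBlocks h 0 0 g) ≤ N := (nm_sum_le _ _).trans (max_le hh hg)
  refine (nm_sub_le _ _).trans ?_
  rw [add_mul]
  refine add_le_add ((nm_smul_le _ _).trans (by gcongr)) ((nm_smul_le _ _).trans ?_)
  exact mul_le_mul_of_nonneg_left (nm_rotJ_le.trans hN) (norm_nonneg _)

theorem nm_conj_le {a x b : Matrix ι ι X.R} {k l m : ℝ} (ha : X.nm a ≤ k) (hx : X.nm x ≤ l)
    (hb : X.nm b ≤ m) : X.nm (a * x * b) ≤ k * l * m := by
  have hk := (nm_nonneg _).trans ha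
  have hl := (nm_nonneg _).trans hx
  have hm := (nm_nonneg _).trans hb
  refine (nm_mul_le _ _).trans (mul_le_mul ((nm_mul_le _ _).trans ?_) hb (nm_nonneg _) (by positivity))
  exact mul_le_mul ha hx (nm_nonneg _) hk

/-- The factor is (|c| + |s|)² ≤ 2, which stays below the factor 4 that homotopies are allowed. -/
theorem nm_rot_conj_le {g h : Matrix ι ι X.R} (hg : X.nm g ≤ 1) (hh : X.nm h ≤ 1)
    (x : Matrix (ι ⊕ ι) (ι ⊕ ι) X.R) (t : unitInterval) :
    X.nm (rot g h t * x * rot' g h t) ≤ 2 * X.nm x := by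
  refine (nm_conj_le (nm_rot_le le_rfl hg hh t) le_rfl (nm_rot'_le le_rfl hg hh t)).trans ?_
  have := norm_add_norm_sq_le t
  have h0 := nm_nonneg x
  nlinarith

end Rotation

end MatAlg

namespace MatAlg

variable {X : MatAlg.{u} p}

/-! ## Homotopies and classes -/

section Classes

variable {ι κ : Type*} [Fintype ι] [Fintype κ] [DecidableEq ι] [DecidableEq κ] {ε r N : ℝ}
  {i : KDeg}

/-- The homotopy relation that defines the classes at parameters `(ε, r, N)`. -/
def Htp (i : KDeg) (X : MatAlg.{u} p) (ε r N : ℝ) (x y : Matrix ι ι X.R) : Prop :=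
  match i with
  | .zero => ∃ γ, X.NC γ ∧ γ 0 = x ∧ γ 1 = y ∧ ∀ t, X.QI (4 * ε) r (4 * N) (γ t)
  | .one => ∃ γ δ, X.NC γ ∧ X.NC δ ∧ γ 0 = x ∧ γ 1 = y ∧
      ∀ t, X.IP (4 * ε) (2 * r) (4 * N) (γ t) (δ t)

variable [X.Nice]

theorem classHomotopic_iff {n : ℕ} (x y : Matrix (Fin n) (Fin n) X.R) :
    ClassHomotopic i X.plus ε r N x y ↔ Htp i X ε r N x y := by
  cases i with
  | zero =>
    refine exists_congr fun γ => and_congr (nc_fin_iff γ) (and_congr Iff.rfl (and_congr Iff.rfl ?_))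
    exact forall_congr' fun t => quasiIdem_iff _
  | one =>
    refine exists_congr fun γ => exists_congr fun δ => and_congr (nc_fin_iff γ)
      (and_congr (nc_fin_iff δ) (and_congr Iff.rfl (and_congr Iff.rfl ?_)))
    exact forall_congr' fun t => inversePair_iff _ _

theorem Htp.submatrix (e : κ ≃ ι) {x y : Matrix ι ι X.R} (h : Htp i X ε r N x y) :
    Htp i X ε r N (x.submatrix e e) (y.submatrix e e) := by
  cases i with
  | zero =>
    obtain ⟨γ, hc, rfl, rfl, hq⟩ := h
    exact ⟨_, hc.submatrix e, rfl, rfl, fun t => (hq t).submatrix e⟩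
  | one =>
    obtain ⟨γ, δ, hc, hd, rfl, rfl, hq⟩ := h
    exact ⟨_, _, hc.submatrix e, hd.submatrix e, rfl, rfl, fun t => (hq t).submatrix e⟩

open Classical in
/-- The class of a matrix, which is `0` if the matrix does not define one. -/
noncomputable def kcl (i : KDeg) (X : MatAlg.{u} p) (ε r N : ℝ) {n : ℕ}
    (x : Matrix (Fin n) (Fin n) X.R) : KUnital i X.plus ε r N :=
  if h : IsQuasi i X.plus ε r N x then kClass i X.plus ε r N x h else 0

theorem kcl_eq {n : ℕ} {x : Matrix (Fin n) (Fin n) X.R} (h : IsQuasi i X.plus ε r N x) :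
    kcl i X ε r N x = kClass i X.plus ε r N x h := dif_pos h

/-- The quotient map onto the Grothendieck group. -/
noncomputable def kMk (i : KDeg) (U : UnitalMatAlg.{u}) (ε r N : ℝ) :
    FreeAbelianGroup (KGen i U ε r N) →+ KUnital i U ε r N :=
  QuotientAddGroup.mk' (kRel i U ε r N)

theorem kMk_of {U : UnitalMatAlg.{u}} {n : ℕ} {x : U.Mat n} (hx : IsQuasi i U ε r N x) :
    kMk i U ε r N (FreeAbelianGroup.of ⟨n, ⟨x, hx⟩⟩) = kClass i U ε r N x hx := rfl

theorem kMk_eq_zero {U : UnitalMatAlg.{u}} {g : FreeAbelianGroup (KGen i U ε r N)}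
    (h : g ∈ kRel i U ε r N) : kMk i U ε r N g = 0 :=
  (QuotientAddGroup.eq_zero_iff g).2 h

theorem kClass_eq_of_equiv {U : UnitalMatAlg.{u}} {n m : ℕ} {x : U.Mat n} {y : U.Mat m}
    (hx : IsQuasi i U ε r N x) (hy : IsQuasi i U ε r N y)
    (h : KGen.Equiv (⟨n, ⟨x, hx⟩⟩ : KGen i U ε r N) ⟨m, ⟨y, hy⟩⟩) :
    kClass i U ε r N x hx = kClass i U ε r N y hy := by
  rw [← sub_eq_zero, ← kMk_of, ← kMk_of, ← map_sub]
  exact kMk_eq_zero (AddSubgroup.subset_closure (Or.inl ⟨_, _, h, rfl⟩))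

theorem kClass_bdiag {U : UnitalMatAlg.{u}} {n m : ℕ} {x : U.Mat n} {y : U.Mat m}
    (hx : IsQuasi i U ε r N x) (hy : IsQuasi i U ε r N y) (h : IsQuasi i U ε r N (bdiag x y)) :
    kClass i U ε r N (bdiag x y) h = kClass i U ε r N x hx + kClass i U ε r N y hy := by
  rw [← sub_eq_zero, ← kMk_of, ← kMk_of, ← kMk_of, ← map_add, ← map_sub]
  refine kMk_eq_zero (AddSubgroup.subset_closure (Or.inr
    ⟨⟨n, ⟨x, hx⟩⟩, ⟨m, ⟨y, hy⟩⟩, h, ?_⟩))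
  abel

theorem padTo_self {S : Type*} [Zero S] (d : S) {n : ℕ} (x : Matrix (Fin n) (Fin n) S) :
    padTo d n x = x := by
  ext1 a b
  simp [padTo]

theorem padTo_zero_zero {S : Type*} [Zero S] {n : ℕ} (k : ℕ) :
    padTo 0 k (0 : Matrix (Fin n) (Fin n) S) = 0 := by
  ext1 a b
  simp [padTo]

theorem padTo_one_one {S : Type*} [Ring S] {n : ℕ} (k : ℕ) :
    padTo 1 k (1 : Matrix (Fin n) (Fin n) S) = 1 := by
  ext1 a b
  simp [padTo, Matrix.one_apply, Fin.ext_iff]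

theorem kcl_eq_of_htp {n : ℕ} {x y : Matrix (Fin n) (Fin n) X.R} (hx : Q i X ε r N x)
    (hy : Q i X ε r N y) (h : Htp i X ε r N x y) : kcl i X ε r N x = kcl i X ε r N y := by
  rw [kcl_eq ((isQuasi_iff x).2 hx), kcl_eq ((isQuasi_iff y).2 hy)]
  refine kClass_eq_of_equiv _ _ ⟨n, le_rfl, le_rfl, ?_⟩
  rw [padTo_self, padTo_self]
  exact (classHomotopic_iff x y).2 h

theorem Q.bdiag {n m : ℕ} {x : Matrix (Fin n) (Fin n) X.R} {y : Matrix (Fin m) (Fin m) X.R}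
    (hx : Q i X ε r N x) (hy : Q i X ε r N y) : Q i X ε r N (bdiag x y) :=
  (hx.sum hy).submatrix finSumFinEquiv.symm

theorem kcl_bdiag {n m : ℕ} {x : Matrix (Fin n) (Fin n) X.R} {y : Matrix (Fin m) (Fin m) X.R}
    (hx : Q i X ε r N x) (hy : Q i X ε r N y) :
    kcl i X ε r N (bdiag x y) = kcl i X ε r N x + kcl i X ε r N y := by
  rw [kcl_eq ((isQuasi_iff x).2 hx), kcl_eq ((isQuasi_iff y).2 hy),
    kcl_eq ((isQuasi_iff _).2 (hx.bdiag hy))]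
  exact kClass_bdiag _ _ _

theorem Htp.refl (hε : 0 ≤ ε) (hr : 0 ≤ r) (hN : 0 ≤ N) {x : Matrix ι ι X.R} (h : Q i X ε r N x) :
    Htp i X ε r N x x := by
  cases i with
  | zero =>
    exact ⟨fun _ => x, NC.const x, rfl, rfl, fun _ => ⟨h.idem.trans_le (by linarith), h.fil,
      h.bd.trans (by linarith), h.bd'.trans (by linarith)⟩⟩
  | one =>
    obtain ⟨y, h⟩ := h
    exact ⟨fun _ => x, fun _ => y, NC.const x, NC.const y, rfl, rfl, fun _ =>
      ⟨h.fil.mono (by linarith), h.fil'.mono (by linarith), h.bd.trans (by linarith),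
      h.bd'.trans (by linarith), h.inv.trans_le (by linarith), h.inv'.trans_le (by linarith)⟩⟩

/-- Padding does not change the class, but it turns the filler of size n into a sum of two fillers
of size n. Thus the class equals its double. -/
theorem kcl_fill (hε : 0 < ε) (hr : 0 ≤ r) (hN : 1 ≤ N) (n : ℕ) :
    kcl i X ε r N (fillMat i X (Fin n)) = 0 := by
  have hq : ∀ k, Q i X ε r N (fillMat i X (Fin k)) := fun k => Q.fill i hε hN
  have h1 : kcl i X ε r N (fillMat i X (Fin n)) = kcl i X ε r N (fillMat i X (Fin (n + n))) := by
    rw [kcl_eq ((isQuasi_iff _).2 (hq _)), kcl_eq ((isQuasi_iff _).2 (hq _))]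
    refine kClass_eq_of_equiv _ _ ⟨n + n, Nat.le_add_right _ _, le_rfl, ?_⟩
    rw [padTo_self]
    refine (classHomotopic_iff (X := X) _ _).2 ?_
    have h2 : padTo (i.filler X.plus.carrier) (n + n) (fillMat i X (Fin n)) =
        fillMat i X (Fin (n + n)) := by
      cases i with
      | zero => exact padTo_zero_zero _
      | one => exact padTo_one_one _
    rw [h2]
    exact Htp.refl hε.le hr (by linarith) (hq _)
  have h3 : (fillMat i X (Fin (n + n))) = bdiag (fillMat i X (Fin n)) (fillMat i X (Fin n)) := by
    cases i with
    | zero =>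
      simp only [fillMat, bdiag, Matrix.fromBlocks_zero, Matrix.reindex_apply]
      rfl
    | one => simp only [fillMat, bdiag, Matrix.fromBlocks_one, Matrix.reindex_apply,
        Matrix.submatrix_one_equiv]
  rw [h3, kcl_bdiag (hq n) (hq n)] at h1
  exact left_eq_add.1 h1

end Classes

/-! ## Conjugation by rotations -/

section Conj

variable {ι : Type*} [Fintype ι] [DecidableEq ι] {ε r N : ℝ} {i : KDeg} [X.Nice]

theorem conj_mul_conj {S : Type*} [Ring S] {a b x y : S} (h : b * a = 1) :
    a * x * b * (a * y * b) = a * (x * y) * b := by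
  calc _ = a * x * (b * a) * y * b := by noncomm_ring
    _ = _ := by rw [h]; noncomm_ring

theorem conj_sub_one {S : Type*} [Ring S] {a b x : S} (h : a * b = 1) :
    a * x * b - 1 = a * (x - 1) * b := by
  rw [mul_sub, sub_mul, mul_one, h]

theorem Fil.conj (hr : 0 ≤ r) {a b x : Matrix ι ι X.R} (ha : X.Fil 0 a) (hb : X.Fil 0 b)
    (hx : X.Fil r x) : X.Fil r (a * x * b) := by
  have h := ((ha.mul le_rfl hr hx).mul (by linarith) le_rfl hb)
  rwa [zero_add, add_zero] at h

/-- Conjugation by the rotation path of the mutually inverse scalar matrices g and h preserves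
propagation and multiplies norms and defects by at most 2. -/
theorem htp_rot (hr : 0 ≤ r) {g h : Matrix ι ι X.R} (hgh : g * h = 1) (hhg : h * g = 1)
    (hg : X.nm g ≤ 1) (hh : X.nm h ≤ 1) (fg : X.Fil 0 g) (fh : X.Fil 0 h)
    {x : Matrix (ι ⊕ ι) (ι ⊕ ι) X.R} (hx : Q i X ε r N x) :
    Htp i X ε r N (Matrix.fromBlocks g 0 0 h * x * Matrix.fromBlocks h 0 0 g)
      (rotJ X ι * x * -rotJ X ι) := by
  have h1 : ∀ t, rot g h t * rot' g h t = 1 := fun t => by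
    rw [← sub_eq_zero, rot_mul_rot', hgh, hhg]; simp
  have h2 : ∀ t, rot' g h t * rot g h t = 1 := fun t => by
    rw [← sub_eq_zero, rot'_mul_rot, hgh, hhg]; simp
  have h3 : ∀ (y : Matrix (ι ⊕ ι) (ι ⊕ ι) X.R) t, X.Fil r y → X.Fil r (rot g h t * y * rot' g h t) :=
    fun y t hy => Fil.conj hr (fg.rot fh t) (fg.rot' fh t) hy
  have h4 : ∀ y : Matrix (ι ⊕ ι) (ι ⊕ ι) X.R, X.NC fun t => rot g h t * y * rot' g h t :=
    fun y => ((NC.rot g h).mul (NC.const y)).mul (NC.rot' g h)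
  have h5 : ∀ {y : Matrix (ι ⊕ ι) (ι ⊕ ι) X.R} {N : ℝ}, X.nm y ≤ N → ∀ t,
      X.nm (rot g h t * y * rot' g h t) ≤ 4 * N := fun hy t => by
    refine (nm_rot_conj_le hg hh _ t).trans ?_
    have := (nm_nonneg _).trans hy
    linarith
  have h6 : ∀ {y : Matrix (ι ⊕ ι) (ι ⊕ ι) X.R} {ε : ℝ}, X.nm y < ε → ∀ t,
      X.nm (rot g h t * y * rot' g h t) < 4 * ε := fun hy t => by
    refine (nm_rot_conj_le hg hh _ t).trans_lt ?_
    have := (nm_nonneg _).trans_lt hy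
    linarith
  cases i with
  | zero =>
    refine ⟨fun t => rot g h t * x * rot' g h t, h4 x, ?_, ?_, fun t => ⟨?_, h3 x t hx.fil, h5 hx.bd t, ?_⟩⟩
    · simp only [rot_zero, rot'_zero]
    · simp only [rot_one, rot'_one]
    · rw [conj_mul_conj (h2 t), ← sub_mul, ← mul_sub]
      exact h6 hx.idem t
    · rw [← neg_sub, conj_sub_one (h1 t), nm_neg, ← nm_neg, ← neg_mul, ← mul_neg, neg_sub]
      exact h5 hx.bd' t
  | one =>
    obtain ⟨y, hx⟩ := hx
    refine ⟨fun t => rot g h t * x * rot' g h t, fun t => rot g h t * y * rot' g h t,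
      h4 x, h4 y, ?_, ?_, fun t => ⟨(h3 x t hx.fil).mono (by linarith),
        (h3 y t hx.fil').mono (by linarith), h5 hx.bd t, h5 hx.bd' t, ?_, ?_⟩⟩
    · simp only [rot_zero, rot'_zero]
    · simp only [rot_one, rot'_one]
    · rw [conj_mul_conj (h2 t), conj_sub_one (h1 t)]
      exact h6 hx.inv t
    · rw [conj_mul_conj (h2 t), conj_sub_one (h1 t)]
      exact h6 hx.inv' t

theorem sum_conj (g h x y : Matrix ι ι X.R) :
    Matrix.fromBlocks g 0 0 h * Matrix.fromBlocks x 0 0 y * Matrix.fromBlocks h 0 0 g =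
      Matrix.fromBlocks (g * x * h) 0 0 (h * y * g) := by
  simp [Matrix.fromBlocks_multiply]

theorem permMatrix_mul_inv {S : Type*} [Semiring S] (σ : Equiv.Perm ι) :
    σ.permMatrix S * (σ⁻¹).permMatrix S = 1 := by
  have h := permMatrix_conj (S := S) σ 1
  rwa [mul_one, Matrix.submatrix_one_equiv] at h

theorem permMatrix_inv_mul {S : Type*} [Semiring S] (σ : Equiv.Perm ι) :
    (σ⁻¹).permMatrix S * σ.permMatrix S = 1 := by
  have h := permMatrix_mul_inv (S := S) σ⁻¹
  rwa [inv_inv] at h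

theorem perm_conj_fill (σ : Equiv.Perm ι) :
    (σ⁻¹).permMatrix X.R * fillMat i X ι * σ.permMatrix X.R = fillMat i X ι := by
  cases i with
  | zero => simp [fillMat]
  | one => simp [fillMat, permMatrix_inv_mul]

/-- Conjugation of diag(x, d), with d the filler, by diag(σ, σ⁻¹) gives diag(σxσ⁻¹, d), since σ⁻¹dσ
= d. The rotation path joins this matrix to diag(d, x). Hence classes are meaningful for arbitrary
finite index types. -/
theorem kcl_submatrix (hε : 0 < ε) (hr : 0 ≤ r) (hN : 1 ≤ N) {n : ℕ} (σ : Equiv.Perm (Fin n))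
    (x : Matrix (Fin n) (Fin n) X.R) : kcl i X ε r N (x.submatrix σ σ) = kcl i X ε r N x := by
  by_cases hx : Q i X ε r N x
  · have hd : Q i X ε r N (fillMat i X (Fin n)) := Q.fill i hε hN
    have hs := hx.submatrix σ
    have key := htp_rot (i := i) (ε := ε) (N := N) hr (permMatrix_mul_inv (S := X.R) σ)
      (permMatrix_inv_mul σ) (nm_perm_le σ) (nm_perm_le σ⁻¹) (Fil.perm σ) (Fil.perm σ⁻¹) (hx.sum hd)
    rw [sum_conj, perm_conj_fill, rotJ_conj, permMatrix_conj] at key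
    have h1 := kcl_eq_of_htp (hs.bdiag hd) (hd.bdiag hx) (key.submatrix finSumFinEquiv.symm)
    rw [kcl_bdiag hs hd, kcl_bdiag hd hx, add_comm] at h1
    exact add_left_cancel h1
  -- If x defines no class, neither does its permutation, and both sides are the default value 0.
  · have hs : ¬ Q i X ε r N (x.submatrix σ σ) := fun h => hx (by
      have h' := h.submatrix σ.symm
      rw [Matrix.submatrix_submatrix] at h'
      simpa using h')
    rw [kcl, kcl, dif_neg fun h => hx ((isQuasi_iff x).1 h),
      dif_neg fun h => hs ((isQuasi_iff _).1 h)]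

end Conj

/-! ## Classes of matrices with arbitrary index types -/

section Cl

variable {ι κ : Type*} [Fintype ι] [Fintype κ] [DecidableEq ι] [DecidableEq κ] {ε r N : ℝ}
  {i : KDeg} [X.Nice]

/-- The class of a matrix indexed by a finite type. -/
noncomputable def cl (i : KDeg) (X : MatAlg.{u} p) (ε r N : ℝ) {ι : Type*} [Fintype ι]
    (x : Matrix ι ι X.R) : KUnital i X.plus ε r N := kcl i X ε r N (toFin x)

/-- Parameters for which the classes are well-behaved. -/
structure Par (ε r N : ℝ) : Prop where
  eps : 0 < ε
  prop : 0 ≤ r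
  bd : 1 ≤ N

variable (hP : Par ε r N)
include hP

theorem cl_eq {n : ℕ} (e : ι ≃ Fin n) (x : Matrix ι ι X.R) :
    cl i X ε r N x = kcl i X ε r N (x.submatrix e.symm e.symm) := by
  obtain rfl : Fintype.card ι = n := by simpa using Fintype.card_congr e
  rw [cl, toFin, ← kcl_submatrix hP.eps hP.prop hP.bd (e.symm.trans (Fintype.equivFin ι)),
    Matrix.submatrix_submatrix]
  congr 1
  ext1 i j
  simp

theorem cl_fin {n : ℕ} (x : Matrix (Fin n) (Fin n) X.R) : cl i X ε r N x = kcl i X ε r N x :=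
  cl_eq hP (Equiv.refl _) x

theorem kClass_eq_cl {n : ℕ} {x : Matrix (Fin n) (Fin n) X.R} (h : IsQuasi i X.plus ε r N x) :
    kClass i X.plus ε r N x h = cl i X ε r N x := by
  rw [cl_fin hP, kcl_eq h]

theorem cl_submatrix (e : κ ≃ ι) (x : Matrix ι ι X.R) :
    cl i X ε r N (x.submatrix e e) = cl i X ε r N x := by
  rw [cl_eq hP (Fintype.equivFin ι) x, cl_eq hP (e.trans (Fintype.equivFin ι)),
    Matrix.submatrix_submatrix]
  congr 1
  ext1 i j
  simp

theorem cl_eq_of_htp {x y : Matrix ι ι X.R} (hx : Q i X ε r N x) (hy : Q i X ε r N y)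
    (h : Htp i X ε r N x y) : cl i X ε r N x = cl i X ε r N y := by
  rw [cl_eq hP (Fintype.equivFin ι) x, cl_eq hP (Fintype.equivFin ι) y]
  exact kcl_eq_of_htp (hx.submatrix _) (hy.submatrix _) (h.submatrix _)

theorem cl_sum {x : Matrix ι ι X.R} {y : Matrix κ κ X.R} (hx : Q i X ε r N x)
    (hy : Q i X ε r N y) :
    cl i X ε r N (Matrix.fromBlocks x 0 0 y) = cl i X ε r N x + cl i X ε r N y := by
  rw [cl_eq hP (Fintype.equivFin ι) x, cl_eq hP (Fintype.equivFin κ) y,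
    cl_eq hP ((Equiv.sumCongr (Fintype.equivFin ι) (Fintype.equivFin κ)).trans finSumFinEquiv),
    ← kcl_bdiag (hx.submatrix _) (hy.submatrix _)]
  congr 1
  rw [bdiag, Matrix.reindex_apply]
  ext1 a b
  simp only [Matrix.submatrix_apply, Equiv.symm_trans_apply]
  rcases finSumFinEquiv.symm a with a | a <;> rcases finSumFinEquiv.symm b with b | b <;> rfl

theorem cl_fill : cl i X ε r N (fillMat i X ι) = 0 := by
  rw [cl_eq hP (Fintype.equivFin ι)]
  refine (congrArg _ ?_).trans (kcl_fill hP.eps hP.prop hP.bd (Fintype.card ι))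
  cases i with
  | zero => rfl
  | one => exact Matrix.submatrix_one_equiv _

theorem cl_zero : cl .zero X ε r N (0 : Matrix ι ι X.R) = 0 := cl_fill (i := .zero) hP

theorem cl_one : cl .one X ε r N (1 : Matrix ι ι X.R) = 0 := cl_fill (i := .one) hP

end Cl

end MatAlg

/-! ## Scales -/

/-- A scale, with respect to which norms and propagations of matrices are estimated by `Λ ^ k` and
`k r`, and errors by `Λ ^ k ε`. -/
structure Scale where
  base : ℝ
  eps : ℝ
  prop : ℝ
  two_le : 2 ≤ base
  eps_pos : 0 < eps
  prop_nonneg : 0 ≤ prop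

namespace Scale

open MatAlg

variable {X : MatAlg.{u} p} {ι κ : Type*} [Fintype ι] [Fintype κ] {S : Scale} {k l m n : ℕ}

theorem one_le_pow (S : Scale) (k : ℕ) : 1 ≤ S.base ^ k := one_le_pow₀ (by linarith [S.two_le])

theorem pow_pos (S : Scale) (k : ℕ) : 0 < S.base ^ k := zero_lt_one.trans_le (S.one_le_pow k)

theorem pow_mono (S : Scale) (h : k ≤ l) : S.base ^ k ≤ S.base ^ l :=
  pow_le_pow_right₀ (by linarith [S.two_le]) h

/-- As the base is at least 2, a sum costs a single unit of the exponent. -/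
theorem pow_add_pow_le (S : Scale) (k l : ℕ) :
    S.base ^ k + S.base ^ l ≤ S.base ^ (max k l + 1) := by
  rw [pow_succ]
  have h1 := S.pow_mono (le_max_left k l)
  have h2 := S.pow_mono (le_max_right k l)
  have h3 := S.pow_pos (max k l)
  have := S.two_le
  nlinarith

/-- `x` has norm at most `Λ ^ k` and propagation at most `k r`. -/
structure W (S : Scale) (k : ℕ) (x : Matrix ι ι X.R) : Prop where
  bd : X.nm x ≤ S.base ^ k
  fil : X.Fil (k * S.prop) x

/-- `x` has norm at most `Λ ^ k ε`. -/
def Sm (S : Scale) (k : ℕ) (x : Matrix ι ι X.R) : Prop := X.nm x ≤ S.base ^ k * S.eps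

/-- `x` and `y` differ by at most `Λ ^ k ε`. -/
def Ap (S : Scale) (k : ℕ) (x y : Matrix ι ι X.R) : Prop := S.Sm k (x - y)

theorem W.mono {x : Matrix ι ι X.R} (hx : S.W k x) (h : k ≤ l) : S.W l x :=
  ⟨hx.bd.trans (S.pow_mono h), hx.fil.mono (mul_le_mul_of_nonneg_right (Nat.cast_le.2 h) S.prop_nonneg)⟩

theorem Sm.mono {x : Matrix ι ι X.R} (hx : S.Sm k x) (h : k ≤ l) : S.Sm l x :=
  hx.trans (mul_le_mul_of_nonneg_right (S.pow_mono h) S.eps_pos.le)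

theorem Ap.mono {x y : Matrix ι ι X.R} (hx : S.Ap k x y) (h : k ≤ l) : S.Ap l x y := Sm.mono hx h

section

variable [X.Nice] {x x' y y' z : Matrix ι ι X.R}

theorem W.mul (hx : S.W k x) (hy : S.W l y) : S.W (k + l) (x * y) := by
  refine ⟨(nm_mul_le _ _).trans ?_, ?_⟩
  · rw [pow_add]
    exact mul_le_mul hx.bd hy.bd (nm_nonneg _) (S.pow_pos k).le
  · rw [Nat.cast_add, add_mul]
    have := S.prop_nonneg
    exact hx.fil.mul (by positivity) (by positivity) hy.fil

theorem W.add (hx : S.W k x) (hy : S.W l y) : S.W (max k l + 1) (x + y) := by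
  have h1 : k ≤ max k l + 1 := by omega
  have h2 : l ≤ max k l + 1 := by omega
  exact ⟨((nm_add_le _ _).trans (add_le_add hx.bd hy.bd)).trans (S.pow_add_pow_le k l),
    (hx.mono h1).fil.add (hy.mono h2).fil⟩

theorem W.neg (hx : S.W k x) : S.W k (-x) := ⟨(nm_neg x).trans_le hx.bd, hx.fil.neg⟩

theorem W.sub (hx : S.W k x) (hy : S.W l y) : S.W (max k l + 1) (x - y) := by
  rw [sub_eq_add_neg]
  exact hx.add hy.neg

theorem W.smul {c : ℂ} (hc : ‖c‖ ≤ 1) (hx : S.W k x) : S.W k (c • x) :=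
  ⟨(nm_smul_le c x).trans ((mul_le_of_le_one_left (nm_nonneg _) hc).trans hx.bd), hx.fil.smul c⟩

theorem W.zero : S.W k (0 : Matrix ι ι X.R) := ⟨by rw [nm_zero]; exact (S.pow_pos k).le, Fil.zero⟩

theorem W.one [DecidableEq ι] : S.W k (1 : Matrix ι ι X.R) :=
  ⟨nm_one_le.trans (S.one_le_pow k), Fil.one⟩

theorem W.perm [DecidableEq ι] (σ : Equiv.Perm ι) : S.W k (σ.permMatrix X.R) :=
  ⟨(nm_perm_le σ).trans (S.one_le_pow k), Fil.perm σ⟩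

theorem W.scal (hx : S.W k x) : S.W k (x.map X.scal) := ⟨(nm_scal_le x).trans hx.bd, Fil.scal x⟩

theorem W.submatrix (e : κ ≃ ι) (hx : S.W k x) : S.W k (x.submatrix e e) :=
  ⟨(nm_submatrix e x).trans_le hx.bd, hx.fil.submatrix e⟩

theorem W.sum {y : Matrix κ κ X.R} (hx : S.W k x) (hy : S.W k y) :
    S.W k (Matrix.fromBlocks x 0 0 y) :=
  ⟨(nm_sum_le x y).trans (max_le hx.bd hy.bd), hx.fil.sum hy.fil⟩

theorem W.fromBlocks {a b c d : Matrix ι ι X.R} (ha : S.W k a) (hb : S.W k b) (hc : S.W k c)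
    (hd : S.W k d) : S.W (k + 1) (Matrix.fromBlocks a b c d) := by
  refine ⟨(nm_fromBlocks_le a b c d).trans ?_, ?_⟩
  · have h := S.pow_add_pow_le k k
    rw [max_self] at h
    exact (add_le_add (max_le ha.bd hd.bd) (max_le hb.bd hc.bd)).trans h
  · have h : k ≤ k + 1 := Nat.le_succ k
    exact (ha.mono h).fil.fromBlocks (hb.mono h).fil (hc.mono h).fil (hd.mono h).fil

theorem W.blockDiagonal [DecidableEq κ] {x : κ → Matrix ι ι X.R} (hx : ∀ j, S.W k (x j)) :
    S.W k (Matrix.blockDiagonal x) :=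
  ⟨nm_blockDiagonal_le x (S.pow_pos k).le fun j => (hx j).bd, Fil.blockDiagonal fun j => (hx j).fil⟩

theorem Sm.zero : S.Sm k (0 : Matrix ι ι X.R) := by
  rw [Sm, nm_zero]
  exact mul_nonneg (S.pow_pos k).le S.eps_pos.le

theorem Sm.add (hx : S.Sm k x) (hy : S.Sm l y) : S.Sm (max k l + 1) (x + y) := by
  refine ((nm_add_le _ _).trans (add_le_add hx hy)).trans ?_
  rw [← add_mul]
  exact mul_le_mul_of_nonneg_right (S.pow_add_pow_le k l) S.eps_pos.le

theorem Sm.neg (hx : S.Sm k x) : S.Sm k (-x) := (nm_neg x).trans_le hx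

theorem Sm.sub (hx : S.Sm k x) (hy : S.Sm l y) : S.Sm (max k l + 1) (x - y) := by
  rw [sub_eq_add_neg]
  exact hx.add hy.neg

theorem Sm.smul {c : ℂ} (hc : ‖c‖ ≤ 1) (hx : S.Sm k x) : S.Sm k (c • x) :=
  (nm_smul_le c x).trans ((mul_le_of_le_one_left (nm_nonneg _) hc).trans hx)

theorem Sm.mul_left (hx : S.W k x) (hy : S.Sm l y) : S.Sm (k + l) (x * y) := by
  refine (nm_mul_le _ _).trans ?_
  rw [pow_add, mul_assoc]
  exact mul_le_mul hx.bd hy (nm_nonneg _) (S.pow_pos k).le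

theorem Sm.mul_right (hx : S.Sm k x) (hy : S.W l y) : S.Sm (k + l) (x * y) := by
  refine (nm_mul_le _ _).trans ?_
  rw [pow_add, mul_right_comm]
  exact mul_le_mul hx hy.bd (nm_nonneg _) (mul_nonneg (S.pow_pos k).le S.eps_pos.le)

theorem Sm.submatrix (e : κ ≃ ι) (hx : S.Sm k x) : S.Sm k (x.submatrix e e) :=
  (nm_submatrix e x).trans_le hx

theorem Sm.sum {y : Matrix κ κ X.R} (hx : S.Sm k x) (hy : S.Sm k y) :
    S.Sm k (Matrix.fromBlocks x 0 0 y) :=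
  (nm_sum_le x y).trans (max_le hx hy)

theorem Sm.fromBlocks {a b c d : Matrix ι ι X.R} (ha : S.Sm k a) (hb : S.Sm k b) (hc : S.Sm k c)
    (hd : S.Sm k d) : S.Sm (k + 1) (Matrix.fromBlocks a b c d) := by
  refine (nm_fromBlocks_le a b c d).trans ?_
  have h := S.pow_add_pow_le k k
  rw [max_self] at h
  refine (add_le_add (max_le ha hd) (max_le hb hc)).trans ?_
  rw [← add_mul]
  exact mul_le_mul_of_nonneg_right h S.eps_pos.le

theorem Sm.blockDiagonal [DecidableEq κ] {x : κ → Matrix ι ι X.R} (hx : ∀ j, S.Sm k (x j)) :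
    S.Sm k (Matrix.blockDiagonal x) :=
  nm_blockDiagonal_le x (mul_nonneg (S.pow_pos k).le S.eps_pos.le) hx

theorem Sm.scal (hx : S.Sm k x) : S.Sm k (x.map X.scal) := (nm_scal_le x).trans hx

theorem Ap.sm (h : S.Ap k x y) : S.Sm k (x - y) := h

theorem Ap.refl (x : Matrix ι ι X.R) : S.Ap k x x := by
  rw [Ap, sub_self]
  exact Sm.zero

theorem Ap.of_eq (h : x = y) : S.Ap k x y := h ▸ Ap.refl x

theorem Ap.symm (h : S.Ap k x y) : S.Ap k y x := by
  rw [Ap, ← neg_sub]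
  exact Sm.neg h

theorem Ap.trans (h : S.Ap k x y) (h' : S.Ap l y z) : S.Ap (max k l + 1) x z := by
  rw [Ap, ← sub_add_sub_cancel x y z]
  exact Sm.add h h'

theorem Ap.add (h : S.Ap k x x') (h' : S.Ap l y y') : S.Ap (max k l + 1) (x + y) (x' + y') := by
  rw [Ap, add_sub_add_comm]
  exact Sm.add h h'

theorem Ap.sub (h : S.Ap k x x') (h' : S.Ap l y y') : S.Ap (max k l + 1) (x - y) (x' - y') := by
  rw [Ap, sub_sub_sub_comm]
  exact Sm.sub h h'

theorem Ap.neg (h : S.Ap k x x') : S.Ap k (-x) (-x') := by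
  rw [Ap, neg_sub_neg]
  exact h.symm

theorem Ap.mul_left (hy : S.W l y) (h : S.Ap k x x') : S.Ap (l + k) (y * x) (y * x') := by
  rw [Ap, ← mul_sub]
  exact Sm.mul_left hy h

theorem Ap.mul_right (h : S.Ap k x x') (hy : S.W l y) : S.Ap (k + l) (x * y) (x' * y) := by
  rw [Ap, ← sub_mul]
  exact Sm.mul_right h hy

theorem Ap.mul (hx : S.W k x) (hy : S.W k y') (h : S.Ap k x x') (h' : S.Ap k y y') :
    S.Ap (k + k + 1) (x * y) (x' * y') := by
  have h1 := (Ap.mul_left hx h').trans (Ap.mul_right h hy)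
  rwa [max_self] at h1

theorem Ap.submatrix (e : κ ≃ ι) (h : S.Ap k x y) :
    S.Ap k (x.submatrix e e) (y.submatrix e e) := Sm.submatrix e h

theorem Ap.sum {y y' : Matrix κ κ X.R} (h : S.Ap k x x') (h' : S.Ap k y y') :
    S.Ap k (Matrix.fromBlocks x 0 0 y) (Matrix.fromBlocks x' 0 0 y') := by
  have e : Matrix.fromBlocks x 0 0 y - Matrix.fromBlocks x' 0 0 y' =
      Matrix.fromBlocks (x - x') 0 0 (y - y') := by
    rw [sub_eq_add_neg, Matrix.fromBlocks_neg, Matrix.fromBlocks_add]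
    simp [sub_eq_add_neg]
  rw [Ap, e]
  exact Sm.sum h h'

theorem Ap.fromBlocks {a b c d a' b' c' d' : Matrix ι ι X.R} (ha : S.Ap k a a') (hb : S.Ap k b b')
    (hc : S.Ap k c c') (hd : S.Ap k d d') :
    S.Ap (k + 1) (Matrix.fromBlocks a b c d) (Matrix.fromBlocks a' b' c' d') := by
  have e : Matrix.fromBlocks a b c d - Matrix.fromBlocks a' b' c' d' =
      Matrix.fromBlocks (a - a') (b - b') (c - c') (d - d') := by
    rw [sub_eq_add_neg, Matrix.fromBlocks_neg, Matrix.fromBlocks_add]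
    simp [sub_eq_add_neg]
  rw [Ap, e]
  exact Sm.fromBlocks ha hb hc hd

theorem Ap.blockDiagonal [DecidableEq κ] {x y : κ → Matrix ι ι X.R} (h : ∀ j, S.Ap k (x j) (y j)) :
    S.Ap k (Matrix.blockDiagonal x) (Matrix.blockDiagonal y) := by
  rw [Ap, ← Matrix.blockDiagonal_sub]
  exact Sm.blockDiagonal h

theorem map_sub_scal (x y : Matrix ι ι X.R) :
    (x - y).map X.scal = x.map X.scal - y.map X.scal := Matrix.map_sub _ (map_sub X.scal) x y

theorem Ap.scal (h : S.Ap k x y) : S.Ap k (x.map X.scal) (y.map X.scal) := by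
  rw [Ap, ← map_sub_scal]
  exact Sm.scal h

/-- `x` is a quasi-idempotent. -/
structure Qd (S : Scale) (k : ℕ) (x : Matrix ι ι X.R) : Prop where
  w : S.W k x
  sm : S.Ap k (x * x) x

variable [DecidableEq ι] [DecidableEq κ]

/-- `x` and `y` are quasi-inverse to each other. -/
structure Inv (S : Scale) (k : ℕ) (x y : Matrix ι ι X.R) : Prop where
  w : S.W k x
  w' : S.W k y
  sm : S.Ap k (x * y) 1
  sm' : S.Ap k (y * x) 1

/-- The parameters `(ε', r', N')` are at least `(Λ ^ k ε, k r, Λ ^ k)`. -/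
structure Tgt (S : Scale) (k : ℕ) (ε' r' N' : ℝ) : Prop where
  eps : S.base ^ k * S.eps ≤ ε'
  prop : k * S.prop ≤ r'
  bd : S.base ^ k ≤ N'

variable {ε' r' N' : ℝ}

theorem Tgt.par (h : S.Tgt k ε' r' N') : Par ε' r' N' :=
  ⟨(mul_pos (S.pow_pos k) S.eps_pos).trans_le h.eps,
    (mul_nonneg (Nat.cast_nonneg k) S.prop_nonneg).trans h.prop, (S.one_le_pow k).trans h.bd⟩

theorem Tgt.mono (h : S.Tgt k ε' r' N') (hl : l ≤ k) : S.Tgt l ε' r' N' :=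
  ⟨(mul_le_mul_of_nonneg_right (S.pow_mono hl) S.eps_pos.le).trans h.eps,
    (mul_le_mul_of_nonneg_right (Nat.cast_le.2 hl) S.prop_nonneg).trans h.prop,
    (S.pow_mono hl).trans h.bd⟩

/-- The strict inequality that the definitions require costs one unit of the exponent. -/
theorem Sm.lt (hx : S.Sm k x) (hT : S.Tgt l ε' r' N') (h : k + 1 ≤ l) : X.nm x < ε' := by
  refine (hx.trans_lt ?_).trans_le (hT.mono h).eps
  refine mul_lt_mul_of_pos_right ?_ S.eps_pos
  exact pow_lt_pow_right₀ (by linarith [S.two_le]) (Nat.lt_succ_self k)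

theorem W.fil_tgt (hx : S.W k x) (hT : S.Tgt l ε' r' N') (h : k ≤ l) : X.Fil r' x :=
  (hx.mono h).fil.mono hT.prop

theorem W.le_tgt (hx : S.W k x) (hT : S.Tgt l ε' r' N') (h : k ≤ l) : X.nm x ≤ N' :=
  (hx.mono h).bd.trans hT.bd

theorem Qd.qi (hx : S.Qd k x) (hT : S.Tgt l ε' r' N') (h : k + 1 ≤ l) : X.QI ε' r' N' x :=
  ⟨hx.sm.sm.lt hT h, hx.w.fil_tgt hT (by omega), hx.w.le_tgt hT (by omega),
    ((W.one (k := 0)).sub hx.w).le_tgt hT (by omega)⟩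

theorem Inv.ip (hx : S.Inv k x y) (hT : S.Tgt l ε' r' N') (h : k + 1 ≤ l) : X.IP ε' r' N' x y :=
  ⟨hx.w.fil_tgt hT (by omega), hx.w'.fil_tgt hT (by omega), hx.w.le_tgt hT (by omega),
    hx.w'.le_tgt hT (by omega), hx.sm.sm.lt hT h, hx.sm'.sm.lt hT h⟩

theorem Tgt.four (h : S.Tgt k ε' r' N') : S.Tgt k (4 * ε') r' (4 * N') := by
  have h1 := h.par.eps
  have h2 := h.par.bd
  exact ⟨h.eps.trans (by linarith), h.prop, h.bd.trans (by linarith)⟩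

theorem Tgt.four' (h : S.Tgt k ε' r' N') : S.Tgt k (4 * ε') (2 * r') (4 * N') := by
  have h1 := h.par.prop
  exact ⟨h.four.eps, h.prop.trans (by linarith), h.four.bd⟩

theorem Qd.mono (hx : S.Qd k x) (h : k ≤ l) : S.Qd l x := ⟨hx.w.mono h, hx.sm.mono h⟩

theorem Inv.mono (hx : S.Inv k x y) (h : k ≤ l) : S.Inv l x y :=
  ⟨hx.w.mono h, hx.w'.mono h, hx.sm.mono h, hx.sm'.mono h⟩

theorem Inv.symm (hx : S.Inv k x y) : S.Inv k y x := ⟨hx.w', hx.w, hx.sm', hx.sm⟩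

theorem Inv.submatrix (e : κ ≃ ι) (hx : S.Inv k x y) :
    S.Inv k (x.submatrix e e) (y.submatrix e e) := by
  refine ⟨hx.w.submatrix e, hx.w'.submatrix e, ?_, ?_⟩
  · rw [Matrix.submatrix_mul_equiv, ← Matrix.submatrix_one_equiv e]
    exact hx.sm.submatrix e
  · rw [Matrix.submatrix_mul_equiv, ← Matrix.submatrix_one_equiv e]
    exact hx.sm'.submatrix e

theorem Qd.submatrix (e : κ ≃ ι) (hx : S.Qd k x) : S.Qd k (x.submatrix e e) := by
  refine ⟨hx.w.submatrix e, ?_⟩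
  rw [Matrix.submatrix_mul_equiv]
  exact hx.sm.submatrix e

theorem Qd.sum {y : Matrix κ κ X.R} (hx : S.Qd k x) (hy : S.Qd k y) :
    S.Qd k (Matrix.fromBlocks x 0 0 y) := by
  refine ⟨hx.w.sum hy.w, ?_⟩
  have h := hx.sm.sum hy.sm
  simpa [Matrix.fromBlocks_multiply] using h

theorem Inv.sum {y y' : Matrix κ κ X.R} (hx : S.Inv k x x') (hy : S.Inv k y y') :
    S.Inv k (Matrix.fromBlocks x 0 0 y) (Matrix.fromBlocks x' 0 0 y') := by
  have h := hx.sm.sum hy.sm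
  have h' := hx.sm'.sum hy.sm'
  refine ⟨hx.w.sum hy.w, hx.w'.sum hy.w', ?_, ?_⟩
  · simpa [Matrix.fromBlocks_multiply] using h
  · simpa [Matrix.fromBlocks_multiply] using h'

theorem Qd.zero : S.Qd k (0 : Matrix ι ι X.R) := ⟨W.zero, Ap.of_eq (mul_zero 0)⟩

theorem Qd.one : S.Qd k (1 : Matrix ι ι X.R) := ⟨W.one, Ap.of_eq (mul_one 1)⟩

theorem Inv.one : S.Inv k (1 : Matrix ι ι X.R) 1 :=
  ⟨W.one, W.one, Ap.of_eq (mul_one 1), Ap.of_eq (mul_one 1)⟩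

theorem Inv.of_eq (hx : S.W k x) (hy : S.W k y) (h : x * y = 1) (h' : y * x = 1) : S.Inv k x y :=
  ⟨hx, hy, Ap.of_eq h, Ap.of_eq h'⟩

theorem Inv.mul (hx : S.Inv k x x') (hy : S.Inv k y y') : S.Inv (3 * k + 1) (x * y) (y' * x') := by
  have key : ∀ {x x' y y' : Matrix ι ι X.R}, S.Inv k x x' → S.Inv k y y' →
      S.Ap (3 * k + 1) (x * y * (y' * x')) 1 := by
    intro x x' y y' hx hy
    have h1 : S.Ap (k + k + k) (x * y * (y' * x')) (x * x') := by
      have h := Ap.mul_right (Ap.mul_left hx.w hy.sm) hx.w'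
      rwa [mul_one, ← mul_assoc, mul_assoc (x * y)] at h
    exact (h1.trans hx.sm).mono (by omega)
  exact ⟨(hx.w.mul hy.w).mono (by omega), (hy.w'.mul hx.w').mono (by omega), key hx hy,
    key hy.symm hx.symm⟩

/-- x' is close to x'yy', then to x'xy', then to y'. A quasi-inverse is thus determined by the
element up to a controlled error, and no construction depends essentially on its choice. -/
theorem Inv.near_inv (hx : S.Inv k x x') (hy : S.Inv k y y') (h : S.Ap k x y) :
    S.Ap (2 * k + k + 2) x' y' := by
  have h1 : S.Ap (k + k) x' (x' * (y * y')) := by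
    have := Ap.mul_left hx.w' hy.sm.symm
    rwa [mul_one] at this
  have h2 : S.Ap (k + (k + k)) (x' * (y * y')) (x' * (x * y')) :=
    Ap.mul_left hx.w' (Ap.mul_right h.symm hy.w')
  have h3 : S.Ap (k + k) (x' * (x * y')) y' := by
    have := Ap.mul_right hx.sm' hy.w'
    rwa [one_mul, mul_assoc] at this
  exact ((h1.trans h2).trans h3).mono (by omega)

end

end Scale

namespace Scale

open MatAlg

variable {X : MatAlg.{u} p} {ι κ : Type*} [Fintype ι] [Fintype κ] [DecidableEq ι] [DecidableEq κ]
  {S : Scale} {k l m n : ℕ} [X.Nice] {x x' y y' g g' : Matrix ι ι X.R} {ε' r' N' : ℝ}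

/-! ## Equalities of classes -/

theorem Qd.of_ap (hx : S.Qd k x) (hy : S.W k y) (h : S.Ap k x y) : S.Qd (2 * k + 3) y :=
  ⟨hy.mono (by omega), (((Ap.mul hy hx.w h.symm h.symm).trans hx.sm).trans h).mono (by omega)⟩

theorem Qd.q (hx : S.Qd k x) (hT : S.Tgt l ε' r' N') (h : k + 1 ≤ l) : Q .zero X ε' r' N' x :=
  hx.qi hT h

theorem Inv.q (hx : S.Inv k x x') (hT : S.Tgt l ε' r' N') (h : k + 1 ≤ l) :
    Q .one X ε' r' N' x := ⟨x', hx.ip hT h⟩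

theorem Inv.of_ap (hx : S.Inv k x x') (hy : S.W k y) (h : S.Ap k x y) : S.Inv (2 * k + 1) y x' :=
  ⟨hy.mono (by omega), hx.w'.mono (by omega),
    ((Ap.mul_right h.symm hx.w').trans hx.sm).mono (by omega),
    ((Ap.mul_left hx.w' h.symm).trans hx.sm').mono (by omega)⟩

/-- The segment from `x` to `y`. -/
noncomputable def seg (x y : Matrix ι ι X.R) (t : unitInterval) : Matrix ι ι X.R :=
  (1 - (t : ℝ) : ℂ) • x + ((t : ℝ) : ℂ) • y

theorem seg_zero (x y : Matrix ι ι X.R) : seg x y 0 = x := by simp [seg]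

theorem seg_one (x y : Matrix ι ι X.R) : seg x y 1 = y := by simp [seg]

theorem nc_seg (x y : Matrix ι ι X.R) : X.NC (seg x y) :=
  (NC.smul (by fun_prop) x).add (NC.smul (by fun_prop) y)

theorem norm_coe_le_one (t : unitInterval) : ‖((t : ℝ) : ℂ)‖ ≤ 1 := by
  rw [Complex.norm_real, Real.norm_eq_abs, abs_of_nonneg t.2.1]
  exact t.2.2

theorem norm_one_sub_coe_le_one (t : unitInterval) : ‖(1 - (t : ℝ) : ℂ)‖ ≤ 1 := by
  rw [← Complex.ofReal_one, ← Complex.ofReal_sub, Complex.norm_real, Real.norm_eq_abs,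
    abs_of_nonneg (sub_nonneg.2 t.2.2)]
  linarith [t.2.1]

theorem W.seg (hx : S.W k x) (hy : S.W k y) (t : unitInterval) : S.W (k + 1) (seg x y t) :=
  ((hx.smul (norm_one_sub_coe_le_one t)).add (hy.smul (norm_coe_le_one t))).mono (by omega)

theorem Ap.seg (h : S.Ap k x y) (t : unitInterval) : S.Ap k x (seg x y t) := by
  have e : x - Scale.seg x y t = ((t : ℝ) : ℂ) • (x - y) := by
    rw [Scale.seg, sub_smul, one_smul, smul_sub]
    abel
  rw [Ap, e]
  exact Sm.smul (norm_coe_le_one t) h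

/-- The straight segment is a homotopy: each of its points is as close to x as y is, hence is a
quasi-idempotent at a slightly higher level. -/
theorem cl_zero_near (hT : S.Tgt (2 * k + 6) ε' r' N') (hx : S.Qd k x) (hy : S.W k y)
    (h : S.Ap k x y) : cl .zero X ε' r' N' x = cl .zero X ε' r' N' y := by
  have hq : ∀ t, S.Qd (2 * k + 5) (seg x y t) := fun t =>
    Qd.of_ap (k := k + 1) (hx.mono (by omega)) (hx.w.seg hy t) ((h.seg t).mono (by omega))
  refine cl_eq_of_htp hT.par (hx.qi hT (by omega)) ?_ ⟨seg x y, nc_seg x y, seg_zero x y,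
    seg_one x y, fun t => (hq t).qi hT.four (by omega)⟩
  exact (hx.of_ap hy h).qi hT (by omega)

theorem cl_one_near (hT : S.Tgt (2 * k + 6) ε' r' N') (hx : S.Inv k x x') (hy : S.W k y)
    (h : S.Ap k x y) : cl .one X ε' r' N' x = cl .one X ε' r' N' y := by
  have hq : ∀ t, S.Inv (2 * k + 3) (seg x y t) x' := fun t =>
    Inv.of_ap (k := k + 1) (hx.mono (by omega)) (hx.w.seg hy t) ((h.seg t).mono (by omega))
  refine cl_eq_of_htp hT.par ⟨x', hx.ip hT (by omega)⟩ ⟨x', (hx.of_ap hy h).ip hT (by omega)⟩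
    ⟨seg x y, fun _ => x', nc_seg x y, NC.const x', seg_zero x y,
    seg_one x y, fun t => (hq t).ip hT.four' (by omega)⟩

theorem norm_sn_le (t : unitInterval) : ‖sn t‖ ≤ 1 := by
  nlinarith [norm_sq_add_norm_sq t, norm_nonneg (sn t), sq_nonneg ‖cs t‖]

theorem W.rotJ : S.W k (rotJ X ι) := ⟨nm_rotJ_le.trans (S.one_le_pow k), Fil.rotJ⟩

theorem W.rot (hg : S.W k g) (hg' : S.W k g') (t : unitInterval) : S.W (k + 1) (rot g g' t) :=
  (((hg.sum hg').smul (norm_cs_le t)).add ((W.rotJ (k := k)).smul (norm_sn_le t))).mono (by omega)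

theorem W.rot' (hg : S.W k g) (hg' : S.W k g') (t : unitInterval) : S.W (k + 1) (rot' g g' t) :=
  (((hg'.sum hg).smul (norm_cs_le t)).sub ((W.rotJ (k := k)).smul (norm_sn_le t))).mono (by omega)

/-- The Whitehead argument: with R_t the scalar rotation, diag(x, 1) R_t diag(y, 1) R_t⁻¹ is a path
from diag(xy, 1) to diag(x, y). -/
theorem cl_one_mul (hT : S.Tgt (9 * k + 30) ε' r' N') (hx : S.Inv k x x') (hy : S.Inv k y y') :
    cl .one X ε' r' N' (x * y) = cl .one X ε' r' N' x + cl .one X ε' r' N' y := by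
  have hρ : ∀ t, S.Inv (k + 1) (rot (1 : Matrix ι ι X.R) 1 t) (rot' 1 1 t) := fun t =>
    Inv.of_eq ((W.one.rot W.one t)) (W.one.rot' W.one t)
      (by rw [← sub_eq_zero, rot_mul_rot']; simp) (by rw [← sub_eq_zero, rot'_mul_rot]; simp)
  have ha : S.Inv (k + 1) (Matrix.fromBlocks x 0 0 1) (Matrix.fromBlocks x' 0 0 (1 : Matrix ι ι X.R)) :=
    (hx.sum Inv.one).mono (by omega)
  have hb : S.Inv (k + 1) (Matrix.fromBlocks y 0 0 1) (Matrix.fromBlocks y' 0 0 (1 : Matrix ι ι X.R)) :=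
    (hy.sum Inv.one).mono (by omega)
  have hq : ∀ t, S.Inv (9 * k + 22)
      (Matrix.fromBlocks x 0 0 1 * rot 1 1 t * (Matrix.fromBlocks y 0 0 1 * rot' 1 1 t))
      (rot 1 1 t * Matrix.fromBlocks y' 0 0 1 * (rot' 1 1 t * Matrix.fromBlocks x' 0 0 1)) :=
    fun t => ((ha.mul (hρ t)).mul (hb.mul (hρ t).symm)).mono (by omega)
  have h0 : cl .one X ε' r' N' (Matrix.fromBlocks (x * y) 0 0 (1 : Matrix ι ι X.R)) =
      cl .one X ε' r' N' (Matrix.fromBlocks x 0 0 y) := by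
    refine cl_eq_of_htp hT.par ⟨_, ((hx.mul hy).sum Inv.one).ip hT (by omega)⟩
      ⟨_, (hx.sum hy).ip hT (by omega)⟩ ⟨_, _, ?_, ?_, ?_, ?_, fun t => (hq t).ip hT.four' (by omega)⟩
    · exact ((NC.const _).mul (NC.rot 1 1)).mul ((NC.const _).mul (NC.rot' 1 1))
    · exact ((NC.rot 1 1).mul (NC.const _)).mul ((NC.rot' 1 1).mul (NC.const _))
    · simp [rot_zero, rot'_zero, Matrix.fromBlocks_multiply, Matrix.fromBlocks_one]
    · rw [rot_one, rot'_one, mul_assoc, ← mul_assoc (rotJ X ι), rotJ_conj, Matrix.fromBlocks_multiply]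
      simp
  rw [cl_sum hT.par ((hx.mul hy).q hT (by omega)) (Inv.one.q (k := 0) hT (by omega)),
    cl_sum hT.par (hx.q hT (by omega)) (hy.q hT (by omega)), cl_one hT.par, add_zero] at h0
  exact h0

theorem cl_one_inv (hT : S.Tgt (9 * k + 30) ε' r' N') (hx : S.Inv k x x') :
    cl .one X ε' r' N' x + cl .one X ε' r' N' x' = 0 := by
  rw [← cl_one_mul hT hx hx.symm, cl_one_near (hT.mono (by omega)) (hx.mul hx.symm) W.one
    (hx.sm.mono (by omega)), cl_one hT.par]

/-- It suffices that g'g acts almost as the identity on x; g need not be quasi-invertible. The path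
R_t diag(x, 0) R'_t, with the rotations of the pair g, g', leads from diag(gxg', 0) to diag(0, x),
and R'_t R_t diag(x, 0) differs from diag(x, 0) only by c² diag(g'gx - x, 0). -/
theorem cl_zero_conj (hT : S.Tgt (8 * k + 20) ε' r' N') (hx : S.Qd k x) (hg : S.W k g)
    (hg' : S.W k g') (h : S.Ap k (g' * g * x) x) :
    cl .zero X ε' r' N' (g * x * g') = cl .zero X ε' r' N' x := by
  have hz : S.W k (Matrix.fromBlocks x 0 0 (0 : Matrix ι ι X.R)) := hx.w.sum W.zero
  have e : ∀ t, rot' g g' t * rot g g' t * Matrix.fromBlocks x 0 0 0 - Matrix.fromBlocks x 0 0 0 =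
      (cs t * cs t) • Matrix.fromBlocks (g' * g * x - x) 0 0 (0 : Matrix ι ι X.R) := by
    intro t
    have h1 := rot'_mul_rot g g' t
    rw [sub_eq_iff_eq_add] at h1
    rw [h1, add_mul, one_mul, add_sub_cancel_right, Matrix.smul_mul, Matrix.fromBlocks_multiply]
    simp [sub_mul]
  have hs : ∀ t, S.Ap k (rot' g g' t * rot g g' t * Matrix.fromBlocks x 0 0 0)
      (Matrix.fromBlocks x 0 0 (0 : Matrix ι ι X.R)) := by
    intro t
    rw [Ap, e t]
    refine Sm.smul ?_ (Sm.sum h Sm.zero)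
    rw [norm_mul]
    exact mul_le_one₀ (norm_cs_le t) (norm_nonneg _) (norm_cs_le t)
  have hq : ∀ t, S.Qd (4 * k + 8) (rot g g' t * Matrix.fromBlocks x 0 0 0 * rot' g g' t) := by
    intro t
    have hr := hg.rot hg' t
    have hr' := hg.rot' hg' t
    refine ⟨((hr.mul hz).mul hr').mono (by omega), ?_⟩
    have h1 := Ap.mul_right (Ap.mul_left (hr.mul hz) (hs t)) hr'
    have h2 := Ap.mul_right (Ap.mul_left hr (hx.sum Qd.zero).sm) hr'
    refine Ap.mono (k := max (((k + 1 + k) + k) + (k + 1)) (((k + 1) + k) + (k + 1)) + 1) ?_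
      (by omega)
    refine Ap.trans ?_ h2
    convert h1 using 1 <;> noncomm_ring
  have h0 : cl .zero X ε' r' N' (Matrix.fromBlocks (g * x * g') 0 0 (0 : Matrix ι ι X.R)) =
      cl .zero X ε' r' N' (Matrix.fromBlocks (0 : Matrix ι ι X.R) 0 0 x) := by
    have e0 : rot g g' 0 * Matrix.fromBlocks x 0 0 0 * rot' g g' 0 =
        Matrix.fromBlocks (g * x * g') 0 0 (0 : Matrix ι ι X.R) := by
      simp [rot_zero, rot'_zero, Matrix.fromBlocks_multiply]
    refine cl_eq_of_htp hT.par ?_ ((Qd.zero.sum hx).qi hT (by omega))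
      ⟨fun t => rot g g' t * Matrix.fromBlocks x 0 0 0 * rot' g g' t, ?_, ?_, ?_,
        fun t => (hq t).qi hT.four (by omega)⟩
    · rw [← e0]
      exact (hq 0).qi hT (by omega)
    · exact ((NC.rot g g').mul (NC.const _)).mul (NC.rot' g g')
    · exact e0
    · simp only [rot_one, rot'_one, rotJ_conj]
  have hc : S.Qd (4 * k + 8) (g * x * g') := by
    refine ⟨((hg.mul hx.w).mul hg').mono (by omega), ?_⟩
    have h1 := Ap.mul_right (Ap.mul_left (hg.mul hx.w) h) hg'
    have h2 := Ap.mul_right (Ap.mul_left hg hx.sm) hg'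
    refine Ap.mono (k := max (((k + k) + k) + k) ((k + k) + k) + 1) ?_ (by omega)
    refine Ap.trans ?_ h2
    convert h1 using 1 <;> noncomm_ring
  rw [cl_sum hT.par (hc.q hT (by omega)) (Qd.zero.q (k := 0) hT (by omega)),
    cl_sum hT.par (Qd.zero.q (k := 0) hT (by omega)) (hx.q hT (by omega)), cl_zero hT.par,
    add_zero, zero_add] at h0
  exact h0

end Scale

/-! ## Homomorphisms on quantitative `K`-groups -/

namespace MatAlg

variable {X : MatAlg.{u} p} {Y : MatAlg.{v} p} {ε r N ε' r' N' : ℝ} {i : KDeg} [X.Nice]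

theorem map_cl [Y.Nice] {c : ℝ} (φ : UnitalHom X.plus Y.plus c) (g : X.R → Y.R)
    (hg : ∀ x, φ.hom x = g x) (h : Relaxes (c * ε) r (c * N) ε' r' N') {ι : Type*} [Fintype ι]
    [DecidableEq ι] {x : Matrix ι ι X.R} (hx : Q i X ε r N x) :
    KUnital.map φ i h (cl i X ε r N x) = cl i Y ε' r' N' (x.map g) := by
  have hx' : IsQuasi i X.plus ε r N (toFin (S := X.R) x) :=
    (isQuasi_iff (toFin x)).2 (hx.submatrix (Fintype.equivFin ι).symm)
  have e : toFin (x.map g) = φ.hom.mapMatrix (toFin x) := by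
    ext1 a b
    exact (hg _).symm
  refine ((congrArg (KUnital.map φ i h) (kcl_eq hx')).trans
    (KUnital.map_kClass φ i h _ hx')).trans ?_
  exact ((congrArg (kcl i Y ε' r' N') e).trans (kcl_eq _)).symm

theorem relax_cl (h : Relaxes ε r N ε' r' N') {ι : Type*} [Fintype ι] [DecidableEq ι]
    {x : Matrix ι ι X.R} (hx : Q i X ε r N x) :
    KUnital.map (UnitalHom.id X.plus) i h.one_mul (cl i X ε r N x) = cl i X ε' r' N' x :=
  map_cl (UnitalHom.id X.plus) id (fun _ => rfl) h.one_mul hx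

theorem padTo_zero_add {S : Type*} [Zero S] {n : ℕ} (m : ℕ) (x : Matrix (Fin n) (Fin n) S) :
    padTo 0 (n + m) x = bdiag x (0 : Matrix (Fin m) (Fin m) S) := by
  ext1 a b
  induction a using Fin.addCases <;> induction b using Fin.addCases <;> simp [padTo, bdiag]

theorem padTo_one_add {S : Type*} [Ring S] {n : ℕ} (m : ℕ) (x : Matrix (Fin n) (Fin n) S) :
    padTo 1 (n + m) x = bdiag x (1 : Matrix (Fin m) (Fin m) S) := by
  ext1 a b
  induction a using Fin.addCases with
  | left a =>
    induction b using Fin.addCases with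
    | left b => simp [padTo, bdiag]
    | right b =>
      have : Fin.castAdd m a ≠ Fin.natAdd n b := fun h => by
        have := congrArg Fin.val h
        simp at this
        omega
      simp [padTo, bdiag, this]
  | right a =>
    induction b using Fin.addCases with
    | left b =>
      have : Fin.natAdd n a ≠ Fin.castAdd m b := fun h => by
        have := congrArg Fin.val h
        simp at this
        omega
      simp [padTo, bdiag, this]
    | right b => simp [padTo, bdiag, Matrix.one_apply]

theorem padTo_eq_bdiag {n : ℕ} (m : ℕ) (x : Matrix (Fin n) (Fin n) X.R) :
    padTo (i.filler X.plus.carrier) (n + m) x = bdiag x (fillMat i X (Fin m)) := by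
  cases i with
  | zero => exact padTo_zero_add m x
  | one => exact padTo_one_add m x

/-- The relations compare matrices after padding. Additivity and vanishing on fillers remove the
padding, so that homotopies between matrices of equal size suffice. -/
theorem exists_hom {G : Type*} [AddCommGroup G] (hP : Par ε r N)
    (Φ : ∀ n, Matrix (Fin n) (Fin n) X.R → G)
    (h1 : ∀ n x y, Q i X ε r N x → Q i X ε r N y → Htp i X ε r N x y → Φ n x = Φ n y)
    (h2 : ∀ n m x y, Q i X ε r N x → Q i X ε r N y → Φ (n + m) (bdiag x y) = Φ n x + Φ m y)
    (h3 : ∀ n, Φ n (fillMat i X (Fin n)) = 0) :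
    ∃ F : KUnital i X.plus ε r N →+ G, ∀ (n : ℕ) (x : Matrix (Fin n) (Fin n) X.R)
      (hx : IsQuasi i X.plus ε r N x), F (kClass i X.plus ε r N x hx) = Φ n x := by
  have hp : ∀ (n k : ℕ) (x : Matrix (Fin n) (Fin n) X.R), Q i X ε r N x → n ≤ k →
      Q i X ε r N (padTo (i.filler X.plus.carrier) k x : Matrix (Fin k) (Fin k) X.R) ∧
      Φ k (padTo (i.filler X.plus.carrier) k x) = Φ n x := by
    intro n k x hx hk
    obtain ⟨m, rfl⟩ := Nat.exists_eq_add_of_le hk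
    have hf := Q.fill (X := X) (ι := Fin m) (r := r) i hP.eps hP.bd
    have e := padTo_eq_bdiag (i := i) m x
    refine ⟨?_, ?_⟩
    · rw [e]
      exact hx.bdiag hf
    · exact (congrArg _ e).trans ((h2 _ _ _ _ hx hf).trans (by rw [h3, add_zero]))
  let L : FreeAbelianGroup (KGen i X.plus ε r N) →+ G :=
    FreeAbelianGroup.lift fun a => Φ a.1 a.2.1
  have hL : ∀ a : KGen i X.plus ε r N, L (FreeAbelianGroup.of a) = Φ a.1 a.2.1 := fun a =>
    FreeAbelianGroup.lift_apply_of _ _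
  have hker : kRel i X.plus ε r N ≤ L.ker := by
    refine (AddSubgroup.closure_le _).2 ?_
    rintro g (⟨a, b, ⟨k, ha, hb, h⟩, rfl⟩ | ⟨a, b, h, rfl⟩)
    · refine L.mem_ker.2 ?_
      rw [map_sub, hL, hL, sub_eq_zero]
      obtain ⟨qa, ea⟩ := hp _ k _ ((isQuasi_iff _).1 a.2.2) ha
      obtain ⟨qb, eb⟩ := hp _ k _ ((isQuasi_iff _).1 b.2.2) hb
      exact ea.symm.trans ((h1 _ _ _ qa qb ((classHomotopic_iff _ _).1 h)).trans eb)
    · refine L.mem_ker.2 ?_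
      rw [map_sub, map_sub, hL, hL, hL, sub_sub, sub_eq_zero]
      exact h2 _ _ _ _ ((isQuasi_iff _).1 a.2.2) ((isQuasi_iff _).1 b.2.2)
  exact ⟨QuotientAddGroup.lift _ L hker, fun n x hx => hL ⟨n, ⟨x, hx⟩⟩⟩

end MatAlg

/-! ## Contractive homomorphisms -/

namespace MatAlg

variable {X : MatAlg.{u} p} {Y : MatAlg.{v} p}

/-- `f` preserves the filtrations and is contractive on matrices. -/
structure Contr (f : X.R →+* Y.R) : Prop where
  nrm_le : ∀ (n : ℕ) (x : Matrix (Fin n) (Fin n) X.R), Y.nrmR n (x.map f) ≤ X.nrmR n x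
  fil : ∀ (r : ℝ) (x : X.R), X.snd x ∈ X.fil r → Y.snd (f x) ∈ Y.fil r

theorem mmap_add {S T : Type*} [Ring S] [Ring T] (f : S →+* T) {ι : Type*} (x y : Matrix ι ι S) :
    (x + y).map f = x.map f + y.map f := Matrix.map_add _ (map_add f) x y

theorem mmap_sub {S T : Type*} [Ring S] [Ring T] (f : S →+* T) {ι : Type*} (x y : Matrix ι ι S) :
    (x - y).map f = x.map f - y.map f := Matrix.map_sub _ (map_sub f) x y

theorem mmap_neg {S T : Type*} [Ring S] [Ring T] (f : S →+* T) {ι : Type*} (x : Matrix ι ι S) :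
    (-x).map f = -x.map f := Matrix.map_neg _ (map_neg f) x

theorem mmap_zero {S T : Type*} [Ring S] [Ring T] (f : S →+* T) {ι : Type*} :
    (0 : Matrix ι ι S).map f = 0 := Matrix.map_zero _ (map_zero f)

theorem mmap_one {S T : Type*} [Ring S] [Ring T] (f : S →+* T) {ι : Type*} [DecidableEq ι] :
    (1 : Matrix ι ι S).map f = 1 := Matrix.map_one _ (map_zero f) (map_one f)

end MatAlg

namespace Scale

open MatAlg

section Map

variable {X : MatAlg.{u} p} {Y : MatAlg.{v} p} {f : X.R →+* Y.R} (hf : Contr f) {ι : Type*}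
  [Fintype ι] {S : Scale} {k : ℕ} {x y : Matrix ι ι X.R}
include hf

theorem nm_map_le (x : Matrix ι ι X.R) : Y.nm (x.map f) ≤ X.nm x := hf.nrm_le _ (toFin x)

theorem W.map (hx : S.W k x) : S.W k (x.map f) :=
  ⟨(nm_map_le hf x).trans hx.bd, fun i j => hf.fil _ _ (hx.fil i j)⟩

theorem Sm.map (hx : S.Sm k x) : S.Sm k (x.map f) := (nm_map_le hf x).trans hx

theorem Ap.map (h : S.Ap k x y) : S.Ap k (x.map f) (y.map f) := by
  rw [Ap, ← mmap_sub]
  exact Sm.map hf h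

theorem Inv.map [DecidableEq ι] (h : S.Inv k x y) : S.Inv k (x.map f) (y.map f) := by
  refine ⟨h.w.map hf, h.w'.map hf, ?_, ?_⟩
  · rw [← Matrix.map_mul, ← mmap_one f]
    exact h.sm.map hf
  · rw [← Matrix.map_mul, ← mmap_one f]
    exact h.sm'.map hf

theorem Qd.map (h : S.Qd k x) : S.Qd k (x.map f) := by
  refine ⟨h.w.map hf, ?_⟩
  rw [← Matrix.map_mul]
  exact h.sm.map hf

end Map

end Scale

namespace MatAlg

variable {X : MatAlg.{u} p}

/-! ## Elements of the cone and of the suspension -/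

/-- The cone. -/
noncomputable abbrev Cn (X : MatAlg.{u} p) : MatAlg.{u} p := pathAlg {0} X

/-- The suspension. -/
noncomputable abbrev Sn (X : MatAlg.{u} p) : MatAlg.{u} p := pathAlg {0, 1} X

section

variable {Z : Set unitInterval}

theorem path_ext {x y : (pathAlg Z X).R} (h : ∀ t, ev Z X t x = ev Z X t y) : x = y := by
  refine R_ext ?_ (Subtype.ext (ContinuousMap.ext fun t => ?_))
  · rw [← ev_fst 0, h, ev_fst]
  · exact (ev_snd t x).symm.trans ((congrArg X.snd (h t)).trans (ev_snd t y))

theorem contr_ev [X.Nice] (t : unitInterval) : Contr (ev Z X t) where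
  nrm_le n x := nrm_ev_le x t
  fil r x hx := by
    rw [ev_snd]
    exact hx t

theorem fst_inl_add_inr (z : ℂ) (a : X.carrier) : X.fst (X.inl z + X.inr a) = z := by simp

theorem snd_inl_add_inr (z : ℂ) (a : X.carrier) : X.snd (X.inl z + X.inr a) = a := by simp

/-- The element `(F, z)` of the unitization of a path algebra. -/
noncomputable def mkPath (F : C(unitInterval, X.carrier)) (hF : ∀ t ∈ Z, F t = 0) (z : ℂ) :
    (pathAlg Z X).R :=
  (pathAlg Z X).inl z + (pathAlg Z X).inr ⟨F, hF⟩

theorem ev_mkPath (F : C(unitInterval, X.carrier)) (hF : ∀ t ∈ Z, F t = 0) (z : ℂ)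
    (t : unitInterval) : ev Z X t (mkPath F hF z) = X.inl z + X.inr (F t) := by
  refine R_ext ?_ ?_
  · rw [ev_fst, fst_inl_add_inr]
    exact fst_inl_add_inr _ _
  · rw [ev_snd, snd_inl_add_inr]
    exact congrArg (fun G : (pathAlg Z X).carrier => G.1 t) (snd_inl_add_inr _ _)

theorem snd_path_mem {r : ℝ} {x : (pathAlg Z X).R} :
    (pathAlg Z X).snd x ∈ (pathAlg Z X).fil r ↔ ∀ t, X.snd (ev Z X t x) ∈ X.fil r := by
  simp only [ev_snd]
  exact Iff.rfl

theorem inl_add_inr (x : X.R) : X.inl (X.fst x) + X.inr (X.snd x) = x :=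
  R_ext (by simp) (by simp)

/-- The linear map `A⁺ → (CA)⁺`, `(a, z) ↦ (t ↦ t a, z)`. -/
noncomputable def lift (X : MatAlg.{u} p) : X.R →+ (Cn X).R where
  toFun x := mkPath ⟨fun t => ((t : ℝ) : ℂ) • X.snd x, by fun_prop⟩
    (fun t ht => by
      rw [Set.mem_singleton_iff] at ht
      subst ht
      simp) (X.fst x)
  map_zero' := path_ext fun t => by
    rw [ev_mkPath]
    simp
  map_add' x y := path_ext fun t => by
    rw [map_add (ev {0} X t), ev_mkPath, ev_mkPath, ev_mkPath]
    simp only [map_add, ContinuousMap.coe_mk, smul_add]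
    abel

theorem ev_lift (t : unitInterval) (x : X.R) :
    ev {0} X t (lift X x) = (1 - (t : ℝ) : ℂ) • X.scal x + ((t : ℝ) : ℂ) • x := by
  refine (ev_mkPath _ _ _ t).trans ?_
  refine R_ext ?_ ?_
  · simp only [map_add, fst_inl, fst_inr, map_smul, fst_scal, smul_eq_mul]
    ring
  · simp

theorem ev_one_lift (x : X.R) : ev {0} X 1 (lift X x) = x := by
  rw [ev_lift]
  simp

theorem lift_one : lift X 1 = 1 := path_ext fun t => by
  rw [ev_lift, map_one, map_one, ← add_smul]
  simp

/-- The inclusion `(SA)⁺ → (CA)⁺`. -/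
noncomputable def incl (X : MatAlg.{u} p) : (Sn X).R →+* (Cn X).R :=
  unitize (X := Sn X) (Y := Cn X)
    { toFun := fun F => ⟨F.1, fun t ht => F.2 t (Or.inl ht)⟩
      map_smul' := fun _ _ => rfl
      map_zero' := rfl
      map_add' := fun _ _ => rfl
      map_mul' := fun _ _ => rfl }

theorem ev_incl (t : unitInterval) (x : (Sn X).R) : ev {0} X t (incl X x) = ev {0, 1} X t x := by
  refine R_ext ?_ ?_
  · rw [ev_fst, ev_fst, incl, unitize_fst]
  · rw [ev_snd, ev_snd, incl, unitize_snd]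
    rfl

theorem incl_injective : Function.Injective (incl X) := fun x y h => path_ext fun t => by
  rw [← ev_incl, h, ev_incl]

theorem ev_susp_one (x : (Sn X).R) : ev {0, 1} X 1 x = X.scal (ev {0, 1} X 0 x) := by
  refine R_ext ?_ ?_
  · rw [fst_scal, ev_fst, ev_fst]
  · rw [snd_scal, ev_snd]
    exact ((Sn X).snd x).2 1 (Or.inr rfl)

theorem ev_susp_zero (x : (Sn X).R) : ev {0, 1} X 0 x = X.scal (ev {0, 1} X 0 x) := by
  refine R_ext ?_ ?_
  · rw [fst_scal]
  · rw [snd_scal, ev_snd]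
    exact ((Sn X).snd x).2 0 (Or.inl rfl)

/-- The element `y - lift (y(1))` of `SA`, for `y ∈ (CA)⁺`. -/
noncomputable def core (y : (Cn X).R) : (Sn X).R :=
  mkPath (((Cn X).snd y).1 - ((Cn X).snd (lift X (ev {0} X 1 y))).1) (fun t ht => by
    have h0 : ((Cn X).snd y).1 0 = 0 := ((Cn X).snd y).2 0 rfl
    have h1 : ((Cn X).snd (lift X (ev {0} X 1 y))).1 0 = 0 :=
      ((Cn X).snd (lift X (ev {0} X 1 y))).2 0 rfl
    rcases ht with rfl | ht
    · rw [ContinuousMap.sub_apply, h0, h1, sub_zero]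
    · rw [Set.mem_singleton_iff] at ht
      subst ht
      rw [ContinuousMap.sub_apply, ← ev_snd, ← ev_snd, ev_one_lift, sub_self]) 0

theorem incl_core (y : (Cn X).R) : incl X (core y) = y - lift X (ev {0} X 1 y) :=
  path_ext fun t => by
    rw [ev_incl, core, ev_mkPath, map_sub]
    refine R_ext ?_ ?_
    · rw [map_sub, map_add, fst_inl, fst_inr, ev_fst, ev_fst, ← ev_fst (Z := {0}) 1 (lift X _),
        ev_one_lift, ev_fst]
      simp
    · rw [map_sub, map_add, snd_inl, snd_inr, ContinuousMap.sub_apply, ev_snd, ev_snd, zero_add]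

/-- The homomorphism `F ↦ (t ↦ F(t τ))` from `(SA)⁺` to `(CA)⁺`. -/
noncomputable def dil (X : MatAlg.{u} p) (τ : unitInterval) : (Sn X).R →+* (Cn X).R :=
  unitize (X := Sn X) (Y := Cn X)
    { toFun := fun F => ⟨F.1.comp ⟨fun t => t * τ, by fun_prop⟩, fun t ht => by
        rw [Set.mem_singleton_iff] at ht
        subst ht
        have h : (0 : unitInterval) * τ = 0 := zero_mul τ
        change F.1 (0 * τ) = 0
        rw [h]
        exact F.2 0 (Or.inl rfl)⟩
      map_smul' := fun _ _ => rfl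
      map_zero' := rfl
      map_add' := fun _ _ => rfl
      map_mul' := fun _ _ => rfl }

theorem ev_dil (τ t : unitInterval) (x : (Sn X).R) :
    ev {0} X t (dil X τ x) = ev {0, 1} X (t * τ) x := by
  refine R_ext ?_ ?_
  · rw [ev_fst, ev_fst, dil, unitize_fst]
  · rw [ev_snd, ev_snd, dil, unitize_snd]
    rfl

variable [X.Nice]

theorem contr_incl : Contr (incl X) where
  nrm_le n x := pathAlg_nrm_le_iff.2 fun t => by
    have e : (x.map (incl X)).map (ev {0} X t) = x.map (ev {0, 1} X t) := by
      ext1 i j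
      exact ev_incl t _
    rw [e]
    exact nrm_ev_le x t
  fil r x hx := snd_path_mem.2 fun t => by
    rw [ev_incl]
    exact snd_path_mem.1 hx t

theorem contr_dil (τ : unitInterval) : Contr (dil X τ) where
  nrm_le n x := pathAlg_nrm_le_iff.2 fun t => by
    have e : (x.map (dil X τ)).map (ev {0} X t) = x.map (ev {0, 1} X (t * τ)) := by
      ext1 i j
      exact ev_dil τ t _
    rw [e]
    exact nrm_ev_le x _
  fil r x hx := snd_path_mem.2 fun t => by
    rw [ev_dil]
    exact snd_path_mem.1 hx _

variable {ι : Type*} [Fintype ι]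

theorem nm_incl (x : Matrix ι ι (Sn X).R) : (Cn X).nm (x.map (incl X)) = (Sn X).nm x := by
  refine le_antisymm (Scale.nm_map_le contr_incl x) (pathAlg_nm_le_iff.2 fun t => ?_)
  have e : (x.map (incl X)).map (ev {0} X t) = x.map (ev {0, 1} X t) := by
    ext1 i j
    exact ev_incl t _
  rw [← e]
  exact nm_ev_le _ t

theorem map_lift_ev (x : Matrix ι ι X.R) (t : unitInterval) :
    (x.map (lift X)).map (ev {0} X t) = Scale.seg (x.map X.scal) x t := by
  ext1 i j
  exact ev_lift t _

theorem nm_seg_le {x y : Matrix ι ι X.R} {c : ℝ} (hx : X.nm x ≤ c) (hy : X.nm y ≤ c)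
    (t : unitInterval) : X.nm (Scale.seg x y t) ≤ c := by
  refine (nm_add_le _ _).trans ((add_le_add (nm_smul_le _ _) (nm_smul_le _ _)).trans ?_)
  have h1 : ‖(1 - (t : ℝ) : ℂ)‖ = 1 - t := by
    rw [← Complex.ofReal_one, ← Complex.ofReal_sub, Complex.norm_real, Real.norm_eq_abs,
      abs_of_nonneg (sub_nonneg.2 t.2.2)]
  have h2 : ‖((t : ℝ) : ℂ)‖ = t := by
    rw [Complex.norm_real, Real.norm_eq_abs, abs_of_nonneg t.2.1]
  rw [h1, h2]
  have := t.2.1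
  have := t.2.2
  nlinarith

/-- The value of the lift at each t is a convex combination of x and its scalar part, and the latter
is not larger than x. -/
theorem nm_lift_le (x : Matrix ι ι X.R) : (Cn X).nm (x.map (lift X)) ≤ X.nm x :=
  pathAlg_nm_le_iff.2 fun t => by
    rw [map_lift_ev]
    exact nm_seg_le (nm_scal_le x) le_rfl t

theorem Fil.lift {r : ℝ} {x : Matrix ι ι X.R} (hx : X.Fil r x) :
    (Cn X).Fil r (x.map (lift X)) := fun i j => snd_path_mem.2 fun t => by
  rw [Matrix.map_apply, ev_lift, map_add, map_smul, map_smul, snd_scal, smul_zero, zero_add]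
  exact (X.fil r).smul_mem _ (hx i j)

end

end MatAlg

/-! ### Lifting to the cone and correcting to the suspension. -/

namespace Scale

open MatAlg

variable {X : MatAlg.{u} p} [X.Nice] {ι κ : Type*} [Fintype ι] [Fintype κ] {S : Scale} {k l : ℕ}

theorem W.lift {x : Matrix ι ι X.R} (hx : S.W k x) : S.W k (x.map (lift X)) :=
  ⟨(nm_lift_le x).trans hx.bd, hx.fil.lift⟩

theorem Ap.lift {x y : Matrix ι ι X.R} (h : S.Ap k x y) : S.Ap k (x.map (lift X)) (y.map (lift X)) := by
  have e : (x - y).map (MatAlg.lift X) = x.map (MatAlg.lift X) - y.map (MatAlg.lift X) :=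
    Matrix.map_sub _ (map_sub _) x y
  rw [Ap, ← e]
  exact (nm_lift_le _).trans h

theorem w_incl_iff {x : Matrix ι ι (Sn X).R} : S.W k (x.map (incl X)) ↔ S.W k x := by
  refine ⟨fun h => ⟨?_, fun i j => snd_path_mem.2 fun t => ?_⟩, fun h => h.map contr_incl⟩
  · rw [← nm_incl]
    exact h.bd
  · rw [← ev_incl]
    exact snd_path_mem.1 (h.fil i j) t

theorem ap_incl_iff {x y : Matrix ι ι (Sn X).R} :
    S.Ap k (x.map (incl X)) (y.map (incl X)) ↔ S.Ap k x y := by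
  rw [Ap, ← mmap_sub, Sm, nm_incl]
  exact Iff.rfl

theorem qd_incl_iff {x : Matrix ι ι (Sn X).R} : S.Qd k (x.map (incl X)) ↔ S.Qd k x := by
  refine ⟨fun h => ⟨w_incl_iff.1 h.w, ap_incl_iff.1 ?_⟩, fun h => h.map contr_incl⟩
  rw [Matrix.map_mul]
  exact h.sm

/-- The perturbation `q + y - lift (y(1))` of `y` to a matrix over `(SA)⁺`, where `q` is a scalar
matrix. -/
noncomputable def corr (q : Matrix ι ι (Sn X).R) (y : Matrix ι ι (Cn X).R) : Matrix ι ι (Sn X).R :=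
  q + y.map core

theorem corr_incl (q : Matrix ι ι (Sn X).R) (y : Matrix ι ι (Cn X).R) :
    (corr q y).map (incl X) = q.map (incl X) + (y - (y.map (ev {0} X 1)).map (lift X)) := by
  rw [corr, mmap_add]
  congr 1
  ext1 i j
  exact incl_core _

/-- `q` is a scalar matrix of norm at most `1`, considered over `(SA)⁺`, and `q₀` is the same matrix
over `A⁺`. -/
structure Sc (S : Scale) (q : Matrix ι ι (Sn X).R) (q₀ : Matrix ι ι X.R) : Prop where
  w : S.W 0 q
  eq : q.map (incl X) = q₀.map (MatAlg.lift X)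

variable {q : Matrix ι ι (Sn X).R} {q₀ : Matrix ι ι X.R} {y y' : Matrix ι ι (Cn X).R}

/-- The correction changes y by the lift of q₀ - y(1), and lifting is contractive. Thus a matrix
over the cone that is nearly scalar at t = 1 is close to one over the suspension. -/
theorem corr_ap (hq : S.Sc q q₀) (h : S.Ap k (y.map (ev {0} X 1)) q₀) :
    S.Ap k ((corr q y).map (incl X)) y := by
  have e : (corr q y).map (incl X) - y =
      q₀.map (MatAlg.lift X) - (y.map (ev {0} X 1)).map (MatAlg.lift X) := by
    rw [corr_incl, hq.eq]
    abel
  rw [Ap, e]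
  exact h.symm.lift

theorem corr_w (hq : S.Sc q q₀) (hy : S.W k y) : S.W (k + 2) (corr q y) := by
  rw [← w_incl_iff, corr_incl]
  have h1 := (hy.map (contr_ev 1)).lift
  exact ((hq.w.map contr_incl).add (hy.sub h1)).mono (by omega)

theorem corr_near (q : Matrix ι ι (Sn X).R) (h : S.Ap k y y') :
    S.Ap (k + 2) (corr q y) (corr q y') := by
  rw [← ap_incl_iff, corr_incl, corr_incl]
  have h1 := (h.map (contr_ev 1)).lift
  exact ((Ap.refl (k := 0) _).add (h.sub h1)).mono (by omega)

theorem corr_submatrix (e : κ ≃ ι) (q : Matrix ι ι (Sn X).R) (y : Matrix ι ι (Cn X).R) :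
    (corr q y).submatrix e e = corr (q.submatrix e e) (y.submatrix e e) := rfl

theorem Sc.one [DecidableEq ι] : S.Sc (1 : Matrix ι ι (Sn X).R) 1 := by
  refine ⟨W.one, ?_⟩
  rw [mmap_one, Matrix.map_one _ (map_zero _) lift_one]

theorem Sc.zero : S.Sc (0 : Matrix ι ι (Sn X).R) 0 := by
  refine ⟨W.zero, ?_⟩
  rw [mmap_zero, Matrix.map_zero _ (map_zero _)]

theorem Sc.sum {a : Matrix ι ι (Sn X).R} {a₀ : Matrix ι ι X.R} {b : Matrix κ κ (Sn X).R}
    {b₀ : Matrix κ κ X.R} (ha : S.Sc a a₀) (hb : S.Sc b b₀) :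
    S.Sc (Matrix.fromBlocks a 0 0 b) (Matrix.fromBlocks a₀ 0 0 b₀) := by
  refine ⟨ha.w.sum hb.w, ?_⟩
  rw [Matrix.fromBlocks_map, Matrix.fromBlocks_map, ha.eq, hb.eq]
  congr 1 <;> · ext1 i j; simp

end Scale

/-! ## The invertible lift of `diag(u, u')` -/

section Lift

variable {A B : Type*} [Ring A] [Ring B] {ι κ : Type*} [Fintype ι] [Fintype κ] [DecidableEq ι]
  [DecidableEq κ]

/-- An invertible matrix that agrees with `diag(a, b)` if `a` and `b` are inverse to each other. -/
def eMat (a b : Matrix ι ι A) : Matrix (ι ⊕ ι) (ι ⊕ ι) A :=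
  Matrix.fromBlocks (a + (1 - a * b) * a) (-(1 - a * b)) (1 - b * a) b

/-- The inverse of `eMat a b`. -/
def eMat' (a b : Matrix ι ι A) : Matrix (ι ⊕ ι) (ι ⊕ ι) A :=
  Matrix.fromBlocks b (1 - b * a) (-(1 - a * b)) (a + (1 - a * b) * a)

/-- The projection `diag(1, 0)`. -/
def pMat (A : Type*) [Ring A] (ι κ : Type*) [DecidableEq ι] :
    Matrix (ι ⊕ κ) (ι ⊕ κ) A := Matrix.fromBlocks 1 0 0 0

/-- The matrix is the product of the elementary matrices with off-diagonal entries a (upper), -b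
(lower), a (upper) and the rotation by a right angle. It is therefore invertible for all a and b,
not only for mutually inverse ones, and this is preserved by the lift to the cone. -/
theorem eMat_mul_eMat' (a b : Matrix ι ι A) : eMat a b * eMat' a b = 1 := by
  rw [eMat, eMat', Matrix.fromBlocks_multiply, ← Matrix.fromBlocks_one]
  congr 1 <;> noncomm_ring

theorem eMat'_mul_eMat (a b : Matrix ι ι A) : eMat' a b * eMat a b = 1 := by
  rw [eMat, eMat', Matrix.fromBlocks_multiply, ← Matrix.fromBlocks_one]
  congr 1 <;> noncomm_ring

theorem pMat_mul_pMat : pMat A ι κ * pMat A ι κ = pMat A ι κ := by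
  simp [pMat, Matrix.fromBlocks_multiply]

/-- The idempotent `eMat a b * diag(1, 0) * (eMat a b)⁻¹`. -/
def yMat (a b : Matrix ι ι A) : Matrix (ι ⊕ ι) (ι ⊕ ι) A := eMat a b * pMat A ι ι * eMat' a b

theorem yMat_mul_yMat (a b : Matrix ι ι A) : yMat a b * yMat a b = yMat a b := by
  have h := eMat'_mul_eMat a b
  calc yMat a b * yMat a b =
      eMat a b * pMat A ι ι * (eMat' a b * eMat a b) * pMat A ι ι * eMat' a b := by
        simp only [yMat, mul_assoc]
    _ = eMat a b * (pMat A ι ι * pMat A ι ι) * eMat' a b := by rw [h, mul_one, mul_assoc (eMat a b)]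
    _ = _ := by rw [pMat_mul_pMat, yMat]

theorem fromBlocks_sum_sum (a b c d : Matrix ι ι A) (a' b' c' d' : Matrix κ κ A) :
    Matrix.fromBlocks (Matrix.fromBlocks a 0 0 a') (Matrix.fromBlocks b 0 0 b')
      (Matrix.fromBlocks c 0 0 c') (Matrix.fromBlocks d 0 0 d') =
    (Matrix.fromBlocks (Matrix.fromBlocks a b c d) 0 0 (Matrix.fromBlocks a' b' c' d')).submatrix
      (Equiv.sumSumSumComm ι κ ι κ) (Equiv.sumSumSumComm ι κ ι κ) := by
  ext1 i j
  rcases i with (i | i) | (i | i) <;> rcases j with (j | j) | (j | j) <;> rfl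

theorem fromBlocks_sub {l m n o : Type*} (a a' : Matrix l m A) (b b' : Matrix l o A)
    (c c' : Matrix n m A) (d d' : Matrix n o A) :
    Matrix.fromBlocks a b c d - Matrix.fromBlocks a' b' c' d' =
      Matrix.fromBlocks (a - a') (b - b') (c - c') (d - d') := by
  rw [sub_eq_add_neg, Matrix.fromBlocks_neg, Matrix.fromBlocks_add]
  simp only [sub_eq_add_neg]

theorem eMat_sum (a b : Matrix ι ι A) (a' b' : Matrix κ κ A) :
    eMat (Matrix.fromBlocks a 0 0 a') (Matrix.fromBlocks b 0 0 b') =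
      (Matrix.fromBlocks (eMat a b) 0 0 (eMat a' b')).submatrix
        (Equiv.sumSumSumComm ι κ ι κ) (Equiv.sumSumSumComm ι κ ι κ) := by
  rw [eMat, eMat, eMat, ← fromBlocks_sum_sum]
  simp only [Matrix.fromBlocks_multiply, ← Matrix.fromBlocks_one, fromBlocks_sub,
    Matrix.fromBlocks_neg, Matrix.fromBlocks_add, Matrix.mul_zero,
    Matrix.zero_mul, add_zero, zero_add, sub_zero, neg_zero]

theorem eMat'_sum (a b : Matrix ι ι A) (a' b' : Matrix κ κ A) :
    eMat' (Matrix.fromBlocks a 0 0 a') (Matrix.fromBlocks b 0 0 b') =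
      (Matrix.fromBlocks (eMat' a b) 0 0 (eMat' a' b')).submatrix
        (Equiv.sumSumSumComm ι κ ι κ) (Equiv.sumSumSumComm ι κ ι κ) := by
  rw [eMat', eMat', eMat', ← fromBlocks_sum_sum]
  simp only [Matrix.fromBlocks_multiply, ← Matrix.fromBlocks_one, fromBlocks_sub,
    Matrix.fromBlocks_neg, Matrix.fromBlocks_add, Matrix.mul_zero,
    Matrix.zero_mul, add_zero, zero_add, sub_zero, neg_zero]

theorem pMat_sum : pMat A (ι ⊕ κ) (ι ⊕ κ) =
    (Matrix.fromBlocks (pMat A ι ι) 0 0 (pMat A κ κ)).submatrix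
      (Equiv.sumSumSumComm ι κ ι κ) (Equiv.sumSumSumComm ι κ ι κ) := by
  rw [pMat, pMat, pMat, ← fromBlocks_sum_sum]
  simp only [Matrix.fromBlocks_one, Matrix.fromBlocks_zero]

theorem yMat_sum (a b : Matrix ι ι A) (a' b' : Matrix κ κ A) :
    yMat (Matrix.fromBlocks a 0 0 a') (Matrix.fromBlocks b 0 0 b') =
      (Matrix.fromBlocks (yMat a b) 0 0 (yMat a' b')).submatrix
        (Equiv.sumSumSumComm ι κ ι κ) (Equiv.sumSumSumComm ι κ ι κ) := by
  rw [yMat, eMat_sum, eMat'_sum, pMat_sum, Matrix.submatrix_mul_equiv, Matrix.submatrix_mul_equiv]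
  simp [Matrix.fromBlocks_multiply, yMat]

theorem eMat_map (f : A →+* B) (a b : Matrix ι ι A) :
    (eMat a b).map f = eMat (a.map f) (b.map f) := by
  simp only [eMat, Matrix.fromBlocks_map, MatAlg.mmap_add, MatAlg.mmap_sub, MatAlg.mmap_neg,
    MatAlg.mmap_one, Matrix.map_mul]

theorem eMat'_map (f : A →+* B) (a b : Matrix ι ι A) :
    (eMat' a b).map f = eMat' (a.map f) (b.map f) := by
  simp only [eMat', Matrix.fromBlocks_map, MatAlg.mmap_add, MatAlg.mmap_sub, MatAlg.mmap_neg,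
    MatAlg.mmap_one, Matrix.map_mul]

theorem pMat_map (f : A →+* B) : (pMat A ι κ).map f = pMat B ι κ := by
  simp only [pMat, Matrix.fromBlocks_map, MatAlg.mmap_one, Matrix.map_zero _ (map_zero f)]

theorem yMat_map (f : A →+* B) (a b : Matrix ι ι A) :
    (yMat a b).map f = yMat (a.map f) (b.map f) := by
  simp only [yMat, Matrix.map_mul, eMat_map, eMat'_map, pMat_map]

theorem one_sub_mul_submatrix (e : κ ≃ ι) (a b : Matrix ι ι A) :
    1 - a.submatrix e e * b.submatrix e e = (1 - a * b).submatrix e e := by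
  rw [Matrix.submatrix_mul_equiv, ← Matrix.submatrix_one_equiv e]
  rfl

theorem eMat_submatrix (e : κ ≃ ι) (a b : Matrix ι ι A) :
    eMat (a.submatrix e e) (b.submatrix e e) =
      (eMat a b).submatrix (Equiv.sumCongr e e) (Equiv.sumCongr e e) := by
  rw [eMat, one_sub_mul_submatrix, one_sub_mul_submatrix, Matrix.submatrix_mul_equiv]
  ext1 i j
  rcases i with i | i <;> rcases j with j | j <;> rfl

theorem eMat'_submatrix (e : κ ≃ ι) (a b : Matrix ι ι A) :
    eMat' (a.submatrix e e) (b.submatrix e e) =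
      (eMat' a b).submatrix (Equiv.sumCongr e e) (Equiv.sumCongr e e) := by
  rw [eMat', one_sub_mul_submatrix, one_sub_mul_submatrix, Matrix.submatrix_mul_equiv]
  ext1 i j
  rcases i with i | i <;> rcases j with j | j <;> rfl

theorem pMat_submatrix (e : κ ≃ ι) :
    pMat A κ κ = (pMat A ι ι).submatrix (Equiv.sumCongr e e) (Equiv.sumCongr e e) := by
  rw [pMat, ← Matrix.submatrix_one_equiv e]
  ext1 i j
  rcases i with i | i <;> rcases j with j | j <;> rfl

theorem yMat_submatrix (e : κ ≃ ι) (a b : Matrix ι ι A) :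
    yMat (a.submatrix e e) (b.submatrix e e) =
      (yMat a b).submatrix (Equiv.sumCongr e e) (Equiv.sumCongr e e) := by
  rw [yMat, eMat_submatrix, eMat'_submatrix, pMat_submatrix e, Matrix.submatrix_mul_equiv,
    Matrix.submatrix_mul_equiv, yMat]

end Lift

/-! ### Estimates for the invertible lift and for the boundary idempotent. -/

namespace Scale

open MatAlg

variable {X : MatAlg.{u} p} [X.Nice] {ι κ μ : Type*} [Fintype ι] [Fintype κ] [Fintype μ]
  [DecidableEq ι] [DecidableEq κ] [DecidableEq μ] {S : Scale} {k l : ℕ}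

theorem W.eMat {a b : Matrix ι ι X.R} (ha : S.W k a) (hb : S.W k b) : S.W (3 * k + 3) (eMat a b) :=
  (W.fromBlocks (k := 3 * k + 2)
    ((ha.add ((W.one (k := 0).sub (ha.mul hb)).mul ha)).mono (by omega))
    ((W.one (k := 0).sub (ha.mul hb)).neg.mono (by omega))
    ((W.one (k := 0).sub (hb.mul ha)).mono (by omega)) (hb.mono (by omega))).mono (by omega)

theorem W.eMat' {a b : Matrix ι ι X.R} (ha : S.W k a) (hb : S.W k b) : S.W (3 * k + 3) (eMat' a b) :=
  (W.fromBlocks (k := 3 * k + 2) (hb.mono (by omega))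
    ((W.one (k := 0).sub (hb.mul ha)).mono (by omega))
    ((W.one (k := 0).sub (ha.mul hb)).neg.mono (by omega))
    ((ha.add ((W.one (k := 0).sub (ha.mul hb)).mul ha)).mono (by omega))).mono (by omega)

theorem W.pMat : S.W k (pMat X.R ι κ) := W.one.sum W.zero

section Near

variable {a b a' b' : Matrix ι ι X.R} (ha : S.W k a) (hb : S.W k b) (ha' : S.W k a')
  (hb' : S.W k b') (h : S.Ap k a a') (h' : S.Ap k b b')
include ha hb ha' hb' h h'

theorem Ap.eMat_aux :
    S.Ap (4 * k + 7) (a + (1 - a * b) * a) (a' + (1 - a' * b') * a') ∧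
    S.Ap (4 * k + 7) (1 - a * b) (1 - a' * b') ∧ S.Ap (4 * k + 7) (1 - b * a) (1 - b' * a') := by
  have h1 : S.Ap (2 * k + 2) (1 - a * b) (1 - a' * b') :=
    ((Ap.refl (k := 0) 1).sub (Ap.mul ha hb' h h')).mono (by omega)
  have h2 : S.Ap (2 * k + 2) (1 - b * a) (1 - b' * a') :=
    ((Ap.refl (k := 0) 1).sub (Ap.mul hb ha' h' h)).mono (by omega)
  have h3 : S.W (2 * k + 2) (1 - a * b) := (W.one (k := 0).sub (ha.mul hb)).mono (by omega)
  have h4 := Ap.mul h3 (ha'.mono (by omega)) h1 (h.mono (by omega))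
  exact ⟨(h.add h4).mono (by omega), h1.mono (by omega), h2.mono (by omega)⟩

theorem Ap.eMat : S.Ap (4 * k + 8) (eMat a b) (QuantK.eMat a' b') := by
  obtain ⟨h1, h2, h3⟩ := Ap.eMat_aux ha hb ha' hb' h h'
  exact Ap.fromBlocks h1 h2.neg h3 (h'.mono (by omega))

theorem Ap.eMat' : S.Ap (4 * k + 8) (eMat' a b) (QuantK.eMat' a' b') := by
  obtain ⟨h1, h2, h3⟩ := Ap.eMat_aux ha hb ha' hb' h h'
  exact Ap.fromBlocks (h'.mono (by omega)) h3 h2.neg h1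

theorem Ap.yMat : S.Ap (8 * k + 17) (yMat a b) (QuantK.yMat a' b') := by
  have h1 := Ap.mul_right (Ap.eMat ha hb ha' hb' h h') (W.pMat (k := 0))
  exact (Ap.mul (k := 4 * k + 8) (((ha.eMat hb).mul (W.pMat (k := 0))).mono (by omega))
    ((ha'.eMat' hb').mono (by omega)) (h1.mono (by omega))
    (Ap.eMat' ha hb ha' hb' h h')).mono (by omega)

end Near

section Inv

variable {a b : Matrix ι ι X.R} (h : S.Inv k a b)
include h

/-- The off-diagonal entries are, up to sign, the defects of the pair, and the upper left entry
differs from a by -(ab - 1)a. -/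
theorem Inv.eMat_ap : S.Ap (2 * k + 2) (eMat a b) (Matrix.fromBlocks a 0 0 b) := by
  have h1 : S.Ap (2 * k + 1) (1 - a * b) 0 := by
    have := (Ap.refl (k := 0) (1 : Matrix ι ι X.R)).sub h.sm
    rw [sub_self] at this
    exact this.mono (by omega)
  have h2 : S.Ap (2 * k + 1) (1 - b * a) 0 := by
    have := (Ap.refl (k := 0) (1 : Matrix ι ι X.R)).sub h.sm'
    rw [sub_self] at this
    exact this.mono (by omega)
  refine Ap.fromBlocks (k := 2 * k + 1) ?_ ?_ h2 (Ap.refl _)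
  · have h3 : S.Sm (2 * k) (a * b - 1) := h.sm.sm.mono (by omega)
    have h4 : a + (1 - a * b) * a - a = -((a * b - 1) * a) := by noncomm_ring
    rw [Ap, h4]
    exact ((Sm.mul_right h.sm.sm h.w).neg).mono (by omega)
  · have := h1.neg
    rwa [neg_zero] at this

theorem Inv.eMat'_ap : S.Ap (2 * k + 2) (eMat' a b) (Matrix.fromBlocks b 0 0 a) := by
  have h1 : S.Ap (2 * k + 1) (1 - a * b) 0 := by
    have := (Ap.refl (k := 0) (1 : Matrix ι ι X.R)).sub h.sm
    rw [sub_self] at this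
    exact this.mono (by omega)
  have h2 : S.Ap (2 * k + 1) (1 - b * a) 0 := by
    have := (Ap.refl (k := 0) (1 : Matrix ι ι X.R)).sub h.sm'
    rw [sub_self] at this
    exact this.mono (by omega)
  refine Ap.fromBlocks (k := 2 * k + 1) (Ap.refl _) h2 ?_ ?_
  · have := h1.neg
    rwa [neg_zero] at this
  · have h4 : a + (1 - a * b) * a - a = -((a * b - 1) * a) := by noncomm_ring
    rw [Ap, h4]
    exact ((Sm.mul_right h.sm.sm h.w).neg).mono (by omega)

/-- This is the condition at t = 1 for the correction to the suspension: conjugation of p by a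
matrix close to diag(a, b) gives approximately diag(ab, 0), and ab is close to 1. -/
theorem Inv.yMat_ap : S.Ap (6 * k + 8) (yMat a b) (QuantK.pMat X.R ι ι) := by
  have h1 := Ap.mul_right h.eMat_ap (W.pMat (k := 0) (ι := ι) (κ := ι))
  have h2 := Ap.mul (k := 3 * k + 3) (((h.w.eMat h.w').mul (W.pMat (k := 0))).mono (by omega))
    ((h.w'.sum h.w).mono (by omega)) (h1.mono (by omega)) (h.eMat'_ap.mono (by omega))
  have h3 : Matrix.fromBlocks a 0 0 b * QuantK.pMat X.R ι ι * Matrix.fromBlocks b 0 0 a =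
      Matrix.fromBlocks (a * b) 0 0 0 := by
    simp [QuantK.pMat, Matrix.fromBlocks_multiply]
  rw [h3] at h2
  exact (h2.trans (h.sm.sum (Ap.refl 0))).mono (by omega)

end Inv

theorem W.yMat {a b : Matrix ι ι X.R} (ha : S.W k a) (hb : S.W k b) : S.W (6 * k + 6) (yMat a b) :=
  (((ha.eMat hb).mul (W.pMat (k := 0))).mul (ha.eMat' hb)).mono (by omega)

theorem Sc.pMat : S.Sc (QuantK.pMat (Sn X).R ι κ) (QuantK.pMat X.R ι κ) := Sc.one.sum Sc.zero

/-! ## The boundary of a quasi-invertible -/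

/-- The quasi-idempotent over `(SA)⁺` that represents the boundary of `u`, where `u'` is
quasi-inverse to `u`. -/
noncomputable def dEl (u u' : Matrix ι ι X.R) : Matrix (ι ⊕ ι) (ι ⊕ ι) (Sn X).R :=
  corr (pMat (Sn X).R ι ι) (yMat (u.map (MatAlg.lift X)) (u'.map (MatAlg.lift X)))

theorem map_lift_ev_one (x : Matrix ι ι X.R) : (x.map (MatAlg.lift X)).map (ev {0} X 1) = x := by
  ext1 i j
  exact ev_one_lift _

section

variable {u u' v v' : Matrix ι ι X.R}

theorem Inv.dEl_ap (h : S.Inv k u u') : S.Ap (6 * k + 8) ((dEl u u').map (incl X))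
    (yMat (u.map (MatAlg.lift X)) (u'.map (MatAlg.lift X))) := by
  refine corr_ap Sc.pMat ?_
  rw [yMat_map, map_lift_ev_one, map_lift_ev_one]
  exact h.yMat_ap

theorem Inv.dEl_w (h : S.Inv k u u') : S.W (6 * k + 8) (dEl u u') :=
  corr_w Sc.pMat (h.w.lift.yMat h.w'.lift)

/-- Over the cone the matrix `yMat` is an exact idempotent, so that the whole defect comes from the
correction. -/
theorem Inv.dEl_qd (h : S.Inv k u u') : S.Qd (12 * k + 19) (dEl u u') := by
  rw [← qd_incl_iff]
  have h1 : S.Qd (6 * k + 8) (yMat (u.map (MatAlg.lift X)) (u'.map (MatAlg.lift X))) :=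
    ⟨(h.w.lift.yMat h.w'.lift).mono (by omega), Ap.of_eq (yMat_mul_yMat _ _)⟩
  exact (h1.of_ap (h.dEl_w.map contr_incl) h.dEl_ap.symm).mono (by omega)

/-- Only u and v are assumed to be close; their quasi-inverses are then close by `Inv.near_inv`. -/
theorem Inv.dEl_near (h : S.Inv k u u') (h' : S.Inv k v v') (hv : S.Ap k u v) :
    S.Ap (24 * k + 35) (dEl u u') (dEl v v') := by
  have h1 := h.near_inv h' hv
  refine (corr_near _ (Ap.yMat (k := 3 * k + 2) ?_ ?_ ?_ ?_ ?_ ?_)).mono (by omega)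
  · exact h.w.lift.mono (by omega)
  · exact h.w'.lift.mono (by omega)
  · exact h'.w.lift.mono (by omega)
  · exact h'.w'.lift.mono (by omega)
  · exact hv.lift.mono (by omega)
  · exact h1.lift.mono (by omega)

end

theorem core_zero : core (0 : (Cn X).R) = 0 := incl_injective (by
  rw [incl_core, map_zero, map_zero, map_zero, sub_zero])

theorem corr_sum (q : Matrix ι ι (Sn X).R) (q' : Matrix κ κ (Sn X).R) (y : Matrix ι ι (Cn X).R)
    (y' : Matrix κ κ (Cn X).R) : corr (Matrix.fromBlocks q 0 0 q') (Matrix.fromBlocks y 0 0 y') =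
      Matrix.fromBlocks (corr q y) 0 0 (corr q' y') := by
  rw [corr, Matrix.fromBlocks_map, Matrix.fromBlocks_add, Matrix.map_zero _ core_zero,
    Matrix.map_zero _ core_zero, add_zero, add_zero]
  rfl

theorem dEl_sum (u u' : Matrix ι ι X.R) (v v' : Matrix κ κ X.R) :
    dEl (Matrix.fromBlocks u 0 0 v) (Matrix.fromBlocks u' 0 0 v') =
      (Matrix.fromBlocks (dEl u u') 0 0 (dEl v v')).submatrix
        (Equiv.sumSumSumComm ι κ ι κ) (Equiv.sumSumSumComm ι κ ι κ) := by
  simp only [dEl, Matrix.fromBlocks_map, Matrix.map_zero _ (map_zero (MatAlg.lift X))]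
  rw [yMat_sum, pMat_sum, ← corr_submatrix, corr_sum]

theorem dEl_submatrix (e : κ ≃ ι) (u u' : Matrix ι ι X.R) :
    dEl (u.submatrix e e) (u'.submatrix e e) =
      (dEl u u').submatrix (Equiv.sumCongr e e) (Equiv.sumCongr e e) := by
  rw [dEl, ← Matrix.submatrix_map, ← Matrix.submatrix_map, yMat_submatrix, pMat_submatrix e,
    ← corr_submatrix]
  rfl

theorem dEl_one : dEl (1 : Matrix ι ι X.R) 1 = pMat (Sn X).R ι ι := by
  have h : yMat (1 : Matrix ι ι (Cn X).R) 1 = pMat (Cn X).R ι ι := by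
    simp [yMat, eMat, eMat', pMat]
  rw [dEl, Matrix.map_one _ (map_zero _) lift_one, h]
  refine Matrix.map_injective incl_injective ?_
  change (corr _ _).map (incl X) = (QuantK.pMat _ _ _).map (incl X)
  rw [corr_incl, pMat_map, pMat_map]
  have h2 : (pMat X.R ι ι).map (MatAlg.lift X) = pMat (Cn X).R ι ι := by
    rw [pMat, Matrix.fromBlocks_map, Matrix.map_one _ (map_zero _) lift_one,
      Matrix.map_zero _ (map_zero _)]
    rfl
  rw [h2, sub_self, add_zero]

end Scale

/-! ### From parameters to scales. -/

namespace Scale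

open MatAlg

/-- The scale with base `2 N`. -/
noncomputable def of {ε r N : ℝ} (hP : Par ε r N) : Scale where
  base := 2 * N
  eps := ε
  prop := r
  two_le := by linarith [hP.bd]
  eps_pos := hP.eps
  prop_nonneg := hP.prop

variable {X : MatAlg.{u} p} [X.Nice] {ι κ μ : Type*} [Fintype ι] [Fintype κ] [Fintype μ]
  [DecidableEq ι] [DecidableEq κ] [DecidableEq μ] {S : Scale} {k l : ℕ} {ε r N ε' r' N' : ℝ}

theorem of_pow (hP : Par ε r N) : (Scale.of hP).base ^ 2 = 4 * N * N := by
  change (2 * N) ^ 2 = _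
  ring

/-- With the base 2N, level 2 absorbs the relaxed parameters (4ε, 2r, 4N) of the homotopies, because
(2N)² is at least 4N and at least 4. -/
theorem w_of (hP : Par ε r N) {x : Matrix ι ι X.R} (hx : X.nm x ≤ 4 * N) (hf : X.Fil (2 * r) x) :
    (Scale.of hP).W 2 x := by
  refine ⟨?_, ?_⟩
  · rw [of_pow]
    nlinarith [hP.bd]
  · exact hf

theorem sm_of (hP : Par ε r N) {x : Matrix ι ι X.R} (hx : X.nm x ≤ 4 * ε) :
    (Scale.of hP).Sm 2 x := by
  change X.nm x ≤ (Scale.of hP).base ^ 2 * ε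
  rw [of_pow]
  have := hP.bd
  have := hP.eps
  have h : 4 ≤ 4 * N * N := by nlinarith
  nlinarith

theorem inv_of_ip (hP : Par ε r N) {x y : Matrix ι ι X.R}
    (h : X.IP (4 * ε) (2 * r) (4 * N) x y) : (Scale.of hP).Inv 2 x y :=
  ⟨w_of hP h.bd h.fil, w_of hP h.bd' h.fil', sm_of hP h.inv.le, sm_of hP h.inv'.le⟩

theorem qd_of_qi (hP : Par ε r N) {x : Matrix ι ι X.R} (h : X.QI (4 * ε) (2 * r) (4 * N) x) :
    (Scale.of hP).Qd 2 x :=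
  ⟨w_of hP h.bd h.fil, sm_of hP h.idem.le⟩

theorem ip_four (hP : Par ε r N) {x y : Matrix ι ι X.R} (h : X.IP ε r N x y) :
    X.IP (4 * ε) (2 * r) (4 * N) x y := by
  have h1 := hP.eps
  have h2 := hP.prop
  have h3 := hP.bd
  exact ⟨h.fil.mono (by linarith), h.fil'.mono (by linarith), h.bd.trans (by linarith),
    h.bd'.trans (by linarith), h.inv.trans_le (by linarith), h.inv'.trans_le (by linarith)⟩

theorem qi_four (hP : Par ε r N) {x : Matrix ι ι X.R} (h : X.QI ε r N x) :
    X.QI (4 * ε) (2 * r) (4 * N) x := by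
  have h1 := hP.eps
  have h2 := hP.prop
  have h3 := hP.bd
  exact ⟨h.idem.trans_le (by linarith), h.fil.mono (by linarith), h.bd.trans (by linarith),
    h.bd'.trans (by linarith)⟩

theorem ap_eventually {γ : unitInterval → Matrix ι ι X.R} (hγ : X.NC γ) (s : unitInterval) :
    ∀ᶠ t in 𝓝 s, S.Ap k (γ t) (γ s) := by
  have h := (hγ s).eventually (ge_mem_nhds (mul_pos (S.pow_pos k) S.eps_pos))
  exact h

/-- A locally constant function on the interval is constant. Homotopy invariance is thereby reduced
to invariance under small perturbations, with no loss of control from a subdivision of the path. -/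
theorem eq_of_eventually_eq {G : Type*} {f : unitInterval → G}
    (h : ∀ s, ∀ᶠ t in 𝓝 s, f t = f s) : f 0 = f 1 :=
  ((IsLocallyConstant.iff_eventually_eq f).2 h).apply_eq_of_preconnectedSpace 0 1

/-! ## The boundary map -/

/-- The boundary of `u`, where `u'` is quasi-inverse to `u`. -/
noncomputable def dVal (ε' r' N' : ℝ) (u u' : Matrix ι ι X.R) : KUnital .zero (Sn X).plus ε' r' N' :=
  cl .zero (Sn X) ε' r' N' (dEl u u') - cl .zero (Sn X) ε' r' N' (1 : Matrix ι ι (Sn X).R)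

section

variable {u u' v v' : Matrix ι ι X.R}

/-- For u = v this is independence of the quasi-inverse. In general it makes the boundary locally
constant along homotopies. -/
theorem dVal_congr (hT : S.Tgt (48 * k + 80) ε' r' N') (h : S.Inv k u u') (h' : S.Inv k v v')
    (huv : S.Ap k u v) : dVal ε' r' N' u u' = dVal ε' r' N' v v' := by
  rw [dVal, dVal, cl_zero_near (k := 24 * k + 35) (hT.mono (by omega)) (h.dEl_qd.mono (by omega))
    (h'.dEl_w.mono (by omega)) (h.dEl_near h' huv)]

theorem dVal_sum {v v' : Matrix κ κ X.R} (hT : S.Tgt (12 * k + 20) ε' r' N') (h : S.Inv k u u')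
    (h' : S.Inv k v v') :
    dVal ε' r' N' (Matrix.fromBlocks u 0 0 v) (Matrix.fromBlocks u' 0 0 v') =
      dVal ε' r' N' u u' + dVal ε' r' N' v v' := by
  rw [dVal, dEl_sum, cl_submatrix hT.par, ← Matrix.fromBlocks_one,
    cl_sum hT.par (h.dEl_qd.q hT (by omega)) (h'.dEl_qd.q hT (by omega)),
    cl_sum hT.par (Qd.one.q (k := 0) hT (by omega)) (Qd.one.q (k := 0) hT (by omega)), dVal, dVal]
  abel

theorem dVal_submatrix (hP : Par ε' r' N') (e : κ ≃ ι) :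
    dVal ε' r' N' (u.submatrix e e) (u'.submatrix e e) = dVal ε' r' N' u u' := by
  rw [dVal, dEl_submatrix, cl_submatrix hP, ← Matrix.submatrix_one_equiv e, cl_submatrix hP, dVal]

theorem cl_pMat (hP : Par ε' r' N') : cl .zero X ε' r' N' (pMat X.R ι κ) =
    cl .zero X ε' r' N' (1 : Matrix ι ι X.R) := by
  have h1 : Q .zero X ε' r' N' (1 : Matrix ι ι X.R) := QI.one hP.eps hP.bd
  have h2 : Q .zero X ε' r' N' (0 : Matrix κ κ X.R) := QI.zero hP.eps hP.bd
  rw [pMat, cl_sum hP h1 h2, cl_zero hP, add_zero]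

theorem dVal_one (hP : Par ε' r' N') : dVal ε' r' N' (1 : Matrix ι ι X.R) 1 = 0 := by
  rw [dVal, dEl_one, cl_pMat hP, sub_self]

end

/-- The elements occurring in classes and homotopies are of level 2, so that `dVal_congr` needs the
target level 48 · 2 + 80 = 176. -/
theorem exists_boundary (X : MatAlg.{u} p) [X.Nice] (hP : Par ε r N)
    (hT : (Scale.of hP).Tgt 200 ε' r' N') :
    ∃ F : KUnital .one X.plus ε r N →+ KUnital .zero (Sn X).plus ε' r' N',
      ∀ (n : ℕ) (u u' : Matrix (Fin n) (Fin n) X.R) (hu : IsQuasi .one X.plus ε r N u),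
        (Scale.of hP).Inv 2 u u' → F (kClass .one X.plus ε r N u hu) = dVal ε' r' N' u u' := by
  classical
  have hI : ∀ {n : ℕ} {u u' : Matrix (Fin n) (Fin n) X.R}, X.IP ε r N u u' →
    (Scale.of hP).Inv 2 u u' := fun h => inv_of_ip hP (ip_four hP h)
  -- A quasi-inverse is chosen at the relaxed level 2, so that the function is also defined along
  -- homotopies. The value 0 elsewhere is irrelevant.
  let Φ : ∀ n, Matrix (Fin n) (Fin n) X.R → KUnital .zero (Sn X).plus ε' r' N' := fun n u =>
    if h : ∃ u', (Scale.of hP).Inv 2 u u' then dVal ε' r' N' u h.choose else 0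
  have hΦ : ∀ {n : ℕ} {u u' : Matrix (Fin n) (Fin n) X.R}, (Scale.of hP).Inv 2 u u' →
      Φ n u = dVal ε' r' N' u u' := by
    intro n u u' h
    have h' : ∃ u', (Scale.of hP).Inv 2 u u' := ⟨u', h⟩
    refine (dif_pos h').trans ?_
    exact dVal_congr (hT.mono (by omega)) h'.choose_spec h (Ap.refl u)
  have h1 : ∀ n x y, Q .one X ε r N x → Q .one X ε r N y → Htp .one X ε r N x y →
      Φ n x = Φ n y := by
    rintro n x y - - ⟨γ, δ, hγ, hδ, rfl, rfl, hq⟩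
    have hI' : ∀ t, (Scale.of hP).Inv 2 (γ t) (δ t) := fun t => inv_of_ip hP (hq t)
    rw [hΦ (hI' 0), hΦ (hI' 1)]
    refine eq_of_eventually_eq (f := fun t => dVal ε' r' N' (γ t) (δ t)) fun s => ?_
    filter_upwards [ap_eventually (S := Scale.of hP) (k := 2) hγ s] with t ht
    exact dVal_congr (hT.mono (by omega)) (hI' t) (hI' s) ht
  have h2 : ∀ n m x y, Q .one X ε r N x → Q .one X ε r N y →
      Φ (n + m) (bdiag x y) = Φ n x + Φ m y := by
    rintro n m x y ⟨x', hx⟩ ⟨y', hy⟩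
    rw [hΦ (hI hx), hΦ (hI hy)]
    refine (hΦ (u := bdiag x y) (u' := bdiag x' y')
      (((hI hx).sum (hI hy)).submatrix finSumFinEquiv.symm)).trans ?_
    exact (dVal_submatrix hT.par _).trans (dVal_sum (hT.mono (by omega)) (hI hx) (hI hy))
  have h3 : ∀ n, Φ n (fillMat .one X (Fin n)) = 0 := fun n =>
    (hΦ Inv.one).trans (dVal_one hT.par)
  obtain ⟨F, hF⟩ := exists_hom (i := .one) hP Φ h1 h2 h3
  exact ⟨F, fun n u u' hu h => (hF n u hu).trans (hΦ h)⟩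

/-! ## Independence of the choices -/

/-- The exchange of the outer summands. -/
def swapOuter (ι μ : Type*) : (ι ⊕ μ) ⊕ ι ≃ (ι ⊕ μ) ⊕ ι where
  toFun
    | .inl (.inl i) => .inr i
    | .inl (.inr j) => .inl (.inr j)
    | .inr i => .inl (.inl i)
  invFun
    | .inl (.inl i) => .inr i
    | .inl (.inr j) => .inl (.inr j)
    | .inr i => .inl (.inl i)
  left_inv := by rintro ((i | i) | i) <;> rfl
  right_inv := by rintro ((i | i) | i) <;> rfl

/-- The rearrangement of summands `(ι ⊕ μ) ⊕ ι ≃ (ι ⊕ ι) ⊕ μ`. -/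
def swapInner (ι μ : Type*) : (ι ⊕ μ) ⊕ ι ≃ (ι ⊕ ι) ⊕ μ where
  toFun
    | .inl (.inl i) => .inl (.inl i)
    | .inl (.inr j) => .inr j
    | .inr i => .inl (.inr i)
  invFun
    | .inl (.inl i) => .inl (.inl i)
    | .inr j => .inl (.inr j)
    | .inl (.inr i) => .inr i
  left_inv := by rintro ((i | i) | i) <;> rfl
  right_inv := by rintro ((i | i) | i) <;> rfl

section

variable {A : Type*} [Ring A]

theorem fromBlocks_swapOuter (a c : Matrix ι ι A) (b : Matrix μ μ A) :
    (Matrix.fromBlocks (Matrix.fromBlocks a 0 0 b) 0 0 c).submatrix (swapOuter ι μ) (swapOuter ι μ) =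
      Matrix.fromBlocks (Matrix.fromBlocks c 0 0 b) 0 0 a := by
  ext1 i j
  rcases i with (i | i) | i <;> rcases j with (j | j) | j <;> rfl

theorem fromBlocks_swapInner (a b : Matrix ι ι A) (c : Matrix μ μ A) :
    (Matrix.fromBlocks (Matrix.fromBlocks a 0 0 b) 0 0 c).submatrix (swapInner ι μ) (swapInner ι μ) =
      Matrix.fromBlocks (Matrix.fromBlocks a 0 0 c) 0 0 b := by
  ext1 i j
  rcases i with (i | i) | i <;> rcases j with (j | j) | j <;> rfl

theorem sum_mul_sum (a a' : Matrix ι ι A) (b b' : Matrix κ κ A) :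
    Matrix.fromBlocks a 0 0 b * Matrix.fromBlocks a' 0 0 b' =
      Matrix.fromBlocks (a * a') 0 0 (b * b') := by
  simp [Matrix.fromBlocks_multiply]

end

theorem sum_map {A B : Type*} [Ring A] [Ring B] (f : A →+* B) (a : Matrix ι ι A)
    (b : Matrix κ κ A) : (Matrix.fromBlocks a 0 0 b).map f =
      Matrix.fromBlocks (a.map f) 0 0 (b.map f) := by
  simp only [Matrix.fromBlocks_map, Matrix.map_zero _ (map_zero f)]

theorem Qd.of_conj {P w w' : Matrix ι ι X.R} (hw : S.W k w) (hw' : S.W k w')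
    (h : S.Ap k (w' * w) 1) (hP : S.W 0 P) (hPP : P * P = P) : S.Qd (3 * k) (w * P * w') := by
  refine ⟨((hw.mul hP).mul hw').mono (by omega), ?_⟩
  have h1 := Ap.mul_right (Ap.mul_left (hw.mul hP) h) (hP.mul hw')
  have e1 : w * P * (w' * w) * (P * w') = w * P * w' * (w * P * w') := by simp only [mul_assoc]
  have e2 : w * P * 1 * (P * w') = w * P * w' := by
    rw [mul_one, ← mul_assoc, mul_assoc w, hPP]
  rw [e1, e2] at h1
  exact h1.mono (by omega)

/-- The product of `diag(w, 1)`, `diag(w', 1)` and `diag(E', 1)`, the first two of which have the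
second summand in common, whereas the third one acts on the outer summands. -/
def gMat {A : Type*} [Ring A] (w w' : Matrix (ι ⊕ μ) (ι ⊕ μ) A) (E' : Matrix (ι ⊕ ι) (ι ⊕ ι) A) :
    Matrix ((ι ⊕ μ) ⊕ ι) ((ι ⊕ μ) ⊕ ι) A :=
  Matrix.fromBlocks w 0 0 1 *
    (Matrix.fromBlocks w' 0 0 1).submatrix (swapOuter ι μ) (swapOuter ι μ) *
    (Matrix.fromBlocks E' 0 0 1).submatrix (swapInner ι μ) (swapInner ι μ)

/-- The product of the factors of `gMat w' w E` in the reverse order. -/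
def gMat' {A : Type*} [Ring A] (w w' : Matrix (ι ⊕ μ) (ι ⊕ μ) A) (E : Matrix (ι ⊕ ι) (ι ⊕ ι) A) :
    Matrix ((ι ⊕ μ) ⊕ ι) ((ι ⊕ μ) ⊕ ι) A :=
  (Matrix.fromBlocks E 0 0 1).submatrix (swapInner ι μ) (swapInner ι μ) *
    ((Matrix.fromBlocks w 0 0 1).submatrix (swapOuter ι μ) (swapOuter ι μ) *
      Matrix.fromBlocks w' 0 0 1)

section

variable {A B : Type*} [Ring A] [Ring B]

theorem gMat_map (f : A →+* B) (w w' : Matrix (ι ⊕ μ) (ι ⊕ μ) A) (E' : Matrix (ι ⊕ ι) (ι ⊕ ι) A) :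
    (gMat w w' E').map f = gMat (w.map f) (w'.map f) (E'.map f) := by
  simp only [gMat, Matrix.map_mul, ← Matrix.submatrix_map, sum_map, mmap_one]

theorem gMat'_map (f : A →+* B) (w w' : Matrix (ι ⊕ μ) (ι ⊕ μ) A) (E : Matrix (ι ⊕ ι) (ι ⊕ ι) A) :
    (gMat' w w' E).map f = gMat' (w.map f) (w'.map f) (E.map f) := by
  simp only [gMat', Matrix.map_mul, ← Matrix.submatrix_map, sum_map, mmap_one]

/-- With E' close to diag(u', u) on the two outer summands, the three factors at t = 1 are diag(u,
v, 1), diag(1, v', u') and diag(u', 1, u). Their product is close to 1; the middle factor serves to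
compensate the other two. -/
theorem gMat_diag (u u' : Matrix ι ι A) (v v' : Matrix μ μ A) :
    gMat (Matrix.fromBlocks u 0 0 v) (Matrix.fromBlocks u' 0 0 v') (Matrix.fromBlocks u' 0 0 u) =
      Matrix.fromBlocks (Matrix.fromBlocks (u * u') 0 0 (v * v')) 0 0 (u' * u) := by
  rw [gMat, fromBlocks_swapOuter, fromBlocks_swapInner]
  simp only [sum_mul_sum, mul_one, one_mul]

theorem gMat'_diag (u u' : Matrix ι ι A) (v v' : Matrix μ μ A) :
    gMat' (Matrix.fromBlocks u 0 0 v) (Matrix.fromBlocks u' 0 0 v') (Matrix.fromBlocks u 0 0 u') =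
      Matrix.fromBlocks (Matrix.fromBlocks (u * u') 0 0 (v * v')) 0 0 (u' * u) := by
  rw [gMat', fromBlocks_swapOuter, fromBlocks_swapInner]
  simp only [sum_mul_sum, mul_one, one_mul]

/-- The factor with E' turns E p E' into the projection onto the first summand. The middle factor is
the identity on that summand and leaves the projection unchanged. The factor with w turns it into w
p w'. Only E'E = 1 is used, so that the equality is exact. -/
theorem gMat_conj {w w' : Matrix (ι ⊕ μ) (ι ⊕ μ) A} {E E' : Matrix (ι ⊕ ι) (ι ⊕ ι) A}
    (hE : E' * E = 1) :
    gMat w w' E' * (Matrix.fromBlocks (E * pMat A ι ι * E') 0 0 (0 : Matrix μ μ A)).submatrix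
      (swapInner ι μ) (swapInner ι μ) * gMat' w w' E =
        Matrix.fromBlocks (w * pMat A ι μ * w') 0 0 0 := by
  have h1 : (Matrix.fromBlocks E' 0 0 (1 : Matrix μ μ A)).submatrix (swapInner ι μ) (swapInner ι μ) *
      (Matrix.fromBlocks (E * pMat A ι ι * E') 0 0 (0 : Matrix μ μ A)).submatrix
        (swapInner ι μ) (swapInner ι μ) *
      (Matrix.fromBlocks E 0 0 (1 : Matrix μ μ A)).submatrix (swapInner ι μ) (swapInner ι μ) =
        Matrix.fromBlocks (pMat A ι μ) 0 0 0 := by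
    rw [Matrix.submatrix_mul_equiv, Matrix.submatrix_mul_equiv, sum_mul_sum, sum_mul_sum, mul_zero,
      zero_mul, ← mul_assoc, ← mul_assoc, hE, one_mul, mul_assoc, hE, mul_one]
    exact fromBlocks_swapInner _ _ _
  have h2 : (Matrix.fromBlocks w' 0 0 (1 : Matrix ι ι A)).submatrix (swapOuter ι μ) (swapOuter ι μ) *
      Matrix.fromBlocks (pMat A ι μ) 0 0 0 *
      (Matrix.fromBlocks w 0 0 (1 : Matrix ι ι A)).submatrix (swapOuter ι μ) (swapOuter ι μ) =
        Matrix.fromBlocks (pMat A ι μ) 0 0 0 := by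
    have h3 : Matrix.fromBlocks (pMat A ι μ) 0 0 0 = (Matrix.fromBlocks (Matrix.fromBlocks 0 0 0 0) 0 0
        (1 : Matrix ι ι A)).submatrix (swapOuter ι μ) (swapOuter ι μ) :=
      (fromBlocks_swapOuter _ _ _).symm
    rw [h3, Matrix.submatrix_mul_equiv, Matrix.submatrix_mul_equiv, sum_mul_sum, sum_mul_sum,
      Matrix.fromBlocks_zero, mul_zero, zero_mul, one_mul, one_mul]
  rw [gMat, gMat']
  calc _ = Matrix.fromBlocks w 0 0 1 *
        ((Matrix.fromBlocks w' 0 0 1).submatrix (swapOuter ι μ) (swapOuter ι μ) *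
        ((Matrix.fromBlocks E' 0 0 (1 : Matrix μ μ A)).submatrix (swapInner ι μ) (swapInner ι μ) *
        (Matrix.fromBlocks (E * pMat A ι ι * E') 0 0 (0 : Matrix μ μ A)).submatrix
          (swapInner ι μ) (swapInner ι μ) *
        (Matrix.fromBlocks E 0 0 (1 : Matrix μ μ A)).submatrix (swapInner ι μ) (swapInner ι μ)) *
        (Matrix.fromBlocks w 0 0 1).submatrix (swapOuter ι μ) (swapOuter ι μ)) *
        Matrix.fromBlocks w' 0 0 1 := by simp only [mul_assoc]
    _ = _ := by
      rw [h1, h2, sum_mul_sum, sum_mul_sum, mul_zero, zero_mul]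

end

section

variable {w w' z z' : Matrix (ι ⊕ μ) (ι ⊕ μ) X.R} {E E' D D' : Matrix (ι ⊕ ι) (ι ⊕ ι) X.R}

theorem Inv.gMat (hw : S.Inv k w w') (hE : S.Inv k E E') :
    S.Inv (9 * k + 4) (gMat w w' E') (gMat' w w' E) := by
  have h1 : S.Inv k (Matrix.fromBlocks w 0 0 (1 : Matrix ι ι X.R)) (Matrix.fromBlocks w' 0 0 1) :=
    hw.sum Inv.one
  have h2 : S.Inv k (Matrix.fromBlocks E' 0 0 (1 : Matrix μ μ X.R)) (Matrix.fromBlocks E 0 0 1) :=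
    hE.symm.sum Inv.one
  exact ((h1.mul (h1.symm.submatrix _)).mul ((h2.submatrix _).mono (by omega))).mono (by omega)

theorem Ap.gMat (hw : S.W k w) (hw' : S.W k w') (hz' : S.W k z') (hD' : S.W k D')
    (h : S.Ap k w z) (h' : S.Ap k w' z') (hE' : S.Ap k E' D') :
    S.Ap (4 * k + 3) (gMat w w' E') (Scale.gMat z z' D') := by
  have h1 : S.Ap (2 * k + 1) _ _ :=
    (Ap.mul (hw.sum W.one) ((hz'.sum W.one).submatrix _) (h.sum (Ap.refl (1 : Matrix ι ι X.R)))
      ((h'.sum (Ap.refl (1 : Matrix ι ι X.R))).submatrix (swapOuter ι μ))).mono (by omega)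
  exact (Ap.mul (k := 2 * k + 1)
    (((hw.sum W.one).mul ((hw'.sum W.one).submatrix (swapOuter ι μ))).mono (by omega))
    (((hD'.sum W.one).submatrix (swapInner ι μ)).mono (by omega)) h1
    (((hE'.sum (Ap.refl (1 : Matrix μ μ X.R))).submatrix (swapInner ι μ)).mono
      (by omega))).mono (by omega)

theorem Ap.gMat' (hw : S.W k w) (hE : S.W k E) (hz : S.W k z) (hz' : S.W k z')
    (h : S.Ap k w z) (h' : S.Ap k w' z') (hE' : S.Ap k E D) :
    S.Ap (4 * k + 3) (gMat' w w' E) (Scale.gMat' z z' D) := by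
  have h1 : S.Ap (2 * k + 1) _ _ :=
    (Ap.mul ((hw.sum W.one).submatrix _) (hz'.sum W.one)
      ((h.sum (Ap.refl (1 : Matrix ι ι X.R))).submatrix (swapOuter ι μ))
      (h'.sum (Ap.refl (1 : Matrix ι ι X.R)))).mono (by omega)
  exact (Ap.mul (k := 2 * k + 1)
    (((hE.sum W.one).submatrix (swapInner ι μ)).mono (by omega))
    ((((hz.sum W.one).submatrix (swapOuter ι μ)).mul (hz'.sum W.one)).mono (by omega))
    (((hE'.sum (Ap.refl (1 : Matrix μ μ X.R))).submatrix (swapInner ι μ)).mono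
      (by omega)) h1).mono (by omega)

end

/-- Conjugation by a matrix over the cone need not preserve classes over the suspension. Since G and
G' are close to 1 at t = 1, they can be corrected to matrices over (SA)⁺, and the conjugation is
carried out there. -/
theorem cl_zero_conj_cone {x y : Matrix ι ι (Sn X).R} {G G' z : Matrix ι ι (Cn X).R}
    (hT : S.Tgt (40 * k + 120) ε' r' N') (hG : S.Inv k G G') (h1 : S.Ap k (G.map (ev {0} X 1)) 1)
    (h1' : S.Ap k (G'.map (ev {0} X 1)) 1) (hx : S.Qd k x) (hy : S.Qd k y)
    (hz : S.Ap k (x.map (incl X)) z) (hwz : S.W k z)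
    (h : S.Ap k (y.map (incl X)) (G * z * G')) :
    cl .zero (Sn X) ε' r' N' y = cl .zero (Sn X) ε' r' N' x := by
  have hg : S.Ap k ((corr 1 G).map (incl X)) G := corr_ap Sc.one h1
  have hg' : S.Ap k ((corr 1 G').map (incl X)) G' := corr_ap Sc.one h1'
  have wg : S.W (k + 2) (corr 1 G) := corr_w Sc.one hG.w
  have wg' : S.W (k + 2) (corr 1 G') := corr_w Sc.one hG.w'
  have h2 : S.Ap (4 * k + 12) y (corr 1 G * x * corr 1 G') := by
    rw [← ap_incl_iff, Matrix.map_mul, Matrix.map_mul]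
    have h3 := Ap.mul (k := k + 2) (wg.map contr_incl) (hwz.mono (by omega))
      (hg.mono (by omega)) (hz.mono (by omega))
    have h4 := Ap.mul (k := 2 * k + 5)
      (((wg.map contr_incl).mul (hx.w.map contr_incl)).mono (by omega)) (hG.w'.mono (by omega))
      (h3.mono (by omega)) (hg'.mono (by omega))
    exact (h.trans h4.symm).mono (by omega)
  have h5 : S.Ap (3 * k + 9) (corr 1 G' * corr 1 G * x) x := by
    rw [← ap_incl_iff, Matrix.map_mul, Matrix.map_mul]
    have h6 := (Ap.mul (k := k + 2) (wg'.map contr_incl) (hG.w.mono (by omega))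
      (hg'.mono (by omega)) (hg.mono (by omega))).trans hG.sm'
    have h7 := Ap.mul_right h6 (hx.w.map contr_incl)
    rw [one_mul] at h7
    exact h7.mono (by omega)
  rw [cl_zero_near (k := 4 * k + 12) (hT.mono (by omega)) (hy.mono (by omega))
    (((wg.mul hx.w).mul wg').mono (by omega)) h2]
  exact cl_zero_conj (k := 4 * k + 12) (hT.mono (by omega)) (hx.mono (by omega)) (wg.mono (by omega))
    (wg'.mono (by omega)) (h5.mono (by omega))

/-- The matrix `gMat`, formed from the lift w and the standard lift E, conjugates E p E⁻¹ ⊕ 0 into w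
p w' ⊕ 0 and is close to 1 at t = 1. The class therefore depends only on u, not on the complement v,
the lift w or the approximation e. -/
theorem dVal_eq_of_lift {u u' : Matrix ι ι X.R} {v v' : Matrix μ μ X.R}
    {w w' : Matrix (ι ⊕ μ) (ι ⊕ μ) (Cn X).R} {e : Matrix (ι ⊕ μ) (ι ⊕ μ) (Sn X).R}
    (hT : S.Tgt (4400 * k + 8000) ε' r' N') (hu : S.Inv k u u') (hv : S.Inv k v v')
    (hw : S.Inv k w w') (hwu : S.Ap k (w.map (ev {0} X 1)) (Matrix.fromBlocks u 0 0 v))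
    (he : S.W k e) (hew : S.Ap k (e.map (incl X)) (w * pMat (Cn X).R ι μ * w')) :
    S.Qd (6 * k + 3) e ∧
    cl .zero (Sn X) ε' r' N' e - cl .zero (Sn X) ε' r' N' (1 : Matrix ι ι (Sn X).R) =
      dVal ε' r' N' u u' := by
  have hqe : S.Qd (6 * k + 3) e := by
    rw [← qd_incl_iff]
    have hc : S.Qd (3 * k) (w * pMat (Cn X).R ι μ * w') :=
      Qd.of_conj hw.w hw.w' hw.sm' (W.pMat (k := 0)) (pMat_mul_pMat (ι := ι) (κ := μ))
    exact (Qd.of_ap (k := 3 * k) (hc.mono (by omega)) ((he.map contr_incl).mono (by omega))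
      (hew.symm.mono (by omega))).mono (by omega)
  refine ⟨hqe, ?_⟩
  -- The level c dominates those of E and of the estimates at t = 1. The conjugating matrix is then
  -- of level 9c + 4, and 40(9c + 4) + 120 is at most 4400k + 8000.
  obtain ⟨c, hc⟩ : ∃ c, c = 12 * k + 20 := ⟨_, rfl⟩
  have hwu' : S.Ap c (w'.map (ev {0} X 1)) (Matrix.fromBlocks u' 0 0 v') :=
    ((hw.map (contr_ev 1)).near_inv (hu.sum hv) hwu).mono (by omega)
  have hE : S.Inv c (eMat (u.map (MatAlg.lift X)) (u'.map (MatAlg.lift X)))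
      (eMat' (u.map (MatAlg.lift X)) (u'.map (MatAlg.lift X))) :=
    Inv.of_eq ((hu.w.lift.eMat hu.w'.lift).mono (by omega))
      ((hu.w.lift.eMat' hu.w'.lift).mono (by omega)) (eMat_mul_eMat' _ _) (eMat'_mul_eMat _ _)
  have hone : S.Ap k (Matrix.fromBlocks (Matrix.fromBlocks (u * u') 0 0 (v * v')) 0 0 (u' * u))
      (1 : Matrix ((ι ⊕ μ) ⊕ ι) ((ι ⊕ μ) ⊕ ι) X.R) := by
    rw [← Matrix.fromBlocks_one, ← Matrix.fromBlocks_one]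
    exact (hu.sm.sum hv.sm).sum hu.sm'
  have hG := (hw.mono (show k ≤ c by omega)).gMat hE
  have hG1 : S.Ap (4 * c + 4) ((gMat w w' (eMat' (u.map (MatAlg.lift X))
      (u'.map (MatAlg.lift X)))).map (ev {0} X 1)) 1 := by
    rw [gMat_map, eMat'_map, map_lift_ev_one, map_lift_ev_one]
    rw [← gMat_diag] at hone
    refine ((Ap.gMat (k := c) ((hw.w.map (contr_ev 1)).mono (by omega))
      ((hw.w'.map (contr_ev 1)).mono (by omega)) ((hu.w'.sum hv.w').mono (by omega))
      ((hu.w'.sum hu.w).mono (by omega)) (hwu.mono (by omega)) hwu'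
      (hu.eMat'_ap.mono (by omega))).trans hone).mono (by omega)
  have hG1' : S.Ap (4 * c + 4) ((gMat' w w' (eMat (u.map (MatAlg.lift X))
      (u'.map (MatAlg.lift X)))).map (ev {0} X 1)) 1 := by
    rw [gMat'_map, eMat_map, map_lift_ev_one, map_lift_ev_one]
    rw [← gMat'_diag] at hone
    refine ((Ap.gMat' (k := c) ((hw.w.map (contr_ev 1)).mono (by omega))
      ((hu.w.eMat hu.w').mono (by omega)) ((hu.w.sum hv.w).mono (by omega))
      ((hu.w'.sum hv.w').mono (by omega)) (hwu.mono (by omega)) hwu'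
      (hu.eMat_ap.mono (by omega))).trans hone).mono (by omega)
  have key := cl_zero_conj_cone (k := 9 * c + 4) (ε' := ε') (r' := r') (N' := N')
    (x := (Matrix.fromBlocks (dEl u u') 0 0 (0 : Matrix μ μ (Sn X).R)).submatrix
      (swapInner ι μ) (swapInner ι μ))
    (y := Matrix.fromBlocks e 0 0 (0 : Matrix ι ι (Sn X).R))
    (z := (Matrix.fromBlocks (yMat (u.map (MatAlg.lift X)) (u'.map (MatAlg.lift X))) 0 0
      (0 : Matrix μ μ (Cn X).R)).submatrix (swapInner ι μ) (swapInner ι μ))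
    (hT.mono (by omega)) hG (hG1.mono (by omega)) (hG1'.mono (by omega))
    (((hu.dEl_qd.mono (by omega)).sum Qd.zero).submatrix _) ((hqe.mono (by omega)).sum Qd.zero)
    (by
      rw [← Matrix.submatrix_map, sum_map, mmap_zero]
      exact ((hu.dEl_ap.mono (by omega)).sum (Ap.refl 0)).submatrix _)
    ((((hu.w.lift.yMat hu.w'.lift).mono (by omega)).sum W.zero).submatrix _)
    (by
      rw [yMat, gMat_conj (eMat'_mul_eMat _ _), sum_map, mmap_zero]
      exact (hew.mono (by omega)).sum (Ap.refl 0))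
  rw [cl_submatrix hT.par, cl_sum hT.par (hqe.q hT (by omega)) (Qd.zero.q (k := 0) hT (by omega)),
    cl_sum hT.par (hu.dEl_qd.q hT (by omega)) (Qd.zero.q (k := 0) hT (by omega)), cl_zero hT.par,
    cl_zero hT.par, add_zero, add_zero] at key
  rw [key, dVal]

end Scale

/-! ## Cyclic tuples of quasi-idempotents -/

section Cyc

open MatAlg Scale

variable {A B : Type*} [Ring A] [Ring B] {ι κ : Type*} [Fintype ι] [Fintype κ] [DecidableEq ι]
  [DecidableEq κ]

/-- The multiplication by `t` on the range of `q` and by `1` on its kernel. -/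
def cyc (q t : Matrix ι ι A) : Matrix ι ι A := 1 - q + q * t

theorem cyc_one (q : Matrix ι ι A) : cyc q 1 = 1 := by rw [cyc, mul_one, sub_add_cancel]

theorem cyc_one_left (t : Matrix ι ι A) : cyc 1 t = t := by rw [cyc, one_mul, sub_self, zero_add]

theorem cyc_map (f : A →+* B) (q t : Matrix ι ι A) : (cyc q t).map f = cyc (q.map f) (t.map f) := by
  rw [cyc, mmap_add, mmap_sub, mmap_one, Matrix.map_mul, cyc]

theorem cyc_submatrix (e : κ ≃ ι) (q t : Matrix ι ι A) :
    (cyc q t).submatrix e e = cyc (q.submatrix e e) (t.submatrix e e) := by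
  simp only [cyc, Matrix.submatrix_add, Matrix.submatrix_sub, Matrix.submatrix_one_equiv,
    Pi.add_apply, Pi.sub_apply, ← Matrix.submatrix_mul_equiv _ _ e e e]

theorem cyc_sum (q t : Matrix ι ι A) (q' t' : Matrix κ κ A) :
    cyc (Matrix.fromBlocks q 0 0 q') (Matrix.fromBlocks t 0 0 t') =
      Matrix.fromBlocks (cyc q t) 0 0 (cyc q' t') := by
  rw [cyc, sum_mul_sum, ← Matrix.fromBlocks_one, fromBlocks_sub, Matrix.fromBlocks_add]
  simp [cyc]

/-- An exact identity: the failure of multiplicativity consists of a term with q² - q and a term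
with the commutator of a and q. -/
theorem cyc_mul_cyc_sub (q a b : Matrix ι ι A) :
    cyc q a * cyc q b - cyc q (a * b) =
      (q * q - q) * ((1 - a) * (1 - b)) - q * (a * q - q * a) * (1 - b) := by
  simp only [cyc]
  noncomm_ring

theorem cyc_conj {g g' : Matrix ι ι A} (h : g * g' = 1) (q t : Matrix ι ι A) :
    g * cyc q (g' * t * g) * g' = cyc (g * q * g') t := by
  have h1 : g * (q * (g' * t * g)) * g' = g * q * g' * t * (g * g') := by noncomm_ring
  rw [cyc, cyc, mul_add, add_mul, mul_sub, sub_mul, mul_one, h, h1, h, mul_one]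

/-- The permutation matrix of the permutation of the second coordinate. -/
def tperm (A : Type*) [Ring A] (ι : Type*) [DecidableEq ι] (σ : Equiv.Perm κ) :
    Matrix (ι × κ) (ι × κ) A := Equiv.Perm.permMatrix A ((Equiv.refl ι).prodCongr σ)

theorem tperm_apply (σ : Equiv.Perm κ) (a b : ι × κ) :
    tperm A ι σ a b = if a.1 = b.1 ∧ σ a.2 = b.2 then 1 else 0 := by
  rw [tperm, Equiv.Perm.permMatrix, PEquiv.toMatrix_toPEquiv_eq, Matrix.submatrix_apply,
    Matrix.one_apply]
  exact if_congr Prod.ext_iff rfl rfl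

theorem tperm_map (f : A →+* B) (σ : Equiv.Perm κ) : (tperm A ι σ).map f = tperm B ι σ := by
  ext1 a b
  rw [Matrix.map_apply, tperm_apply, tperm_apply]
  split_ifs <;> simp

theorem tperm_mul (σ τ : Equiv.Perm κ) : tperm A ι σ * tperm A ι τ = tperm A ι (τ * σ) := by
  rw [tperm, tperm, ← Matrix.permMatrix_mul]
  rfl

theorem tperm_one : tperm A ι (1 : Equiv.Perm κ) = 1 := Matrix.permMatrix_one

theorem tperm_mul_inv (σ : Equiv.Perm κ) : tperm A ι σ * tperm A ι σ⁻¹ = 1 := by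
  rw [tperm_mul, inv_mul_cancel, tperm_one]

theorem tperm_inv_mul (σ : Equiv.Perm κ) : tperm A ι σ⁻¹ * tperm A ι σ = 1 := by
  rw [tperm_mul, mul_inv_cancel, tperm_one]

theorem tperm_mul_blockDiagonal (σ : Equiv.Perm κ) (f : κ → Matrix ι ι A) :
    tperm A ι σ * Matrix.blockDiagonal f = Matrix.blockDiagonal (f ∘ σ) * tperm A ι σ := by
  have h : tperm A ι σ * Matrix.blockDiagonal f * tperm A ι σ⁻¹ = Matrix.blockDiagonal (f ∘ σ) := by
    refine (permMatrix_conj ((Equiv.refl ι).prodCongr σ) (Matrix.blockDiagonal f)).trans ?_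
    ext1 a b
    simp [Matrix.blockDiagonal_apply]
  rw [← h, mul_assoc, tperm_inv_mul, mul_one]

theorem blockDiagonal_map (f : A →+* B) (x : κ → Matrix ι ι A) :
    (Matrix.blockDiagonal x).map f = Matrix.blockDiagonal fun j => (x j).map f :=
  Matrix.blockDiagonal_map x f (map_zero f)

theorem blockDiagonal_cyc (x y : κ → Matrix ι ι A) :
    cyc (Matrix.blockDiagonal x) (Matrix.blockDiagonal y) =
      Matrix.blockDiagonal fun j => cyc (x j) (y j) := by
  rw [cyc, ← Matrix.blockDiagonal_mul, ← Matrix.blockDiagonal_one, ← Matrix.blockDiagonal_sub,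
    ← Matrix.blockDiagonal_add]
  rfl

theorem cyc_tperm_apply (f : κ → Matrix ι ι A) (σ : Equiv.Perm κ) (x y : ι × κ) :
    cyc (Matrix.blockDiagonal f) (tperm A ι σ) x y =
      (if x = y then 1 else 0) - (if x.2 = y.2 then f x.2 x.1 y.1 else 0) +
        if σ x.2 = y.2 then f x.2 x.1 y.1 else 0 := by
  rw [cyc, tperm, Equiv.Perm.permMatrix, PEquiv.mul_toMatrix_toPEquiv, Matrix.add_apply,
    Matrix.sub_apply, Matrix.one_apply, Matrix.submatrix_apply, Matrix.blockDiagonal_apply,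
    Matrix.blockDiagonal_apply]
  congr 1
  exact if_congr (Equiv.eq_symm_apply σ) rfl rfl

/-- A block row fixed by the permutation is a row of the identity matrix, whatever the block of f in
it. -/
theorem cyc_tperm_congr {f g : κ → Matrix ι ι A} {σ : Equiv.Perm κ}
    (h : ∀ j, σ j = j ∨ f j = g j) :
    cyc (Matrix.blockDiagonal f) (tperm A ι σ) = cyc (Matrix.blockDiagonal g) (tperm A ι σ) := by
  ext1 x y
  rw [cyc_tperm_apply, cyc_tperm_apply]
  obtain h | h := h x.2
  · rw [h, sub_add_cancel, sub_add_cancel]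
  · rw [h]

variable {n : ℕ}

/-- The separation of the first block. -/
def consEquiv (ι : Type*) (n : ℕ) : ι × Fin (n + 1) ≃ ι ⊕ ι × Fin n where
  toFun x := Fin.cases (Sum.inl x.1) (fun j => Sum.inr (x.1, j)) x.2
  invFun := Sum.elim (fun i => (i, 0)) fun x => (x.1, x.2.succ)
  left_inv := by
    rintro ⟨i, j⟩
    induction j using Fin.cases <;> rfl
  right_inv := by rintro (i | ⟨i, j⟩) <;> rfl

theorem blockDiagonal_cons (f : Fin (n + 1) → Matrix ι ι A) :
    Matrix.blockDiagonal f = (Matrix.fromBlocks (f 0) 0 0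
      (Matrix.blockDiagonal fun j => f j.succ)).submatrix (consEquiv ι n) (consEquiv ι n) := by
  ext1 ⟨i, a⟩ ⟨j, b⟩
  induction a using Fin.cases <;> induction b using Fin.cases <;>
    simp [Matrix.blockDiagonal_apply, consEquiv, Fin.succ_ne_zero, (Fin.succ_ne_zero _).symm]

/-- The extension of a permutation by a fixed point. -/
def fixZero (σ : Equiv.Perm (Fin n)) : Equiv.Perm (Fin (n + 1)) :=
  Equiv.Perm.decomposeFin.symm (0, σ)

theorem fixZero_zero (σ : Equiv.Perm (Fin n)) : fixZero σ 0 = 0 := by simp [fixZero]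

theorem fixZero_succ (σ : Equiv.Perm (Fin n)) (j : Fin n) : fixZero σ j.succ = (σ j).succ := by
  simp [fixZero]

theorem tperm_fixZero (σ : Equiv.Perm (Fin n)) :
    tperm A ι (fixZero σ) = (Matrix.fromBlocks 1 0 0
      (tperm A ι σ)).submatrix (consEquiv ι n) (consEquiv ι n) := by
  ext1 ⟨i, a⟩ ⟨j, b⟩
  rw [tperm_apply]
  induction a using Fin.cases <;> induction b using Fin.cases <;>
    simp [consEquiv, fixZero_zero, fixZero_succ, Fin.succ_ne_zero, (Fin.succ_ne_zero _).symm,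
      tperm_apply, Matrix.one_apply]

theorem cyc_fixZero (f : Fin (n + 1) → Matrix ι ι A) (σ : Equiv.Perm (Fin n)) :
    cyc (Matrix.blockDiagonal f) (tperm A ι (fixZero σ)) = (Matrix.fromBlocks 1 0 0
      (cyc (Matrix.blockDiagonal fun j => f j.succ) (tperm A ι σ))).submatrix
        (consEquiv ι n) (consEquiv ι n) := by
  rw [blockDiagonal_cons, tperm_fixZero, ← cyc_submatrix, cyc_sum, cyc_one]

/-- The backward rotation. -/
def back (n : ℕ) : Equiv.Perm (Fin n) := (finRotate n)⁻¹

/-- The rotation of n + 2 points is composed of a transposition of the first two points and the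
rotation of the last n + 1 points. This is how one sample point is removed. -/
theorem back_succ (n : ℕ) : back (n + 2) = fixZero (back (n + 1)) * Equiv.swap 0 1 := by
  refine inv_eq_of_mul_eq_one_right ?_
  have h : fixZero (finRotate (n + 1)) * fixZero (back (n + 1)) = 1 := by
    ext1 j
    induction j using Fin.cases with
    | zero => simp [fixZero_zero]
    | succ j => simp [fixZero_succ, back]
  have h' : finRotate (n + 2) = Equiv.swap 0 1 * fixZero (finRotate (n + 1)) := by
    rw [finRotate_succ_eq_decomposeFin]
    ext1 j
    induction j using Fin.cases with
    | zero => simp [fixZero_zero]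
    | succ j => simp [fixZero_succ]
  rw [h', mul_assoc, ← mul_assoc (fixZero _), h, one_mul, Equiv.swap_mul_self]

theorem tperm_back (n : ℕ) : tperm A ι (back (n + 2)) =
    tperm A ι (Equiv.swap 0 1) * tperm A ι (fixZero (back (n + 1))) := by
  rw [tperm_mul, back_succ]

end Cyc

/-! ### Quasi-invertibility and classes of compressed cyclic shifts. -/

namespace Scale

open MatAlg

variable {X : MatAlg.{u} p} [X.Nice] {ι κ : Type*} [Fintype ι] [Fintype κ] [DecidableEq ι]
  [DecidableEq κ] {S : Scale} {k l : ℕ} {ε' r' N' : ℝ}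

section

variable {q q' t t' a b : Matrix ι ι X.R}

theorem W.cyc (hq : S.W k q) (ht : S.W k t) : S.W (2 * k + 2) (QuantK.cyc q t) :=
  (((W.one (X := X) (ι := ι) (S := S) (k := 0)).sub hq).add (hq.mul ht)).mono (by omega)

theorem Ap.cyc (hq : S.W k q) (ht : S.W k t') (h : S.Ap k q q') (h' : S.Ap k t t') :
    S.Ap (2 * k + 2) (QuantK.cyc q t) (QuantK.cyc q' t') :=
  (((Ap.refl (X := X) (ι := ι) (S := S) (k := 0) 1).sub h).add (Ap.mul hq ht h h')).mono (by omega)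

theorem Ap.cyc_mul (hq : S.Qd k q) (ha : S.W k a) (hb : S.W k b) (h : S.Ap k (a * q) (q * a)) :
    S.Ap (3 * k + 3) (QuantK.cyc q a * QuantK.cyc q b) (QuantK.cyc q (a * b)) := by
  rw [Ap, cyc_mul_cyc_sub]
  have h1 := (W.one (X := X) (ι := ι) (S := S) (k := 0)).sub ha
  have h2 := (W.one (X := X) (ι := ι) (S := S) (k := 0)).sub hb
  exact ((hq.sm.sm.mul_right (h1.mul h2)).sub ((Sm.mul_left hq.w h.sm).mul_right h2)).mono (by omega)

/-- If t almost commutes with q, so does t' = t⁻¹, because t'q - qt' is obtained from the commutator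
of t and q by multiplying with t' on both sides, up to sign. `cyc_mul_cyc_sub` then applies to both
products. -/
theorem Inv.cyc (hq : S.Qd k q) (ht : S.W k t) (ht' : S.W k t') (e : t * t' = 1) (e' : t' * t = 1)
    (h : S.Ap k (t * q) (q * t)) : S.Inv (5 * k + 3) (QuantK.cyc q t) (QuantK.cyc q t') := by
  have h' : S.Ap (3 * k) (t' * q) (q * t') := by
    have h1 := Ap.mul_right (Ap.mul_left ht' h) ht'
    have e1 : t' * (t * q) * t' = q * t' := by rw [← mul_assoc, e', one_mul]
    have e2 : t' * (q * t) * t' = t' * q := by rw [mul_assoc, mul_assoc, e, mul_one]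
    rw [e1, e2] at h1
    exact h1.symm.mono (by omega)
  have h1 := Ap.cyc_mul hq ht ht' h
  have h2 : S.Ap (5 * k + 3) (QuantK.cyc q t' * QuantK.cyc q t) (QuantK.cyc q (t' * t)) := by
    rw [Ap, cyc_mul_cyc_sub q t' t]
    have h1 := (W.one (X := X) (ι := ι) (S := S) (k := 0)).sub ht
    have h2 := (W.one (X := X) (ι := ι) (S := S) (k := 0)).sub ht'
    exact ((hq.sm.sm.mul_right (h2.mul h1)).sub ((Sm.mul_left hq.w h'.sm).mul_right h1)).mono
      (by omega)
  rw [e, cyc_one] at h1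
  rw [e', cyc_one] at h2
  exact ⟨(W.cyc hq.w ht).mono (by omega), (W.cyc hq.w ht').mono (by omega), h1.mono (by omega), h2⟩

end

theorem W.tperm (σ : Equiv.Perm κ) : S.W k (QuantK.tperm X.R ι σ) := W.perm _

theorem Qd.blockDiagonal {f : κ → Matrix ι ι X.R} (h : ∀ j, S.Qd k (f j)) :
    S.Qd k (Matrix.blockDiagonal f) := by
  refine ⟨W.blockDiagonal fun j => (h j).w, ?_⟩
  rw [← Matrix.blockDiagonal_mul]
  exact Ap.blockDiagonal fun j => (h j).sm

theorem ap_tperm_comm {f : κ → Matrix ι ι X.R} {σ : Equiv.Perm κ}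
    (h : ∀ j, S.Ap k (f (σ j)) (f j)) :
    S.Ap k (QuantK.tperm X.R ι σ * Matrix.blockDiagonal f)
      (Matrix.blockDiagonal f * QuantK.tperm X.R ι σ) := by
  rw [tperm_mul_blockDiagonal]
  exact (Ap.mul_right (Ap.blockDiagonal h) (W.tperm (k := 0) σ)).mono (by omega)

/-- The level 5k + 3 does not involve the number of blocks. -/
theorem Inv.cyc_tperm {f : κ → Matrix ι ι X.R} {σ : Equiv.Perm κ} (hf : ∀ j, S.Qd k (f j))
    (h : ∀ j, S.Ap k (f (σ j)) (f j)) :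
    S.Inv (5 * k + 3) (QuantK.cyc (Matrix.blockDiagonal f) (QuantK.tperm X.R ι σ))
      (QuantK.cyc (Matrix.blockDiagonal f) (QuantK.tperm X.R ι σ⁻¹)) :=
  Inv.cyc (Qd.blockDiagonal hf) (W.tperm σ) (W.tperm _) (tperm_mul_inv σ) (tperm_inv_mul σ)
    (ap_tperm_comm h)

theorem cl_blockDiagonal (hP : Par ε' r' N') {i : KDeg} : ∀ {n : ℕ} (f : Fin n → Matrix ι ι X.R),
    (∀ j, Q i X ε' r' N' (f j)) →
    cl i X ε' r' N' (Matrix.blockDiagonal f) = ∑ j, cl i X ε' r' N' (f j) ∧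
      Q i X ε' r' N' (Matrix.blockDiagonal f)
  | 0, f, _ => by
    have h : Matrix.blockDiagonal f = fillMat i X (ι × Fin 0) := by
      ext1 x
      exact x.2.elim0
    rw [h, cl_fill hP, Finset.univ_eq_empty, Finset.sum_empty]
    exact ⟨rfl, Q.fill i hP.eps hP.bd⟩
  | n + 1, f, hf => by
    obtain ⟨h1, h2⟩ := cl_blockDiagonal hP (fun j => f j.succ) fun j => hf _
    rw [blockDiagonal_cons, cl_submatrix hP, cl_sum hP (hf 0) h2, h1, Fin.sum_univ_succ]
    exact ⟨rfl, ((hf 0).sum h2).submatrix _⟩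

/-- The class of the cyclic shift compressed to a tuple of quasi-idempotents. -/
noncomputable def rotCl (X : MatAlg.{u} p) (ε' r' N' : ℝ) {n : ℕ} (f : Fin n → Matrix ι ι X.R) :
    KUnital .one X.plus ε' r' N' :=
  cl .one X ε' r' N' (QuantK.cyc (Matrix.blockDiagonal f) (QuantK.tperm X.R ι (back n)))

/-- As f 0 = f 1, the transposition of the first two blocks commutes with f, and `back_succ`
decomposes the compressed shift approximately as a product. The compressed transposition depends
only on f 0, since the other blocks are fixed; the second factor is the identity on the first block
and the compressed shift of the remaining tuple. -/
theorem rotCl_cons {n : ℕ} {f : Fin (n + 2) → Matrix ι ι X.R} (hT : S.Tgt (45 * k + 60) ε' r' N')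
    (hf : ∀ j, S.Qd k (f j)) (h0 : f 0 = f 1)
    (h : ∀ j, S.Ap k (f (back (n + 1) j).succ) (f j.succ)) :
    rotCl X ε' r' N' f = cl .one X ε' r' N' (QuantK.cyc (Matrix.blockDiagonal fun _ => f 0)
      (QuantK.tperm X.R ι (Equiv.swap (0 : Fin (n + 2)) 1))) +
        rotCl X ε' r' N' fun j => f j.succ := by
  have hsw : f ∘ Equiv.swap 0 1 = f := by
    funext j
    rw [Function.comp_apply, Equiv.swap_apply_def]
    split_ifs with h1 h2
    · rw [h1, h0]
    · rw [h2, h0]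
    · rfl
  have e1 : QuantK.cyc (Matrix.blockDiagonal fun _ => f 0)
      (QuantK.tperm X.R ι (Equiv.swap (0 : Fin (n + 2)) 1)) =
      QuantK.cyc (Matrix.blockDiagonal f) (QuantK.tperm X.R ι (Equiv.swap (0 : Fin (n + 2)) 1)) := by
    refine cyc_tperm_congr fun j => ?_
    by_cases hj : j = 0
    · exact Or.inr (by rw [hj])
    · by_cases hj1 : j = 1
      · exact Or.inr (by rw [hj1, h0])
      · exact Or.inl (Equiv.swap_apply_of_ne_of_ne hj hj1)
  have hS : ∀ j, S.Ap k (f (Equiv.swap 0 1 j)) (f j) := fun j => Ap.of_eq (congrFun hsw j)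
  have hE : ∀ j, S.Ap k (f (fixZero (back (n + 1)) j)) (f j) := by
    intro j
    induction j using Fin.cases with
    | zero => exact Ap.of_eq (by rw [fixZero_zero])
    | succ j => rw [fixZero_succ]; exact h j
  have h1 : cl .one X ε' r' N' (QuantK.cyc (Matrix.blockDiagonal f)
      (QuantK.tperm X.R ι (fixZero (back (n + 1))))) = rotCl X ε' r' N' fun j => f j.succ := by
    have hI := Inv.cyc_tperm (f := fun j : Fin (n + 1) => f j.succ) (fun j => hf j.succ) h
    rw [cyc_fixZero, cl_submatrix hT.par, cl_sum hT.par (Inv.one.q (k := 0) hT (by omega))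
      (hI.q hT (by omega)), cl_one hT.par, zero_add, rotCl]
  rw [e1, ← h1, ← cl_one_mul (hT.mono (by omega)) (Inv.cyc_tperm hf hS) (Inv.cyc_tperm hf hE), rotCl,
    tperm_back]
  refine (cl_one_near (k := 15 * k + 10) (hT.mono (by omega))
    (((Inv.cyc_tperm hf hS).mul (Inv.cyc_tperm hf hE)).mono (by omega))
    ((W.cyc (k := k) (W.blockDiagonal fun j => (hf j).w)
      ((W.tperm (k := 0) _).mul (W.tperm (k := 0) _) |>.mono (by omega))).mono (by omega))
    ((Ap.cyc_mul (Qd.blockDiagonal hf) (W.tperm _) (W.tperm _) (ap_tperm_comm hS)).mono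
      (by omega))).symm

end Scale

namespace Scale

open MatAlg

variable {X : MatAlg.{u} p} {ι κ : Type*} [Fintype ι] [Fintype κ] {S : Scale} {k l m n : ℕ}
  {Z : Set unitInterval}

/-! ## Subdivisions of paths -/

/-- The values of `x` at points of distance at most `1 / (n + 1)` differ by at most `Λ ^ k ε`. -/
def Osc (S : Scale) (k n : ℕ) (x : Matrix ι ι (pathAlg Z X).R) : Prop :=
  ∀ a b : unitInterval, |(a : ℝ) - b| ≤ 1 / (n + 1) → S.Ap k (x.map (ev Z X a)) (x.map (ev Z X b))

theorem Osc.mono {x : Matrix ι ι (pathAlg Z X).R} (h : S.Osc k m x) (hmn : m ≤ n) :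
    S.Osc k n x := fun a b hab => h a b (hab.trans (Nat.one_div_le_one_div hmn))

/-- The finitely many entries are uniformly continuous, and the norm of a matrix is at most the sum
of the norms of its entries. The bound for n depends on x and its size. -/
theorem osc_eventually (x : Matrix ι ι (pathAlg Z X).R) : ∀ᶠ n in atTop, S.Osc k n x := by
  obtain ⟨δ, hδ, h⟩ : ∃ δ > 0, Fintype.card ι * (Fintype.card ι * δ) ≤ S.base ^ k * S.eps := by
    have h0 := mul_pos (S.pow_pos k) S.eps_pos
    refine ⟨S.base ^ k * S.eps / (Fintype.card ι * Fintype.card ι + 1), by positivity, ?_⟩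
    rw [← mul_assoc, mul_div_assoc', div_le_iff₀ (by positivity)]
    nlinarith
  have h1 : ∀ i j, ∀ᶠ n : ℕ in atTop, ∀ a b : unitInterval, |(a : ℝ) - b| ≤ 1 / (n + 1) →
      ‖((pathAlg Z X).snd (x i j)).1 a - ((pathAlg Z X).snd (x i j)).1 b‖ ≤ δ := by
    intro i j
    obtain ⟨η, hη, h2⟩ := Metric.uniformContinuous_iff.1 (CompactSpace.uniformContinuous_of_continuous
      ((pathAlg Z X).snd (x i j)).1.continuous) δ hδ
    filter_upwards [(tendsto_one_div_add_atTop_nhds_zero_nat (𝕜 := ℝ)).eventually (gt_mem_nhds hη)]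
      with n hn a b hab
    have h3 := h2 (a := a) (b := b) (by rw [Subtype.dist_eq, Real.dist_eq]; exact hab.trans_lt hn)
    rw [dist_eq_norm] at h3
    exact h3.le
  filter_upwards [eventually_all.2 fun i => eventually_all.2 (h1 i)] with n hn a b hab
  refine le_trans ?_ h
  refine (nrmR_le_sum _ _).trans ?_
  refine (Finset.sum_le_card_nsmul _ _ (Fintype.card ι * δ) fun i _ =>
    (Finset.sum_le_card_nsmul _ _ δ fun j _ => ?_).trans_eq ?_).trans_eq ?_
  · rw [toFin, Matrix.submatrix_apply, Matrix.sub_apply, Matrix.map_apply, Matrix.map_apply, map_sub,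
      map_sub, ev_fst, ev_fst, ev_snd, ev_snd, sub_self, norm_zero, zero_add]
    exact hn _ _ a b hab
  · simp
  · simp

/-- Equidistant points. -/
noncomputable def pts (n : ℕ) (j : Fin (n + 1)) : unitInterval :=
  ⟨j / (n + 1), by positivity, (div_le_one (by positivity)).2 (by exact_mod_cast j.2.le)⟩

theorem pts_zero (n : ℕ) : pts n 0 = 0 := by simp [pts]

/-- The point that divides the segment from `a` to `b` in the ratio `s : 1 - s`. -/
noncomputable def between (a b s : unitInterval) : unitInterval :=
  ⟨(1 - s) * a + s * b, by
    have := s.2.1; have := s.2.2; have := a.2.1; have := b.2.1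
    have : (0 : ℝ) ≤ 1 - s := by linarith
    positivity, by
    have := s.2.1; have := s.2.2; have := a.2.2; have := b.2.2
    nlinarith⟩

theorem between_zero (a b : unitInterval) : between a b 0 = a := by simp [between]

theorem between_one (a b : unitInterval) : between a b 1 = b := by simp [between]

theorem between_self (a s : unitInterval) : between a a s = a := by
  ext
  simp only [between]
  ring

theorem abs_between_sub_le (a b s t : unitInterval) :
    |(between a b t : ℝ) - between a b s| ≤ |(t : ℝ) - s| := by
  have h : (between a b t : ℝ) - between a b s = (t - s) * (b - a) := by
    simp only [between]
    ring
  rw [h, abs_mul]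
  refine mul_le_of_le_one_right (abs_nonneg _) (abs_le.2 ⟨?_, ?_⟩) <;>
    linarith [a.2.1, a.2.2, b.2.1, b.2.2]

theorem abs_between_le {a b a' b' : unitInterval} {δ : ℝ} (h : |(a' : ℝ) - a| ≤ δ)
    (h' : |(b' : ℝ) - b| ≤ δ) (s : unitInterval) : |(between a' b' s : ℝ) - between a b s| ≤ δ := by
  have e : (between a' b' s : ℝ) - between a b s = (1 - s) * (a' - a) + s * (b' - b) := by
    simp only [between]
    ring
  have := s.2.1; have := s.2.2
  rw [abs_le] at *
  rw [e]
  constructor <;> nlinarith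

/-- The successive points of `τ` are close. -/
structure Steps (δ : ℝ) {n : ℕ} (τ : Fin (n + 1) → unitInterval) : Prop where
  zero : τ 0 = 0
  step : ∀ i : Fin n, |(τ i.castSucc : ℝ) - τ i.succ| ≤ δ
  last : |(τ (Fin.last n) : ℝ) - (1 : unitInterval)| ≤ δ

theorem steps_pts (n : ℕ) : Steps (1 / (n + 1)) (pts n) where
  zero := pts_zero n
  step i := by
    have h : ((pts n i.castSucc : unitInterval) : ℝ) - pts n i.succ = -(1 / (n + 1)) := by
      simp only [pts, Fin.val_castSucc, Fin.val_succ, Nat.cast_add, Nat.cast_one]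
      ring
    rw [h, abs_neg, abs_of_pos (by positivity)]
  last := by
    have h : ((pts n (Fin.last n) : unitInterval) : ℝ) - (1 : unitInterval) = -(1 / (n + 1)) := by
      simp only [pts, Fin.val_last, Set.Icc.coe_one]
      field_simp
      ring
    rw [h, abs_neg, abs_of_pos (by positivity)]

theorem Steps.mono {δ δ' : ℝ} {τ : Fin (n + 1) → unitInterval} (h : Steps δ τ) (hδ : δ ≤ δ') :
    Steps δ' τ := ⟨h.zero, fun i => (h.step i).trans hδ, h.last.trans hδ⟩

theorem Steps.cons {δ : ℝ} (hδ : 0 ≤ δ) {τ : Fin (n + 1) → unitInterval} (h : Steps δ τ) :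
    Steps (n := n + 1) δ (Fin.cons 0 τ : Fin (n + 2) → unitInterval) where
  zero := rfl
  step i := by
    induction i using Fin.cases with
    | zero => simpa [h.zero] using hδ
    | succ i => simpa using h.step i
  last := by simpa [← Fin.succ_last] using h.last

theorem Steps.between {δ : ℝ} {τ τ' : Fin (n + 1) → unitInterval} (h : Steps δ τ) (h' : Steps δ τ')
    (s : unitInterval) : Steps δ fun j => Scale.between (τ j) (τ' j) s where
  zero := by rw [h.zero, h'.zero, between_self]
  step i := abs_between_le (h.step i) (h'.step i) s
  last := by
    have := abs_between_le h.last h'.last s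
    rwa [between_self] at this

/-- The shift compares neighbouring sample points. At the end of the tuple it compares the last
point, which is close to 1, with 0, and there g(1) = g(0) is used. -/
theorem ap_steps {g : unitInterval → Matrix ι ι X.R}
    (ho : ∀ a b : unitInterval, |(a : ℝ) - b| ≤ 1 / (m + 1) → S.Ap k (g a) (g b)) (h01 : g 1 = g 0)
    {τ : Fin (n + 1) → unitInterval} (hτ : Steps (1 / (m + 1)) τ) (j : Fin (n + 1)) :
    S.Ap k (g (τ (back (n + 1) j))) (g (τ j)) := by
  obtain ⟨i, rfl⟩ := (finRotate (n + 1)).surjective j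
  have e : back (n + 1) (finRotate (n + 1) i) = i := (finRotate (n + 1)).symm_apply_apply i
  rw [e]
  induction i using Fin.lastCases with
  | last =>
    rw [finRotate_last, hτ.zero, ← h01]
    exact ho _ _ hτ.last
  | cast i =>
    have e' : finRotate (n + 1) i.castSucc = i.succ := finRotate_of_lt i.2
    rw [e']
    exact ho _ _ (hτ.step i)

theorem map_ev_one (x : Matrix ι ι (Sn X).R) : x.map (ev {0, 1} X 1) = x.map (ev {0, 1} X 0) := by
  ext1 i j
  rw [Matrix.map_apply, Matrix.map_apply, ev_susp_one, ← ev_susp_zero]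

/-! ## The Bott map -/

variable [DecidableEq ι] [DecidableEq κ] [X.Nice] {ε' r' N' ε r N : ℝ}

theorem rotCl_near {f g : Fin n → Matrix ι ι X.R} (hT : S.Tgt (10 * k + 12) ε' r' N')
    (hf : ∀ j, S.Qd k (f j)) (h : ∀ j, S.Ap k (f (back n j)) (f j)) (hg : ∀ j, S.W k (g j))
    (hfg : ∀ j, S.Ap k (f j) (g j)) : rotCl X ε' r' N' f = rotCl X ε' r' N' g :=
  cl_one_near (k := 5 * k + 3) (hT.mono (by omega)) (Inv.cyc_tperm hf h)
    ((W.cyc (W.blockDiagonal hg) (W.tperm _)).mono (by omega))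
    ((Ap.cyc (W.blockDiagonal fun j => (hf j).w) (W.tperm _) (Ap.blockDiagonal hfg)
      (Ap.refl _)).mono (by omega))

/-- The class of the cyclic shift compressed to the values of `e` at `n + 1` equidistant points. -/
noncomputable def bVal (ε' r' N' : ℝ) (n : ℕ) (e : Matrix ι ι (Sn X).R) :
    KUnital .one X.plus ε' r' N' :=
  rotCl X ε' r' N' (fun j => e.map (ev {0, 1} X (pts n j))) -
    rotCl X ε' r' N' (fun _ : Fin (n + 1) => e.map (ev {0, 1} X 0))

variable {e e₁ : Matrix ι ι (Sn X).R}

/-- Two tuples of sample points are joined by linear interpolation, which preserves the distance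
bounds between successive points. Along the interpolation the class is locally constant. -/
theorem rotCl_steps {g : unitInterval → Matrix ι ι X.R} (hT : S.Tgt (10 * k + 12) ε' r' N')
    (hg : ∀ t, S.Qd k (g t))
    (ho : ∀ a b : unitInterval, |(a : ℝ) - b| ≤ 1 / (m + 1) → S.Ap k (g a) (g b)) (h01 : g 1 = g 0)
    {τ τ' : Fin (n + 1) → unitInterval} (hτ : Steps (1 / (m + 1)) τ) (hτ' : Steps (1 / (m + 1)) τ') :
    rotCl X ε' r' N' (fun j => g (τ j)) = rotCl X ε' r' N' (fun j => g (τ' j)) := by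
  have h : ∀ s : unitInterval, ∀ᶠ t in 𝓝 s,
      rotCl X ε' r' N' (fun j => g (between (τ j) (τ' j) t)) =
        rotCl X ε' r' N' (fun j => g (between (τ j) (τ' j) s)) := fun s => by
    have h1 : ∀ᶠ t : unitInterval in 𝓝 s, |(t : ℝ) - s| ≤ 1 / (m + 1) := by
      have h2 := Metric.closedBall_mem_nhds s (Nat.one_div_pos_of_nat (α := ℝ) (n := m))
      filter_upwards [h2] with t ht
      rwa [Metric.mem_closedBall, Subtype.dist_eq, Real.dist_eq] at ht
    filter_upwards [h1] with t ht
    exact rotCl_near hT (fun j => hg _) (ap_steps ho h01 (hτ.between hτ' t)) (fun j => (hg _).w)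
      fun j => ho _ _ ((abs_between_sub_le _ _ s t).trans ht)
  have h' := eq_of_eventually_eq h
  simpa only [between_zero, between_one] using h'

/-- The n + 2 equidistant points are moved to the n + 1 equidistant points with the initial point
doubled, and `rotCl_cons` removes the double. The transposition that splits off involves only g(0),
so that it also occurs for the constant tuple and cancels in the difference. -/
theorem rotCl_succ {g : unitInterval → Matrix ι ι X.R} (hT : S.Tgt (45 * k + 60) ε' r' N')
    (hg : ∀ t, S.Qd k (g t))
    (ho : ∀ a b : unitInterval, |(a : ℝ) - b| ≤ 1 / (n + 1) → S.Ap k (g a) (g b)) (h01 : g 1 = g 0) :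
    rotCl X ε' r' N' (fun j => g (pts (n + 1) j)) - rotCl X ε' r' N' (fun _ : Fin (n + 2) => g 0) =
      rotCl X ε' r' N' (fun j => g (pts n j)) - rotCl X ε' r' N' (fun _ : Fin (n + 1) => g 0) := by
  have hn : (0 : ℝ) ≤ 1 / (n + 1) := by positivity
  have h1 := rotCl_steps (hT.mono (by omega)) hg ho h01
    ((steps_pts (n + 1)).mono (Nat.one_div_le_one_div n.le_succ)) ((steps_pts n).cons hn)
  have h2 := rotCl_cons (f := fun j => g ((Fin.cons 0 (pts n) : Fin (n + 2) → unitInterval) j)) hT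
    (fun j => hg _) (congrArg g (pts_zero n).symm) (ap_steps ho h01 (steps_pts n))
  have h3 := rotCl_cons (f := fun _ : Fin (n + 2) => g 0) hT (fun j => hg _) rfl fun j => Ap.refl _
  rw [h1, h2, h3]
  exact add_sub_add_left_eq_sub _ _ _

/-- Only e has to oscillate little: the shift compressed to the samples of e is quasi-invertible,
and the one belonging to e₁ is a small perturbation of it. -/
theorem bVal_near (hT : S.Tgt (10 * k + 12) ε' r' N') (he : S.Qd k e) (ho : S.Osc k n e)
    (he' : S.W k e₁) (h : S.Ap k e e₁) : bVal ε' r' N' n e = bVal ε' r' N' n e₁ := by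
  have hg : ∀ t, S.Qd k (e.map (ev {0, 1} X t)) := fun t => he.map (contr_ev t)
  have hg' : ∀ t, S.W k (e₁.map (ev {0, 1} X t)) := fun t => he'.map (contr_ev t)
  have hgg : ∀ t, S.Ap k (e.map (ev {0, 1} X t)) (e₁.map (ev {0, 1} X t)) :=
    fun t => h.map (contr_ev t)
  refine congrArg₂ (· - ·) ?_ ?_
  · exact rotCl_near hT (fun j => hg _) (ap_steps ho (map_ev_one e) (steps_pts n)) (fun j => hg' _)
      fun j => hgg _
  · exact rotCl_near hT (fun j => hg _) (fun j => Ap.refl _) (fun j => hg' _) fun j => hgg _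

theorem bVal_succ (hT : S.Tgt (45 * k + 60) ε' r' N') (he : S.Qd k e) (ho : S.Osc k n e) :
    bVal ε' r' N' (n + 1) e = bVal ε' r' N' n e := by
  have hg : ∀ t, S.Qd k (e.map (ev {0, 1} X t)) := fun t => he.map (contr_ev t)
  have h := rotCl_succ (n := n) (g := fun t => e.map (ev {0, 1} X t)) hT hg ho (map_ev_one e)
  rw [bVal, bVal]
  exact h

theorem bVal_eq (hT : S.Tgt (45 * k + 60) ε' r' N') (he : S.Qd k e) (ho : S.Osc k m e)
    (hmn : m ≤ n) : bVal ε' r' N' n e = bVal ε' r' N' m e := by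
  induction n, hmn using Nat.le_induction with
  | base => rfl
  | succ n hmn ih => rw [bVal_succ hT he (ho.mono hmn), ih]

end Scale

/-! ### Additivity of the Bott map and its construction on `K`-groups. -/

section

variable {A : Type*} [Ring A] {ι κ o : Type*} [Fintype ι] [Fintype κ] [DecidableEq ι]
  [DecidableEq κ] [Fintype o] [DecidableEq o]

theorem blockDiagonal_sum (f : o → Matrix ι ι A) (g : o → Matrix κ κ A) :
    Matrix.blockDiagonal (fun j => Matrix.fromBlocks (f j) 0 0 (g j)) =
      (Matrix.fromBlocks (Matrix.blockDiagonal f) 0 0 (Matrix.blockDiagonal g)).submatrix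
        (Equiv.sumProdDistrib ι κ o) (Equiv.sumProdDistrib ι κ o) := by
  ext1 ⟨i, a⟩ ⟨j, b⟩
  rcases i with i | i <;> rcases j with j | j <;> simp [Matrix.blockDiagonal_apply]

theorem tperm_sum (σ : Equiv.Perm o) : tperm A (ι ⊕ κ) σ =
    (Matrix.fromBlocks (tperm A ι σ) 0 0 (tperm A κ σ)).submatrix
      (Equiv.sumProdDistrib ι κ o) (Equiv.sumProdDistrib ι κ o) := by
  ext1 ⟨i, a⟩ ⟨j, b⟩
  rw [tperm_apply]
  rcases i with i | i <;> rcases j with j | j <;> simp [tperm_apply]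

theorem blockDiagonal_submatrix (e : κ ≃ ι) (f : o → Matrix ι ι A) :
    Matrix.blockDiagonal (fun j => (f j).submatrix e e) =
      (Matrix.blockDiagonal f).submatrix (e.prodCongr (Equiv.refl o)) (e.prodCongr (Equiv.refl o)) := by
  ext1 ⟨i, a⟩ ⟨j, b⟩
  simp [Matrix.blockDiagonal_apply]

theorem tperm_submatrix (e : κ ≃ ι) (σ : Equiv.Perm o) : tperm A κ σ =
    (tperm A ι σ).submatrix (e.prodCongr (Equiv.refl o)) (e.prodCongr (Equiv.refl o)) := by
  ext1 ⟨i, a⟩ ⟨j, b⟩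
  simp [tperm_apply]

end

namespace Scale

open MatAlg

variable {X : MatAlg.{u} p} [X.Nice] {ι κ : Type*} [Fintype ι] [Fintype κ] [DecidableEq ι]
  [DecidableEq κ] {S : Scale} {k l m n : ℕ} {ε' r' N' ε r N : ℝ}

theorem rotCl_submatrix (hP : Par ε' r' N') (e : κ ≃ ι) (f : Fin n → Matrix ι ι X.R) :
    rotCl X ε' r' N' (fun j => (f j).submatrix e e) = rotCl X ε' r' N' f := by
  rw [rotCl, blockDiagonal_submatrix, tperm_submatrix e, ← cyc_submatrix, cl_submatrix hP, rotCl]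

theorem rotCl_sum {f : Fin n → Matrix ι ι X.R} {g : Fin n → Matrix κ κ X.R}
    (hT : S.Tgt (5 * k + 4) ε' r' N') (hf : ∀ j, S.Qd k (f j)) (h : ∀ j, S.Ap k (f (back n j)) (f j))
    (hg : ∀ j, S.Qd k (g j)) (h' : ∀ j, S.Ap k (g (back n j)) (g j)) :
    rotCl X ε' r' N' (fun j => Matrix.fromBlocks (f j) 0 0 (g j)) =
      rotCl X ε' r' N' f + rotCl X ε' r' N' g := by
  rw [rotCl, blockDiagonal_sum, tperm_sum, ← cyc_submatrix, cl_submatrix hT.par, cyc_sum,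
    cl_sum hT.par ((Inv.cyc_tperm hf h).q hT (by omega)) ((Inv.cyc_tperm hg h').q hT (by omega)),
    rotCl, rotCl]

theorem bVal_submatrix (hP : Par ε' r' N') (f : κ ≃ ι) (e : Matrix ι ι (Sn X).R) :
    bVal ε' r' N' n (e.submatrix f f) = bVal ε' r' N' n e := by
  rw [bVal, bVal, ← rotCl_submatrix hP f, ← rotCl_submatrix hP f]
  rfl

theorem bVal_sum {e : Matrix ι ι (Sn X).R} {e' : Matrix κ κ (Sn X).R}
    (hT : S.Tgt (5 * k + 4) ε' r' N') (he : S.Qd k e) (ho : S.Osc k n e) (he' : S.Qd k e')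
    (ho' : S.Osc k n e') :
    bVal ε' r' N' n (Matrix.fromBlocks e 0 0 e') = bVal ε' r' N' n e + bVal ε' r' N' n e' := by
  have hg : ∀ t, S.Qd k (e.map (ev {0, 1} X t)) := fun t => he.map (contr_ev t)
  have hg' : ∀ t, S.Qd k (e'.map (ev {0, 1} X t)) := fun t => he'.map (contr_ev t)
  have h1 := rotCl_sum hT (fun j : Fin (n + 1) => hg _) (ap_steps ho (map_ev_one e) (steps_pts n))
    (fun j => hg' _) (ap_steps ho' (map_ev_one e') (steps_pts n))
  have h2 := rotCl_sum hT (fun j : Fin (n + 1) => hg 0) (fun j => Ap.refl _) (fun j => hg' 0)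
    (fun j => Ap.refl _)
  simp only [bVal, sum_map]
  rw [h1, h2]
  abel

theorem bVal_const {e : Matrix ι ι (Sn X).R} (h : ∀ t, e.map (ev {0, 1} X t) = e.map (ev {0, 1} X 0)) :
    bVal ε' r' N' n e = 0 := by
  rw [bVal, sub_eq_zero]
  exact congrArg _ (funext fun j => h _)

open Classical in
/-- The eventual value of `bVal ε' r' N' n e`. -/
noncomputable def bLim (ε' r' N' : ℝ) (e : Matrix ι ι (Sn X).R) : KUnital .one X.plus ε' r' N' :=
  if h : ∃ v, ∀ᶠ n in atTop, bVal ε' r' N' n e = v then h.choose else 0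

theorem bLim_eq {e : Matrix ι ι (Sn X).R} {v : KUnital .one X.plus ε' r' N'}
    (h : ∀ᶠ n in atTop, bVal ε' r' N' n e = v) : bLim ε' r' N' e = v := by
  have h' : ∃ v, ∀ᶠ n in atTop, bVal ε' r' N' n e = v := ⟨v, h⟩
  rw [bLim, dif_pos h']
  obtain ⟨n, h1, h2⟩ := (h'.choose_spec.and h).exists
  exact h1.symm.trans h2

theorem bLim_spec (hT : S.Tgt (45 * k + 60) ε' r' N') {e : Matrix ι ι (Sn X).R} (he : S.Qd k e) :
    ∀ᶠ n in atTop, bVal ε' r' N' n e = bLim ε' r' N' e := by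
  obtain ⟨m, hm⟩ := (osc_eventually (S := S) (k := k) e).exists
  have h : ∀ᶠ n in atTop, bVal ε' r' N' n e = bVal ε' r' N' m e := by
    filter_upwards [eventually_ge_atTop m] with n hn
    exact bVal_eq hT he hm hn
  rwa [bLim_eq h]

/-- The number of sample points has no uniform bound on the group. The eventual value `bLim` removes
it, and every property is checked at sufficiently large numbers of points. -/
theorem exists_bott (X : MatAlg.{u} p) [X.Nice] (hP : Par ε r N)
    (hT : (Scale.of hP).Tgt 200 ε' r' N') :
    ∃ F : KUnital .zero (Sn X).plus ε r N →+ KUnital .one X.plus ε' r' N',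
      ∀ (n : ℕ) (e : Matrix (Fin n) (Fin n) (Sn X).R) (he : IsQuasi .zero (Sn X).plus ε r N e),
        ∀ᶠ m in atTop, F (kClass .zero (Sn X).plus ε r N e he) = bVal ε' r' N' m e := by
  have hI : ∀ {n : ℕ} {e : Matrix (Fin n) (Fin n) (Sn X).R}, (Sn X).QI ε r N e →
    (Scale.of hP).Qd 2 e := fun h => qd_of_qi hP (qi_four hP h)
  have hT' : (Scale.of hP).Tgt (45 * 2 + 60) ε' r' N' := hT.mono (by omega)
  have h1 : ∀ n x y, Q .zero (Sn X) ε r N x → Q .zero (Sn X) ε r N y → Htp .zero (Sn X) ε r N x y →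
      bLim (ι := Fin n) ε' r' N' x = bLim ε' r' N' y := by
    rintro n x y - - ⟨γ, hγ, rfl, rfl, hq⟩
    have hI' : ∀ t, (Scale.of hP).Qd 2 (γ t) := fun t =>
      qd_of_qi hP ⟨(hq t).idem, (hq t).fil.mono (by linarith [hP.prop]), (hq t).bd, (hq t).bd'⟩
    refine eq_of_eventually_eq (f := fun t => bLim ε' r' N' (γ t)) fun s => ?_
    filter_upwards [ap_eventually (S := Scale.of hP) (k := 2) hγ s] with t ht
    refine bLim_eq ?_
    -- A number of points that is large enough for γ s also serves for nearby γ t, without any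
    -- estimate of the oscillation of γ t.
    filter_upwards [bLim_spec hT' (hI' s), osc_eventually (S := Scale.of hP) (k := 2) (γ s)]
      with m hm ho
    rw [← hm]
    exact (bVal_near (k := 2) (hT.mono (by omega)) (hI' s) ho (hI' t).w ht.symm).symm
  have h2 : ∀ n m x y, Q .zero (Sn X) ε r N x → Q .zero (Sn X) ε r N y →
      bLim (ι := Fin (n + m)) ε' r' N' (bdiag x y) = bLim (ι := Fin n) ε' r' N' x +
        bLim (ι := Fin m) ε' r' N' y := by
    intro n m x y hx hy
    refine bLim_eq ?_
    filter_upwards [bLim_spec hT' (hI hx), bLim_spec hT' (hI hy),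
      osc_eventually (S := Scale.of hP) (k := 2) x, osc_eventually (S := Scale.of hP) (k := 2) y]
      with k h1 h2 h3 h4
    rw [← h1, ← h2]
    exact (bVal_submatrix hT.par _ _).trans (bVal_sum (hT.mono (by omega)) (hI hx) h3 (hI hy) h4)
  have h3 : ∀ n, bLim ε' r' N' (fillMat .zero (Sn X) (Fin n)) = 0 := by
    intro n
    refine bLim_eq (Eventually.of_forall fun m => bVal_const fun t => ?_)
    exact (mmap_zero _).trans (mmap_zero _).symm
  obtain ⟨F, hF⟩ := exists_hom hP (fun n (e : Matrix (Fin n) (Fin n) (Sn X).R) => bLim ε' r' N' e)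
    h1 h2 h3
  refine ⟨F, fun n e he => ?_⟩
  filter_upwards [bLim_spec hT' (hI ((isQuasi_iff (i := .zero) e).1 he))] with m hm
  exact (hF n e he).trans hm.symm

end Scale

/-! ## The Bott map after the boundary map -/

theorem back_succ_apply {n : ℕ} (i : Fin n) : back (n + 1) i.succ = i.castSucc := by
  have e' : finRotate (n + 1) i.castSucc = i.succ := finRotate_of_lt i.2
  rw [← e']
  exact (finRotate (n + 1)).symm_apply_apply _

theorem back_zero {n : ℕ} : back (n + 1) 0 = Fin.last n := by
  rw [← finRotate_last]
  exact (finRotate (n + 1)).symm_apply_apply _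

namespace Scale

open MatAlg

variable {X : MatAlg.{u} p} [X.Nice] {ι κ : Type*} [Fintype ι] [Fintype κ] [DecidableEq ι]
  [DecidableEq κ] {S : Scale} {k l m n : ℕ} {ε' r' N' ε r N : ℝ}

theorem Inv.blockDiagonal {f f' : κ → Matrix ι ι X.R} (h : ∀ j, S.Inv k (f j) (f' j)) :
    S.Inv k (Matrix.blockDiagonal f) (Matrix.blockDiagonal f') := by
  refine ⟨W.blockDiagonal fun j => (h j).w, W.blockDiagonal fun j => (h j).w', ?_, ?_⟩
  · rw [← Matrix.blockDiagonal_mul, ← Matrix.blockDiagonal_one]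
    exact Ap.blockDiagonal fun j => (h j).sm
  · rw [← Matrix.blockDiagonal_mul, ← Matrix.blockDiagonal_one]
    exact Ap.blockDiagonal fun j => (h j).sm'

theorem cl_one_conj {g g' x x' : Matrix ι ι X.R} (hT : S.Tgt (27 * k + 50) ε' r' N')
    (hg : S.Inv k g g') (hx : S.Inv k x x') :
    cl .one X ε' r' N' (g * x * g') = cl .one X ε' r' N' x := by
  rw [cl_one_mul (k := 3 * k + 1) (hT.mono (by omega)) (hg.mul hx) (hg.symm.mono (by omega)),
    cl_one_mul (k := k) (hT.mono (by omega)) hg hx]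
  have h := cl_one_inv (hT.mono (by omega)) hg
  rw [add_right_comm, h, zero_add]

/-- With E and E' the block diagonal matrices, cyc(EqE', T) = E cyc(q, E'TE) E', and E'TE is the
block diagonal matrix of the transition matrices E'_j E_{j-1} (indices modulo n + 1) times T. All
transitions are close to 1 except the one from the last block to the first, which is close to v. As
v commutes with q, the matrix factors approximately into cyc(q, V) and cyc(q, T), and the class of
the first factor is that of cyc(q, v). -/
theorem rotCl_conj {E E' f : Fin (n + 1) → Matrix ι ι X.R} {q v y : Matrix ι ι X.R}
    (hT : S.Tgt (81 * l + 400) ε' r' N') (hE : ∀ j, S.W l (E j)) (hE' : ∀ j, S.W l (E' j))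
    (h1 : ∀ j, E j * E' j = 1) (h2 : ∀ j, E' j * E j = 1) (hq : S.W 0 q) (hqq : q * q = q)
    (hf : ∀ j, S.W l (f j)) (hfE : ∀ j, S.Ap l (f j) (E j * q * E' j)) (hv : S.W l v)
    (hvq : v * q = q * v) (hy : S.Inv l (cyc q v) y) (hd : S.Ap l (E' 0 * E (Fin.last n)) v)
    (hd' : ∀ i : Fin n, S.Ap l (E' i.succ * E i.castSucc) 1) :
    rotCl X ε' r' N' f =
      cl .one X ε' r' N' (cyc q v) + rotCl X ε' r' N' (fun _ : Fin (n + 1) => q) := by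
  obtain ⟨V, hV⟩ : ∃ V : Fin (n + 1) → Matrix ι ι X.R, V = Fin.cons v fun _ => 1 := ⟨_, rfl⟩
  have hVw : ∀ j, S.W l (V j) := by
    intro j
    rw [hV]
    induction j using Fin.cases with
    | zero => exact hv
    | succ j => exact W.one
  have hVd : ∀ j, S.Ap l (E' j * E (back (n + 1) j)) (V j) := by
    intro j
    rw [hV]
    induction j using Fin.cases with
    | zero => rw [back_zero]; exact hd
    | succ j => rw [back_succ_apply]; exact hd' j
  have hVc : S.Inv l (Matrix.blockDiagonal fun j => cyc q (V j))
      (Matrix.blockDiagonal (Fin.cons y fun _ => 1 : Fin (n + 1) → Matrix ι ι X.R)) := by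
    refine Inv.blockDiagonal fun j => ?_
    rw [hV]
    induction j using Fin.cases with
    | zero => exact hy
    | succ j =>
      simp only [Fin.cons_succ, cyc_one]
      exact Inv.one
  have hVcl : cl .one X ε' r' N' (Matrix.blockDiagonal fun j => cyc q (V j)) =
      cl .one X ε' r' N' (cyc q v) := by
    have h : ∀ j : Fin n, cyc q (V j.succ) = 1 := fun j => by
      rw [hV, Fin.cons_succ, cyc_one]
    have h' : cyc q (V 0) = cyc q v := by rw [hV, Fin.cons_zero]
    rw [(cl_blockDiagonal hT.par _ fun j => ?_).1, Fin.sum_univ_succ, h', Finset.sum_eq_zero, add_zero]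
    · intro j _
      rw [h, cl_one hT.par]
    · induction j using Fin.cases with
      | zero => rw [h']; exact hy.q hT (by omega)
      | succ j => rw [h]; exact Inv.one.q (k := 0) hT (by omega)
  have hQ : S.Qd 0 (Matrix.blockDiagonal fun _ : Fin (n + 1) => q) :=
    Qd.blockDiagonal fun _ => ⟨hq, Ap.of_eq hqq⟩
  have hR : S.Inv 3 _ _ := Inv.cyc_tperm (f := fun _ : Fin (n + 1) => q) (σ := back (n + 1))
    (fun _ => ⟨hq, Ap.of_eq hqq⟩) fun _ => Ap.refl (k := 0) _
  have hW : S.Inv l (Matrix.blockDiagonal E) (Matrix.blockDiagonal E') :=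
    Inv.blockDiagonal fun j => Inv.of_eq (hE j) (hE' j) (h1 j) (h2 j)
  have hM := (hVc.mono (show l ≤ l + 3 by omega)).mul (hR.mono (show 3 ≤ l + 3 by omega))
  have e1 : cl .one X ε' r' N' (Matrix.blockDiagonal E * ((Matrix.blockDiagonal fun j => cyc q (V j)) *
      cyc (Matrix.blockDiagonal fun _ : Fin (n + 1) => q) (tperm X.R ι (back (n + 1)))) *
        Matrix.blockDiagonal E') =
      cl .one X ε' r' N' (cyc q v) + rotCl X ε' r' N' (fun _ : Fin (n + 1) => q) := by
    rw [cl_one_conj (k := 3 * (l + 3) + 1) (hT.mono (by omega)) (hW.mono (by omega)) hM,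
      cl_one_mul (k := l + 3) (hT.mono (by omega)) (hVc.mono (by omega)) (hR.mono (by omega)), hVcl,
      rotCl]
  rw [← e1, rotCl]
  have hMM := (((hW.mono (show l ≤ 3 * (l + 3) + 1 by omega)).mul hM).mono
    (show _ ≤ 9 * l + 31 by omega)).mul (hW.symm.mono (by omega))
  have hTw : S.W l (tperm X.R ι (back (n + 1))) := W.tperm _
  have hTw0 : S.W 0 (tperm X.R ι (back (n + 1))) := W.tperm _
  have hEE : Matrix.blockDiagonal E * Matrix.blockDiagonal E' = 1 := by
    rw [← Matrix.blockDiagonal_mul, ← Matrix.blockDiagonal_one]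
    exact congrArg _ (funext h1)
  have a1 : S.Ap (4 * l + 2) (cyc (Matrix.blockDiagonal f) (tperm X.R ι (back (n + 1))))
      (cyc (Matrix.blockDiagonal E * (Matrix.blockDiagonal fun _ => q) * Matrix.blockDiagonal E')
        (tperm X.R ι (back (n + 1)))) := by
    rw [← Matrix.blockDiagonal_mul, ← Matrix.blockDiagonal_mul]
    exact (Ap.cyc (W.blockDiagonal hf) hTw (Ap.blockDiagonal hfE) (Ap.refl _)).mono (by omega)
  have e2 : Matrix.blockDiagonal E' * tperm X.R ι (back (n + 1)) * Matrix.blockDiagonal E =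
      (Matrix.blockDiagonal fun j => E' j * E (back (n + 1) j)) * tperm X.R ι (back (n + 1)) := by
    rw [mul_assoc, tperm_mul_blockDiagonal, ← mul_assoc, ← Matrix.blockDiagonal_mul]
    rfl
  have a2 : S.Ap (2 * l + 2) (cyc (Matrix.blockDiagonal fun _ : Fin (n + 1) => q)
      ((Matrix.blockDiagonal fun j => E' j * E (back (n + 1) j)) * tperm X.R ι (back (n + 1))))
      (cyc (Matrix.blockDiagonal fun _ => q) (Matrix.blockDiagonal V * tperm X.R ι (back (n + 1)))) :=
    Ap.cyc (hQ.w.mono (by omega)) ((W.blockDiagonal hVw).mul hTw0) (Ap.refl _)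
      (Ap.mul_right (Ap.blockDiagonal hVd) hTw0)
  have a3 : S.Ap (3 * l + 3) (cyc (Matrix.blockDiagonal fun _ : Fin (n + 1) => q)
      (Matrix.blockDiagonal V) * cyc (Matrix.blockDiagonal fun _ => q) (tperm X.R ι (back (n + 1))))
      (cyc (Matrix.blockDiagonal fun _ => q) (Matrix.blockDiagonal V * tperm X.R ι (back (n + 1)))) := by
    refine Ap.cyc_mul (hQ.mono (by omega)) (W.blockDiagonal hVw) hTw (Ap.of_eq ?_)
    rw [← Matrix.blockDiagonal_mul, ← Matrix.blockDiagonal_mul]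
    refine congrArg _ (funext fun j => ?_)
    rw [hV]
    induction j using Fin.cases with
    | zero => exact hvq
    | succ j => simp
  rw [blockDiagonal_cyc] at a3
  rw [← cyc_conj hEE, e2] at a1
  have a4 := Ap.mul_right (Ap.mul_left hW.w (a2.trans a3.symm)) hW.w'
  exact (cl_one_near (k := 27 * l + 94) (hT.mono (by omega)) (hMM.mono (by omega))
    ((W.cyc (W.blockDiagonal hf) hTw).mono (by omega))
    ((a1.trans a4).symm.mono (by omega))).symm

/-- The holonomy of the loop E p E⁻¹ around the circle is E(0)⁻¹E(1) compressed by p, that is,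
nearly u₀'u with u₀ the scalar part of u. Its class is [u] - [u₀]. -/
theorem bVal_dEl {u u' : Matrix ι ι X.R} (hT : S.Tgt (2000 * k + 4000) ε' r' N') (hu : S.Inv k u u')
    (ho : S.Osc 0 n (eMat (u.map (MatAlg.lift X)) (u'.map (MatAlg.lift X)))) :
    bVal ε' r' N' n (dEl u u') = cl .one X ε' r' N' u - cl .one X ε' r' N' (u.map X.scal) := by
  obtain ⟨l, hl⟩ : ∃ l, l = 12 * k + 20 := ⟨_, rfl⟩
  have hz : S.Inv k (u.map X.scal) (u'.map X.scal) := by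
    have hs := hu.sm.scal
    have hs' := hu.sm'.scal
    rw [Matrix.map_mul, mmap_one] at hs hs'
    exact ⟨hu.w.scal, hu.w'.scal, hs, hs'⟩
  have l0 : ∀ x : Matrix ι ι X.R, (x.map (MatAlg.lift X)).map (ev {0} X 0) = x.map X.scal := by
    intro x
    ext1 i j
    rw [Matrix.map_apply, Matrix.map_apply, Matrix.map_apply, ev_lift]
    simp
  have hw : ∀ t, S.W l ((eMat (u.map (MatAlg.lift X)) (u'.map (MatAlg.lift X))).map (ev {0} X t)) :=
    fun t => ((hu.w.lift.eMat hu.w'.lift).map (contr_ev t)).mono (by omega)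
  have hw' : ∀ t, S.W l ((eMat' (u.map (MatAlg.lift X)) (u'.map (MatAlg.lift X))).map (ev {0} X t)) :=
    fun t => ((hu.w.lift.eMat' hu.w'.lift).map (contr_ev t)).mono (by omega)
  have h1 : ∀ t, (eMat (u.map (MatAlg.lift X)) (u'.map (MatAlg.lift X))).map (ev {0} X t) *
      (eMat' (u.map (MatAlg.lift X)) (u'.map (MatAlg.lift X))).map (ev {0} X t) = 1 := fun t => by
    rw [← Matrix.map_mul, eMat_mul_eMat', mmap_one]
  have h2 : ∀ t, (eMat' (u.map (MatAlg.lift X)) (u'.map (MatAlg.lift X))).map (ev {0} X t) *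
      (eMat (u.map (MatAlg.lift X)) (u'.map (MatAlg.lift X))).map (ev {0} X t) = 1 := fun t => by
    rw [← Matrix.map_mul, eMat'_mul_eMat, mmap_one]
  have hfw : ∀ t, S.W l ((dEl u u').map (ev {0, 1} X t)) := fun t =>
    (hu.dEl_w.map (contr_ev t)).mono (by omega)
  have hfE : ∀ t, S.Ap l ((dEl u u').map (ev {0, 1} X t))
      ((eMat (u.map (MatAlg.lift X)) (u'.map (MatAlg.lift X))).map (ev {0} X t) * pMat X.R ι ι *
        (eMat' (u.map (MatAlg.lift X)) (u'.map (MatAlg.lift X))).map (ev {0} X t)) := by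
    intro t
    have h := hu.dEl_ap.map (contr_ev t)
    rw [yMat, Matrix.map_mul, Matrix.map_mul, pMat_map] at h
    refine (Ap.trans (k := 0) (Ap.of_eq ?_) h).mono (by omega)
    ext1 i j
    exact (ev_incl t _).symm
  -- Compression by p retains only the first diagonal block of the holonomy.
  have hq2 : ∀ a b : Matrix ι ι X.R, cyc (pMat X.R ι ι) (Matrix.fromBlocks a 0 0 b) =
      Matrix.fromBlocks a 0 0 1 := by
    intro a b
    rw [pMat, cyc_sum, cyc_one_left, cyc, sub_zero, zero_mul, add_zero]
  have hvI := hz.symm.mul hu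
  have hEl : S.Ap (3 * k + 3) ((eMat (u.map (MatAlg.lift X)) (u'.map (MatAlg.lift X))).map
      (ev {0} X (pts n (Fin.last n)))) (Matrix.fromBlocks u 0 0 u') := by
    have h := ho _ _ (steps_pts n).last
    have h' := hu.eMat_ap
    rw [eMat_map (ev {0} X 1), map_lift_ev_one, map_lift_ev_one] at h
    exact (h.trans h').mono (by omega)
  have hE0 : S.Ap (3 * k + 3) ((eMat' (u.map (MatAlg.lift X)) (u'.map (MatAlg.lift X))).map
      (ev {0} X (pts n 0))) (Matrix.fromBlocks (u'.map X.scal) 0 0 (u.map X.scal)) := by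
    rw [pts_zero, eMat'_map, l0, l0]
    exact hz.eMat'_ap.mono (by omega)
  have hd := Ap.mul (k := l) (hw' _) ((hu.w.sum hu.w').mono (by omega)) (hE0.mono (by omega))
    (hEl.mono (by omega))
  rw [sum_mul_sum] at hd
  -- The sampled loop: its closing transition is close to diag(u₀'u, u₀u').
  have A := rotCl_conj (l := 2 * l + 1) (n := n)
    (E := fun j => (eMat (u.map (MatAlg.lift X)) (u'.map (MatAlg.lift X))).map (ev {0} X (pts n j)))
    (E' := fun j => (eMat' (u.map (MatAlg.lift X)) (u'.map (MatAlg.lift X))).map (ev {0} X (pts n j)))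
    (f := fun j => (dEl u u').map (ev {0, 1} X (pts n j)))
    (q := pMat X.R ι ι)
    (v := Matrix.fromBlocks (u'.map X.scal * u) 0 0 (u.map X.scal * u'))
    (hT.mono (by omega)) (fun j => (hw _).mono (by omega)) (fun j => (hw' _).mono (by omega))
    (fun j => h1 _) (fun j => h2 _) W.pMat pMat_mul_pMat (fun j => (hfw _).mono (by omega))
    (fun j => (hfE _).mono (by omega))
    ((((hz.w'.mul hu.w).sum (hz.w.mul hu.w'))).mono (by omega))
    (by simp [pMat, Matrix.fromBlocks_multiply])
    (y := Matrix.fromBlocks (u' * u.map X.scal) 0 0 1)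
    (by rw [hq2]; exact (hvI.sum Inv.one).mono (by omega))
    (hd.mono (by omega))
    (fun i => by
      have h := Ap.mul_left (hw' (pts n i.succ)) (ho _ _ ((steps_pts n).step i))
      rw [h2] at h
      exact h.mono (by omega))
  -- The constant loop: all transitions are trivial. The term with the constant tuple p is the same
  -- as for the sampled loop and cancels.
  have B := rotCl_conj (l := l) (n := n)
    (E := fun _ => (eMat (u.map (MatAlg.lift X)) (u'.map (MatAlg.lift X))).map (ev {0} X 0))
    (E' := fun _ => (eMat' (u.map (MatAlg.lift X)) (u'.map (MatAlg.lift X))).map (ev {0} X 0))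
    (f := fun _ => (dEl u u').map (ev {0, 1} X 0)) (q := pMat X.R ι ι) (v := 1) (y := 1)
    (hT.mono (by omega)) (fun j => hw _) (fun j => hw' _) (fun j => h1 _) (fun j => h2 _)
    W.pMat pMat_mul_pMat (fun j => hfw _) (fun j => hfE _) W.one (by rw [mul_one, one_mul])
    (by rw [cyc_one]; exact Inv.one) (Ap.of_eq (h2 _)) (fun i => Ap.of_eq (h2 _))
  rw [cyc_one, cl_one hT.par, zero_add] at B
  rw [hq2, cl_sum hT.par (hvI.q hT (by omega)) (Inv.one.q (k := 0) hT (by omega)), cl_one hT.par,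
    add_zero, cl_one_mul (hT.mono (by omega)) hz.symm hu] at A
  have C := cl_one_inv (hT.mono (by omega)) hz
  rw [bVal, A, B, add_sub_cancel_right, add_comm, sub_eq_add_neg, add_right_inj]
  exact (neg_eq_of_add_eq_zero_right C).symm

end Scale

/-! ## The boundary map after the Bott map -/

section

open Scale MatAlg

variable {A B : Type*} [Ring A] [Ring B] {ι κ : Type*} [Fintype ι] [Fintype κ] [DecidableEq ι]
  [DecidableEq κ]

/-- The symmetry that exchanges `diag(1, 0)` and `diag(1 - q, q)` for an idempotent `q`. -/
def sMat (q : Matrix ι ι A) : Matrix (ι ⊕ ι) (ι ⊕ ι) A := Matrix.fromBlocks (1 - q) q q (1 - q)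

theorem sMat_map (f : A →+* B) (q : Matrix ι ι A) : (sMat q).map f = sMat (q.map f) := by
  simp only [sMat, Matrix.fromBlocks_map, mmap_sub, mmap_one]

theorem sMat_mul_sMat_sub (q : Matrix ι ι A) : sMat q * sMat q - 1 =
    Matrix.fromBlocks (q * q - q + (q * q - q)) (-(q * q - q + (q * q - q)))
      (-(q * q - q + (q * q - q))) (q * q - q + (q * q - q)) := by
  rw [sMat, Matrix.fromBlocks_multiply, ← Matrix.fromBlocks_one, fromBlocks_sub]
  congr 1 <;> noncomm_ring

theorem sMat_conj_pMat_sub (q : Matrix ι ι A) :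
    sMat q * pMat A ι ι * sMat q - Matrix.fromBlocks (1 - q) 0 0 q =
      Matrix.fromBlocks (q * q - q) (-(q * q - q)) (-(q * q - q)) (q * q - q) := by
  rw [sMat, pMat, Matrix.fromBlocks_multiply, Matrix.fromBlocks_multiply, fromBlocks_sub]
  congr 1 <;> noncomm_ring

/-- The conjugate depends on q only through the products qd and dq. Thus q may be replaced by any
matrix that agrees with it where d is supported. -/
theorem sMat_conj_corner {q q' d : Matrix ι ι A} (h : q * d = q' * d) (h' : d * q = d * q') :
    sMat q * Matrix.fromBlocks 0 0 0 d * sMat q = sMat q' * Matrix.fromBlocks 0 0 0 d * sMat q' := by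
  have e1 : ∀ x y : Matrix ι ι A, Matrix.fromBlocks x y y x * Matrix.fromBlocks 0 0 0 d =
      Matrix.fromBlocks 0 (y * d) 0 (x * d) := fun x y => by simp [Matrix.fromBlocks_multiply]
  have e2 : Matrix.fromBlocks (0 : Matrix ι ι A) 0 0 d * sMat q =
      Matrix.fromBlocks 0 0 0 d * sMat q' := by
    simp [sMat, Matrix.fromBlocks_multiply, h', mul_sub]
  have e3 : sMat q * Matrix.fromBlocks (0 : Matrix ι ι A) 0 0 d =
      sMat q' * Matrix.fromBlocks 0 0 0 d := by
    simp [sMat, Matrix.fromBlocks_multiply, h, sub_mul]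
  rw [mul_assoc, e2, ← mul_assoc, e3]

/-- The conjugate of `sMat q` by `diag(1, t)` if `t` is an invertible that commutes with `q`. -/
def tMat (q t t' : Matrix ι ι A) : Matrix (ι ⊕ ι) (ι ⊕ ι) A :=
  Matrix.fromBlocks (1 - q) (q * t) (q * t') (1 - q)

theorem tMat_mul_sMat_sub (q t t' : Matrix ι ι A) :
    tMat q t t' * sMat q - Matrix.fromBlocks (cyc q t) 0 0 (cyc q t') =
      Matrix.fromBlocks (q * q - q + (q * (t * q - q * t) + (q * q - q) * t))
        (-(q * q - q + (q * (t * q - q * t) + (q * q - q) * t)))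
        (-(q * q - q + (q * (t' * q - q * t') + (q * q - q) * t')))
        (q * q - q + (q * (t' * q - q * t') + (q * q - q) * t')) := by
  rw [tMat, sMat, Matrix.fromBlocks_multiply, fromBlocks_sub]
  simp only [cyc]
  congr 1 <;> noncomm_ring

theorem conj_sMat_sub {t t' : Matrix ι ι A} (h : t' * t = 1) (q : Matrix ι ι A) :
    Matrix.fromBlocks 1 0 0 t' * sMat q * Matrix.fromBlocks 1 0 0 t - tMat q t t' =
      Matrix.fromBlocks 0 0 (t' * q - q * t') (-((t' * q - q * t') * t)) := by
  rw [tMat, sMat, Matrix.fromBlocks_multiply, Matrix.fromBlocks_multiply, fromBlocks_sub]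
  have e1 : t' * (1 - q) * t - (1 - q) = -((t' * q - q * t') * t) := by
    have e : q * t' * t = q := by rw [mul_assoc, h, mul_one]
    rw [mul_sub, sub_mul, mul_one, h, sub_mul, e]
    abel
  congr 1
  · simp
  · simp
  · simp
  · rw [← e1]
    simp

end

/-! ### Estimates for the symmetry `sMat` and its conjugate by a shift. -/

namespace Scale

open MatAlg

variable {X : MatAlg.{u} p} [X.Nice] {ι κ : Type*} [Fintype ι] [Fintype κ] [DecidableEq ι]
  [DecidableEq κ] {S : Scale} {k l m n : ℕ} {ε' r' N' ε r N : ℝ}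

section

variable {q t t' : Matrix ι ι X.R}

theorem W.sMat (hq : S.W k q) : S.W (k + 2) (QuantK.sMat q) :=
  have h := (W.one (X := X) (ι := ι) (S := S) (k := 0)).sub hq
  (W.fromBlocks (h.mono (by omega)) (hq.mono (by omega)) (hq.mono (by omega)) h).mono (by omega)

theorem Qd.sMat_sq (hq : S.Qd k q) : S.Ap (k + 2) (QuantK.sMat q * QuantK.sMat q) 1 := by
  have h := hq.sm.sm.add hq.sm.sm
  rw [Ap, sMat_mul_sMat_sub]
  exact (Sm.fromBlocks h h.neg h.neg h).mono (by omega)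

theorem Qd.sMat_inv (hq : S.Qd k q) : S.Inv (k + 2) (QuantK.sMat q) (QuantK.sMat q) :=
  ⟨hq.w.sMat, hq.w.sMat, hq.sMat_sq, hq.sMat_sq⟩

theorem Qd.sMat_conj (hq : S.Qd k q) :
    S.Ap (k + 1) (QuantK.sMat q * QuantK.pMat X.R ι ι * QuantK.sMat q)
      (Matrix.fromBlocks (1 - q) 0 0 q) := by
  have h := hq.sm.sm
  rw [Ap, sMat_conj_pMat_sub]
  exact Sm.fromBlocks h h.neg h.neg h

theorem Qd.sMat_conj' (hq : S.Qd k q) :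
    S.Ap (3 * k + 8) (QuantK.sMat q * Matrix.fromBlocks (1 - q) 0 0 q * QuantK.sMat q)
      (QuantK.pMat X.R ι ι) := by
  have h1 := Ap.mul_right (Ap.mul_left hq.w.sMat hq.sMat_conj.symm) hq.w.sMat
  have hP : S.W 0 (QuantK.pMat X.R ι ι) := W.pMat
  have h2 := Ap.mul_right hq.sMat_sq (hP.mul (hq.w.sMat.mul hq.w.sMat))
  have h3 := Ap.mul_left hP hq.sMat_sq
  rw [one_mul] at h2
  rw [mul_one] at h3
  have e : QuantK.sMat q * (QuantK.sMat q * QuantK.pMat X.R ι ι * QuantK.sMat q) * QuantK.sMat q =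
      QuantK.sMat q * QuantK.sMat q * (QuantK.pMat X.R ι ι * (QuantK.sMat q * QuantK.sMat q)) := by
    noncomm_ring
  rw [e] at h1
  exact (h1.trans (h2.trans h3)).mono (by omega)

/-- This identifies the value at t = 1 of the second lift. If t commutes with an exact idempotent q,
the conjugate of the symmetry by diag(1, t), multiplied by the symmetry, equals diag(cyc q t, cyc q
t'). -/
theorem Ap.tMat_sMat (hq : S.Qd k q) (ht : S.W 0 t) (ht' : S.W 0 t') (e : t' * t = 1)
    (h : S.Ap l (t * q) (q * t)) (h' : S.Ap l (t' * q) (q * t')) :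
    S.Ap (2 * k + l + 5) (Matrix.fromBlocks 1 0 0 t' * QuantK.sMat q * Matrix.fromBlocks 1 0 0 t *
      QuantK.sMat q) (Matrix.fromBlocks (QuantK.cyc q t) 0 0 (QuantK.cyc q t')) := by
  have h1 : S.Ap (l + 1) (Matrix.fromBlocks 1 0 0 t' * QuantK.sMat q * Matrix.fromBlocks 1 0 0 t)
      (tMat q t t') := by
    rw [Ap, conj_sMat_sub e]
    exact Sm.fromBlocks Sm.zero Sm.zero h'.sm (Sm.mul_right h'.sm ht).neg
  have h2 : ∀ {s}, S.W 0 s → S.Ap l (s * q) (q * s) →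
      S.Sm (k + l + 2) (q * q - q + (q * (s * q - q * s) + (q * q - q) * s)) := fun hs h =>
    (hq.sm.sm.add ((Sm.mul_left hq.w h.sm).add (Sm.mul_right hq.sm.sm hs))).mono (by omega)
  have h3 : S.Ap (k + l + 3) (tMat q t t' * QuantK.sMat q)
      (Matrix.fromBlocks (QuantK.cyc q t) 0 0 (QuantK.cyc q t')) := by
    rw [Ap, tMat_mul_sMat_sub]
    exact Sm.fromBlocks (h2 ht h) (h2 ht h).neg (h2 ht' h').neg (h2 ht' h')
  exact ((Ap.mul_right h1 hq.w.sMat).trans h3).mono (by omega)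

end

/-- The left side is w p w' for the second lift w. The inner symmetry turns p into diag(1 - F, F),
and the shift turns the latter into diag(1 - F, F + D). The next symmetry returns diag(1 - F, F) to
p and acts on D as the symmetry of Z does, since F and Z agree where D is supported. Reading these
steps backwards with Z in place of F gives the right side. -/
theorem ap_conj_corner {F Z D T T' : Matrix ι ι X.R} (hF : S.Qd k F) (hZ : S.Qd k Z)
    (hT : S.W 0 T) (hT' : S.W 0 T') (hTT : S.Ap k (T * F * T') (F + D))
    (h : F * D = Z * D) (h' : D * F = D * Z) :
    S.Ap (5 * k + 20)
      (Matrix.fromBlocks 1 0 0 T' * sMat F * Matrix.fromBlocks 1 0 0 T * sMat F * pMat X.R ι ι *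
        (sMat F * (Matrix.fromBlocks 1 0 0 T' * (sMat F * Matrix.fromBlocks 1 0 0 T))))
      (Matrix.fromBlocks 1 0 0 T' * sMat Z * Matrix.fromBlocks (1 - Z) 0 0 (Z + D) *
        (sMat Z * Matrix.fromBlocks 1 0 0 T)) := by
  have hC : S.W 0 (Matrix.fromBlocks (1 : Matrix ι ι X.R) 0 0 T) := W.one.sum hT
  have hC' : S.W 0 (Matrix.fromBlocks (1 : Matrix ι ι X.R) 0 0 T') := W.one.sum hT'
  have hsplit : ∀ a : Matrix ι ι X.R, Matrix.fromBlocks (1 - a) 0 0 (a + D) =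
      Matrix.fromBlocks (1 - a) 0 0 a + Matrix.fromBlocks 0 0 0 D := fun a => by
    rw [Matrix.fromBlocks_add]
    simp
  -- The effect of the inner symmetry followed by the shift.
  have a1 : S.Ap (k + 2) (Matrix.fromBlocks 1 0 0 T * (sMat F * pMat X.R ι ι * sMat F) *
      Matrix.fromBlocks 1 0 0 T') (Matrix.fromBlocks (1 - F) 0 0 (F + D)) := by
    have h1 := Ap.mul_right (Ap.mul_left hC hF.sMat_conj) hC'
    rw [sum_mul_sum, sum_mul_sum, one_mul, mul_one] at h1
    exact (h1.trans ((Ap.refl (k := k) (1 - F)).sum hTT)).mono (by omega)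
  have a2 := Ap.mul_right (Ap.mul_left hF.w.sMat a1) hF.w.sMat
  have a3 : S.Ap (3 * k + 9) (sMat F * Matrix.fromBlocks (1 - F) 0 0 (F + D) * sMat F)
      (pMat X.R ι ι + sMat Z * Matrix.fromBlocks 0 0 0 D * sMat Z) := by
    rw [hsplit, mul_add, add_mul, sMat_conj_corner h h']
    exact (hF.sMat_conj'.add (Ap.refl (k := 0) _)).mono (by omega)
  -- The same expression as for F: by `sMat_conj_corner`, F enters only through its products with D.
  have a4 : S.Ap (3 * k + 9) (sMat Z * Matrix.fromBlocks (1 - Z) 0 0 (Z + D) * sMat Z)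
      (pMat X.R ι ι + sMat Z * Matrix.fromBlocks 0 0 0 D * sMat Z) := by
    rw [hsplit, mul_add, add_mul]
    exact (hZ.sMat_conj'.add (Ap.refl (k := 0) _)).mono (by omega)
  have a5 := Ap.mul_right (Ap.mul_left hC' ((a2.trans a3).trans a4.symm)) hC
  refine (Ap.trans (k := 0) (Ap.of_eq ?_) (a5.trans (Ap.of_eq (k := 0) ?_))).mono (by omega)
  · simp only [mul_assoc]
  · simp only [mul_assoc]

end Scale

/-! ### The boundary of a compressed cyclic shift. -/

namespace Scale

open MatAlg

variable {X : MatAlg.{u} p} [X.Nice] {ι κ : Type*} [Fintype ι] [Fintype κ] [DecidableEq ι]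
  [DecidableEq κ] {S : Scale} {k l m n : ℕ} {ε' r' N' ε r N : ℝ}

theorem ev_scal {Z : Set unitInterval} (t : unitInterval) (x : (pathAlg Z X).R) :
    ev Z X t ((pathAlg Z X).scal x) = X.scal (ev Z X t x) := by
  refine R_ext ?_ ?_
  · rw [ev_fst, fst_scal, fst_scal, ev_fst]
  · rw [ev_snd, snd_scal, snd_scal]
    rfl

section

variable {e : Matrix ι ι (Sn X).R}

theorem map_dil_zero : e.map (dil X 0) = (e.map (Sn X).scal).map (incl X) := by
  ext1 i j
  refine path_ext fun t => ?_
  rw [Matrix.map_apply, Matrix.map_apply, Matrix.map_apply, ev_dil, mul_zero, ev_incl, ev_scal,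
    ev_susp_zero]
  refine R_ext ?_ ?_ <;> simp [ev_fst]

theorem map_dil_one : e.map (dil X 1) = e.map (incl X) := by
  ext1 i j
  refine path_ext fun t => ?_
  rw [Matrix.map_apply, Matrix.map_apply, ev_dil, mul_one, ev_incl]

theorem Osc.ap_dil (h : S.Osc k n e) {a b : unitInterval} (hab : |(a : ℝ) - b| ≤ 1 / (n + 1)) :
    S.Ap k (e.map (dil X a)) (e.map (dil X b)) := by
  have hd : ∀ (s t : unitInterval), (e.map (dil X s)).map (ev {0} X t) = e.map (ev {0, 1} X (t * s)) := by
    intro s t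
    ext1 i j
    exact ev_dil s t _
  refine pathAlg_nm_le_iff.2 fun t => ?_
  rw [mmap_sub, hd, hd]
  refine h _ _ ?_
  rw [Set.Icc.coe_mul, Set.Icc.coe_mul, ← mul_sub, abs_mul, abs_of_nonneg t.2.1]
  exact (mul_le_of_le_one_left (abs_nonneg _) t.2.2).trans hab

theorem Qd.scal {X : MatAlg.{u} p} [X.Nice] {x : Matrix ι ι X.R} (h : S.Qd k x) :
    S.Qd k (x.map X.scal) := by
  have h' := h.sm.scal
  rw [Matrix.map_mul] at h'
  exact ⟨h.w.scal, h'⟩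

theorem Qd.one_sub {x : Matrix ι ι X.R} (h : S.Qd k x) : S.Qd (k + 1) (1 - x) := by
  refine ⟨((W.one (k := 0)).sub h.w).mono (by omega), ?_⟩
  have e1 : (1 - x) * (1 - x) - (1 - x) = x * x - x := by noncomm_ring
  rw [Ap, e1]
  exact h.sm.sm.mono (by omega)

/-- The symmetry conjugates diag(1, 0) approximately into diag(1 - x, x). -/
theorem cl_one_sub_add {x : Matrix ι ι X.R} (h : S.Qd k x) (hT : S.Tgt (8 * k + 40) ε' r' N') :
    cl .zero X ε' r' N' (1 - x) + cl .zero X ε' r' N' x = cl .zero X ε' r' N' (1 : Matrix ι ι X.R) := by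
  have hp : S.Qd (k + 2) (pMat X.R ι ι) := ⟨W.pMat, Ap.of_eq pMat_mul_pMat⟩
  have h1 := h.one_sub
  have h2 := cl_zero_conj (k := k + 2) (g := sMat x) (g' := sMat x) (hT.mono (by omega)) hp
    h.w.sMat h.w.sMat (by
      have := Ap.mul_right h.sMat_sq (W.pMat (k := 0) (ι := ι) (κ := ι))
      rw [one_mul] at this
      exact this)
  rw [cl_pMat hT.par] at h2
  rw [← h2, ← cl_sum hT.par (h1.q hT (by omega)) (h.q hT (by omega))]
  exact cl_zero_near (k := 2 * k + 4) (hT.mono (by omega)) ((h1.sum (h.mono (by omega))).mono (by omega))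
    (((h.w.sMat.mul (W.pMat (k := 0))).mul h.w.sMat).mono (by omega)) (h.sMat_conj.symm.mono (by omega))

theorem blockDiagonal_cons_map {A B : Type*} [Ring A] [Ring B] (f : A →+* B) (a b : Matrix ι ι A) :
    (Matrix.blockDiagonal (Fin.cons a fun _ => b : Fin (n + 1) → Matrix ι ι A)).map f =
      (Matrix.blockDiagonal fun _ : Fin (n + 1) => b.map f) +
        Matrix.blockDiagonal (Fin.cons (a.map f - b.map f) fun _ => 0 : Fin (n + 1) → Matrix ι ι B) := by
  rw [blockDiagonal_map, ← Matrix.blockDiagonal_add]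
  refine congrArg _ (funext fun j => ?_)
  induction j using Fin.cases <;> simp

/-- F consists of the contracted loops t ↦ e(t t_j), which are close for neighbouring j. It begins
with the constant loop, and its last block is close to e itself. Shifting F by one place therefore
alters it, up to a small error, only in block 0, by D = e - e(0). There F agrees with the scalar
matrix Z, and `ap_conj_corner` yields a matrix over the suspension. -/
theorem Qd.cyc_boundary (he : S.Qd k e) (ho : S.Osc k n e) :
    let T := tperm (Cn X).R ι (back (n + 1))
    let T' := tperm (Cn X).R ι (back (n + 1))⁻¹
    let F := Matrix.blockDiagonal fun j => e.map (dil X (pts n j))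
    let Z := Matrix.blockDiagonal fun _ : Fin (n + 1) => e.map (Sn X).scal
    let e₁ := Matrix.fromBlocks 1 0 0 (tperm (Sn X).R ι (back (n + 1))⁻¹) * sMat Z *
      Matrix.fromBlocks (1 - Z) 0 0 (Matrix.blockDiagonal
        (Fin.cons e fun _ => e.map (Sn X).scal : Fin (n + 1) → Matrix ι ι (Sn X).R)) *
      (sMat Z * Matrix.fromBlocks 1 0 0 (tperm (Sn X).R ι (back (n + 1))))
    S.Ap (5 * k + 21) (e₁.map (incl X))
      (Matrix.fromBlocks 1 0 0 T' * sMat F * Matrix.fromBlocks 1 0 0 T * sMat F *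
        pMat (Cn X).R _ _ * (sMat F * (Matrix.fromBlocks 1 0 0 T' *
          (sMat F * Matrix.fromBlocks 1 0 0 T)))) := by
  intro T T' F Z e₁
  have hTI : T * T' = 1 := tperm_mul_inv _
  -- In block 0 the shift brings in t ↦ e(t t_n), which is close to e because t_n is close to 1.
  have hfb : ∀ j : Fin (n + 1), S.Ap k (e.map (dil X (pts n (back (n + 1) j))))
      (e.map (dil X (pts n j)) + (Fin.cons (e.map (incl X) - (e.map (Sn X).scal).map (incl X))
        fun _ => 0 : Fin (n + 1) → Matrix ι ι (Cn X).R) j) := by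
    intro j
    induction j using Fin.cases with
    | zero =>
      rw [back_zero, Fin.cons_zero, pts_zero, map_dil_zero, add_sub_cancel, ← map_dil_one]
      exact ho.ap_dil (steps_pts n).last
    | succ j =>
      rw [back_succ_apply, Fin.cons_succ, add_zero]
      exact ho.ap_dil ((steps_pts n).step j)
  have hFD : S.Ap k (T * F * T') (F + Matrix.blockDiagonal
      (Fin.cons (e.map (incl X) - (e.map (Sn X).scal).map (incl X)) fun _ => 0 :
        Fin (n + 1) → Matrix ι ι (Cn X).R)) := by
    rw [tperm_mul_blockDiagonal, mul_assoc, hTI, mul_one, ← Matrix.blockDiagonal_add]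
    exact Ap.blockDiagonal hfb
  have hmul : ∀ (x y : Fin (n + 1) → Matrix ι ι (Cn X).R) (d : Matrix ι ι (Cn X).R), x 0 = y 0 →
      Matrix.blockDiagonal x * Matrix.blockDiagonal (Fin.cons d fun _ => 0) =
        Matrix.blockDiagonal y * Matrix.blockDiagonal (Fin.cons d fun _ => 0) := by
    intro x y d h
    rw [← Matrix.blockDiagonal_mul, ← Matrix.blockDiagonal_mul]
    refine congrArg _ (funext fun j => ?_)
    induction j using Fin.cases <;> simp [h]
  have hmul' : ∀ (x y : Fin (n + 1) → Matrix ι ι (Cn X).R) (d : Matrix ι ι (Cn X).R), x 0 = y 0 →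
      Matrix.blockDiagonal (Fin.cons d fun _ => 0) * Matrix.blockDiagonal x =
        Matrix.blockDiagonal (Fin.cons d fun _ => 0) * Matrix.blockDiagonal y := by
    intro x y d h
    rw [← Matrix.blockDiagonal_mul, ← Matrix.blockDiagonal_mul]
    refine congrArg _ (funext fun j => ?_)
    induction j using Fin.cases <;> simp [h]
  have h0 : e.map (dil X (pts n 0)) = (e.map (Sn X).scal).map (incl X) := by
    rw [pts_zero, map_dil_zero]
  have key := ap_conj_corner (S := S) (k := k) (F := F)
    (Z := Matrix.blockDiagonal fun _ : Fin (n + 1) => (e.map (Sn X).scal).map (incl X))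
    (Qd.blockDiagonal fun j => he.map (contr_dil _))
    (Qd.blockDiagonal fun j => he.scal.map contr_incl) (W.tperm _) (W.tperm _) hFD
    (hmul _ _ _ h0) (hmul' _ _ _ h0)
  refine (Ap.trans (k := 0) (Ap.of_eq ?_) key.symm).mono (by omega)
  have hZ : Z.map (incl X) =
      Matrix.blockDiagonal fun _ : Fin (n + 1) => (e.map (Sn X).scal).map (incl X) :=
    blockDiagonal_map _ _
  rw [Matrix.map_mul, Matrix.map_mul, Matrix.map_mul, Matrix.map_mul, sum_map, sum_map, sum_map,
    sMat_map, tperm_map, tperm_map, blockDiagonal_cons_map, mmap_sub, mmap_one, hZ]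

/-- The boundary of the class of the compressed cyclic shift. -/
theorem dVal_cyc (hT : S.Tgt (120000 * k + 310000) ε' r' N') (he : S.Qd k e) (ho : S.Osc k n e) :
    dVal ε' r' N' (cyc (Matrix.blockDiagonal fun j => e.map (ev {0, 1} X (pts n j)))
        (tperm X.R ι (back (n + 1))))
      (cyc (Matrix.blockDiagonal fun j => e.map (ev {0, 1} X (pts n j)))
        (tperm X.R ι (back (n + 1))⁻¹)) =
    cl .zero (Sn X) ε' r' N' e - cl .zero (Sn X) ε' r' N' (e.map (Sn X).scal) := by
  -- The lift is a product of four factors of level at most k + 2, and each of the three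
  -- multiplications replaces the level l by 3l + 1.
  obtain ⟨K, hK⟩ : ∃ K, K = 27 * k + 67 := ⟨_, rfl⟩
  have hstep := ap_steps ho (map_ev_one e) (steps_pts n)
  have hM := Inv.cyc_tperm (f := fun j => e.map (ev {0, 1} X (pts n j))) (σ := back (n + 1))
    (fun j => he.map (contr_ev _)) hstep
  have hz := he.scal
  have hF : S.Qd k (Matrix.blockDiagonal fun j => e.map (dil X (pts n j))) :=
    Qd.blockDiagonal fun j => he.map (contr_dil _)
  have hZ : S.Qd k (Matrix.blockDiagonal fun _ : Fin (n + 1) => e.map (Sn X).scal) :=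
    Qd.blockDiagonal fun j => hz
  have hS := hF.sMat_inv
  have hC : S.Inv 0 (Matrix.fromBlocks (1 : Matrix (ι × Fin (n + 1)) (ι × Fin (n + 1)) (Cn X).R) 0 0
      (tperm (Cn X).R ι (back (n + 1)))) (Matrix.fromBlocks 1 0 0 (tperm (Cn X).R ι (back (n + 1))⁻¹)) :=
    Inv.one.sum (Inv.of_eq (W.tperm _) (W.tperm _) (tperm_mul_inv _) (tperm_inv_mul _))
  have hw := (((((hC.symm.mono (show 0 ≤ k + 2 by omega)).mul hS).mul (hC.mono (by omega))).mul
    (hS.mono (by omega))).mono (show _ ≤ K by omega))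
  have hdil : (Matrix.blockDiagonal fun j => e.map (dil X (pts n j))).map (ev {0} X 1) =
      Matrix.blockDiagonal fun j => e.map (ev {0, 1} X (pts n j)) := by
    rw [blockDiagonal_map]
    refine congrArg _ (funext fun j => ?_)
    ext1 a b
    rw [Matrix.map_apply, Matrix.map_apply, ev_dil, one_mul, Matrix.map_apply]
  have hstep' : ∀ j, S.Ap k (e.map (ev {0, 1} X (pts n ((back (n + 1))⁻¹ j))))
      (e.map (ev {0, 1} X (pts n j))) := fun j => by
    have h := hstep ((back (n + 1))⁻¹ j)
    have e1 : back (n + 1) ((back (n + 1))⁻¹ j) = j := (back (n + 1)).apply_symm_apply j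
    rw [e1] at h
    exact h.symm
  have hwu := Ap.tMat_sMat (S := S) (k := k) (l := k)
    (q := Matrix.blockDiagonal fun j => e.map (ev {0, 1} X (pts n j)))
    (t := tperm X.R ι (back (n + 1))) (t' := tperm X.R ι (back (n + 1))⁻¹)
    (Qd.blockDiagonal fun j => he.map (contr_ev _)) (W.tperm _) (W.tperm _) (tperm_inv_mul _)
    (ap_tperm_comm hstep) (ap_tperm_comm hstep')
  have hew := he.cyc_boundary ho
  dsimp only at hew
  have hcons : ∀ j : Fin (n + 1), S.Qd k ((Fin.cons e fun _ => e.map (Sn X).scal :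
      Fin (n + 1) → Matrix ι ι (Sn X).R) j) := by
    intro j
    induction j using Fin.cases
    · exact he
    · exact hz
  have h1Z : S.Qd (k + 1) (1 - Matrix.blockDiagonal fun _ : Fin (n + 1) => e.map (Sn X).scal) :=
    hZ.one_sub
  have he₂ := h1Z.sum ((Qd.blockDiagonal hcons).mono (show k ≤ k + 1 by omega))
  have hg : S.W (k + 2) (Matrix.fromBlocks 1 0 0 (tperm (Sn X).R ι (back (n + 1))⁻¹) *
      sMat (Matrix.blockDiagonal fun _ : Fin (n + 1) => e.map (Sn X).scal)) :=
    (((W.one (k := 0)).sum (W.tperm _)).mul hZ.w.sMat).mono (by omega)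
  have hg' : S.W (k + 2) (sMat (Matrix.blockDiagonal fun _ : Fin (n + 1) => e.map (Sn X).scal) *
      Matrix.fromBlocks 1 0 0 (tperm (Sn X).R ι (back (n + 1)))) :=
    (hZ.w.sMat.mul ((W.one (k := 0)).sum (W.tperm _))).mono (by omega)
  -- The complement of the compressed shift is its quasi-inverse, the compressed inverse shift.
  have main := dVal_eq_of_lift (k := K) (hT.mono (by omega)) (hM.mono (by omega))
    (hM.symm.mono (by omega)) hw (by
      rw [Matrix.map_mul, Matrix.map_mul, Matrix.map_mul, sum_map, sum_map, mmap_one, sMat_map, hdil,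
        tperm_map, tperm_map]
      exact hwu.mono (by omega)) (((hg.mul he₂.w).mul hg').mono (by omega)) (hew.mono (by omega))
  rw [← main.2]
  have hgg := Ap.mul_right hZ.sMat_sq he₂.w
  rw [one_mul] at hgg
  have hCC : Matrix.fromBlocks (1 : Matrix (ι × Fin (n + 1)) (ι × Fin (n + 1)) (Sn X).R) 0 0
      (tperm (Sn X).R ι (back (n + 1))) * Matrix.fromBlocks 1 0 0 (tperm (Sn X).R ι (back (n + 1))⁻¹) =
      1 := by
    rw [sum_mul_sum, one_mul, tperm_mul_inv, Matrix.fromBlocks_one]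
  -- As Z and the shift are scalar, the conjugation takes place over (SA)⁺ and can be removed. There
  -- remains [1 - Z] + [e] + n[z], where z is the scalar part of e, to be compared with [1] = [1 -
  -- Z] + (n + 1)[z].
  rw [cl_zero_conj (k := 2 * k + 4) (hT.mono (by omega)) (he₂.mono (by omega)) (hg.mono (by omega))
    (hg'.mono (by omega)) (by
      rw [mul_assoc (sMat _), ← mul_assoc (Matrix.fromBlocks 1 0 0 (tperm _ _ _)), hCC, one_mul]
      exact hgg.mono (by omega)), cl_sum hT.par (h1Z.q hT (by omega))
      ((Qd.blockDiagonal hcons).q hT (by omega)),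
    (cl_blockDiagonal hT.par _ fun j => (hcons j).q hT (by omega)).1, Fin.sum_univ_succ,
    ← cl_one_sub_add hZ (hT.mono (by omega)),
    (cl_blockDiagonal hT.par (fun _ : Fin (n + 1) => e.map (Sn X).scal) fun j =>
      hz.q hT (by omega)).1, Fin.sum_univ_succ]
  simp only [Fin.cons_zero, Fin.cons_succ]
  abel

end

end Scale

/-! ## The choices in the construction of the boundary map -/

/-- The control pair `((2N)^K, K)`. -/
noncomputable def powPair (K : ℕ) (hK : 1 ≤ K) : ControlPair where
  lam N := (2 * N) ^ K
  h _ _ := K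
  one_le_lam N hN := one_le_pow₀ (by linarith)
  lam_mono := fun a ha b hb hab =>
    pow_le_pow_left₀ (by linarith [Set.mem_Ici.1 ha]) (by linarith) K
  one_le_h _ _ _ _ _ := by exact_mod_cast hK
  h_anti _ _ := antitoneOn_const

theorem powPair_le {K L : ℕ} (hK : 1 ≤ K) (hL : 1 ≤ L) (h : K ≤ L) :
    (powPair K hK).Le (powPair L hL) := fun N hN =>
  ⟨pow_le_pow_right₀ (by linarith) h, fun _ _ _ => by exact_mod_cast Nat.cast_le.2 h⟩

namespace Scale

open MatAlg

variable {X : MatAlg.{u} p} [X.Nice] {ι κ : Type*} [Fintype ι] [Fintype κ] [DecidableEq ι]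
  [DecidableEq κ] {S : Scale} {k l m n : ℕ} {ε' r' N' ε r N : ℝ}

/-- The bound for the norms is (|c| + |s|)² N ≤ 2N. One of the two defects remains below ε; the
other one is conjugated by a rotation and at most doubles. These are the parameters that the choice
of v requires. -/
theorem ip_rot (hP : Par ε r N) {u u' : Matrix ι ι X.R} (h : X.IP ε r N u u')
    (t : unitInterval) :
    X.IP (2 * ε) (2 * r) (2 * (N + ε)) (rot u u' t * rot' 1 1 t) (rot 1 1 t * rot' u u' t) := by
  have hε := hP.eps
  have hN := hP.bd
  have hr := hP.prop
  have b1 : X.nm (rot (1 : Matrix ι ι X.R) 1 t) ≤ ‖cs t‖ + ‖sn t‖ :=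
    (nm_rot_le le_rfl nm_one_le nm_one_le t).trans_eq (mul_one _)
  have b1' : X.nm (rot' (1 : Matrix ι ι X.R) 1 t) ≤ ‖cs t‖ + ‖sn t‖ :=
    (nm_rot'_le le_rfl nm_one_le nm_one_le t).trans_eq (mul_one _)
  have e1 : rot' (1 : Matrix ι ι X.R) 1 t * rot 1 1 t = 1 := by
    rw [← sub_eq_zero, rot'_mul_rot]
    simp
  have e1' : rot (1 : Matrix ι ι X.R) 1 t * rot' 1 1 t = 1 := by
    rw [← sub_eq_zero, rot_mul_rot']
    simp
  have hlt : ∀ {x : Matrix (ι ⊕ ι) (ι ⊕ ι) X.R},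
      X.nm x < ε → X.nm ((cs t * cs t) • x) < ε := fun {x} hx => by
    refine ((nm_smul_le _ _).trans (mul_le_of_le_one_left (nm_nonneg _) ?_)).trans_lt hx
    rw [norm_mul]
    exact mul_le_one₀ (norm_cs_le t) (norm_nonneg _) (norm_cs_le t)
  have h2 := norm_add_norm_sq_le t
  have h0 : 0 ≤ ‖cs t‖ + ‖sn t‖ := by positivity
  have a1 : X.nm (rot u u' t * rot' u u' t - 1) < ε := by
    rw [rot_mul_rot']
    exact hlt ((nm_sum_le _ _).trans_lt (max_lt h.inv h.inv'))
  have a2 : X.nm (rot' u u' t * rot u u' t - 1) < ε := by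
    rw [rot'_mul_rot]
    exact hlt ((nm_sum_le _ _).trans_lt (max_lt h.inv' h.inv))
  refine ⟨?_, ?_, ?_, ?_, ?_, ?_⟩
  · rw [two_mul]
    exact (Fil.rot h.fil h.fil' t).mul hr hr (Fil.rot' Fil.one Fil.one t)
  · rw [two_mul]
    exact (Fil.rot Fil.one Fil.one t).mul hr hr (Fil.rot' h.fil h.fil' t)
  · refine (nm_mul_le _ _).trans ((mul_le_mul (nm_rot_le hN h.bd h.bd' t) b1' (nm_nonneg _)
      (by positivity)).trans ?_)
    nlinarith
  · refine (nm_mul_le _ _).trans ((mul_le_mul b1 (nm_rot'_le hN h.bd h.bd' t) (nm_nonneg _)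
      h0).trans ?_)
    nlinarith
  · have e : rot u u' t * rot' 1 1 t * (rot 1 1 t * rot' u u' t) - 1 =
        rot u u' t * rot' u u' t - 1 := by
      rw [mul_assoc, ← mul_assoc (rot' 1 1 t), e1, one_mul]
    rw [e]
    linarith
  · have e : rot 1 1 t * rot' u u' t * (rot u u' t * rot' 1 1 t) - 1 =
        rot 1 1 t * (rot' u u' t * rot u u' t - 1) * rot' 1 1 t := by
      rw [mul_sub, sub_mul, mul_one, e1']
      simp only [mul_assoc]
    rw [e]
    exact (nm_rot_conj_le nm_one_le nm_one_le _ t).trans_lt (by linarith)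

theorem rot_mul_rot'_zero (u u' : Matrix ι ι X.R) :
    rot u u' 0 * rot' 1 1 0 = Matrix.fromBlocks u 0 0 u' := by
  rw [rot_zero, rot'_zero, Matrix.fromBlocks_one, mul_one]

theorem rot_mul_rot'_one (u u' : Matrix ι ι X.R) : rot u u' 1 * rot' 1 1 1 = 1 := by
  rw [rot_one, rot'_one, mul_neg, rotJ_mul_rotJ, neg_neg]

theorem invHomotopic_of_ip {ε₁ r₁ N₁ : ℝ} {γ δ : unitInterval → Matrix (Fin m) (Fin m) X.R}
    {x y : Matrix (Fin m) (Fin m) X.R} (hγ : X.NC γ) (hδ : X.NC δ) (h0 : γ 0 = x) (h1 : γ 1 = y)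
    (h : ∀ t, X.IP ε₁ r₁ N₁ (γ t) (δ t)) : InvHomotopic X.plus ε₁ r₁ N₁ x y :=
  ⟨γ, δ, (nc_fin_iff _).2 hγ, (nc_fin_iff _).2 hδ, h0, h1, fun t => (inversePair_iff _ _).2 (h t)⟩

theorem invHomotopic_submatrix {ε₁ r₁ N₁ : ℝ} {γ δ : unitInterval → Matrix ι ι X.R}
    {x y : Matrix ι ι X.R} (hγ : X.NC γ) (hδ : X.NC δ) (h0 : γ 0 = x) (h1 : γ 1 = y)
    (h : ∀ t, X.IP ε₁ r₁ N₁ (γ t) (δ t)) (e : Fin m ≃ ι) :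
    InvHomotopic X.plus ε₁ r₁ N₁ (x.submatrix e e : X.plus.Mat m) (y.submatrix e e) :=
  invHomotopic_of_ip (hγ.submatrix e) (hδ.submatrix e) (congrArg (fun z => z.submatrix e e) h0)
    (congrArg (fun z => z.submatrix e e) h1) fun t => (h t).submatrix e

theorem invHomotopic_bdiag (hP : Par ε r N) {u u' : Matrix (Fin n) (Fin n) X.R}
    (h : X.IP ε r N u u') :
    InvHomotopic X.plus (2 * ε) (2 * r) (2 * (N + ε)) (bdiag u u' : X.plus.Mat (n + n)) 1 := by
  have h2 := invHomotopic_submatrix ((NC.rot u u').mul (NC.rot' 1 1))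
    ((NC.rot 1 1).mul (NC.rot' u u')) (rot_mul_rot'_zero u u') (rot_mul_rot'_one u u')
    (ip_rot hP h) (finSumFinEquiv (m := n) (n := n)).symm
  rw [Matrix.submatrix_one_equiv] at h2
  exact h2

theorem incl_inr (F : (Sn X).carrier) :
    incl X ((Sn X).inr F) = (Cn X).inr (suspToCone X F) := by
  refine R_ext ?_ ?_
  · exact (unitize_fst (X := Sn X) (Y := Cn X) _ _).trans
      ((fst_inr (X := Sn X) F).trans (fst_inr (X := Cn X) _).symm)
  · exact (unitize_snd (X := Sn X) (Y := Cn X) _ _).trans ((congrArg (fun G : (Sn X).carrier =>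
      suspToCone X G) (snd_inr (X := Sn X) F)).trans (snd_inr (X := Cn X) _).symm)

theorem coneEval_eq (x : (Cn X).R) : coneEval X x = ev {0} X 1 x := by
  refine R_ext ?_ ?_
  · rw [ev_fst]
    exact evalPlus_fst _ _
  · rw [ev_snd]
    exact evalPlus_snd _ _

theorem inr_snd_core (x : (Cn X).R) : (Sn X).inr ((Sn X).snd (core x)) = core x := by
  have h : (Sn X).fst (core x) = 0 := fst_inl_add_inr _ _
  refine Eq.trans ?_ (inl_add_inr (core x))
  rw [h]
  simp

end Scale

namespace Scale

open MatAlg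

variable {X : MatAlg.{u} p} [X.Nice] {ι κ : Type*} [Fintype ι] [Fintype κ] [DecidableEq ι]
  [DecidableEq κ] {S : Scale} {k l m n : ℕ} {ε' r' N' ε r N : ℝ}

theorem tgt_of_pow (hP : Par ε r N) (k : ℕ) :
    (Scale.of hP).Tgt k ((2 * N) ^ k * ε) (k * r) ((2 * N) ^ k) := ⟨le_rfl, le_rfl, le_rfl⟩

theorem Inv.eMat_lift {u u' : Matrix ι ι X.R} (h : S.Inv k u u') :
    S.Inv (3 * k + 3) (eMat (u.map (MatAlg.lift X)) (u'.map (MatAlg.lift X)))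
      (eMat' (u.map (MatAlg.lift X)) (u'.map (MatAlg.lift X))) :=
  Inv.of_eq (h.w.lift.eMat h.w'.lift) (h.w.lift.eMat' h.w'.lift) (eMat_mul_eMat' _ _)
    (eMat'_mul_eMat _ _)

theorem Inv.eMat_lift_ev {u u' : Matrix ι ι X.R} (h : S.Inv k u u') :
    S.Ap (2 * k + 2) ((eMat (u.map (MatAlg.lift X)) (u'.map (MatAlg.lift X))).map (ev {0} X 1))
      (Matrix.fromBlocks u 0 0 u') := by
  rw [eMat_map, map_lift_ev_one, map_lift_ev_one]
  exact h.eMat_ap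

theorem Inv.yMat_lift_sub {u u' : Matrix ι ι X.R} (h : S.Inv k u u') :
    S.Sm (6 * k + 8) (yMat (u.map (MatAlg.lift X)) (u'.map (MatAlg.lift X)) - pMat (Cn X).R ι ι -
      ((yMat (u.map (MatAlg.lift X)) (u'.map (MatAlg.lift X))).map core).map (incl X)) := by
  have h1 := h.dEl_ap.symm
  rw [dEl, corr, mmap_add, pMat_map, Ap, ← sub_sub] at h1
  exact h1

theorem Inv.core_fil {u u' : Matrix ι ι X.R} (h : S.Inv k u u') :
    (Sn X).Fil ((6 * k + 8 : ℕ) * S.prop)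
      ((yMat (u.map (MatAlg.lift X)) (u'.map (MatAlg.lift X))).map core) := by
  have h1 := (h.dEl_w.sub (W.pMat (k := 0))).fil
  have h2 := h.dEl_w.fil.sub (W.pMat (X := Sn X) (S := S) (k := 6 * k + 8)).fil
  rw [dEl, corr, add_sub_cancel_left] at h2
  exact h2

theorem inr_snd_core_incl (c : (Cn X).R) :
    (Cn X).inr (suspToCone X ((Sn X).snd (core c))) = incl X (core c) := by
  rw [← incl_inr, inr_snd_core]

theorem boundaryChoice_of_matrix {c c' : ControlPair} {u : Matrix (Fin n) (Fin n) X.R}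
    {v : Matrix (Fin m) (Fin m) X.R} {w w' : Matrix (Fin n ⊕ Fin m) (Fin n ⊕ Fin m) (Cn X).R}
    {y : Matrix (Fin n ⊕ Fin m) (Fin n ⊕ Fin m) (Sn X).carrier}
    (hv : Q .one X ε r N v)
    (huv : InvHomotopic X.plus (2 * ε) (2 * r) (2 * (N + ε)) (bdiag u v : X.plus.Mat (n + m)) 1)
    (hw : (Cn X).IP (c.lam N * ε) (c.h ε N * r) (c.lam N) w w')
    (hl : X.nm (w.map (ev {0} X 1) - Matrix.fromBlocks u 0 0 v) < c.lam N * ε)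
    (hy : ∀ i j, y i j ∈ (Sn X).fil (c'.h ε N * r))
    (hc : (Cn X).nm (w * pMat (Cn X).R (Fin n) (Fin m) * w' - pMat (Cn X).R (Fin n) (Fin m) -
      y.map fun F => (Cn X).inr (suspToCone X F)) < 3 * c'.lam N * ε) :
    Nonempty (BoundaryChoice X c c' ε r N (u : X.plus.Mat n)) := by
  let e : Fin (n + m) ≃ Fin n ⊕ Fin m := finSumFinEquiv.symm
  have hl' := (nm_submatrix (X := X) e _).trans_lt hl
  rw [nm_fin] at hl'
  have hc' := (nm_submatrix (X := Cn X) e _).trans_lt hc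
  rw [nm_fin] at hc'
  refine ⟨⟨m, v, w.submatrix e e, w'.submatrix e e, y.submatrix e e, (isQuasi_iff v).2 hv, huv,
    (inversePair_iff (X := Cn X) _ _).2 (hw.submatrix e), ?_, fun i j => hy _ _, ?_⟩⟩
  · refine lt_of_le_of_lt (le_of_eq ?_) hl'
    exact congrArg (X.nrmR (n + m)) (Matrix.ext fun i j => by
      exact congrArg (fun z => z - _) (coneEval_eq (X := X) _))
  · refine lt_of_le_of_lt (le_of_eq ?_) hc'
    refine congrArg ((Cn X).nrmR (n + m)) ?_
    have e1 : ((w * pMat (Cn X).R (Fin n) (Fin m) * w').submatrix e e) =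
        w.submatrix e e * (pMat (Cn X).R (Fin n) (Fin m)).submatrix e e * w'.submatrix e e := by
      rw [Matrix.submatrix_mul_equiv, Matrix.submatrix_mul_equiv]
    exact congrArg (fun z => z - _ - _) e1.symm

/-- The complement is u', the lift is E, and y is the part of the corrected idempotent that lies in
the suspension. At level k = 2 the lift has level 3k + 3 = 9 and the correction level 6k + 8 = 20,
which the exponents 12 and 32 leave room for. -/
theorem nonempty_boundaryChoice (hP : Par ε r N) {u u' : Matrix (Fin n) (Fin n) X.R}
    (h : X.IP ε r N u u') : Nonempty (BoundaryChoice X (powPair 12 (by norm_num))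
      (powPair 32 (by norm_num)) ε r N (u : X.plus.Mat n)) := by
  have hI : (Scale.of hP).Inv 2 u u' := inv_of_ip hP (ip_four hP h)
  have hN := hP.bd
  refine boundaryChoice_of_matrix (c := powPair 12 (by norm_num)) (c' := powPair 32 (by norm_num))
    (y := (yMat (u.map (MatAlg.lift X)) (u'.map (MatAlg.lift X))).map
      fun c => (Sn X).snd (core c)) ⟨u, ⟨h.fil', h.fil, h.bd', h.bd, h.inv', h.inv⟩⟩
    (invHomotopic_bdiag hP h) (hI.eMat_lift.ip (tgt_of_pow hP 12) (by norm_num))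
    (hI.eMat_lift_ev.sm.lt (tgt_of_pow hP 12) (by norm_num)) (fun i j => ?_) ?_
  · refine hI.core_fil.mono ?_ i j
    change ((6 * 2 + 8 : ℕ) : ℝ) * r ≤ ((32 : ℕ) : ℝ) * r
    exact mul_le_mul_of_nonneg_right (by norm_num) hP.prop
  · have h1 := hI.yMat_lift_sub.lt (tgt_of_pow hP 32) (by norm_num)
    have e1 : ((yMat (u.map (MatAlg.lift X)) (u'.map (MatAlg.lift X))).map
        fun c => (Sn X).snd (core c)).map (fun F => (Cn X).inr (suspToCone X F)) =
        ((yMat (u.map (MatAlg.lift X)) (u'.map (MatAlg.lift X))).map core).map (incl X) :=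
      Matrix.ext fun i j => inr_snd_core_incl _
    rw [e1]
    refine h1.trans_le ?_
    change (2 * N) ^ 32 * ε ≤ 3 * (2 * N) ^ 32 * ε
    have h3 : 0 ≤ (2 * N) ^ 32 * ε := mul_nonneg (by positivity) hP.eps.le
    linarith

/-- All data of a choice are brought to level 35, and 162000 = 4400 · 35 + 8000 is the corresponding
level in `dVal_eq_of_lift`. The factor 3 in the condition on y is absorbed by two units of the
exponent. -/
theorem dVal_eq_of_matrix (hP : Par ε r N) (hε : ε ≤ 1) (hT : (Scale.of hP).Tgt 162000 ε' r' N')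
    {u u' : Matrix ι ι X.R} {v v' : Matrix κ κ X.R} {w w' : Matrix (ι ⊕ κ) (ι ⊕ κ) (Cn X).R}
    {y : Matrix (ι ⊕ κ) (ι ⊕ κ) (Sn X).carrier}
    (hu : X.IP ε r N u u') (hv : X.IP ε r N v v')
    (hw : (Cn X).IP ((2 * N) ^ 12 * ε) ((12 : ℕ) * r) ((2 * N) ^ 12) w w')
    (hl : X.nm (w.map (ev {0} X 1) - Matrix.fromBlocks u 0 0 v) < (2 * N) ^ 12 * ε)
    (hy : ∀ i j, y i j ∈ (Sn X).fil ((32 : ℕ) * r))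
    (hc : (Cn X).nm (w * pMat (Cn X).R ι κ * w' - pMat (Cn X).R ι κ -
      y.map fun F => (Cn X).inr (suspToCone X F)) < 3 * (2 * N) ^ 32 * ε) :
    (Scale.of hP).Qd 213 (y.map (Sn X).inr + pMat (Sn X).R ι κ) ∧
    cl .zero (Sn X) ε' r' N' (y.map (Sn X).inr + pMat (Sn X).R ι κ) -
      cl .zero (Sn X) ε' r' N' (1 : Matrix ι ι (Sn X).R) = dVal ε' r' N' u u' := by
  have hu2 : (Scale.of hP).Inv 2 u u' := inv_of_ip hP (ip_four hP hu)
  have hv2 : (Scale.of hP).Inv 2 v v' := inv_of_ip hP (ip_four hP hv)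
  have hw2 : (Scale.of hP).Inv 12 w w' :=
    ⟨⟨hw.bd, hw.fil⟩, ⟨hw.bd', hw.fil'⟩, hw.inv.le, hw.inv'.le⟩
  have hl2 : (Scale.of hP).Ap 12 (w.map (ev {0} X 1)) (Matrix.fromBlocks u 0 0 v) := hl.le
  have e1 : (y.map (Sn X).inr + pMat (Sn X).R ι κ).map (incl X) =
      (y.map fun F => (Cn X).inr (suspToCone X F)) + pMat (Cn X).R ι κ := by
    rw [mmap_add, pMat_map]
    exact congrArg (fun z => z + _) (Matrix.ext fun i j => incl_inr _)
  have hb : 3 ≤ (Scale.of hP).base ^ 2 := by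
    rw [of_pow]
    nlinarith [hP.bd]
  have hc2 : (Scale.of hP).Ap 34 ((y.map (Sn X).inr + pMat (Sn X).R ι κ).map (incl X))
      (w * pMat (Cn X).R ι κ * w') := by
    refine Ap.symm ?_
    rw [e1, Ap, add_comm, ← sub_sub]
    refine hc.le.trans ?_
    change 3 * (Scale.of hP).base ^ 32 * ε ≤ (Scale.of hP).base ^ (2 + 32) * ε
    rw [pow_add]
    exact mul_le_mul_of_nonneg_right (mul_le_mul_of_nonneg_right hb
      ((Scale.of hP).pow_pos 32).le) hP.eps.le
  -- No bound for y is assumed. Its norm is estimated through w p w', of level 24, and the error of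
  -- level 34, in which ε ≤ 1 is used.
  have he : (Scale.of hP).W 35 (y.map (Sn X).inr + pMat (Sn X).R ι κ) := by
    constructor
    · rw [← nm_incl]
      have h1 := (hw2.w.mul (W.pMat (k := 0))).mul hw2.w'
      have h2 := nm_add_le (w * pMat (Cn X).R ι κ * w')
        ((y.map (Sn X).inr + pMat (Sn X).R ι κ).map (incl X) - w * pMat (Cn X).R ι κ * w')
      rw [add_sub_cancel] at h2
      refine h2.trans ((add_le_add h1.bd (hc2.sm.trans (mul_le_of_le_one_right
        ((Scale.of hP).pow_pos 34).le hε))).trans ?_)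
      exact (Scale.of hP).pow_add_pow_le _ _
    · refine Fil.add (fun i j => ?_) (W.pMat (S := Scale.of hP) (k := 35)).fil
      rw [Matrix.map_apply, snd_inr]
      exact (Sn X).fil_mono _ _ (mul_le_mul_of_nonneg_right (by norm_num) hP.prop) (hy i j)
  exact dVal_eq_of_lift (k := 35) hT (hu2.mono (by omega)) (hv2.mono (by omega))
    (hw2.mono (by omega)) (hl2.mono (by omega)) he (hc2.mono (by omega))

theorem submatrix_submatrix_symm {A : Type*} (f : ι ≃ κ) (x : Matrix κ κ A) :
    (x.submatrix f f).submatrix f.symm f.symm = x := by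
  rw [Matrix.submatrix_submatrix]
  simp

theorem dVal_eq_of_fin (hP : Par ε r N) (hε : ε ≤ 1) (hT : (Scale.of hP).Tgt 162000 ε' r' N')
    (f : ι ⊕ κ ≃ Fin l) {u u' : Matrix ι ι X.R} {v v' : Matrix κ κ X.R}
    {w w' : Matrix (Fin l) (Fin l) (Cn X).R}
    {y : Matrix (Fin l) (Fin l) (Sn X).carrier}
    (hu : X.IP ε r N u u') (hv : X.IP ε r N v v')
    (hw : (Cn X).IP ((2 * N) ^ 12 * ε) ((12 : ℕ) * r) ((2 * N) ^ 12) w w')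
    (hl : X.nrmR l (w.map (ev {0} X 1) -
      (Matrix.fromBlocks u 0 0 v).submatrix f.symm f.symm) < (2 * N) ^ 12 * ε)
    (hy : ∀ i j, y i j ∈ (Sn X).fil ((32 : ℕ) * r))
    (hc : (Cn X).nrmR l (w * (pMat (Cn X).R ι κ).submatrix f.symm f.symm * w' -
      (pMat (Cn X).R ι κ).submatrix f.symm f.symm -
      y.map fun F => (Cn X).inr (suspToCone X F)) < 3 * (2 * N) ^ 32 * ε) :
    (Sn X).QI ε' r' N' (y.map (Sn X).inr + (pMat (Sn X).R ι κ).submatrix f.symm f.symm) ∧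
    (Sn X).QI ε' r' N' ((pMat (Sn X).R ι κ).submatrix f.symm f.symm) ∧
    cl .zero (Sn X) ε' r' N' (y.map (Sn X).inr + (pMat (Sn X).R ι κ).submatrix f.symm f.symm) -
      cl .zero (Sn X) ε' r' N' ((pMat (Sn X).R ι κ).submatrix f.symm f.symm) =
        dVal ε' r' N' u u' := by
  have e0 : y.map (Sn X).inr + (pMat (Sn X).R ι κ).submatrix f.symm f.symm =
      ((y.submatrix f f).map (Sn X).inr + pMat (Sn X).R ι κ).submatrix f.symm f.symm := by
    conv_lhs => rw [← submatrix_submatrix_symm f y]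
    rfl
  rw [← nm_fin] at hl hc
  have hl1 : X.nm ((w.submatrix f f).map (ev {0} X 1) - Matrix.fromBlocks u 0 0 v) <
      (2 * N) ^ 12 * ε := by
    refine lt_of_le_of_lt (le_of_eq ?_) hl
    rw [← nm_submatrix (X := X) f.symm]
    conv_rhs => rw [← submatrix_submatrix_symm f w]
    rfl
  have hc1 : (Cn X).nm (w.submatrix f f * pMat (Cn X).R ι κ * w'.submatrix f f -
      pMat (Cn X).R ι κ - (y.submatrix f f).map fun F => (Cn X).inr (suspToCone X F)) <
      3 * (2 * N) ^ 32 * ε := by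
    refine lt_of_le_of_lt (le_of_eq ?_) hc
    rw [← nm_submatrix (X := Cn X) f.symm]
    conv_rhs => rw [← submatrix_submatrix_symm f w, ← submatrix_submatrix_symm f w',
      ← submatrix_submatrix_symm f y, Matrix.submatrix_mul_equiv, Matrix.submatrix_mul_equiv]
    rfl
  obtain ⟨h1, h2⟩ := dVal_eq_of_matrix hP hε hT hu hv (hw.submatrix f) hl1 (fun i j => hy _ _) hc1
  have hp : (Scale.of hP).Qd 0 (pMat (Sn X).R ι κ) := Qd.one.sum Qd.zero
  rw [e0, cl_submatrix hT.par, cl_submatrix hT.par, cl_pMat hT.par]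
  exact ⟨(h1.submatrix f.symm).qi hT (by omega), (hp.submatrix f.symm).qi hT (by omega), h2⟩

theorem kClass_of_boundaryChoice (hP : Par ε r N) (hε : ε ≤ 1)
    (hT : (Scale.of hP).Tgt 162000 ε' r' N') {u u' : Matrix (Fin n) (Fin n) X.R}
    (hu : X.IP ε r N u u') (b : BoundaryChoice X (powPair 12 (by norm_num))
      (powPair 32 (by norm_num)) ε r N (u : X.plus.Mat n)) :
    ∃ (he : IsQuasi .zero (susp X).plus ε' r' N'
        ((b.y.map Unitization.inr : (susp X).plus.Mat (n + b.m)) + suspProj X n b.m))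
      (hp : IsQuasi .zero (susp X).plus ε' r' N' (suspProj X n b.m)),
      kClass .zero _ _ _ _ _ he - kClass .zero _ _ _ _ _ hp = dVal ε' r' N' u u' := by
  obtain ⟨v', hv⟩ := (isQuasi_iff (i := .one) b.v).1 b.v_inv
  have hl1 : X.nrmR (n + b.m) (Matrix.map (b.w : Matrix _ _ (Cn X).R) (ev {0} X 1) -
      (Matrix.fromBlocks u 0 0 b.v).submatrix finSumFinEquiv.symm finSumFinEquiv.symm) <
      (2 * N) ^ 12 * ε := by
    refine lt_of_le_of_lt (le_of_eq ?_) b.lift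
    exact congrArg (X.nrmR (n + b.m)) (Matrix.ext fun i j =>
      congrArg (fun z => z - _) (coneEval_eq (X := X) _).symm)
  obtain ⟨h1, h2, h3⟩ := dVal_eq_of_fin hP hε hT (finSumFinEquiv (m := n) (n := b.m)) hu hv
    ((inversePair_iff (X := Cn X) _ _).1 b.pair) hl1 b.y_mem b.y_close
  refine ⟨(isQuasi_iff (X := Sn X) (i := .zero) _).2 h1,
    (isQuasi_iff (X := Sn X) (i := .zero) _).2 h2, ?_⟩
  rw [← h3]
  exact congrArg₂ (· - ·) (kClass_eq_cl (X := Sn X) hT.par _) (kClass_eq_cl (X := Sn X) hT.par _)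

end Scale

namespace MatAlg

variable {X : MatAlg.{u} p} [X.Nice] {ι κ : Type*} [Fintype ι] [Fintype κ] [DecidableEq ι]
  [DecidableEq κ] {i : KDeg} {k l m n : ℕ} {ε' r' N' ε r N : ℝ}

/-! ## Scalar parts -/

theorem aug_cl_eq {x y : Matrix ι ι X.R} (hx : Q i X ε r N x) (hy : Q i X ε r N y)
    (h : x.map X.scal = y.map X.scal) :
    KUnital.map X.aug i (relaxes_one ε r N) (cl i X ε r N x) =
      KUnital.map X.aug i (relaxes_one ε r N) (cl i X ε r N y) := by
  have hx' : IsQuasi i X.plus ε r N (toFin (S := X.R) x) :=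
    (isQuasi_iff (toFin x)).2 (hx.submatrix (Fintype.equivFin ι).symm)
  have hy' : IsQuasi i X.plus ε r N (toFin (S := X.R) y) :=
    (isQuasi_iff (toFin y)).2 (hy.submatrix (Fintype.equivFin ι).symm)
  have e : X.aug.hom.mapMatrix (toFin x) = X.aug.hom.mapMatrix (toFin y) := by
    ext1 a b
    have h' : ∀ a b, X.fst (X.scal (x a b)) = X.fst (X.scal (y a b)) := fun a b =>
      congrArg X.fst (congrFun (congrFun h a) b)
    exact h' _ _
  refine ((congrArg (KUnital.map X.aug i _) (kcl_eq hx')).trans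
    (KUnital.map_kClass X.aug i _ _ hx')).trans (Eq.trans ?_
    ((congrArg (KUnital.map X.aug i _) (kcl_eq hy')).trans
      (KUnital.map_kClass X.aug i _ _ hy')).symm)
  exact congrArg (QuotientAddGroup.mk' _) (congrArg FreeAbelianGroup.of (KGen.ext_mat e _ _))

/-- The unital homomorphism `ℂ → A⁺`. -/
noncomputable def scalars (X : MatAlg.{u} p) [X.Nice] : UnitalHom (complexAlg p) X.plus 1 where
  hom := X.inl
  pos := one_pos
  map_fil r _ _ := (X.fil r).zero_mem
  bound n z := by
    rw [one_mul]
    exact Nice.nrm_scalar n z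

theorem map_scalars_aug (h : Relaxes ε r N ε' r' N') (hP' : Par ε' r' N')
    {x : Matrix (Fin n) (Fin n) X.R} (hx : IsQuasi i X.plus ε r N x) :
    KUnital.map (scalars X) i h.one_mul (KUnital.map X.aug i (relaxes_one ε r N)
      (kClass i X.plus ε r N x hx)) = cl i X ε' r' N' (x.map X.scal) := by
  refine (congrArg (KUnital.map (scalars X) i h.one_mul) (KUnital.map_kClass X.aug i _ x hx)).trans
    ((KUnital.map_kClass (scalars X) i _ _ _).trans ?_)
  exact kClass_eq_cl hP' _

/-- The class of the scalar part of x is the image of π_*[x] under the inclusion of the scalars. On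
the kernel of π_* the correction term therefore vanishes. -/
theorem eq_relax_of_sub_scal (hP : Par ε r N) (h : Relaxes ε r N ε' r' N') (hP' : Par ε' r' N')
    {G : KUnital i X.plus ε r N →+ KUnital i X.plus ε' r' N'}
    (H : ∀ n (x : Matrix (Fin n) (Fin n) X.R) (hx : IsQuasi i X.plus ε r N x),
      G (kClass i X.plus ε r N x hx) = cl i X ε' r' N' x - cl i X ε' r' N' (x.map X.scal))
    {x : KUnital i X.plus ε r N} (hx : x ∈ KGrp i X ε r N) :
    G x = KUnital.map (UnitalHom.id X.plus) i h.one_mul x := by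
  have e : G = KUnital.map (UnitalHom.id X.plus) i h.one_mul -
      (KUnital.map (scalars X) i h.one_mul).comp (KUnital.map X.aug i (relaxes_one ε r N)) := by
    refine KUnital.hom_ext fun n x hx => ?_
    refine (H n x hx).trans ?_
    rw [AddMonoidHom.sub_apply, AddMonoidHom.comp_apply]
    refine congrArg₂ (· - ·) ?_ (map_scalars_aug h hP' hx).symm
    exact ((congrArg (KUnital.map (UnitalHom.id X.plus) i h.one_mul) (kClass_eq_cl hP hx)).trans
      (relax_cl h ((isQuasi_iff x).1 hx))).symm
  rw [e, AddMonoidHom.sub_apply, AddMonoidHom.comp_apply, AddMonoidHom.mem_ker.1 hx, map_zero,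
    sub_zero]

end MatAlg

/-! ### Augmentation, relaxation and naturality of the two constructions. -/

namespace Scale

open MatAlg

variable {X : MatAlg.{u} p} [X.Nice] {ι κ : Type*} [Fintype ι] [Fintype κ] [DecidableEq ι]
  [DecidableEq κ] {S : Scale} {k l m n : ℕ} {ε₁ r₁ N₁ ε' r' N' ε r N : ℝ}

theorem scal_core (c : (Cn X).R) : (Sn X).scal (core c) = 0 := by
  refine R_ext ?_ ?_
  · rw [fst_scal, map_zero]
    exact fst_inl_add_inr _ _
  · rw [snd_scal, map_zero]

theorem dEl_scal (u u' : Matrix ι ι X.R) :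
    (dEl u u').map (Sn X).scal = (pMat (Sn X).R ι ι).map (Sn X).scal := by
  rw [dEl, corr, mmap_add]
  refine Eq.trans ?_ (add_zero _)
  exact congrArg (fun z => _ + z) (Matrix.ext fun i j => scal_core _)

theorem aug_dVal {u u' : Matrix ι ι X.R} (hT : S.Tgt (12 * k + 20) ε' r' N')
    (hu : S.Inv k u u') :
    KUnital.map (Sn X).aug .zero (relaxes_one ε' r' N') (dVal ε' r' N' u u') = 0 := by
  have hp : S.Qd 0 (pMat (Sn X).R ι ι) := Qd.one.sum Qd.zero
  rw [dVal, map_sub, ← cl_pMat (κ := ι) hT.par, sub_eq_zero]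
  exact aug_cl_eq (hu.dEl_qd.q hT (by omega)) (hp.q hT (by omega)) (dEl_scal u u')

theorem relax_dVal {u u' : Matrix ι ι X.R} (hT : S.Tgt (12 * k + 20) ε₁ r₁ N₁)
    (hu : S.Inv k u u') (h : Relaxes ε₁ r₁ N₁ ε' r' N') :
    KUnital.map (UnitalHom.id (Sn X).plus) .zero h.one_mul (dVal ε₁ r₁ N₁ u u') =
      dVal ε' r' N' u u' := by
  rw [dVal, map_sub, dVal]
  exact congrArg₂ (· - ·) (relax_cl (X := Sn X) h (hu.dEl_qd.q hT (by omega)))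
    (relax_cl (X := Sn X) h (Qd.one.q (k := 0) hT (by omega)))

section

variable {e : Matrix ι ι (Sn X).R}

theorem inv_rot (he : S.Qd k e) (ho : S.Osc k n e) :
    S.Inv (5 * k + 3) (cyc (Matrix.blockDiagonal fun j => e.map (ev {0, 1} X (pts n j)))
        (tperm X.R ι (back (n + 1))))
      (cyc (Matrix.blockDiagonal fun j => e.map (ev {0, 1} X (pts n j)))
        (tperm X.R ι (back (n + 1))⁻¹)) :=
  Inv.cyc_tperm (fun _ => he.map (contr_ev _)) (ap_steps ho (map_ev_one e) (steps_pts n))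

theorem inv_rot_const (he : S.Qd k e) :
    S.Inv (5 * k + 3) (cyc (Matrix.blockDiagonal fun _ : Fin (n + 1) => e.map (ev {0, 1} X 0))
        (tperm X.R ι (back (n + 1))))
      (cyc (Matrix.blockDiagonal fun _ => e.map (ev {0, 1} X 0))
        (tperm X.R ι (back (n + 1))⁻¹)) :=
  Inv.cyc_tperm (fun _ => he.map (contr_ev _)) fun _ => Ap.refl _

theorem scal_ev (t : unitInterval) (x : (Sn X).R) :
    X.scal (ev {0, 1} X t x) = X.scal (ev {0, 1} X 0 x) := by
  refine R_ext ?_ ?_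
  · rw [fst_scal, fst_scal, ev_fst, ev_fst]
  · rw [snd_scal, snd_scal]

/-- The scalar part of e(t) does not depend on t, so that the sampled and the constant loop give
compressed shifts with the same scalar part. -/
theorem aug_bVal (hT : S.Tgt (5 * k + 4) ε' r' N') (he : S.Qd k e) (ho : S.Osc k n e) :
    KUnital.map X.aug .one (relaxes_one ε' r' N') (bVal ε' r' N' n e) = 0 := by
  rw [bVal, map_sub, sub_eq_zero]
  refine aug_cl_eq ((inv_rot he ho).q hT (by omega)) ((inv_rot_const he).q hT (by omega)) ?_
  rw [cyc_map, cyc_map, blockDiagonal_map, blockDiagonal_map]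
  refine congrArg (fun f => cyc (Matrix.blockDiagonal f) _) (funext fun j => ?_)
  exact Matrix.ext fun a b => scal_ev _ _

/-- For a fixed number of sample points the compressed shift is formed by ring operations and
permutation matrices, which homomorphisms preserve. -/
theorem map_bVal {Y : MatAlg.{u} p} [Y.Nice] {c : ℝ} (φ : UnitalHom X.plus Y.plus c)
    (g : X.R →+* Y.R) (hg : ∀ x, φ.hom x = g x) (g' : (Sn X).R →+* (Sn Y).R)
    (hg' : ∀ t x, ev {0, 1} Y t (g' x) = g (ev {0, 1} X t x))
    (h : Relaxes (c * ε₁) r₁ (c * N₁) ε' r' N')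
    (hT : S.Tgt (5 * k + 4) ε₁ r₁ N₁) (he : S.Qd k e) (ho : S.Osc k n e) :
    KUnital.map φ .one h (bVal ε₁ r₁ N₁ n e) = bVal ε' r' N' n (e.map g') := by
  have key : ∀ τ : Fin (n + 1) → unitInterval,
      (cyc (Matrix.blockDiagonal fun j => e.map (ev {0, 1} X (τ j)))
        (tperm X.R ι (back (n + 1)))).map g =
      cyc (Matrix.blockDiagonal fun j => (e.map g').map (ev {0, 1} Y (τ j)))
        (tperm Y.R ι (back (n + 1))) := fun τ => by
    rw [cyc_map, blockDiagonal_map, tperm_map]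
    refine congrArg (fun f => cyc (Matrix.blockDiagonal f) _) (funext fun j => ?_)
    exact Matrix.ext fun a b => (hg' _ _).symm
  rw [bVal, map_sub, bVal]
  refine congrArg₂ (· - ·) ?_ ?_
  · exact (map_cl φ g hg h ((inv_rot he ho).q hT (by omega))).trans (congrArg _ (key _))
  · exact (map_cl φ g hg h ((inv_rot_const he).q hT (by omega))).trans (congrArg _ (key fun _ => 0))

theorem relax_bVal (hT : S.Tgt (5 * k + 4) ε₁ r₁ N₁) (he : S.Qd k e) (ho : S.Osc k n e)
    (h : Relaxes ε₁ r₁ N₁ ε' r' N') :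
    KUnital.map (UnitalHom.id X.plus) .one h.one_mul (bVal ε₁ r₁ N₁ n e) = bVal ε' r' N' n e :=
  map_bVal (UnitalHom.id X.plus) (RingHom.id _) (fun _ => rfl) (RingHom.id _) (fun _ _ => rfl)
    h.one_mul hT he ho

end

end Scale

section

open MatAlg Scale

variable (X : MatAlg.{u} p) [X.Nice] {K L M : ℕ} {ε r N ε' r' N' : ℝ}

/-! ## The boundary map and its inverse as controlled morphisms -/

/-- `F` maps the class of `u` to its boundary. -/
structure IsBoundaryHom (F : KUnital .one X.plus ε r N →+ KUnital .zero (Sn X).plus ε' r' N') :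
    Prop where
  apply : ∀ (n : ℕ) (u u' : Matrix (Fin n) (Fin n) X.R) (hu : IsQuasi .one X.plus ε r N u),
    X.IP (4 * ε) (2 * r) (4 * N) u u' → F (kClass .one X.plus ε r N u hu) = dVal ε' r' N' u u'
  aug : ∀ x, KUnital.map (Sn X).aug .zero (relaxes_one ε' r' N') (F x) = 0

/-- `F` maps the class of `e` to the eventual value of `bVal`. -/
structure IsBottHom (F : KUnital .zero (Sn X).plus ε r N →+ KUnital .one X.plus ε' r' N') :
    Prop where
  apply : ∀ (n : ℕ) (e : Matrix (Fin n) (Fin n) (Sn X).R) (he : IsQuasi .zero (Sn X).plus ε r N e),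
    ∀ᶠ m in atTop, F (kClass .zero (Sn X).plus ε r N e he) = bVal ε' r' N' m e
  aug : ∀ x, KUnital.map X.aug .one (relaxes_one ε' r' N') (F x) = 0

variable {X}

theorem exists_isBoundaryHom (hP : Par ε r N) (hT : (Scale.of hP).Tgt 200 ε' r' N') :
    ∃ F : KUnital .one X.plus ε r N →+ KUnital .zero (Sn X).plus ε' r' N', IsBoundaryHom X F := by
  obtain ⟨F, hF⟩ := exists_boundary X hP hT
  refine ⟨F, ⟨fun n u u' hu h => hF n u u' hu (inv_of_ip hP h), fun x => ?_⟩⟩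
  have e : (KUnital.map (Sn X).aug .zero (relaxes_one ε' r' N')).comp F = 0 := by
    refine KUnital.hom_ext fun n u hu => ?_
    obtain ⟨u', h⟩ := (isQuasi_iff (i := .one) u).1 hu
    have hI := inv_of_ip hP (ip_four hP h)
    exact (congrArg _ (hF n u u' hu hI)).trans (aug_dVal (hT.mono (by omega)) hI)
  exact DFunLike.congr_fun e x

theorem exists_isBottHom (hP : Par ε r N) (hT : (Scale.of hP).Tgt 200 ε' r' N') :
    ∃ F : KUnital .zero (Sn X).plus ε r N →+ KUnital .one X.plus ε' r' N', IsBottHom X F := by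
  obtain ⟨F, hF⟩ := exists_bott X hP hT
  refine ⟨F, ⟨hF, fun x => ?_⟩⟩
  have e : (KUnital.map X.aug .one (relaxes_one ε' r' N')).comp F = 0 := by
    refine KUnital.hom_ext fun n x hx => ?_
    have hI : (Scale.of hP).Qd 2 x := qd_of_qi hP (qi_four hP ((isQuasi_iff (i := .zero) x).1 hx))
    obtain ⟨m, h1, h2⟩ := ((hF n x hx).and (osc_eventually (S := Scale.of hP) (k := 2) x)).exists
    exact (congrArg _ h1).trans (aug_bVal (hT.mono (by omega)) hI h2)
  exact DFunLike.congr_fun e x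

open Classical in
/-- The boundary map, for parameters for which it is defined. -/
noncomputable def boundaryHom (X : MatAlg.{u} p) [X.Nice] (ε r N ε' r' N' : ℝ) :
    KGrp .one X ε r N →+ KGrp .zero (susp X) ε' r' N' :=
  if h : ∃ F : KUnital .one X.plus ε r N →+ KUnital .zero (Sn X).plus ε' r' N', IsBoundaryHom X F
  then (h.choose.comp (KGrp .one X ε r N).subtype).codRestrict (KGrp .zero (susp X) ε' r' N')
    fun x => h.choose_spec.aug x.1
  else 0

open Classical in
/-- The inverse of the boundary map, for parameters for which it is defined. -/
noncomputable def bottHom (X : MatAlg.{u} p) [X.Nice] (ε r N ε' r' N' : ℝ) :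
    KGrp .zero (susp X) ε r N →+ KGrp .one X ε' r' N' :=
  if h : ∃ F : KUnital .zero (Sn X).plus ε r N →+ KUnital .one X.plus ε' r' N', IsBottHom X F
  then (h.choose.comp (KGrp .zero (susp X) ε r N).subtype).codRestrict (KGrp .one X ε' r' N')
    fun x => h.choose_spec.aug x.1
  else 0

theorem boundaryHom_spec (hP : Par ε r N) (hT : (Scale.of hP).Tgt 200 ε' r' N') :
    ∃ F : KUnital .one X.plus ε r N →+ KUnital .zero (Sn X).plus ε' r' N', IsBoundaryHom X F ∧
      ∀ x : KGrp .one X ε r N, (boundaryHom X ε r N ε' r' N' x).1 = F x.1 := by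
  have h := exists_isBoundaryHom (X := X) hP hT
  refine ⟨h.choose, h.choose_spec, fun x => ?_⟩
  exact congrArg (fun G : KGrp .one X ε r N →+ KGrp .zero (susp X) ε' r' N' => (G x).1) (dif_pos h)

theorem bottHom_spec (hP : Par ε r N) (hT : (Scale.of hP).Tgt 200 ε' r' N') :
    ∃ F : KUnital .zero (Sn X).plus ε r N →+ KUnital .one X.plus ε' r' N', IsBottHom X F ∧
      ∀ x : KGrp .zero (susp X) ε r N, (bottHom X ε r N ε' r' N' x).1 = F x.1 := by
  have h := exists_isBottHom (X := X) hP hT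
  refine ⟨h.choose, h.choose_spec, fun x => ?_⟩
  exact congrArg (fun G : KGrp .zero (susp X) ε r N →+ KGrp .one X ε' r' N' => (G x).1) (dif_pos h)

theorem powPair_relaxes {K : ℕ} (hK : 1 ≤ K) {ε r N ε' r' N' : ℝ} (hN : 1 ≤ N)
    (hε : 0 < ε) (h : Relaxes ε r N ε' r' N') (hr : K * r ≤ K * r') :
    Relaxes ((powPair K hK).lam N * ε) ((powPair K hK).h ε N * r) ((powPair K hK).lam N)
      ((powPair K hK).lam N' * ε') ((powPair K hK).h ε' N' * r') ((powPair K hK).lam N') := by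
  have h1 : (powPair K hK).lam N ≤ (powPair K hK).lam N' :=
    (powPair K hK).lam_mono hN (hN.trans h.bd) h.bd
  have h2 := (powPair K hK).one_le_lam N hN
  exact ⟨mul_le_mul h1 h.eps hε.le (by linarith), hr, h1⟩

theorem isBoundaryHom_relax {ε₁ r₁ N₁ ε₂ r₂ N₂ : ℝ} (hP : Par ε r N)
    (hT : (Scale.of hP).Tgt 50 ε' r' N') (hP₁ : Par ε₁ r₁ N₁)
    (hT₁ : (Scale.of hP₁).Tgt 50 ε₂ r₂ N₂) (h : Relaxes ε r N ε₁ r₁ N₁)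
    (h' : Relaxes ε' r' N' ε₂ r₂ N₂)
    {F : KUnital .one X.plus ε r N →+ KUnital .zero (Sn X).plus ε' r' N'} (hF : IsBoundaryHom X F)
    {G : KUnital .one X.plus ε₁ r₁ N₁ →+ KUnital .zero (Sn X).plus ε₂ r₂ N₂}
    (hG : IsBoundaryHom X G) (x : KUnital .one X.plus ε r N) :
    KUnital.map (UnitalHom.id (Sn X).plus) .zero h'.one_mul (F x) =
      KUnital.map (UnitalHom.id (Sn X).plus) .zero (relaxes_one ε₂ r₂ N₂)
        (G (KUnital.map (UnitalHom.id X.plus) .one h.one_mul x)) := by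
  have e : (KUnital.map (UnitalHom.id (Sn X).plus) .zero h'.one_mul).comp F =
      (KUnital.map (UnitalHom.id (Sn X).plus) .zero (relaxes_one ε₂ r₂ N₂)).comp
        (G.comp (KUnital.map (UnitalHom.id X.plus) .one h.one_mul)) := by
    refine KUnital.hom_ext fun n u hu => ?_
    obtain ⟨u', hI⟩ := (isQuasi_iff (i := .one) u).1 hu
    have hI₁ : X.IP ε₁ r₁ N₁ u u' := ⟨hI.fil.mono h.prop, hI.fil'.mono h.prop, hI.bd.trans h.bd,
      hI.bd'.trans h.bd, hI.inv.trans_le h.eps, hI.inv'.trans_le h.eps⟩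
    have h4 := ip_four hP hI
    have h4₁ := ip_four hP₁ hI₁
    have e1 := KUnital.map_kClass (UnitalHom.id X.plus) .one h.one_mul u hu
    have e2 := hG.apply n u u' ((UnitalHom.id X.plus).isQuasi h.one_mul hu) h4₁
    refine ((congrArg _ (hF.apply n u u' hu h4)).trans (relax_dVal (hT.mono (by omega))
      (inv_of_ip hP h4) h')).trans (Eq.symm ?_)
    exact (congrArg _ ((congrArg G e1).trans e2)).trans (relax_dVal (hT₁.mono (by omega))
      (inv_of_ip hP₁ h4₁) ⟨le_rfl, le_rfl, le_rfl⟩)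
  exact DFunLike.congr_fun e x

/-- The two Bott values are compared at a number of sample points that is large enough for e and for
its image. With φ the identity this is compatibility with relaxation; with φ = f⁺ it is naturality.
-/
theorem isBottHom_map {Y : MatAlg.{u} p} [Y.Nice] {c : ℝ} {ε₁ r₁ N₁ ε₂ r₂ N₂ ε₃ r₃ N₃ : ℝ}
    (φ : UnitalHom X.plus Y.plus c) (g : X.R →+* Y.R) (hg : ∀ x, φ.hom x = g x)
    (ψ : UnitalHom (Sn X).plus (Sn Y).plus c) (g' : (Sn X).R →+* (Sn Y).R)
    (hψ : ∀ x, ψ.hom x = g' x)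
    (hg' : ∀ t x, ev {0, 1} Y t (g' x) = g (ev {0, 1} X t x))
    (hP : Par ε r N) (hT : (Scale.of hP).Tgt 50 ε' r' N') (hP₁ : Par ε₁ r₁ N₁)
    (hT₁ : (Scale.of hP₁).Tgt 50 ε₂ r₂ N₂) (h : Relaxes (c * ε) r (c * N) ε₁ r₁ N₁)
    (h' : Relaxes (c * ε') r' (c * N') ε₃ r₃ N₃) (h₂ : Relaxes ε₂ r₂ N₂ ε₃ r₃ N₃)
    {F : KUnital .zero (Sn X).plus ε r N →+ KUnital .one X.plus ε' r' N'} (hF : IsBottHom X F)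
    {G : KUnital .zero (Sn Y).plus ε₁ r₁ N₁ →+ KUnital .one Y.plus ε₂ r₂ N₂}
    (hG : IsBottHom Y G) (x : KUnital .zero (Sn X).plus ε r N) :
    KUnital.map φ .one h' (F x) = KUnital.map (UnitalHom.id Y.plus) .one h₂.one_mul
      (G (KUnital.map ψ .zero h x)) := by
  have e : (KUnital.map φ .one h').comp F = (KUnital.map (UnitalHom.id Y.plus) .one
      h₂.one_mul).comp (G.comp (KUnital.map ψ .zero h)) := by
    refine KUnital.hom_ext fun n x hx => ?_
    have hx' : IsQuasi .zero (Sn Y).plus ε₁ r₁ N₁ (x.map g' : (Sn Y).plus.Mat n) := by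
      have h1 := ψ.isQuasi h hx
      have h2 : ψ.hom.mapMatrix x = x.map g' := Matrix.ext fun i j => hψ _
      rwa [h2] at h1
    have hI : (Scale.of hP).Qd 2 x := qd_of_qi hP (qi_four hP ((isQuasi_iff (i := .zero) x).1 hx))
    have hI₁ : (Scale.of hP₁).Qd 2 (x.map g') :=
      qd_of_qi hP₁ (qi_four hP₁ ((isQuasi_iff (X := Sn Y) (i := .zero) _).1 hx'))
    obtain ⟨m, ⟨⟨h1, h2⟩, h3⟩, h4⟩ := (((hF.apply n x hx).and
      (osc_eventually (S := Scale.of hP) (k := 2) x)).and (hG.apply n (x.map g') hx')).and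
      (osc_eventually (S := Scale.of hP₁) (k := 2) (x.map g')) |>.exists
    have e1 : KUnital.map ψ .zero h (kClass .zero _ _ _ _ x hx) =
        kClass .zero (Sn Y).plus ε₁ r₁ N₁ (x.map g' : (Sn Y).plus.Mat n) hx' :=
      (KUnital.map_kClass ψ .zero h x hx).trans (congrArg (QuotientAddGroup.mk' _)
        (congrArg FreeAbelianGroup.of (KGen.ext_mat (Matrix.ext fun i j => hψ _) _ _)))
    refine ((congrArg _ h1).trans (map_bVal φ g hg g' hg' h' (hT.mono (by omega)) hI h2)).trans
      (Eq.symm ?_)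
    exact (congrArg _ ((congrArg G e1).trans h3)).trans
      (relax_bVal (hT₁.mono (by omega)) hI₁ h4 h₂)
  exact DFunLike.congr_fun e x

/-- The boundary map `𝒦_1(A) → 𝒦_0(SA)`. -/
noncomputable def boundaryMorphism (X : MatAlg.{u} p) [X.Nice] (K : ℕ) (hK : 200 ≤ K) :
    ControlledMorphism (powPair K (by omega)) .one .zero X (susp X) where
  map ε r N := boundaryHom X ε r N _ _ _
  natural ε r N ε' r' N' h h' hrel hr x := by
    have hP : Par ε r N := ⟨h.eps_pos, h.r_pos.le, h.one_le⟩
    have hP' : Par ε' r' N' := ⟨h'.eps_pos, h'.r_pos.le, h'.one_le⟩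
    have hR := powPair_relaxes (K := K) (by omega) h.one_le h.eps_pos hrel hr
    have hT := tgt_of_pow hP K
    have hT' := tgt_of_pow hP' K
    obtain ⟨F, hF, hx⟩ := boundaryHom_spec (X := X) hP (hT.mono hK)
    obtain ⟨F', hF', hx'⟩ := boundaryHom_spec (X := X) hP' (hT'.mono hK)
    refine ⟨hR, ⟨le_rfl, le_rfl, le_rfl⟩, Subtype.ext ?_⟩
    refine (congrArg (KUnital.map (UnitalHom.id (Sn X).plus) .zero hR.one_mul) (hx x)).trans ?_
    refine (isBoundaryHom_relax hP (hT.mono (by omega)) hP' (hT'.mono (by omega)) hrel hR hF hF'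
      x.1).trans ?_
    exact congrArg (KUnital.map (UnitalHom.id (Sn X).plus) .zero (relaxes_one _ _ _))
      (hx' (KGrp.relax .one X hrel x)).symm

/-- The inverse `𝒦_0(SA) → 𝒦_1(A)` of the boundary map. -/
noncomputable def bottMorphism (X : MatAlg.{u} p) [X.Nice] (K : ℕ) (hK : 200 ≤ K) :
    ControlledMorphism (powPair K (by omega)) .zero .one (susp X) X where
  map ε r N := bottHom X ε r N _ _ _
  natural ε r N ε' r' N' h h' hrel hr x := by
    have hP : Par ε r N := ⟨h.eps_pos, h.r_pos.le, h.one_le⟩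
    have hP' : Par ε' r' N' := ⟨h'.eps_pos, h'.r_pos.le, h'.one_le⟩
    have hR := powPair_relaxes (K := K) (by omega) h.one_le h.eps_pos hrel hr
    have hT := tgt_of_pow hP K
    have hT' := tgt_of_pow hP' K
    obtain ⟨F, hF, hx⟩ := bottHom_spec (X := X) hP (hT.mono hK)
    obtain ⟨F', hF', hx'⟩ := bottHom_spec (X := X) hP' (hT'.mono hK)
    refine ⟨hR, ⟨le_rfl, le_rfl, le_rfl⟩, Subtype.ext ?_⟩
    refine (congrArg (KUnital.map (UnitalHom.id X.plus) .one hR.one_mul) (hx x)).trans ?_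
    refine (isBottHom_map (UnitalHom.id X.plus) (RingHom.id _) (fun _ => rfl)
      (UnitalHom.id (Sn X).plus) (RingHom.id _) (fun _ => rfl) (fun _ _ => rfl) hP
      (hT.mono (by omega)) hP' (hT'.mono (by omega)) hrel.one_mul hR.one_mul
      ⟨le_rfl, le_rfl, le_rfl⟩ hF hF' x.1).trans ?_
    exact congrArg (KUnital.map (UnitalHom.id X.plus) .one (relaxes_one _ _ _))
      (hx' (KGrp.relax .zero (susp X) hrel x)).symm

end

section

open MatAlg Scale

variable {X : MatAlg.{u} p} [X.Nice] {ι : Type*} [Fintype ι] [DecidableEq ι] {K L M : ℕ}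
  {ε r N ε₁ r₁ N₁ ε₂ r₂ N₂ ε' r' N' : ℝ}

/-! ## The compositions -/

theorem IsBoundaryHom.cl {F : KUnital .one X.plus ε r N →+ KUnital .zero (Sn X).plus ε' r' N'}
    (hF : IsBoundaryHom X F) (hP' : Par ε' r' N') {u u' : Matrix ι ι X.R}
    (hu : Q .one X ε r N u) (h : X.IP (4 * ε) (2 * r) (4 * N) u u') :
    F (cl .one X ε r N u) = dVal ε' r' N' u u' := by
  have hq : IsQuasi .one X.plus ε r N (toFin (S := X.R) u) :=
    (isQuasi_iff (i := .one) (toFin u)).2 (Q.submatrix (i := .one) (Fintype.equivFin ι).symm hu)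
  refine (congrArg F (kcl_eq hq)).trans ?_
  refine (hF.apply _ (toFin u) (toFin u') hq (h.submatrix (Fintype.equivFin ι).symm)).trans ?_
  exact dVal_submatrix hP' (Fintype.equivFin ι).symm

theorem IsBottHom.cl {F : KUnital .zero (Sn X).plus ε r N →+ KUnital .one X.plus ε' r' N'}
    (hF : IsBottHom X F) (hP' : Par ε' r' N') {e : Matrix ι ι (Sn X).R}
    (he : Q .zero (Sn X) ε r N e) :
    ∀ᶠ m in atTop, F (cl .zero (Sn X) ε r N e) = bVal ε' r' N' m e := by
  have hq : IsQuasi .zero (Sn X).plus ε r N (toFin (S := (Sn X).R) e) :=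
    (isQuasi_iff (i := .zero) (toFin e)).2 (Q.submatrix (i := .zero) (Fintype.equivFin ι).symm he)
  filter_upwards [hF.apply _ (toFin e) hq] with m hm
  refine (congrArg F (kcl_eq hq)).trans (hm.trans ?_)
  exact bVal_submatrix hP' (Fintype.equivFin ι).symm e

/-- The boundary of u is [`dEl`] - [1]. The constant loop 1 has Bott value 0, and the number of
points is taken large enough for `dEl` and for the lift E that enters `bVal_dEl`. Level 8000 is 2000
· 2 + 4000. -/
theorem bott_boundary (hP : Par ε r N) (hT : (Scale.of hP).Tgt 50 ε₁ r₁ N₁)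
    (hT₁ : (Scale.of hT.par).Tgt 50 ε₂ r₂ N₂) (h₂ : Relaxes ε₂ r₂ N₂ ε' r' N')
    (h : Relaxes ε r N ε' r' N') (hT' : (Scale.of hP).Tgt 8000 ε' r' N')
    {F : KUnital .one X.plus ε r N →+ KUnital .zero (Sn X).plus ε₁ r₁ N₁} (hF : IsBoundaryHom X F)
    {G : KUnital .zero (Sn X).plus ε₁ r₁ N₁ →+ KUnital .one X.plus ε₂ r₂ N₂} (hG : IsBottHom X G)
    {x : KUnital .one X.plus ε r N} (hx : x ∈ KGrp .one X ε r N) :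
    KUnital.map (UnitalHom.id X.plus) .one h₂.one_mul (G (F x)) =
      KUnital.map (UnitalHom.id X.plus) .one h.one_mul x := by
  refine eq_relax_of_sub_scal (G := (KUnital.map (UnitalHom.id X.plus) .one h₂.one_mul).comp
    (G.comp F)) hP h hT'.par (fun n u hu => ?_) hx
  obtain ⟨u', hI⟩ := (isQuasi_iff (i := .one) u).1 hu
  have h4 := ip_four hP hI
  have hu2 : (Scale.of hP).Inv 2 u u' := inv_of_ip hP h4
  have hq : (Sn X).QI ε₁ r₁ N₁ (dEl u u') := hu2.dEl_qd.qi hT (by omega)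
  have hq1 : (Sn X).QI ε₁ r₁ N₁ (1 : Matrix (Fin n) (Fin n) (Sn X).R) :=
    Qd.one.qi (k := 0) hT (by omega)
  obtain ⟨m, ⟨⟨h1, h2⟩, h3⟩, h5⟩ := (((hG.cl hT₁.par hq).and (hG.cl hT₁.par hq1)).and
    (osc_eventually (S := Scale.of hT.par) (k := 2) (dEl u u'))).and
    (osc_eventually (S := Scale.of hP) (k := 0)
      (eMat (u.map (MatAlg.lift X)) (u'.map (MatAlg.lift X)))) |>.exists
  have h6 : bVal ε₂ r₂ N₂ m (1 : Matrix (Fin n) (Fin n) (Sn X).R) = 0 :=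
    bVal_const fun t => by rw [mmap_one, mmap_one]
  have e1 : G (F (kClass .one X.plus ε r N u hu)) = bVal ε₂ r₂ N₂ m (dEl u u') := by
    refine (congrArg G (hF.apply n u u' hu h4)).trans ?_
    rw [dVal, map_sub]
    refine (congrArg₂ (· - ·) h1 h2).trans ?_
    rw [h6, sub_zero]
  refine (congrArg _ e1).trans ?_
  refine (relax_bVal (hT₁.mono (by omega)) (qd_of_qi hT.par (qi_four hT.par hq)) h3 h₂).trans ?_
  exact bVal_dEl (k := 2) (hT'.mono (by omega)) hu2 h5

theorem ev_scal_eq (t : unitInterval) (e : Matrix ι ι (Sn X).R) :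
    (e.map (Sn X).scal).map (ev {0, 1} X t) = e.map (ev {0, 1} X 0) := by
  ext1 i j
  rw [Matrix.map_apply, Matrix.map_apply, Matrix.map_apply, ev_scal, scal_ev, ← ev_susp_zero]

/-- `dVal_cyc` is applied to both terms of the Bott value. Level 550000 is 120000 · 2 + 310000. -/
theorem boundary_bott (hP : Par ε r N) (hT : (Scale.of hP).Tgt 50 ε₁ r₁ N₁)
    (hT₁ : (Scale.of hT.par).Tgt 50 ε₂ r₂ N₂) (h₂ : Relaxes ε₂ r₂ N₂ ε' r' N')
    (h : Relaxes ε r N ε' r' N') (hT' : (Scale.of hP).Tgt 550000 ε' r' N')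
    {G : KUnital .zero (Sn X).plus ε r N →+ KUnital .one X.plus ε₁ r₁ N₁} (hG : IsBottHom X G)
    {F : KUnital .one X.plus ε₁ r₁ N₁ →+ KUnital .zero (Sn X).plus ε₂ r₂ N₂}
    (hF : IsBoundaryHom X F)
    {x : KUnital .zero (Sn X).plus ε r N} (hx : x ∈ KGrp .zero (Sn X) ε r N) :
    KUnital.map (UnitalHom.id (Sn X).plus) .zero h₂.one_mul (F (G x)) =
      KUnital.map (UnitalHom.id (Sn X).plus) .zero h.one_mul x := by
  refine eq_relax_of_sub_scal (G := (KUnital.map (UnitalHom.id (Sn X).plus) .zero h₂.one_mul).comp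
    (F.comp G)) hP h hT'.par (fun n e he => ?_) hx
  have he2 : (Scale.of hP).Qd 2 e := qd_of_qi hP (qi_four hP ((isQuasi_iff (i := .zero) e).1 he))
  obtain ⟨m, h1, h2⟩ := ((hG.apply n e he).and
    (osc_eventually (S := Scale.of hP) (k := 2) e)).exists
  have key : ∀ {w w' : Matrix (Fin n × Fin (m + 1)) (Fin n × Fin (m + 1)) X.R},
      (Scale.of hP).Inv (5 * 2 + 3) w w' →
      KUnital.map (UnitalHom.id (Sn X).plus) .zero h₂.one_mul (F (MatAlg.cl .one X ε₁ r₁ N₁ w)) =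
        dVal ε' r' N' w w' := fun {w w'} hw => by
    have hi := ip_four hT.par (hw.ip hT (by omega))
    exact (congrArg _ (hF.cl hT₁.par (hw.q hT (by omega)) hi)).trans
      (relax_dVal (hT₁.mono (by omega)) (inv_of_ip hT.par hi) h₂)
  -- The constant term is the compressed shift of the loop that is constantly the scalar part of e.
  -- By `dVal_cyc` its boundary is the difference of two equal classes.
  have hs : (Scale.of hP).Osc 2 m (e.map (Sn X).scal) := fun a b _ =>
    Ap.of_eq ((ev_scal_eq a e).trans (ev_scal_eq b e).symm)
  have e2 := dVal_cyc (k := 2) (hT'.mono (by omega)) he2.scal hs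
  have e3 : (e.map (Sn X).scal).map (Sn X).scal = e.map (Sn X).scal := rfl
  rw [e3, sub_self] at e2
  simp only [ev_scal_eq] at e2
  have e1 := dVal_cyc (k := 2) (hT'.mono (by omega)) he2 h2
  refine (congrArg (fun z => KUnital.map (UnitalHom.id (Sn X).plus) .zero h₂.one_mul (F z)) h1).trans
    ?_
  rw [bVal]
  simp only [map_sub]
  refine (congrArg₂ (· - ·) ((key (inv_rot he2 h2)).trans e1)
    ((key (inv_rot_const he2)).trans e2)).trans (sub_zero _)

end

/-! ### Composition of control pairs and the final assembly. -/

section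

open MatAlg Scale

/-- As 2N ≥ 2, one has 2(2N)^K ≤ (2N)^(K+1), so that a composition of such control pairs is again
dominated by one. -/
theorem powPair_comp {K L M : ℕ} (hK : 1 ≤ K) (hL : 1 ≤ L) (hM : 1 ≤ M) (h : (K + 1) * L + K ≤ M)
    {N : ℝ} (hN : 1 ≤ N) :
    (powPair L hL).lam ((powPair K hK).lam N) * (powPair K hK).lam N ≤ (powPair M hM).lam N := by
  change (2 * (2 * N) ^ K) ^ L * (2 * N) ^ K ≤ (2 * N) ^ M
  have h1 : 2 * (2 * N) ^ K ≤ (2 * N) ^ (K + 1) := by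
    rw [pow_succ, mul_comm]
    exact mul_le_mul_of_nonneg_left (by linarith) (by positivity)
  calc (2 * (2 * N) ^ K) ^ L * (2 * N) ^ K ≤ ((2 * N) ^ (K + 1)) ^ L * (2 * N) ^ K :=
        mul_le_mul_of_nonneg_right (pow_le_pow_left₀ (by positivity) h1 L) (by positivity)
    _ = (2 * N) ^ ((K + 1) * L + K) := by rw [← pow_mul, ← pow_add]
    _ ≤ (2 * N) ^ M := pow_le_pow_right₀ (by linarith) h

theorem powPair_comp_relaxes {K L M : ℕ} (hK : 1 ≤ K) (hL : 1 ≤ L) (hM : 1 ≤ M)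
    (h : (K + 1) * L + K ≤ M) {ε r N : ℝ} (hP : Par ε r N) :
    Relaxes ((2 * (2 * N) ^ K) ^ L * ((2 * N) ^ K * ε)) (L * (K * r)) ((2 * (2 * N) ^ K) ^ L)
      ((2 * N) ^ M * ε) (M * r) ((2 * N) ^ M) := by
  have hN := hP.bd
  have h1 : (2 * (2 * N) ^ K) ^ L * (2 * N) ^ K ≤ (2 * N) ^ M := powPair_comp hK hL hM h hP.bd
  have h2 : (1 : ℝ) ≤ (2 * N) ^ K := one_le_pow₀ (by linarith)
  refine ⟨?_, ?_, ?_⟩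
  · rw [← mul_assoc]
    exact mul_le_mul_of_nonneg_right h1 hP.eps.le
  · rw [← mul_assoc]
    refine mul_le_mul_of_nonneg_right ?_ hP.prop
    have h3 : L * K ≤ M := by nlinarith
    exact_mod_cast h3
  · exact (le_mul_of_one_le_right (by positivity) h2).trans h1

theorem powPair_self_relaxes {M : ℕ} (hM : 1 ≤ M) {ε r N : ℝ} (hP : Par ε r N) :
    Relaxes ε r N ((2 * N) ^ M * ε) (M * r) ((2 * N) ^ M) := by
  have hN := hP.bd
  refine ⟨le_mul_of_one_le_left hP.eps.le (one_le_pow₀ (by linarith)),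
    le_mul_of_one_le_left hP.prop (by exact_mod_cast hM), ?_⟩
  exact (le_self_pow₀ (by linarith : 1 ≤ 2 * N) (by omega)).trans' (by linarith)

variable (X : MatAlg.{u} p) [X.Nice] {K L M : ℕ}

theorem bottMorphism_isLeftInverse (hK : 200 ≤ K) (hL : 200 ≤ L) (hM : 8000 ≤ M)
    (h : (K + 1) * L + K ≤ M) :
    IsLeftInverse (powPair M (by omega)) (bottMorphism X L hL) (boundaryMorphism X K hK) := by
  refine ⟨fun N hN => powPair_comp (by omega) (by omega) (by omega) h hN, fun ε r N ha x => ?_⟩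
  have hP : Par ε r N := ⟨ha.eps_pos, ha.r_pos.le, ha.one_le⟩
  have hT := tgt_of_pow hP K
  have hT₁ := tgt_of_pow hT.par L
  have h₁ := powPair_comp_relaxes (by omega) (by omega) (by omega) h hP
  have h₂ := powPair_self_relaxes (M := M) (by omega) hP
  obtain ⟨F, hF, hx⟩ := boundaryHom_spec (X := X) hP (hT.mono hK)
  obtain ⟨G, hG, hy⟩ := bottHom_spec (X := X) hT.par (hT₁.mono hL)
  refine ⟨h₁, h₂, Subtype.ext ?_⟩
  refine (congrArg (KUnital.map (UnitalHom.id X.plus) .one h₁.one_mul)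
    ((hy ((boundaryMorphism X K hK).map ε r N x)).trans (congrArg G (hx x)))).trans ?_
  exact bott_boundary hP (hT.mono (by omega)) (hT₁.mono (by omega)) h₁ h₂
    ((tgt_of_pow hP M).mono hM) hF hG x.2

theorem boundaryMorphism_isLeftInverse (hK : 200 ≤ K) (hL : 200 ≤ L) (hM : 550000 ≤ M)
    (h : (L + 1) * K + L ≤ M) :
    IsLeftInverse (powPair M (by omega)) (boundaryMorphism X K hK) (bottMorphism X L hL) := by
  refine ⟨fun N hN => powPair_comp (by omega) (by omega) (by omega) h hN, fun ε r N ha x => ?_⟩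
  have hP : Par ε r N := ⟨ha.eps_pos, ha.r_pos.le, ha.one_le⟩
  have hT := tgt_of_pow hP L
  have hT₁ := tgt_of_pow hT.par K
  have h₁ := powPair_comp_relaxes (by omega) (by omega) (by omega) h hP
  have h₂ := powPair_self_relaxes (M := M) (by omega) hP
  obtain ⟨G, hG, hx⟩ := bottHom_spec (X := X) hP (hT.mono hL)
  obtain ⟨F, hF, hy⟩ := boundaryHom_spec (X := X) hT.par (hT₁.mono hK)
  refine ⟨h₁, h₂, Subtype.ext ?_⟩
  refine (congrArg (KUnital.map (UnitalHom.id (Sn X).plus) .zero h₁.one_mul)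
    ((hy ((bottMorphism X L hL).map ε r N x)).trans (congrArg F (hx x)))).trans ?_
  exact boundary_bott hP (hT.mono (by omega)) (hT₁.mono (by omega)) h₁ h₂
    ((tgt_of_pow hP M).mono hM) hG hF x.2

/-- Admissibility gives ε ≤ 1, which bounds the norm of y. The class does not depend on the choice
because it is always equal to `dVal`. -/
theorem boundaryMorphism_isBoundaryMap (hK : 162000 ≤ K) :
    IsBoundaryMap X (powPair 12 (by norm_num)) (powPair 32 (by norm_num))
      (boundaryMorphism X K (by omega)) := by
  intro ε r N ha n u hu
  have hP : Par ε r N := ⟨ha.eps_pos, ha.r_pos.le, ha.one_le⟩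
  have hε : ε ≤ 1 := by
    have h1 := (powPair K (by omega)).one_le_lam N ha.one_le
    refine ha.eps_lt.le.trans ?_
    rw [div_le_one (by linarith)]
    linarith
  have hT := tgt_of_pow hP K
  obtain ⟨u', hI⟩ := (isQuasi_iff (X := X) (i := .one) u).1 hu
  refine ⟨nonempty_boundaryChoice hP hI, fun b => ?_⟩
  obtain ⟨he, hp, hb⟩ := kClass_of_boundaryChoice hP hε (hT.mono hK) hI b
  refine ⟨he, hp, fun x hx => ?_⟩
  obtain ⟨F, hF, hFx⟩ := boundaryHom_spec (X := X) hP (hT.mono (by omega))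
  exact (hFx x).trans ((congrArg F hx).trans
    ((hF.apply n u u' hu (ip_four hP hI)).trans hb.symm))

variable {X}

theorem relax_map {U : UnitalMatAlg.{u}} {V : UnitalMatAlg.{u}} {κ : ℝ} {i : KDeg}
    (φ : UnitalHom U V κ) {ε r N ε₁ r₁ N₁ ε₂ r₂ N₂ : ℝ} (h : Relaxes (κ * ε) r (κ * N) ε₁ r₁ N₁)
    (h₁ : Relaxes ε₁ r₁ N₁ ε₂ r₂ N₂) (h₂ : Relaxes (κ * ε) r (κ * N) ε₂ r₂ N₂)
    (x : KUnital i U ε r N) :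
    KUnital.map (UnitalHom.id V) i h₁.one_mul (KUnital.map φ i h x) = KUnital.map φ i h₂ x := by
  have e : (KUnital.map (UnitalHom.id V) i h₁.one_mul).comp (KUnital.map φ i h) =
      KUnital.map φ i h₂ := by
    refine KUnital.hom_ext fun n x hx => ?_
    simp only [AddMonoidHom.comp_apply, KUnital.map_kClass]
    rfl
  exact DFunLike.congr_fun e x

theorem ev_plusHom {Y : MatAlg.{u} p} (f : FilteredHom X Y) (t : unitInterval) (x : (Sn X).R) :
    ev {0, 1} Y t (f.susp.plusHom x) = f.plusHom (ev {0, 1} X t x) := by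
  refine R_ext ?_ ?_
  · refine (ev_fst t _).trans ((f.susp.plusHom_fst x).trans ?_)
    exact ((f.plusHom_fst _).trans (ev_fst t x)).symm
  · refine (ev_snd t _).trans (Eq.trans ?_ (f.plusHom_snd _).symm)
    exact (congrArg (fun F : (susp Y).carrier => F.1 t) (f.susp.plusHom_snd x)).trans
      (congrArg f.hom (ev_snd t x)).symm

theorem bottMorphism_natural {Y : MatAlg.{u} p} [Y.Nice] (hL : 200 ≤ L) (f : FilteredHom X Y)
    {κ : ℝ} (hκ : f.PlusBound κ) {ε r N : ℝ} (hP : Par ε r N) (hP₁ : Par (κ * ε) r (κ * N))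
    (h : Relaxes ε r N (κ * ε) r (κ * N))
    (h' : Relaxes ((2 * N) ^ L * ε) (L * r) ((2 * N) ^ L)
      (κ * ((2 * N) ^ L * ε)) (L * r) (κ * (2 * N) ^ L))
    (x : KGrp .zero (susp X) ε r N) :
    SameAt (max ((2 * (κ * N)) ^ L * (κ * ε)) (κ * ((2 * N) ^ L * ε)))
      (max (L * r) (L * r)) (max ((2 * (κ * N)) ^ L) (κ * (2 * N) ^ L))
      ((bottMorphism Y L hL).map (κ * ε) r (κ * N) (f.susp.star hκ.susp .zero ε r N h x))
      (f.star hκ .one ((2 * N) ^ L * ε) (L * r) ((2 * N) ^ L) h'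
        ((bottMorphism X L hL).map ε r N x)) := by
  have hT := tgt_of_pow hP L
  have hT₁ := tgt_of_pow hP₁ L
  obtain ⟨F, hF, hx⟩ := bottHom_spec (X := X) hP (hT.mono hL)
  obtain ⟨G, hG, hy⟩ := bottHom_spec (X := Y) hP₁ (hT₁.mono hL)
  refine ⟨⟨le_max_left _ _, le_max_left _ _, le_max_left _ _⟩,
    ⟨le_max_right _ _, le_max_right _ _, le_max_right _ _⟩, Subtype.ext ?_⟩
  have h₁ : Relaxes ((2 * (κ * N)) ^ L * (κ * ε)) (L * r) ((2 * (κ * N)) ^ L)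
      (max ((2 * (κ * N)) ^ L * (κ * ε)) (κ * ((2 * N) ^ L * ε)))
      (max (L * r) (L * r)) (max ((2 * (κ * N)) ^ L) (κ * (2 * N) ^ L)) :=
    ⟨le_max_left _ _, le_max_left _ _, le_max_left _ _⟩
  have h₂ : Relaxes (κ * ((2 * N) ^ L * ε)) (L * r) (κ * (2 * N) ^ L)
      (max ((2 * (κ * N)) ^ L * (κ * ε)) (κ * ((2 * N) ^ L * ε)))
      (max (L * r) (L * r)) (max ((2 * (κ * N)) ^ L) (κ * (2 * N) ^ L)) :=
    ⟨le_max_right _ _, le_max_right _ _, le_max_right _ _⟩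
  refine (congrArg (KUnital.map (UnitalHom.id Y.plus) .one h₁.one_mul)
    (hy (f.susp.star hκ.susp .zero ε r N h x))).trans ?_
  refine (isBottHom_map (f.plus hκ) f.plusHom (fun _ => rfl) (f.susp.plus hκ.susp) f.susp.plusHom
    (fun _ => rfl) (ev_plusHom f) hP (hT.mono (by omega)) hP₁ (hT₁.mono (by omega))
    ⟨le_rfl, le_rfl, le_rfl⟩ h₂ h₁ hF hG x.1).symm.trans ?_
  refine (relax_map (f.plus hκ) ⟨le_rfl, le_rfl, le_rfl⟩ h₂ h₂ (F x.1)).symm.trans ?_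
  exact congrArg (fun z => KUnital.map (UnitalHom.id Y.plus) .one h₂.one_mul
    (KUnital.map (f.plus hκ) .one ⟨le_rfl, le_rfl, le_rfl⟩ z)) (hx x).symm

end

end QuantK

theorem mainTheorem4 (p : ℝ≥0∞) [Fact (1 ≤ p)] (hp : p ≠ ∞) :
    ∃ (c c' cD cB cI : QuantK.ControlPair)
      (D : ∀ A : QuantK.FilteredSQpAlgebra.{u} p,
        QuantK.ControlledMorphism cD .one .zero A.toMatAlg (QuantK.susp A.toMatAlg))
      (B : ∀ A : QuantK.FilteredSQpAlgebra.{u} p,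
        QuantK.ControlledMorphism cB .zero .one (QuantK.susp A.toMatAlg) A.toMatAlg),
      c.Le c' ∧ c'.Le cD ∧
      (∀ A, QuantK.IsBoundaryMap A.toMatAlg c c' (D A)) ∧
      (∀ A, QuantK.IsControlledInverse cI (D A) (B A)) ∧
      ∀ (A A' : QuantK.FilteredSQpAlgebra.{u} p)
        (f : QuantK.FilteredHom A.toMatAlg A'.toMatAlg) (κ : ℝ) (hκ : f.PlusBound κ)
        (ε r N : ℝ), cB.Adm ε r N → cB.Adm (κ * ε) r (κ * N) →
        ∀ (h : QuantK.Relaxes ε r N (κ * ε) r (κ * N))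
          (h' : QuantK.Relaxes (cB.lam N * ε) (cB.h ε N * r) (cB.lam N)
            (κ * (cB.lam N * ε)) (cB.h ε N * r) (κ * cB.lam N))
          (x : QuantK.KGrp .zero (QuantK.susp A.toMatAlg) ε r N),
          QuantK.SameAt
            (max (cB.lam (κ * N) * (κ * ε)) (κ * (cB.lam N * ε)))
            (max (cB.h (κ * ε) (κ * N) * r) (cB.h ε N * r))
            (max (cB.lam (κ * N)) (κ * cB.lam N))
            ((B A').map (κ * ε) r (κ * N) (f.susp.star hκ.susp .zero ε r N h x))
            (f.star hκ .one (cB.lam N * ε) (cB.h ε N * r) (cB.lam N) h' ((B A).map ε r N x)) := by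
  have hn : ∀ A : QuantK.FilteredSQpAlgebra.{u} p, A.toMatAlg.Nice := fun A => A.nice hp
  -- The exponents 12 and 32 come from the existence of choices, 162000 from their independence and
  -- 200 from the Bott map. Both compositions need (162000 + 1)(200 + 1) - 1 = 32562200, which
  -- 40000000 exceeds.
  refine ⟨QuantK.powPair 12 (by norm_num), QuantK.powPair 32 (by norm_num),
    QuantK.powPair 162000 (by norm_num), QuantK.powPair 200 (by norm_num),
    QuantK.powPair 40000000 (by norm_num),
    fun A => QuantK.boundaryMorphism A.toMatAlg 162000 (by norm_num),
    fun A => QuantK.bottMorphism A.toMatAlg 200 (by norm_num),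
    QuantK.powPair_le _ _ (by norm_num), QuantK.powPair_le _ _ (by norm_num),
    fun A => QuantK.boundaryMorphism_isBoundaryMap A.toMatAlg le_rfl,
    fun A => ⟨QuantK.powPair_le _ _ (by norm_num), QuantK.powPair_le _ _ (by norm_num),
      QuantK.bottMorphism_isLeftInverse A.toMatAlg (by norm_num) (by norm_num) (by norm_num)
        (by norm_num),
      QuantK.boundaryMorphism_isLeftInverse A.toMatAlg (by norm_num) (by norm_num) (by norm_num)
        (by norm_num)⟩, ?_⟩
  intro A A' f κ hκ ε r N h₁ h₂ h h' x
  exact QuantK.bottMorphism_natural (by norm_num) f hκ ⟨h₁.eps_pos, h₁.r_pos.le, h₁.one_le⟩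
    ⟨h₂.eps_pos, h₂.r_pos.le, h₂.one_le⟩ h h' x
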